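/- **Setting.** Let $M$ be a smooth $d$-dimensional manifold (Hausdorff, second countable, not necessarily compact) with a Lie filtration of depth $N\ge1$: smooth sub-bundles $0=H^0\subseteq H^1\subseteq\cdots\subseteq H^N=TM$, $H^j=TM$ for $j>N$, with $[X,Y]\in C^\infty(M,H^{j+k})$ whenever $X\in C^\infty(M,H^j)$ and $Y\in C^\infty(M,H^k)$. Let $\mathfrak t_HM=\bigoplus_{k=1}^N H^k/H^{k-1}$ (graded pieces of constant rank), with dilations $\delta_t=t^k$ on $H^k/H^{k-1}$, and let $d_H=\sum_{k=1}^N k\,\mathrm{rank}(H^k/H^{k-1})$. Fix a splitting, i.e. a smooth bundle isomorphism $\psi:\mathfrak t_HM\to TM$ that on each $H^k/H^{k-1}$ is a right inverse of the quotient map $H^k\to H^k/H^{k-1}$, a smooth connection $\nabla$ on $\mathfrak t_HM$ that commutes with the dilations $\delta_t$, $t>0$, and let $\exp_x$ be its exponential map ($t\mapsto\exp_x(tv)$ has velocity $\psi$ of a $\nabla$-parallel field and initial velocity $\psi(v)$), considered on a fibrewise star-shaped neighbourhood of the zero section on which $(x,v)\mapsto(x,\exp_xv)$ is a diffeomorphism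 onto its image. The $H$-tangent groupoid is $\mathbb T_HM=(\mathfrak t_HM\times\{0\})\sqcup(M\times M\times\mathbb R^\times)$, with the smooth structure for which $M\times M\times\mathbb R^\times$ is an open submanifold and $(x,z,h)\mapsto(x,\exp_x(\delta_hz),h)$ for $h\ne0$, $(x,z,0)\mapsto((x,z),0)$, is an open chart. Put $r(x,y,h)=(x,h)$, $s(x,y,h)=(y,h)$, $r((x,z),0)=s((x,z),0)=(x,0)$, and $\alpha_\lambda(x,y,h)=(x,y,\lambda^{-1}h)$, $\alpha_\lambda((x,z),0)=((x,\delta_\lambda z),0)$ for $\lambda>0$. For a submersion $\pi:X\to B$ let $\mathcal E'_\pi(X)$ be the space of continuous $C^\infty(B)$-linear maps $C^\infty(X)\to C^\infty(B)$, with the topology of bounded convergence; the pairing is written $(\cdot,\cdot)$. On $\mathcal E'_r(\mathbb T_HM)$ put $((\alpha_\lambda)_*\mathbb P,f)(x,h)=(\mathbb P,f\circ\alpha_\lambda)(x,\lambda h)$ and $\mathcal L_Z\mathbb P=\frac{d}{d\lambda}\big|_{\lambda=1}(\alpha_\lambda)_*\mathbb P$. Let $\mathbb P_1\in\mathcal E'_r(M\times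 M)$ (here $r(x,y)=x$) be the restriction of $\mathbb P$ to $h=1$. Let $\Omega_r$ be the bundle of densities along the fibres of $r$, and let $C_p^\infty(\mathbb T_HM,\Omega_r)\subset\mathcal E'_r(\mathbb T_HM)$ be the space of smooth sections of $\Omega_r$ with $r$-proper and $s$-proper support, acting by integration along the fibres of $r$. A *pseudodifferential kernel of order* $m\in\mathbb C$ is a $\mathbb P\in\mathcal E'_r(\mathbb T_HM)$ with $(\mathcal L_Z-m)\mathbb P\in C_p^\infty(\mathbb T_HM,\Omega_r)$; a *pseudodifferential operator of order* $m$ is a $P\in\mathcal E'_r(M\times M)$ of the form $P=\mathbb P_1$ for such a $\mathbb P$. *Local trace.* Let $\Omega M$ be the density bundle of $M$. If $\mathbb P\in\mathcal E'_r(\mathbb T_HM)$ is given by a continuous section of $\Omega_r$, then $\mathrm{tr}\,\mathbb P=(\mathrm{tr}_h\mathbb P)_{h\in\mathbb R}\in C^0(M\times\mathbb R,\Omega M)$ is the restriction of this section to the units $((x,0),0)$ and $(x,x,h)$, where $\Omega_r$ is identified with $\Omega M$ at the units through the exponential chart and $\psi$ (so that $\mathrm{tr}_h\mathbb P(x)=|h|^{d_H}\,p(x,x,h)$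 for $h\neq0$, if $p$ is the section). For a pseudodifferential operator $P$ of order $m$ with $\Re(m)<-d_H$, $\mathrm{tr}(P)=\mathrm{tr}_1(\mathbb P)\in C^0(M,\Omega M)$ for any kernel $\mathbb P$ of order $m$ with $\mathbb P_1=P$. *Residue density.* For a pseudodifferential operator $A$ of order $-d_H$, the Couchet–Yuncken residue density $\mathrm{res}(A)$ is the density on $M$ with $\mathrm{tr}_0\big(\lambda^{d_H}(\alpha_\lambda)_*\mathbb A-\mathbb A\big)=\log(\lambda)\,\mathrm{res}(A)$ for all $\lambda>0$ and any kernel $\mathbb A$ of order $-d_H$ with $\mathbb A_1=A$. *Holomorphic families.* Let $\Omega\subseteq\mathbb C$ be open and connected and $\mu:\Omega\to\mathbb C$ holomorphic. A holomorphic pseudodifferential kernel family with order function $\mu$ is a holomorphic map $s\mapsto\mathbb P(s)\in\mathcal E'_r(\mathbb T_HM)$ on $\Omega$ such that each $\mathbb P(s)$ is a pseudodifferential kernel of order $\mu(s)$; a holomorphic pseudodifferential family with order function $\mu$ is a family $P(s)=\mathbb P(s)_1$, $s\in\Omega$, for such a $\mathbb P$. **Theorem 5.2.** Let $\{P(s)\}_{s\in\Omega}$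 be a holomorphic pseudodifferential family with order function $\mu$, and assume that $\{s\in\Omega:\Re\mu(s)<-d_H\}\ne\emptyset$. 1. For $\Re\mu(s)<-d_H$ the local trace $\mathrm{tr}\,P(s)\in C^0(M,\Omega M)$ is defined (it exists and does not depend on the kernel), and the $C^0(M,\Omega M)$-valued function $s\mapsto\mathrm{tr}\,P(s)$ extends to a meromorphic function on $\Omega$ that is holomorphic outside $\mu^{-1}(\{-d_H,-d_H+1,-d_H+2,\dots\})$. If $s_0\in\Omega$, $\mu(s_0)=-d_H$ and $\mu$ is injective near $s_0$, then $\mathrm{res}(P(s_0))$ is well defined and $$\mathrm{Res}_{s=s_0}\mathrm{tr}\,P(s)=-\frac1{\mu'(s_0)}\mathrm{res}(P(s_0)).$$ 2. For every holomorphic pseudodifferential kernel family $\mathbb P$ with order function $\mu$ and $\mathbb P(s)_1=P(s)$ for all $s\in\Omega$, the local trace $\mathrm{tr}\,\mathbb P(s)$ is defined for $\Re\mu(s)<-d_H$, and the $C^0(M\times\mathbb R,\Omega M)$-valued function $s\mapsto\mathrm{tr}\,\mathbb P(s)$ likewise extends to a meromorphic function on $\Omega$ that is holomorphic outside $\mu^{-1}(-d_H+\mathbb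 N)$, where $\mathbb N=\{0,1,2,\dots\}$; for $s_0$ as in 1. and all $h\in\mathbb R$, $$\mathrm{Res}_{s=s_0}\mathrm{tr}_h\,\mathbb P(s)=-\frac1{\mu'(s_0)}\mathrm{res}(P(s_0)).$$ -/

import Mathlib

open scoped Manifold ContDiff Topology
open Set Filter

universe u

noncomputable section

namespace HCalc

/-- The model space `ℝᵈ`. -/
abbrev Euc (d : ℕ) : Type := EuclideanSpace ℝ (Fin d)

/-! ### Smooth structures given by parametrizations, and their Fréchet function spaces -/

/-- A family of parametrizations `map i : dom i → X` with open domains in a normed space `F`.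
For a smooth manifold `X` these are the inverses of the charts of an atlas. -/
structure ParamAtlas (F : Type) [NormedAddCommGroup F] [NormedSpace ℝ F] (X : Type u) where
  ι : Type u
  dom : ι → Set F
  isOpen_dom : ∀ i, IsOpen (dom i)
  map : ι → F → X

namespace ParamAtlas

variable {F F' : Type} [NormedAddCommGroup F] [NormedSpace ℝ F]
  [NormedAddCommGroup F'] [NormedSpace ℝ F'] {X X' : Type u}

/-- The manifold topology: a set is open iff its preimage under every parametrization is open. -/
@[reducible] def topology (A : ParamAtlas F X) : TopologicalSpace X :=
  ⨆ i, TopologicalSpace.coinduced (fun y : A.dom i => A.map i y) inferInstance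

/-- The algebra of smooth complex valued functions. -/
def smooth (A : ParamAtlas F X) : Subalgebra ℂ (X → ℂ) where
  carrier := {f | ∀ i, ContDiffOn ℝ ∞ (fun y => f (A.map i y)) (A.dom i)}
  mul_mem' hf hg i := (hf i).mul (hg i)
  add_mem' hf hg i := (hf i).add (hg i)
  algebraMap_mem' _ _ := contDiffOn_const

/-- `C^∞(X)`. -/
def Smooth (A : ParamAtlas F X) : Type u := A.smooth

instance (A : ParamAtlas F X) : AddCommGroup A.Smooth := inferInstanceAs (AddCommGroup A.smooth)
instance (A : ParamAtlas F X) : Module ℂ A.Smooth := inferInstanceAs (Module ℂ A.smooth)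
instance (A : ParamAtlas F X) : FunLike A.Smooth X ℂ where
  coe f := f.1
  coe_injective _ _ h := Subtype.ext h

theorem contDiffOn (A : ParamAtlas F X) (f : A.Smooth) (i : A.ι) :
    ContDiffOn ℝ ∞ (fun y => f (A.map i y)) (A.dom i) := f.2 i

/-- Indices of the seminorms: a parametrization, an order of differentiation and a compact set. -/
def SeminormIndex (A : ParamAtlas F X) : Type u :=
  Σ i : A.ι, ℕ × {K : Set F // IsCompact K ∧ K ⊆ A.dom i}

theorem bddAbove_iteratedFDeriv {A : ParamAtlas F X} (j : A.SeminormIndex) (f : A.Smooth) :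
    BddAbove (range fun y : j.2.2.1 =>
      ‖iteratedFDeriv ℝ j.2.1 (fun z => f (A.map j.1 z)) y.1‖) := by
  obtain ⟨i, n, K, hK, hKi⟩ := j
  have hc : ContinuousOn (fun y => ‖iteratedFDeriv ℝ n (fun z => f (A.map i z)) y‖) K := by
    intro y hy
    have h1 : ContDiffAt ℝ ∞ (fun z => f (A.map i z)) y :=
      (A.contDiffOn f i).contDiffAt ((A.isOpen_dom i).mem_nhds (hKi hy))
    exact (h1.continuousAt_iteratedFDeriv (by exact_mod_cast le_top)).norm.continuousWithinAt
  have h2 := (hK.image_of_continuousOn hc).bddAbove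
  rwa [image_eq_range] at h2

/-- The seminorms `sup_{y ∈ K} ‖Dⁿ(f ∘ map i)(y)‖`, `K ⊆ dom i` compact, of the usual Fréchet
topology of `C^∞(X)`. -/
def seminorm (A : ParamAtlas F X) : SeminormFamily ℂ A.Smooth A.SeminormIndex := fun j =>
  Seminorm.of
    (fun f => ⨆ y : j.2.2.1, ‖iteratedFDeriv ℝ j.2.1 (fun z => f (A.map j.1 z)) y.1‖)
    (fun f g => by
      refine Real.iSup_le (fun y => ?_) (add_nonneg (Real.iSup_nonneg fun _ => norm_nonneg _)
        (Real.iSup_nonneg fun _ => norm_nonneg _))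
      have hn := (A.isOpen_dom j.1).mem_nhds (j.2.2.2.2 y.2)
      have hf : ContDiffAt ℝ j.2.1 (fun z => f (A.map j.1 z)) y.1 :=
        ((A.contDiffOn f j.1).contDiffAt hn).of_le (by exact_mod_cast le_top)
      have hg : ContDiffAt ℝ j.2.1 (fun z => g (A.map j.1 z)) y.1 :=
        ((A.contDiffOn g j.1).contDiffAt hn).of_le (by exact_mod_cast le_top)
      have h := iteratedFDeriv_add_apply hf hg
      have h' : (fun z => (f + g) (A.map j.1 z)) =
        (fun z => f (A.map j.1 z)) + (fun z => g (A.map j.1 z)) := rfl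
      rw [h', h]
      exact (norm_add_le _ _).trans (add_le_add
        (le_ciSup (bddAbove_iteratedFDeriv j f) y) (le_ciSup (bddAbove_iteratedFDeriv j g) y)))
    (fun a f => by
      rw [Real.mul_iSup_of_nonneg (norm_nonneg _)]
      congr 1
      ext y
      have hn := (A.isOpen_dom j.1).mem_nhds (j.2.2.2.2 y.2)
      have hf : ContDiffAt ℝ j.2.1 (fun z => f (A.map j.1 z)) y.1 :=
        ((A.contDiffOn f j.1).contDiffAt hn).of_le (by exact_mod_cast le_top)
      have h' : (fun z => (a • f) (A.map j.1 z)) = a • (fun z => f (A.map j.1 z)) := rfl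
      rw [h', iteratedFDeriv_const_smul_apply hf, norm_smul])

instance (A : ParamAtlas F X) : TopologicalSpace A.Smooth :=
  A.seminorm.moduleFilterBasis.topology
instance (A : ParamAtlas F X) : IsTopologicalAddGroup A.Smooth :=
  A.seminorm.addGroupFilterBasis.isTopologicalAddGroup
instance (A : ParamAtlas F X) : ContinuousSMul ℂ A.Smooth :=
  A.seminorm.moduleFilterBasis.continuousSMul

theorem withSeminorms (A : ParamAtlas F X) : WithSeminorms A.seminorm := ⟨rfl⟩

/-- Pullback of smooth functions along a map that is linear in suitable parametrizations. -/
def pullbackLinear (A : ParamAtlas F X) (A' : ParamAtlas F' X') (φ : X' → X)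
    (h : ∀ i, ∃ j, ∃ L : F' ≃L[ℝ] F, MapsTo L (A'.dom i) (A.dom j) ∧
      ∀ y ∈ A'.dom i, φ (A'.map i y) = A.map j (L y)) :
    A.Smooth →ₗ[ℂ] A'.Smooth where
  toFun f := ⟨fun p => f (φ p), fun i => by
    obtain ⟨j, L, hL, hφ⟩ := h i
    have h1 : ContDiffOn ℝ ∞ (fun y => f (A.map j (L y))) (A'.dom i) :=
      (A.contDiffOn f j).comp L.contDiff.contDiffOn hL
    exact h1.congr fun y hy => congrArg f (hφ y hy)⟩
  map_add' _ _ := rfl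
  map_smul' _ _ := rfl

/-- The pullback is continuous. -/
def pullback (A : ParamAtlas F X) (A' : ParamAtlas F' X') (φ : X' → X)
    (h : ∀ i, ∃ j, ∃ L : F' ≃L[ℝ] F, MapsTo L (A'.dom i) (A.dom j) ∧
      ∀ y ∈ A'.dom i, φ (A'.map i y) = A.map j (L y)) :
    A.Smooth →L[ℂ] A'.Smooth where
  toLinearMap := pullbackLinear A A' φ h
  cont := by
    refine WithSeminorms.continuous_of_isBounded A.withSeminorms A'.withSeminorms
      (pullbackLinear A A' φ h) fun k => ?_
    obtain ⟨i, n, K, hK, hKi⟩ := k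
    obtain ⟨j, L, hL, hφ⟩ := h i
    have hLK : IsCompact (L '' K) := hK.image L.continuous
    have hLKj : L '' K ⊆ A.dom j := by
      rintro _ ⟨y, hy, rfl⟩
      exact hL (hKi hy)
    let m : A.SeminormIndex := ⟨j, n, L '' K, hLK, hLKj⟩
    refine ⟨{m}, ⟨‖(L : F' →L[ℝ] F)‖ ^ n, by positivity⟩, fun f => ?_⟩
    rw [Finset.sup_singleton]
    refine Real.iSup_le (fun y => ?_) (mul_nonneg (NNReal.coe_nonneg _) (apply_nonneg _ _))
    have h1 : (fun z => f (φ (A'.map i z))) =ᶠ[𝓝 y.1] ((fun z => f (A.map j z)) ∘ L) := by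
      filter_upwards [(A'.isOpen_dom i).mem_nhds (hKi y.2)] with z hz
      exact congrArg f (hφ z hz)
    have h2 := h1.iteratedFDeriv ℝ n
    have h3 : iteratedFDeriv ℝ n ((fun z => f (A.map j z)) ∘ L) y.1 =
        (iteratedFDeriv ℝ n (fun z => f (A.map j z)) (L y.1)).compContinuousLinearMap
          fun _ => (L : F' →L[ℝ] F) := by
      have := L.iteratedFDerivWithin_comp_right (fun z => f (A.map j z)) uniqueDiffOn_univ
        (x := y.1) (mem_univ _) n
      simpa only [preimage_univ, iteratedFDerivWithin_univ] using this
    have h4 : ‖iteratedFDeriv ℝ n (fun z => f (φ (A'.map i z))) y.1‖ ≤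
        ‖iteratedFDeriv ℝ n (fun z => f (A.map j z)) (L y.1)‖ * ‖(L : F' →L[ℝ] F)‖ ^ n := by
      rw [h2.eq_of_nhds, h3]
      refine (ContinuousMultilinearMap.norm_compContinuousLinearMap_le _ _).trans ?_
      simp
    refine h4.trans ?_
    rw [mul_comm]
    exact mul_le_mul_of_nonneg_left
      (le_ciSup (bddAbove_iteratedFDeriv m f) ⟨L y.1, mem_image_of_mem _ y.2⟩) (by positivity)

theorem pullback_apply (A : ParamAtlas F X) (A' : ParamAtlas F' X') (φ : X' → X)
    (h : ∀ i, ∃ j, ∃ L : F' ≃L[ℝ] F, MapsTo L (A'.dom i) (A.dom j) ∧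
      ∀ y ∈ A'.dom i, φ (A'.map i y) = A.map j (L y)) (f : A.Smooth) (p : X') :
    pullback A A' φ h f p = f (φ p) := rfl

end ParamAtlas

/-- The space `E'_r` of `r`-fibred distributions for a submersion `r : X → B`: continuous
`C^∞(B)`-linear maps `C^∞(X) → C^∞(B)`, with the topology of bounded convergence. -/
def FibredDist {F F' : Type} [NormedAddCommGroup F] [NormedSpace ℝ F]
    [NormedAddCommGroup F'] [NormedSpace ℝ F'] {X B : Type u}
    (A : ParamAtlas F X) (A' : ParamAtlas F' B) (r : X → B) :
    Submodule ℂ (A.Smooth →L[ℂ] A'.Smooth) where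
  carrier := {T | ∀ (g : A'.Smooth) (u v : A.Smooth), (∀ p, v p = g (r p) * u p) →
    ∀ b, T v b = g b * T u b}
  add_mem' {S T} hS hT g u v h b := by
    change S v b + T v b = g b * (S u b + T u b)
    rw [hS g u v h b, hT g u v h b, mul_add]
  zero_mem' _ _ _ _ b := by
    change (0 : ℂ) = _ * 0
    rw [mul_zero]
  smul_mem' c T hT g u v h b := by
    change c * T v b = g b * (c * T u b)
    rw [hT g u v h b]
    ring

/-! ### Holomorphic and meromorphic functions with values in topological vector spaces -/

section Holomorphic

variable {V : Type*} [AddCommGroup V] [Module ℂ V] [TopologicalSpace V]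

/-- Complex differentiability at every point of `Ω` (which is open in all uses). -/
def HolomorphicOn (F : ℂ → V) (Ω : Set ℂ) : Prop :=
  ∀ s ∈ Ω, ∃ D : V, Tendsto (fun z => (z - s)⁻¹ • (F z - F s)) (𝓝[≠] s) (𝓝 D)

/-- `F` is meromorphic at `s₀`, and `R` is its residue: on a punctured neighbourhood of `s₀`,
`F` is the sum of a finite principal part `∑ (s - s₀)^{-(k+1)} a_k` with `a_0 = R` and a function
that is holomorphic near `s₀`. -/
def HasResidueAt (F : ℂ → V) (s₀ : ℂ) (R : V) : Prop :=
  ∃ (n : ℕ) (a : ℕ → V) (G : ℂ → V) (U : Set ℂ), IsOpen U ∧ s₀ ∈ U ∧ HolomorphicOn G U ∧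
    a 0 = R ∧ ∀ s ∈ U, s ≠ s₀ →
      F s = G s + ∑ k ∈ Finset.range (n + 1), ((s - s₀) ^ (k + 1))⁻¹ • a k

/-- `F` is holomorphic at `s₀` or has a pole of finite order there. -/
def IsMeromorphicAt (F : ℂ → V) (s₀ : ℂ) : Prop := ∃ R, HasResidueAt F s₀ R

end Holomorphic

/-! ### Densities -/

/-- Densities on a `d`-dimensional real vector space `V`: functions `ρ` of `d` vectors with
`ρ(A v) = |det A| ρ(v)`. -/
def Dens (d : ℕ) (V : Type*) [AddCommGroup V] [Module ℝ V] :
    Submodule ℂ ((Fin d → V) → ℂ) where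
  carrier := {ρ | ∀ (A : Matrix (Fin d) (Fin d) ℝ) (v : Fin d → V),
    ρ (fun i => ∑ j, A i j • v j) = ((|A.det| : ℝ) : ℂ) * ρ v}
  add_mem' {ρ η} hρ hη A v := by
    simp only [Pi.add_apply, hρ A v, hη A v, mul_add]
  zero_mem' A v := by simp
  smul_mem' c ρ hρ A v := by
    simp only [Pi.smul_apply, smul_eq_mul, hρ A v]
    ring

section Manifold

variable {d N : ℕ} {M : Type u} [TopologicalSpace M] [ChartedSpace (Euc d) M]

/-- The coordinate frame at `x` of the chart of `M` centred at `x₀`. -/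
def chartFrame (x₀ x : M) (i : Fin d) : TangentSpace (𝓡 d) x :=
  (mfderiv (𝓡 d) (𝓡 d) (chartAt (Euc d) x₀) x).inverse (EuclideanSpace.single i (1 : ℝ))

/-- The vector field `X` is smooth on `V`. -/
def SmoothField [IsManifold (𝓡 d) ∞ M] (X : ∀ x : M, TangentSpace (𝓡 d) x) (V : Set M) : Prop :=
  ContMDiffOn (𝓡 d) (𝓡 d).tangent ∞ (fun x => (⟨x, X x⟩ : TangentBundle (𝓡 d) M)) V

variable (d M) in
/-- The charts of `M`. -/
def baseAtlas : ParamAtlas (Euc d) M where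
  ι := M
  dom x₀ := (chartAt (Euc d) x₀).target
  isOpen_dom x₀ := (chartAt (Euc d) x₀).open_target
  map x₀ := (chartAt (Euc d) x₀).symm

variable (d M) in
/-- The charts of `M × ℝ`. -/
def cylinderAtlas : ParamAtlas (Euc d × ℝ) (M × ℝ) where
  ι := M
  dom x₀ := (chartAt (Euc d) x₀).target ×ˢ univ
  isOpen_dom x₀ := (chartAt (Euc d) x₀).open_target.prod isOpen_univ
  map x₀ p := ((chartAt (Euc d) x₀).symm p.1, p.2)

variable (d M) in
/-- The charts of `M × M`. -/
def pairAtlas : ParamAtlas (Euc d × Euc d) (M × M) where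
  ι := M × M
  dom c := (chartAt (Euc d) c.1).target ×ˢ (chartAt (Euc d) c.2).target
  isOpen_dom c := (chartAt (Euc d) c.1).open_target.prod (chartAt (Euc d) c.2).open_target
  map c p := ((chartAt (Euc d) c.1).symm p.1, (chartAt (Euc d) c.2).symm p.2)

section ContDens

variable {B : Type u} [TopologicalSpace B]

/-- Continuous sections of the pullback `ℓ^*ΩM` of the density bundle of `M` along `ℓ : B → M`. -/
def contDens (ℓ : B → M) : Submodule ℂ (∀ b : B, Dens d (TangentSpace (𝓡 d) (ℓ b))) where
  carrier := {ρ | ∀ x₀ : M, ContinuousOn (fun b => (ρ b).1 (chartFrame x₀ (ℓ b)))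
    (ℓ ⁻¹' (chartAt (Euc d) x₀).source)}
  add_mem' hρ hη x₀ := (hρ x₀).add (hη x₀)
  zero_mem' _ := continuousOn_const
  smul_mem' c _ hρ x₀ := (hρ x₀).const_smul c

/-- `C⁰(B, ℓ^*ΩM)`. -/
def ContDens (ℓ : B → M) : Type u := contDens (d := d) ℓ

namespace ContDens

instance (ℓ : B → M) : AddCommGroup (ContDens (d := d) ℓ) :=
  inferInstanceAs (AddCommGroup (contDens (d := d) ℓ))
instance (ℓ : B → M) : Module ℂ (ContDens (d := d) ℓ) :=
  inferInstanceAs (Module ℂ (contDens (d := d) ℓ))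

/-- The value `ρ_b(v₁, …, v_d)`. -/
def eval {ℓ : B → M} (ρ : ContDens (d := d) ℓ) (b : B) (v : Fin d → TangentSpace (𝓡 d) (ℓ b)) :
    ℂ := (ρ.1 b).1 v

variable (d) in
/-- Indices of the seminorms: a chart, and a compact set that `ℓ` maps into its domain. -/
def SeminormIndex (ℓ : B → M) : Type u :=
  Σ x₀ : M, {K : Set B // IsCompact K ∧ K ⊆ ℓ ⁻¹' (chartAt (Euc d) x₀).source}

theorem bddAbove_eval {ℓ : B → M} (j : SeminormIndex d ℓ) (ρ : ContDens (d := d) ℓ) :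
    BddAbove (range fun b : j.2.1 => ‖ρ.eval b.1 (chartFrame j.1 (ℓ b.1))‖) := by
  obtain ⟨x₀, K, hK, hKx⟩ := j
  have h2 := (hK.image_of_continuousOn ((ρ.2 x₀).mono hKx).norm).bddAbove
  rwa [image_eq_range] at h2

/-- The seminorms `sup_{b ∈ K} |ρ_b(∂_1, …, ∂_d)|` of locally uniform convergence. -/
def seminorm (ℓ : B → M) : SeminormFamily ℂ (ContDens (d := d) ℓ) (SeminormIndex d ℓ) := fun j =>
  Seminorm.of (fun ρ => ⨆ b : j.2.1, ‖ρ.eval b.1 (chartFrame j.1 (ℓ b.1))‖)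
    (fun ρ η => Real.iSup_le (fun b => (norm_add_le _ _).trans (add_le_add
        (le_ciSup (bddAbove_eval j ρ) b) (le_ciSup (bddAbove_eval j η) b)))
      (add_nonneg (Real.iSup_nonneg fun _ => norm_nonneg _)
        (Real.iSup_nonneg fun _ => norm_nonneg _)))
    (fun a ρ => by
      rw [Real.mul_iSup_of_nonneg (norm_nonneg _)]
      congr 1
      ext b
      exact norm_mul _ _)

instance (ℓ : B → M) : TopologicalSpace (ContDens (d := d) ℓ) :=
  (seminorm (d := d) ℓ).moduleFilterBasis.topology
instance (ℓ : B → M) : IsTopologicalAddGroup (ContDens (d := d) ℓ) :=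
  (seminorm (d := d) ℓ).addGroupFilterBasis.isTopologicalAddGroup
instance (ℓ : B → M) : ContinuousSMul ℂ (ContDens (d := d) ℓ) :=
  (seminorm (d := d) ℓ).moduleFilterBasis.continuousSMul

end ContDens

end ContDens

/-! ### Carnot manifolds -/

variable [IsManifold (𝓡 d) ∞ M]

variable (d N M) in
/-- A Lie filtration `0 = H⁰ ⊆ H¹ ⊆ ⋯ ⊆ Hᴺ = TM` of the tangent bundle of `M` by sub-bundles
(with `H^j = TM` for `j > N`). The `k`-th graded piece is `H^{k+1} / H^k`, `k = 0, …, N - 1`;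
its weight is `k + 1`. -/
structure LieFiltration where
  H : ℕ → ∀ x : M, Submodule ℝ (TangentSpace (𝓡 d) x)
  depth_pos : 1 ≤ N
  zero : ∀ x, H 0 x = ⊥
  mono : ∀ x, Monotone fun j => H j x
  top : ∀ x j, N ≤ j → H j x = ⊤
  /-- the ranks of the graded pieces -/
  rank : Fin N → ℕ
  finrank_eq : ∀ x (k : Fin N), Module.finrank ℝ (H (k + 1) x) = Module.finrank ℝ (H k x) + rank k
  /-- The `H^j` are nested smooth sub-bundles: locally there is a smooth frame `X` of `TM`
  such that each `H^j` is spanned by a part of it. -/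
  exists_frame : ∀ x, ∃ V : Set M, IsOpen V ∧ x ∈ V ∧
    ∃ (w : Fin d → Fin N) (X : Fin d → ∀ x : M, TangentSpace (𝓡 d) x),
      (∀ i, SmoothField (X i) V) ∧ ∀ y ∈ V, LinearIndependent ℝ (fun i => X i y) ∧
        ∀ j, H j y = Submodule.span ℝ ((fun i => X i y) '' {i | (w i : ℕ) < j})
  lie_bracket : ∀ (j k : ℕ) (X Y : ∀ x : M, TangentSpace (𝓡 d) x),
    SmoothField X univ → SmoothField Y univ → (∀ x, X x ∈ H j x) → (∀ x, Y x ∈ H k x) →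
      ∀ x, VectorField.mlieBracket (𝓡 d) X Y x ∈ H (j + k) x

namespace LieFiltration

/-- The homogeneous dimension. -/
def homDim (H : LieFiltration d N M) : ℕ := ∑ k : Fin N, ((k : ℕ) + 1) * H.rank k

/-- The graded piece `H^{k+1}_x / H^k_x`. -/
abbrev Piece (H : LieFiltration d N M) (k : Fin N) (x : M) : Type :=
  H.H (k + 1) x ⧸ (H.H k x).submoduleOf (H.H (k + 1) x)

/-- The fibre at `x` of the associated graded bundle `𝔱_H M`; it is also the underlying space of
the osculating group at `x`. -/
abbrev Osc (H : LieFiltration d N M) (x : M) : Type := ∀ k : Fin N, H.Piece k x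

/-- The dilation `δ_t`. -/
def dil (H : LieFiltration d N M) (t : ℝ) {x : M} (z : H.Osc x) : H.Osc x :=
  fun k => t ^ ((k : ℕ) + 1) • z k

/-- A splitting: a smooth bundle isomorphism `ψ : 𝔱_H M → TM` whose restriction to each graded
piece is a right inverse of the quotient map. -/
structure Splitting (H : LieFiltration d N M) where
  iso : ∀ x, H.Osc x ≃ₗ[ℝ] TangentSpace (𝓡 d) x
  right_inv : ∀ x (k : Fin N) (q : H.Piece k x), ∃ h : iso x (Pi.single k q) ∈ H.H (k + 1) x,
    (Submodule.Quotient.mk ⟨iso x (Pi.single k q), h⟩ : H.Piece k x) = q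
  smooth : ∀ (k : Fin N) (Y : ∀ x, H.H (k + 1) x) (V : Set M), IsOpen V →
    SmoothField (fun x => (Y x : TangentSpace (𝓡 d) x)) V →
      SmoothField (fun x => iso x (Pi.single k (Submodule.Quotient.mk (Y x)))) V

end LieFiltration

variable {H : LieFiltration d N M}

namespace LieFiltration.Splitting

/-- The dilation `δ_t`, transported to `TM`. -/
def dil (ψ : H.Splitting) (t : ℝ) (x : M) (v : TangentSpace (𝓡 d) x) : TangentSpace (𝓡 d) x :=
  ψ.iso x (H.dil t ((ψ.iso x).symm v))

/-- A connection on `𝔱_H M` with `∇_X (δ_t Z) = δ_t ∇_X Z` for `t > 0`. It is written as a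
connection on `TM` by means of the isomorphism `ψ`. -/
structure GradedConnection (ψ : H.Splitting) where
  cov : CovariantDerivative (𝓡 d) (Euc d) (fun x : M => TangentSpace (𝓡 d) x)
  smooth : CovariantDerivative.ContMDiffCovariantDerivative cov ∞
  graded : ∀ (t : ℝ), 0 < t → ∀ (Z : ∀ x : M, TangentSpace (𝓡 d) x) (x : M),
    MDifferentiableAt (𝓡 d) (𝓡 d).tangent (fun y => (⟨y, Z y⟩ : TangentBundle (𝓡 d) M)) x →
    ∀ X : TangentSpace (𝓡 d) x, cov (fun y => ψ.dil t y (Z y)) x X = ψ.dil t x (cov Z x X)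

/-- The curve `γ` has velocity `w` at time `t` and satisfies `∇_{γ'} γ' = 0` there; here `γ'` is
extended to a smooth vector field near `γ t`, of which `γ` is an integral curve near `t`. -/
def GradedConnection.IsGeodesicAt {ψ : H.Splitting} (C : ψ.GradedConnection) (γ : ℝ → M) (t : ℝ)
    (w : TangentBundle (𝓡 d) M) : Prop :=
  ∃ Y : ∀ x : M, TangentSpace (𝓡 d) x, (∃ V ∈ 𝓝 (γ t), SmoothField Y V) ∧
    (⟨γ t, Y (γ t)⟩ : TangentBundle (𝓡 d) M) = w ∧ IsMIntegralCurveAt γ Y t ∧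
    C.cov Y (γ t) (Y (γ t)) = 0

/-- The exponential map of the connection on a neighbourhood `dom` of the zero section of
`𝔱_H M ≅ TM` on which `(x, v) ↦ (x, exp_x v)` is a diffeomorphism onto its image. -/
structure Exponential (ψ : H.Splitting) extends ψ.GradedConnection where
  exp : TangentBundle (𝓡 d) M → M
  dom : Set (TangentBundle (𝓡 d) M)
  isOpen_dom : IsOpen dom
  zero_mem : ∀ x : M, (⟨x, 0⟩ : TangentBundle (𝓡 d) M) ∈ dom
  star : ∀ (x : M) (v : TangentSpace (𝓡 d) x) (t : ℝ), t ∈ Icc (0 : ℝ) 1 →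
    (⟨x, v⟩ : TangentBundle (𝓡 d) M) ∈ dom → (⟨x, t • v⟩ : TangentBundle (𝓡 d) M) ∈ dom
  /-- `t ↦ exp_x(tv)` is a geodesic with initial velocity `v`. -/
  velocity : ∀ (x : M) (v : TangentSpace (𝓡 d) x), (⟨x, v⟩ : TangentBundle (𝓡 d) M) ∈ dom →
    toGradedConnection.IsGeodesicAt (fun t : ℝ => exp ⟨x, t • v⟩) 0 ⟨x, v⟩
  geodesic : ∀ (x : M) (v : TangentSpace (𝓡 d) x), (⟨x, v⟩ : TangentBundle (𝓡 d) M) ∈ dom →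
    ∀ t ∈ Icc (0 : ℝ) 1, ∃ w,
      toGradedConnection.IsGeodesicAt (fun t : ℝ => exp ⟨x, t • v⟩) t w
  smooth_exp : ContMDiffOn (𝓡 d).tangent (𝓡 d) ∞ exp dom
  injective : ∀ (x : M) (v w : TangentSpace (𝓡 d) x), (⟨x, v⟩ : TangentBundle (𝓡 d) M) ∈ dom →
    (⟨x, w⟩ : TangentBundle (𝓡 d) M) ∈ dom → exp ⟨x, v⟩ = exp ⟨x, w⟩ → v = w
  immersive : ∀ (x : M) (v : Euc d), (⟨x, v⟩ : TangentBundle (𝓡 d) M) ∈ dom →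
    Function.Injective (mfderiv (𝓡 d) (𝓡 d) (fun v' : Euc d => exp ⟨x, v'⟩) v)

/-- A smooth local frame of `TM` over the open set `carrier` that is graded with respect to the
decomposition `TM = ⨁ ψ(H^{k+1}/H^k)`, i.e. a local trivialization `U × ℝᵈ` of `𝔱_H M` as a bundle
of graded vector spaces. The weight of `vec i` is `weight i + 1`. -/
structure GradedFrame (ψ : H.Splitting) where
  carrier : Set M
  isOpen_carrier : IsOpen carrier
  weight : Fin d → Fin N
  vec : Fin d → ∀ x : M, TangentSpace (𝓡 d) x
  smooth : ∀ i, SmoothField (vec i) carrier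
  linearIndependent : ∀ x ∈ carrier, LinearIndependent ℝ (fun i => vec i x)
  graded : ∀ i, ∀ x ∈ carrier, ∃ q : H.Piece (weight i) x, vec i x = ψ.iso x (Pi.single (weight i) q)

/-- `δ_h (∑ z_i X_i(x))`, where `X` is the frame. -/
def GradedFrame.point {ψ : H.Splitting} (X : ψ.GradedFrame) (x : M) (z : Euc d) (h : ℝ) :
    TangentSpace (𝓡 d) x :=
  ∑ i, (h ^ ((X.weight i : ℕ) + 1) * z i) • X.vec i x

end LieFiltration.Splitting

/-! ### The `H`-tangent groupoid -/

variable {ψ : H.Splitting}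

/-- The `H`-tangent groupoid `𝕋_H M = (T_H M × {0}) ⊔ (M × M × ℝ^×)`. Its smooth structure is given
by the exponential chart, see `TGroupoid.atlas`. -/
inductive TGroupoid (D : ψ.Exponential) : Type u
  | osc (x : M) (z : H.Osc x) : TGroupoid D
  | pair (x y : M) (h : ℝ) (hh : h ≠ 0) : TGroupoid D

namespace TGroupoid

variable (D : ψ.Exponential)

/-- The range map. -/
def r : TGroupoid D → M × ℝ
  | osc x _ => (x, 0)
  | pair x _ h _ => (x, h)

/-- The source map. -/
def s : TGroupoid D → M × ℝ
  | osc x _ => (x, 0)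
  | pair _ y h _ => (y, h)

/-- The parametrization `(x, z, h) ↦ (x, exp_x(δ_h z), h)` for `h ≠ 0`, `(x, z, 0) ↦ (x, z)`, in the
chart of `M` centred at `x₀` and in the graded frame `X`. -/
def expParam (x₀ : M) (X : ψ.GradedFrame) (p : Euc d × Euc d × ℝ) : TGroupoid D :=
  if hh : p.2.2 = 0 then
    osc ((chartAt (Euc d) x₀).symm p.1)
      ((ψ.iso _).symm (∑ i, p.2.1 i • X.vec i ((chartAt (Euc d) x₀).symm p.1)))
  else
    pair ((chartAt (Euc d) x₀).symm p.1)
      (D.exp ⟨_, X.point ((chartAt (Euc d) x₀).symm p.1) p.2.1 p.2.2⟩) p.2.2 hh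

/-- Indices of the parametrizations of `𝕋_H M`: pairs of charts for the part `h ≠ 0`, and local
exponential coordinate charts. -/
inductive ParamIndex : Type u
  | pair (x₀ y₀ : M) : ParamIndex
  | exp (x₀ : M) (X : ψ.GradedFrame) (O : Set (Euc d × Euc d × ℝ)) (isOpen : IsOpen O)
      (subset : ∀ p ∈ O, p.1 ∈ (chartAt (Euc d) x₀).target ∧
        (chartAt (Euc d) x₀).symm p.1 ∈ X.carrier ∧
        (⟨_, X.point ((chartAt (Euc d) x₀).symm p.1) p.2.1 p.2.2⟩ : TangentBundle (𝓡 d) M)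
          ∈ D.dom) : ParamIndex

/-- The smooth structure of the `H`-tangent groupoid. -/
def atlas : ParamAtlas (Euc d × Euc d × ℝ) (TGroupoid D) where
  ι := ParamIndex D
  dom
    | .pair x₀ y₀ => (chartAt (Euc d) x₀).target ×ˢ (chartAt (Euc d) y₀).target ×ˢ {h | h ≠ 0}
    | .exp _ _ O _ _ => O
  isOpen_dom
    | .pair x₀ y₀ => (chartAt (Euc d) x₀).open_target.prod
        ((chartAt (Euc d) y₀).open_target.prod isOpen_ne)
    | .exp _ _ _ h _ => h
  map
    | .pair x₀ y₀ => fun p =>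
        if hh : p.2.2 = 0 then osc ((chartAt (Euc d) x₀).symm p.1) 0
        else pair ((chartAt (Euc d) x₀).symm p.1) ((chartAt (Euc d) y₀).symm p.2.1) p.2.2 hh
    | .exp x₀ X _ _ _ => expParam D x₀ X

instance : TopologicalSpace (TGroupoid D) := (atlas D).topology

/-- The zoom action `α_λ`. -/
def zoom (l : ℝ) (hl : 0 < l) : TGroupoid D → TGroupoid D
  | osc x z => osc x (H.dil l z)
  | pair x y h hh => pair x y (l⁻¹ * h) (mul_ne_zero (inv_ne_zero hl.ne') hh)

/-- The zoom action in an exponential chart with weights `w`: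
`(y, z, h) ↦ (y, δ_λ z, λ⁻¹ h)`. -/
def zoomLinear (w : Fin d → Fin N) (l : ℝ) (hl : 0 < l) :
    (Euc d × Euc d × ℝ) ≃L[ℝ] (Euc d × Euc d × ℝ) :=
  (ContinuousLinearEquiv.refl ℝ (Euc d)).prodCongr
    (ContinuousLinearEquiv.prodCongr
      (LinearEquiv.toContinuousLinearEquiv
        { toFun := fun z => WithLp.toLp 2 fun i => l ^ ((w i : ℕ) + 1) * z i
          invFun := fun z => WithLp.toLp 2 fun i => (l ^ ((w i : ℕ) + 1))⁻¹ * z i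
          map_add' := fun z z' => by ext i; simp [mul_add]
          map_smul' := fun c z => by ext i; simp [mul_left_comm]
          left_inv := fun z => by
            ext i
            have : l ^ ((w i : ℕ) + 1) ≠ 0 := pow_ne_zero _ hl.ne'
            simp [this]
          right_inv := fun z => by
            ext i
            have : l ^ ((w i : ℕ) + 1) ≠ 0 := pow_ne_zero _ hl.ne'
            simp [this] })
      (ContinuousLinearEquiv.smulLeft (Units.mk0 l⁻¹ (inv_ne_zero hl.ne'))))

theorem zoomLinear_apply (w : Fin d → Fin N) (l : ℝ) (hl : 0 < l) (p : Euc d × Euc d × ℝ) :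
    zoomLinear w l hl p =
      (p.1, WithLp.toLp 2 fun i => l ^ ((w i : ℕ) + 1) * p.2.1 i, l⁻¹ * p.2.2) := rfl

theorem point_zoom (X : ψ.GradedFrame) (x : M) (l : ℝ) (hl : 0 < l) (z : Euc d) (h : ℝ) :
    X.point x (WithLp.toLp 2 fun i => l ^ ((X.weight i : ℕ) + 1) * z i) (l⁻¹ * h) =
      X.point x z h := by
  unfold LieFiltration.Splitting.GradedFrame.point
  refine Finset.sum_congr rfl fun i _ => ?_
  congr 1
  have : l ^ ((X.weight i : ℕ) + 1) ≠ 0 := pow_ne_zero _ hl.ne'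
  change (l⁻¹ * h) ^ ((X.weight i : ℕ) + 1) * (l ^ ((X.weight i : ℕ) + 1) * z i) = _
  rw [mul_pow, inv_pow]
  field_simp

theorem dil_symm_sum (X : ψ.GradedFrame) (x : M) (hx : x ∈ X.carrier) (l : ℝ) (z : Euc d) :
    H.dil l ((ψ.iso x).symm (∑ i, z i • X.vec i x)) =
      (ψ.iso x).symm (∑ i, (l ^ ((X.weight i : ℕ) + 1) * z i) • X.vec i x) := by
  choose q hq using fun i => X.graded i x hx
  have h1 : ∀ i, (ψ.iso x).symm (X.vec i x) = Pi.single (X.weight i) (q i) := fun i => by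
    rw [hq i, LinearEquiv.symm_apply_apply]
  simp only [map_sum, map_smul, h1]
  funext k
  simp only [LieFiltration.dil, Finset.sum_apply, Finset.smul_sum, Pi.smul_apply]
  refine Finset.sum_congr rfl fun i _ => ?_
  by_cases hk : k = X.weight i
  · subst hk
    rw [smul_smul]
  · simp [Pi.single_eq_of_ne hk]

theorem zoom_linear (l : ℝ) (hl : 0 < l) (i : (atlas D).ι) :
    ∃ j, ∃ L : (Euc d × Euc d × ℝ) ≃L[ℝ] (Euc d × Euc d × ℝ),
      MapsTo L ((atlas D).dom i) ((atlas D).dom j) ∧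
        ∀ y ∈ (atlas D).dom i, zoom D l hl ((atlas D).map i y) = (atlas D).map j (L y) := by
  cases i with
  | pair x₀ y₀ =>
    refine ⟨.pair x₀ y₀, (ContinuousLinearEquiv.refl ℝ (Euc d)).prodCongr
      ((ContinuousLinearEquiv.refl ℝ (Euc d)).prodCongr
      (ContinuousLinearEquiv.smulLeft (Units.mk0 l⁻¹ (inv_ne_zero hl.ne')))), ?_, ?_⟩
    · rintro ⟨y, y', h⟩ ⟨h1, h2, h3⟩
      exact ⟨h1, h2, mul_ne_zero (inv_ne_zero hl.ne') h3⟩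
    · rintro ⟨y, y', h⟩ ⟨h1, h2, h3⟩
      have h4 : h ≠ 0 := h3
      have h5 : l⁻¹ * h ≠ 0 := mul_ne_zero (inv_ne_zero hl.ne') h3
      have e1 : (atlas D).map (.pair x₀ y₀) (y, y', h) =
          pair ((chartAt (Euc d) x₀).symm y) ((chartAt (Euc d) y₀).symm y') h h4 := dif_neg h4
      have e2 : (atlas D).map (.pair x₀ y₀) (y, y', l⁻¹ * h) =
          pair ((chartAt (Euc d) x₀).symm y) ((chartAt (Euc d) y₀).symm y') (l⁻¹ * h) h5 :=
        dif_neg h5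
      rw [e1]
      exact e2.symm
  | exp x₀ X O hO hsub =>
    refine ⟨.exp x₀ X (zoomLinear X.weight l hl '' O)
      ((zoomLinear X.weight l hl).toHomeomorph.isOpenMap O hO) ?_, zoomLinear X.weight l hl,
      mapsTo_image _ _, ?_⟩
    · rintro _ ⟨p, hp, rfl⟩
      obtain ⟨h1, h2, h3⟩ := hsub p hp
      refine ⟨h1, h2, ?_⟩
      rw [zoomLinear_apply]
      dsimp only
      rw [point_zoom X _ l hl]
      exact h3
    · rintro ⟨y, z, h⟩ hp
      obtain ⟨h1, h2, h3⟩ := hsub _ hp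
      rw [zoomLinear_apply]
      change zoom D l hl (expParam D x₀ X (y, z, h)) = expParam D x₀ X (_, _, _)
      unfold expParam
      by_cases h0 : h = 0
      · have h5 : l⁻¹ * h = 0 := by rw [h0, mul_zero]
        rw [dif_pos h0, dif_pos h5]
        change osc _ (H.dil l _) = _
        rw [dil_symm_sum X _ h2]
      · have h5 : l⁻¹ * h ≠ 0 := mul_ne_zero (inv_ne_zero hl.ne') h0
        rw [dif_neg h0, dif_neg h5]
        dsimp only
        simp only [point_zoom X _ l hl]
        rfl

/-- `f ↦ f ∘ α_λ` on `C^∞(𝕋_H M)`. -/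
def zoomPullback (l : ℝ) (hl : 0 < l) : (atlas D).Smooth →L[ℂ] (atlas D).Smooth :=
  ParamAtlas.pullback _ _ (zoom D l hl) (zoom_linear D l hl)

end TGroupoid

/-- `g ↦ ((x, h) ↦ g(x, λ h))` on `C^∞(M × ℝ)`. -/
def heightPullback (l : ℝ) (hl : 0 < l) :
    (cylinderAtlas d M).Smooth →L[ℂ] (cylinderAtlas d M).Smooth :=
  ParamAtlas.pullback _ _ (fun p : M × ℝ => (p.1, l * p.2)) fun x₀ =>
    ⟨x₀, (ContinuousLinearEquiv.refl ℝ (Euc d)).prodCongr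
      (ContinuousLinearEquiv.smulLeft (Units.mk0 l hl.ne')),
      fun _ hp => ⟨hp.1, trivial⟩, fun _ _ => rfl⟩

/-- `E'_r(𝕋_H M)`. -/
abbrev GroupoidDist (D : ψ.Exponential) :
    Submodule ℂ ((TGroupoid.atlas D).Smooth →L[ℂ] (cylinderAtlas d M).Smooth) :=
  FibredDist (TGroupoid.atlas D) (cylinderAtlas d M) (TGroupoid.r D)

variable (d M) in
/-- `E'_r(M × M)`, the Schwartz kernels of operators `C^∞(M) → C^∞(M)`. -/
abbrev PairDist : Submodule ℂ ((pairAtlas d M).Smooth →L[ℂ] (baseAtlas d M).Smooth) :=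
  FibredDist (pairAtlas d M) (baseAtlas d M) Prod.fst

namespace GroupoidDist

variable {D : ψ.Exponential}

/-- The pushforward `((α_λ)_* ℙ, f)(x, h) = (ℙ, f ∘ α_λ)(x, λ h)`. -/
def push (l : ℝ) (hl : 0 < l) (P : GroupoidDist D) : GroupoidDist D :=
  ⟨(heightPullback l hl).comp (P.1.comp (TGroupoid.zoomPullback D l hl)), by
    intro g u v huv b
    have hb : (g : M × ℝ → ℂ) b =
        heightPullback (d := d) (M := M) l⁻¹ (inv_pos.mpr hl) g (b.1, l * b.2) := by
      change g b = g (b.1, l⁻¹ * (l * b.2))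
      rw [inv_mul_cancel_left₀ hl.ne']
    rw [hb]
    refine P.2 (heightPullback l⁻¹ (inv_pos.mpr hl) g) (TGroupoid.zoomPullback D l hl u)
      (TGroupoid.zoomPullback D l hl v) (fun p => ?_) (b.1, l * b.2)
    have h1 := huv (TGroupoid.zoom D l hl p)
    have h2 : TGroupoid.r D (TGroupoid.zoom D l hl p) =
        ((TGroupoid.r D p).1, l⁻¹ * (TGroupoid.r D p).2) := by
      cases p with
      | osc x z => simp [TGroupoid.r, TGroupoid.zoom]
      | pair x y h hh => rfl
    rw [h2] at h1
    exact h1⟩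

/-- `L = L_Z ℙ`, the derivative of `λ ↦ (α_λ)_* ℙ` at `λ = 1` in `E'_r(𝕋_H M)`. -/
def IsLieDeriv (P L : GroupoidDist D) : Prop :=
  Tendsto (fun l : {l : ℝ // 0 < l} => (((l.1 - 1 : ℝ) : ℂ))⁻¹ • (push l.1 l.2 P - P))
    (𝓝[≠] ⟨1, one_pos⟩) (𝓝 L)

/-- `P = ℙ_1`, the restriction of `ℙ` to the fibre `M × M × {1}`. -/
def IsRestrictionAtOne (P : GroupoidDist D) (P₁ : PairDist d M) : Prop :=
  ∀ (f : (TGroupoid.atlas D).Smooth) (g : (pairAtlas d M).Smooth),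
    (∀ x y, g (x, y) = f (.pair x y 1 one_ne_zero)) → ∀ x, P₁.1 g x = P.1 f (x, 1)

end GroupoidDist

/-! ### Densities along the `r`-fibres -/

/-- Sections of the bundle `Ω_r` of densities along the fibres of `r : 𝕋_H M → M × ℝ`. The tangent
space of the fibre of `r` at `(x, y, h)` is `T_y M`, and at `(x, z, 0)` it is `𝔱_H M_x`. (The
values of `pair` at `h = 0` are not used.) -/
structure FibredDensity (D : ψ.Exponential) where
  osc : ∀ x : M, H.Osc x → Dens d (H.Osc x)
  pair : ∀ _x y : M, ℝ → Dens d (TangentSpace (𝓡 d) y)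

namespace FibredDensity

variable {D : ψ.Exponential}

/-- The coefficient of the density in a parametrization of `𝕋_H M`, with respect to the coordinates
on the fibre of `r` (the middle group of coordinates). -/
def coeff (f : FibredDensity D) : TGroupoid.ParamIndex D → Euc d × Euc d × ℝ → ℂ
  | .pair x₀ y₀ => fun p =>
      (f.pair ((chartAt (Euc d) x₀).symm p.1) ((chartAt (Euc d) y₀).symm p.2.1) p.2.2).1
        (chartFrame y₀ _)
  | .exp x₀ X _ _ _ => fun p =>
      if p.2.2 = 0 then
        (f.osc ((chartAt (Euc d) x₀).symm p.1) ((ψ.iso _).symm (∑ i, p.2.1 i • X.vec i _))).1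
          (fun i => (ψ.iso _).symm (X.vec i _))
      else
        (f.pair ((chartAt (Euc d) x₀).symm p.1)
          (D.exp ⟨_, X.point ((chartAt (Euc d) x₀).symm p.1) p.2.1 p.2.2⟩) p.2.2).1
          (fun i => mfderiv (𝓡 d) (𝓡 d)
            (fun z : Euc d => D.exp ⟨_, X.point ((chartAt (Euc d) x₀).symm p.1) z p.2.2⟩) p.2.1
            (EuclideanSpace.single i (1 : ℝ)))

/-- Smooth sections of `Ω_r`. -/
def IsSmooth (f : FibredDensity D) : Prop :=
  ∀ i, ContDiffOn ℝ ∞ (f.coeff i) ((TGroupoid.atlas D).dom i)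

/-- Continuous sections of `Ω_r`. -/
def IsContinuous (f : FibredDensity D) : Prop :=
  ∀ i, ContinuousOn (f.coeff i) ((TGroupoid.atlas D).dom i)

/-- The support of the density. -/
def support (f : FibredDensity D) : Set (TGroupoid D) :=
  closure {p | match p with
    | .osc x z => f.osc x z ≠ 0
    | .pair x y h _ => f.pair x y h ≠ 0}

/-- The support is `r`-proper and `s`-proper. -/
def IsProper (f : FibredDensity D) : Prop :=
  ∀ K : Set (M × ℝ), IsCompact K → IsCompact (f.support ∩ TGroupoid.r D ⁻¹' K) ∧
    IsCompact (f.support ∩ TGroupoid.s D ⁻¹' K)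

/-- The fibred distribution `T` is given by integration of the density `f` along the fibres of `r`.
In the fibre `𝔱_H M_x` over `(x, 0)` this is tested on functions with compact support, in any linear
coordinates; in the fibre `M` over `(x, h)`, `h ≠ 0`, on functions with compact support in the
domain of a chart. -/
def Represents (f : FibredDensity D) (T : GroupoidDist D) : Prop :=
  (∀ (x : M) (L : Euc d ≃ₗ[ℝ] H.Osc x) (u : (TGroupoid.atlas D).Smooth),
    HasCompactSupport (fun z : Euc d => u (.osc x (L z))) →
      T.1 u (x, 0) = ∫ z : Euc d,
        u (.osc x (L z)) * (f.osc x (L z)).1 (fun i => L (EuclideanSpace.single i (1 : ℝ)))) ∧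
  ∀ (x : M) (h : ℝ) (hh : h ≠ 0) (y₀ : M) (u : (TGroupoid.atlas D).Smooth),
    HasCompactSupport (fun y => u (.pair x y h hh)) →
    tsupport (fun y => u (.pair x y h hh)) ⊆ (chartAt (Euc d) y₀).source →
      T.1 u (x, h) = ∫ y in (chartAt (Euc d) y₀).target,
        u (.pair x ((chartAt (Euc d) y₀).symm y) h hh) *
          (f.pair x ((chartAt (Euc d) y₀).symm y) h).1 (chartFrame y₀ _)

end FibredDensity

/-! ### The pseudodifferential calculus -/

namespace GroupoidDist

variable {D : ψ.Exponential}

/-- `ℙ` belongs to `C^∞_p(𝕋_H M, Ω_r)`. -/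
def IsSmoothProper (P : GroupoidDist D) : Prop :=
  ∃ f : FibredDensity D, f.IsSmooth ∧ f.IsProper ∧ f.Represents P

/-- `ℙ` is a pseudodifferential kernel of order `m`: `(L_Z - m) ℙ ∈ C^∞_p(𝕋_H M, Ω_r)`. -/
def IsKernel (m : ℂ) (P : GroupoidDist D) : Prop :=
  ∃ L, IsLieDeriv P L ∧ IsSmoothProper (L - m • P)

/-- `τ = tr ℙ`: the fibred distribution `ℙ` is a continuous section of `Ω_r`, and `τ` is its
restriction to the unit space `M × ℝ`. The restriction of `Ω_r` to the unit space is identified with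
the pullback of `ΩM` by means of the exponential chart: by `ψ` at `h = 0`, and by `δ_h`, of
determinant `± h^{d_H}`, at `h ≠ 0`. -/
def HasLocalTrace (P : GroupoidDist D) (τ : ContDens (d := d) (Prod.fst : M × ℝ → M)) : Prop :=
  ∃ f : FibredDensity D, f.IsContinuous ∧ f.Represents P ∧
    (∀ (x : M) (v : Fin d → TangentSpace (𝓡 d) x),
      τ.eval (x, 0) v = (f.osc x 0).1 (fun i => (ψ.iso x).symm (v i))) ∧
    ∀ (x : M) (h : ℝ), h ≠ 0 → ∀ v : Fin d → TangentSpace (𝓡 d) x,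
      τ.eval (x, h) v = ((|h| ^ H.homDim : ℝ) : ℂ) * (f.pair x x h).1 v

/-- A holomorphic pseudodifferential kernel family on `Ω` with order function `μ`. -/
def IsHolomorphicKernelFamily (Ω : Set ℂ) (μ : ℂ → ℂ) (P : ℂ → GroupoidDist D) : Prop :=
  HolomorphicOn P Ω ∧ ∀ s ∈ Ω, IsKernel (μ s) (P s)

end GroupoidDist

namespace PairDist

variable (D : ψ.Exponential)

/-- `P` is a pseudodifferential operator of order `m`. -/
def IsPseudodifferential (m : ℂ) (P : PairDist d M) : Prop :=
  ∃ Q : GroupoidDist D, GroupoidDist.IsKernel m Q ∧ GroupoidDist.IsRestrictionAtOne Q P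

/-- `τ = tr P` for a pseudodifferential operator `P` of order `m`: `τ = tr_1 ℙ` for every kernel `ℙ`
of order `m` with `ℙ_1 = P`. -/
def HasLocalTrace (m : ℂ) (P : PairDist d M) (τ : ContDens (d := d) (id : M → M)) : Prop :=
  IsPseudodifferential D m P ∧
    ∀ Q : GroupoidDist D, GroupoidDist.IsKernel m Q → GroupoidDist.IsRestrictionAtOne Q P →
      ∃ σ, GroupoidDist.HasLocalTrace Q σ ∧ ∀ (x : M) (v : Fin d → TangentSpace (𝓡 d) x),
        τ.eval x v = σ.eval (x, 1) v

/-- `ρ = res(P)`, the residue density of a pseudodifferential operator `P` of order `-d_H`: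
`tr_0 (λ^{d_H} (α_λ)_* ℙ - ℙ) = log λ · ρ` for every kernel `ℙ` of order `-d_H` with `ℙ_1 = P` and
every `λ > 0`. -/
def IsResidueDensity (P : PairDist d M) (ρ : ContDens (d := d) (id : M → M)) : Prop :=
  IsPseudodifferential D (-(H.homDim : ℂ)) P ∧
    ∀ Q : GroupoidDist D, GroupoidDist.IsKernel (-(H.homDim : ℂ)) Q → GroupoidDist.IsRestrictionAtOne Q P →
      ∀ (l : ℝ) (hl : 0 < l),
        ∃ σ, GroupoidDist.HasLocalTrace (((l : ℂ) ^ H.homDim) • GroupoidDist.push l hl Q - Q) σ ∧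
          ∀ (x : M) (v : Fin d → TangentSpace (𝓡 d) x),
            σ.eval (x, 0) v = (Real.log l : ℂ) * ρ.eval x v

/-- A holomorphic pseudodifferential family on `Ω` with order function `μ`. -/
def IsHolomorphicFamily (Ω : Set ℂ) (μ : ℂ → ℂ) (P : ℂ → PairDist d M) : Prop :=
  ∃ Q : ℂ → GroupoidDist D, GroupoidDist.IsHolomorphicKernelFamily Ω μ Q ∧
    ∀ s ∈ Ω, GroupoidDist.IsRestrictionAtOne (Q s) (P s)

end PairDist

end Manifold

end HCalc

end

/-!
The continuation of the local trace of a holomorphic family of pseudodifferential kernels `ℙ(s)`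
rests on the fact that a kernel is recovered from its defect of homogeneity. Let `f_s` be the smooth
density along the fibres of `r` that represents `(L_Z - μ(s)) ℙ(s)`. Along the zoom action,
`t ↦ t^{-μ(s)} (α_t)_* ℙ(s)` has the derivative `t^{-μ(s)-1} (α_t)_* f_s`, so that for
`Re μ(s) < -d_H`
`ℙ(s) = ∫₀¹ t^{-μ(s)-1} (α_t)_* f_s dt`.
The right-hand side is a continuous density (`represents_of_re_lt`): the zooms of `f_s` are bounded
by `t^{-d_H}`, as the Jacobian determinant of the exponential coordinates at height `h` has the factor
`h^{d_H}` (`exists_bound_coeff_zoom`, `exists_bound_pairCoeff_zoom`). With `τ_s(x, h)` the trace of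
`f_s` and `e(s) = -μ(s) - d_H`, its trace at `(x, h)` is the Mellin integral
`∫₀¹ t^{e(s)-1} τ_s(x, th) dt` (`unitDens_mellinDens`).

Integration by parts continues the Mellin integral in `e`, with poles only where `-e ∈ ℕ`, and with
the residue `τ(x, 0)` at `e = 0`, whatever `h` is (`mellinCont`, `mellinCont_eq_reg`,
`mellinReg_zero_zero`). At a point where `e(s) = -j`, the pole has finite order, as `e + j` does not
vanish identically on the connected set `Ω`, which contains points with `Re e > 0`
(`exists_factorization`). At a simple zero `s₀` of `e`, the residue is
`τ_{s₀}(x, 0) / e'(s₀) = -τ_{s₀}(x, 0) / μ'(s₀)`. The trace `τ_{s₀}(x, 0)` is the residue density: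
the trace at `h = 0` of `λ^{d_H} (α_λ)_* ℙ - ℙ` is `∫₁^λ t⁻¹ τ(x, 0) dt` (`hasLocalTrace_push_sub`).
It depends only on the restriction of the kernel to `h = 1`, since it is the coefficient of the
logarithmic divergence of the kernel at the unit `(x, x, 1)` (`unitDens_zero_eq_of_restriction`).

What remains is that `τ_s`, together with all its derivatives in `h`, depends holomorphically on `s`
(`holSmooth_coeff`). The hypothesis provides holomorphy of `ℙ(s)` only, in the topology of bounded
convergence, and nothing about the dependence of `f_s` on `s`. However, `f_s` at a unit is the limit,
for each `s`, of the pairing of `(1 + ε)^{-μ(s)} (α_{1+ε})_* ℙ(s) - ℙ(s)` with `ε⁻¹` times a test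
function concentrated at scale `ε` (`mollified`, `push_sub_testFun`). These pairings are holomorphic
in `s`, grow at most polynomially in `ε⁻¹`, uniformly for `s` in compact sets
(`exists_polynomial_bound`), and converge at the rate `ε` for each `s` separately, with a constant
that is not controlled in `s`. A form of Hartogs' lemma (`hartogs`) turns this into locally uniform
convergence for `ε = 2⁻ᵏ` (`holC_of_hartogs`). It is proved with Jensen's formula: the set of `s` where
the constant is large has small area, hence meets many circles in sets of small angular measure.

Joint continuity, and holomorphy in `s`, of coefficients give holomorphy and residues in the space of
continuous densities (`HolDens.holomorphicOn`, `HolDens.hasResidueAt`). The statement for families on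
`M` is the restriction to `h = 1` of the statement for kernels.
-/

noncomputable section

namespace HCalc
open MeasureTheory Real Metric

/-! ### Hartogs' lemma -/

/-- A two-constants estimate: a holomorphic function that is at most `exp b` on a circle, except on a
part of angular measure `δ` where it is at most `exp a`, satisfies the averaged bound at the centre.
This is the inequality in Jensen's formula. -/
theorem log_norm_le_circle {g : ℂ → ℂ} {s : ℂ} {r a b δ : ℝ} (hr : 0 < r)
    (hg : AnalyticOnNhd ℂ g (closedBall s r)) (hs : g s ≠ 0) {B : Set ℂ} (hBo : MeasurableSet B)
    (hab : b ≤ a) (hB : ∀ z ∈ sphere s r, z ∈ B → ‖g z‖ ≤ Real.exp a)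
    (hB' : ∀ z ∈ sphere s r, z ∉ B → ‖g z‖ ≤ Real.exp b)
    (hδ : volume {θ ∈ Ioc (-π) π | circleMap s r θ ∈ B} ≤ ENNReal.ofReal δ) (hδ0 : 0 ≤ δ) :
    Real.log ‖g s‖ ≤ b + (a - b) * δ / (2 * π) := by
  have hra : |r| = r := abs_of_pos hr
  have hJ := AnalyticOnNhd.circleAverage_log_norm (f := g) hr.ne' (by rwa [hra]) hs
  have hsum : 0 ≤ ∑ᶠ u, (MeromorphicOn.divisor g (closedBall s |r|) u : ℝ) *
      Real.log (r * ‖s - u‖⁻¹) := by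
    refine finsum_nonneg fun u => ?_
    by_cases hu : u ∈ closedBall s |r|
    · refine mul_nonneg ?_ ?_
      · exact_mod_cast (MeromorphicOn.AnalyticOnNhd.divisor_nonneg (by rwa [hra]) :
          0 ≤ MeromorphicOn.divisor g (closedBall s |r|)) u
      · by_cases h0 : s - u = 0
        · simp [h0]
        · refine Real.log_nonneg ?_
          rw [← div_eq_mul_inv, le_div_iff₀ (norm_pos_iff.2 h0), one_mul]
          rw [hra, mem_closedBall, dist_comm, dist_eq_norm] at hu
          exact hu
    · rw [Function.locallyFinsuppWithin.apply_eq_zero_of_notMem _ hu]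
      simp
  -- comparison of `log ‖g‖` with the step function `Bd` on the circle
  let F : ℂ → ℝ := fun z => if g z = 0 then b else Real.log ‖g z‖
  let Bd : ℂ → ℝ := fun z => B.indicator (fun _ => a - b) z + b
  have hcod : (fun z => Real.log ‖g z‖) =ᶠ[codiscreteWithin (sphere s |r|)] F := by
    have h1 : ∀ᶠ z in codiscreteWithin (closedBall s |r|), g z ≠ 0 := by
      rw [hra]
      refine (hg.preimage_zero_mem_codiscreteWithin (x := s) hs (by simp [hr.le]) ?_)
      exact (convex_closedBall s r).isConnected ⟨s, by simp [hr.le]⟩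
    filter_upwards [codiscreteWithin_mono sphere_subset_closedBall h1] with z hz
    simp [F, hz]
  have hint : CircleIntegrable (fun z => Real.log ‖g z‖) s r :=
    MeromorphicOn.circleIntegrable_log_norm fun z hz =>
      (hg z (sphere_subset_closedBall (by rwa [hra] at hz))).meromorphicAt
  have hF : CircleIntegrable F s r := hint.congr_codiscreteWithin hcod
  have hm : Measurable Bd := (measurable_const.indicator hBo).add_const b
  have hBd : CircleIntegrable Bd s r := by
    have : IntervalIntegrable (fun θ => Bd (circleMap s r θ)) volume 0 (2 * π) := by
      refine (intervalIntegrable_const (c := |a - b| + |b|)).mono_fun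
        (hm.comp (continuous_circleMap s r).measurable).aestronglyMeasurable ?_
      refine Eventually.of_forall fun θ => ?_
      simp only [Bd, indicator, Real.norm_eq_abs]
      rw [abs_of_nonneg (by positivity : 0 ≤ |a - b| + |b|)]
      split_ifs
      · exact abs_add_le _ _
      · simp
    exact this
  have h1 : circleAverage (fun z => Real.log ‖g z‖) s r ≤ circleAverage Bd s r := by
    rw [circleAverage_congr_codiscreteWithin hcod hr.ne']
    refine circleAverage_mono hF hBd fun z hz => ?_
    rw [hra] at hz
    simp only [F, Bd, indicator]
    by_cases h0 : g z = 0
    · simp only [h0, if_true]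
      split_ifs <;> linarith
    · simp only [h0, if_false]
      split_ifs with hzB
      · have := Real.log_le_log (norm_pos_iff.2 h0) (hB z hz hzB)
        rw [Real.log_exp] at this; linarith
      · have := Real.log_le_log (norm_pos_iff.2 h0) (hB' z hz hzB)
        rw [Real.log_exp] at this; linarith
  have h2 : circleAverage Bd s r ≤ b + (a - b) * δ / (2 * π) := by
    rw [circleAverage_eq_integral_add (-π), intervalIntegral.integral_comp_add_right
      (fun θ => Bd (circleMap s r θ))]
    rw [show (0 + -π) = -π by ring, show 2 * π + -π = π by ring]
    let Θ : Set ℝ := {θ | circleMap s r θ ∈ B}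
    have hΘ : MeasurableSet Θ := (continuous_circleMap s r).measurable hBo
    have e1 : ∀ θ, Bd (circleMap s r θ) = Θ.indicator (fun _ => a - b) θ + b := fun θ => rfl
    simp only [e1]
    rw [intervalIntegral.integral_add, intervalIntegral.integral_const]
    · rw [intervalIntegral.integral_of_le (by linarith [Real.pi_pos]),
        setIntegral_indicator hΘ, setIntegral_const]
      have h3 : volume.real (Ioc (-π) π ∩ Θ) ≤ δ :=
        ENNReal.toReal_le_of_le_ofReal hδ0 hδ
      have hp := Real.pi_pos
      simp only [smul_eq_mul]
      have h4 : volume.real (Ioc (-π) π ∩ Θ) * (a - b) ≤ δ * (a - b) :=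
        mul_le_mul_of_nonneg_right h3 (by linarith)
      calc (2 * π)⁻¹ * (volume.real (Ioc (-π) π ∩ Θ) * (a - b) + (π - -π) * b)
          ≤ (2 * π)⁻¹ * (δ * (a - b) + (π - -π) * b) := by gcongr
        _ = b + (a - b) * δ / (2 * π) := by field_simp; ring
    · exact (intervalIntegrable_const (c := a - b)).mono_fun
        (measurable_const.indicator hΘ).aestronglyMeasurable
        (Eventually.of_forall fun θ => by
          simp only [indicator]; split_ifs <;> simp)
    · exact intervalIntegrable_const
  linarith

/-- Among the circles about `s` of radius between `ρ` and `2ρ`, one meets an open set of small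
area in a set of small angular measure. -/
theorem exists_circle_small (s : ℂ) {ρ δ : ℝ} (hρ : 0 < ρ) (hδ : 0 < δ) {B : Set ℂ}
    (hB : MeasurableSet B) (hv : volume B < ENNReal.ofReal (ρ ^ 2 * δ)) :
    ∃ r ∈ Ioc ρ (2 * ρ), volume {θ ∈ Ioc (-π) π | circleMap s r θ ∈ B} ≤ ENNReal.ofReal δ := by
  by_contra! hcon
  -- otherwise integration in polar coordinates makes the area of `B` too large
  refine absurd hv (not_lt.2 ?_)
  have e0 : volume B = ∫⁻ p : ℂ, B.indicator 1 (s + p) := by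
    rw [lintegral_add_left_eq_self (fun p : ℂ => B.indicator (1 : ℂ → ENNReal) p) s,
      lintegral_indicator_one hB]
  rw [e0, ← Complex.lintegral_comp_polarCoord_symm]
  have hmeas : MeasurableSet {q : ℝ × ℝ | circleMap s q.1 q.2 ∈ B} := by
    have : Continuous fun q : ℝ × ℝ => circleMap s q.1 q.2 := by
      unfold circleMap; fun_prop
    exact this.measurable hB
  let f : ℝ × ℝ → ENNReal := fun q => ENNReal.ofReal ρ *
    {q : ℝ × ℝ | circleMap s q.1 q.2 ∈ B}.indicator 1 q
  have hfm : Measurable f := measurable_const.mul (measurable_one.indicator hmeas)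
  have hsub : Ioc ρ (2 * ρ) ×ˢ Ioo (-π) π ⊆ polarCoord.target := by
    rw [polarCoord_target]
    exact prod_mono (fun x hx => hρ.trans hx.1) subset_rfl
  calc ENNReal.ofReal (ρ ^ 2 * δ)
      = ∫⁻ _ in Ioc ρ (2 * ρ), ENNReal.ofReal ρ * ENNReal.ofReal δ := by
        rw [setLIntegral_const, Real.volume_Ioc, ← ENNReal.ofReal_mul hρ.le,
          ← ENNReal.ofReal_mul (by positivity)]
        congr 1; ring
    _ ≤ ∫⁻ r in Ioc ρ (2 * ρ), ∫⁻ θ in Ioo (-π) π, f (r, θ) := by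
        refine setLIntegral_mono' measurableSet_Ioc fun r hr => ?_
        simp only [f]
        have hΘ : MeasurableSet {θ | circleMap s r θ ∈ B} :=
          (continuous_circleMap s r).measurable hB
        have e1 : ∀ θ, ({q : ℝ × ℝ | circleMap s q.1 q.2 ∈ B}.indicator (1 : ℝ × ℝ → ENNReal)) (r, θ)
          = ({θ | circleMap s r θ ∈ B}.indicator 1) θ := fun θ => rfl
        simp only [e1]
        rw [lintegral_const_mul _ (measurable_one.indicator hΘ)]
        gcongr
        refine (hcon r hr).le.trans (le_of_eq ?_)
        rw [restrict_Ioo_eq_restrict_Ioc, lintegral_indicator_one hΘ, Measure.restrict_apply hΘ]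
        congr 1; ext θ; exact and_comm
    _ = ∫⁻ q in Ioc ρ (2 * ρ) ×ˢ Ioo (-π) π, f q := by
        rw [Measure.volume_eq_prod, setLIntegral_prod _ hfm.aemeasurable]
    _ ≤ ∫⁻ q in Ioc ρ (2 * ρ) ×ˢ Ioo (-π) π, ENNReal.ofReal q.1 •
          B.indicator 1 (s + Complex.polarCoord.symm q) := by
        refine setLIntegral_mono' (measurableSet_Ioc.prod measurableSet_Ioo) fun q hq => ?_
        simp only [f, smul_eq_mul]
        gcongr
        · exact hq.1.1.le
        · refine le_of_eq ?_
          have : s + Complex.polarCoord.symm q = circleMap s q.1 q.2 := by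
            rw [Complex.polarCoord_symm_apply, circleMap, Complex.exp_mul_I]
            push_cast; rfl
          rw [this]; rfl
    _ ≤ _ := lintegral_mono_set hsub

/-- **Hartogs' lemma** in quantitative form. Holomorphic functions `g i` on a disc that are
uniformly of size `O(e^{A L i})`, and at every single point of size `O(e^{-L i})`, are uniformly
of size `O(e^{-L i / 2})` on a smaller disc. -/
theorem hartogs {ι : Type*} {g : ι → ℂ → ℂ} {L : ι → ℝ} {s₀ : ℂ} {R A C : ℝ} (hR : 0 < R)
    (hL : ∀ i, 0 ≤ L i) (hA : 0 ≤ A)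
    (hg : ∀ i, DifferentiableOn ℂ (g i) (ball s₀ (2 * R)))
    (hC : ∀ i, ∀ s ∈ ball s₀ (2 * R), ‖g i s‖ ≤ C * Real.exp (A * L i))
    (hpt : ∀ s ∈ ball s₀ (2 * R), ∃ n : ℝ, ∀ i, ‖g i s‖ ≤ n * Real.exp (-L i)) :
    ∃ C', ∀ s ∈ ball s₀ R, ∀ i, ‖g i s‖ ≤ C' * Real.exp (-(L i) / 2) := by
  -- the points where the bound with the constant `n` fails form open sets that decrease to `∅`
  let B : ℕ → Set ℂ := fun n => {s ∈ ball s₀ (2 * R) | ∃ i, n * Real.exp (-L i) < ‖g i s‖}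
  have hBo : ∀ n, IsOpen (B n) := fun n => by
    have : B n = ⋃ i, (ball s₀ (2 * R) ∩ (fun s => ‖g i s‖) ⁻¹' Ioi (n * Real.exp (-L i))) := by
      ext s; simp [B]
    rw [this]
    exact isOpen_iUnion fun i => (hg i).continuousOn.norm.isOpen_inter_preimage isOpen_ball isOpen_Ioi
  have hBa : Antitone B := fun n m hnm s ⟨h1, i, h2⟩ =>
    ⟨h1, i, lt_of_le_of_lt (by gcongr) h2⟩
  have hBe : ⋂ n, B n = ∅ := by
    refine eq_empty_of_forall_notMem fun s hs => ?_
    rw [mem_iInter] at hs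
    obtain ⟨n, hn⟩ := hpt s (hs 0).1
    obtain ⟨k, hk⟩ := exists_nat_ge n
    obtain ⟨_, i, hi⟩ := hs k
    have := hn i
    have h3 : n * Real.exp (-L i) ≤ k * Real.exp (-L i) := by gcongr
    linarith
  have hlim : Tendsto (fun n => volume (B n)) atTop (𝓝 0) := by
    have h := tendsto_measure_iInter_atTop (μ := volume)
      (fun n => (hBo n).measurableSet.nullMeasurableSet) hBa
      ⟨0, ((measure_mono (sep_subset _ _)).trans_lt measure_ball_lt_top).ne⟩
    rwa [hBe, measure_empty] at h
  have hp := Real.pi_pos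
  -- `δ / 2π` is the weight for which the mean of the exponents `A` and `-1` is `-1 / 2`
  set δ : ℝ := 2 * π / (2 * (A + 1)) with hδd
  have hδ : 0 < δ := by positivity
  have hρ : 0 < R / 4 := by positivity
  have hev := (hlim.eventually_lt_const
    (ENNReal.ofReal_pos.2 (by positivity : 0 < (R / 4) ^ 2 * δ))).and (eventually_ge_atTop 1)
  obtain ⟨n, hn, hn1⟩ := hev.exists
  have hn1' : (1 : ℝ) ≤ n := by exact_mod_cast hn1
  set C₁ := max C 1
  refine ⟨C₁ * n, fun s hs i => ?_⟩
  by_cases h0 : g i s = 0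
  · rw [h0, norm_zero]; positivity
  obtain ⟨r, hr, hrB⟩ := exists_circle_small s hρ hδ (hBo n).measurableSet hn
  have hr0 : 0 < r := hρ.trans hr.1
  have hcb : closedBall s r ⊆ ball s₀ (2 * R) := fun z hz => by
    rw [mem_closedBall] at hz; rw [mem_ball] at hs ⊢
    have := dist_triangle z s s₀
    have := hr.2
    linarith
  have hC1 : (1 : ℝ) ≤ C₁ := le_max_right _ _
  have key := log_norm_le_circle (g := g i) (a := Real.log C₁ + Real.log n + A * L i)
    (b := Real.log C₁ + Real.log n - L i) hr0
    ((hg i).analyticOnNhd isOpen_ball |>.mono hcb) h0 (hBo n).measurableSet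
    (by nlinarith [hL i]) (fun z hz _ => ?_) (fun z hz hzB => ?_) hrB hδ.le
  · have e1 : Real.log C₁ + Real.log n - L i +
        (Real.log C₁ + Real.log n + A * L i - (Real.log C₁ + Real.log n - L i)) * δ / (2 * π) =
        Real.log C₁ + Real.log n + -(L i) / 2 := by
      rw [hδd]; field_simp; ring
    rw [e1] at key
    have := Real.exp_le_exp.2 key
    rwa [Real.exp_log (norm_pos_iff.2 h0), Real.exp_add, Real.exp_add, Real.exp_log (by linarith),
      Real.exp_log (by linarith)] at this
  · rw [Real.exp_add, Real.exp_add, Real.exp_log (by linarith), Real.exp_log (by linarith)]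
    refine (hC i z (hcb (sphere_subset_closedBall hz))).trans ?_
    gcongr
    calc C ≤ C₁ := le_max_left _ _
      _ ≤ C₁ * n := le_mul_of_one_le_right (by linarith) hn1'
  · rw [sub_eq_add_neg, Real.exp_add, Real.exp_add, Real.exp_log (by linarith),
      Real.exp_log (by linarith)]
    have h1 : ‖g i z‖ ≤ n * Real.exp (-L i) := by
      by_contra! h
      exact hzB ⟨hcb (sphere_subset_closedBall hz), i, h⟩
    refine h1.trans ?_
    gcongr
    exact le_mul_of_one_le_left (by linarith) hC1

end HCalc

namespace HCalc
open MeasureTheory Metric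

/-! ### Cut-off functions, parametric integrals, and derivatives in the last variable -/

/-- Smooth cut-off functions in a finite-dimensional space. -/
theorem exists_bump {G : Type*} [NormedAddCommGroup G] [NormedSpace ℝ G] [FiniteDimensional ℝ G]
    {K U : Set G} (hK : IsCompact K) (hU : IsOpen U) (hKU : K ⊆ U) :
    ∃ χ : G → ℝ, ContDiff ℝ ∞ χ ∧ HasCompactSupport χ ∧ tsupport χ ⊆ U ∧
      (∀ᶠ x in 𝓝ˢ K, χ x = 1) ∧ ∀ x, χ x ∈ Icc (0 : ℝ) 1 := by
  obtain ⟨K', hK', hKK', hK'U⟩ := exists_compact_between hK hU hKU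
  obtain ⟨f, h1, h0, h⟩ := exists_contMDiffMap_one_nhds_of_subset_interior (n := ⊤) 𝓘(ℝ, G)
    hK.isClosed hKK'
  have hs : tsupport f ⊆ K' := by
    refine closure_minimal (fun x hx => ?_) hK'.isClosed
    by_contra hxK
    exact hx (h0 x hxK)
  exact ⟨f, f.contMDiff.contDiff, hK'.of_isClosed_subset (isClosed_tsupport _) hs,
    hs.trans hK'U, h1, h⟩

open Convolution in
/-- Differentiation under an integral over a compact set. -/
theorem contDiffOn_parametric_integral {P G : Type*} [NormedAddCommGroup P] [NormedSpace ℝ P]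
    [NormedAddCommGroup G] [NormedSpace ℝ G] [FiniteDimensional ℝ G] [MeasurableSpace G]
    [BorelSpace G] {μ : Measure G} {w : G → ℂ} (hw : LocallyIntegrable w μ) {k : Set G}
    (hk : IsCompact k) (hwk : ∀ t, t ∉ k → w t = 0) {Φ : P × G → ℂ} {W : Set (P × G)}
    (hW : IsOpen W) (hΦ : ContDiffOn ℝ ∞ Φ W) {s : Set P} (hs : ∀ p ∈ s, ∀ t ∈ k, (p, t) ∈ W) :
    ContDiffOn ℝ ∞ (fun p => ∫ t, w t * Φ (p, t) ∂μ) s := by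
  intro p hp
  obtain ⟨u, V, hu, hV, hpu, hkV, huV⟩ := generalized_tube_lemma (isCompact_singleton (x := p)) hk
    hW (by rintro ⟨q, t⟩ ⟨rfl, ht⟩; exact hs _ hp t ht)
  obtain ⟨χ, hχ, hχc, hχV, hχ1, -⟩ := exists_bump hk hV hkV
  have hpu' : p ∈ u := hpu rfl
  -- the integral is the value at `0` of the convolution of `w` with `g q`
  let g : P → G → ℂ := fun q t => χ (-t) * Φ (q, -t)
  have hg : ContDiffOn ℝ ∞ ↿g (u ×ˢ univ) := by
    rintro ⟨q, t⟩ ⟨hq, -⟩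
    refine ContDiffAt.contDiffWithinAt ?_
    by_cases ht : -t ∈ tsupport χ
    · have h1 : ContDiffAt ℝ ∞ Φ (q, -t) := hΦ.contDiffAt (hW.mem_nhds (huV ⟨hq, hχV ht⟩))
      have h2 : ContDiffAt ℝ ∞ (fun x : P × G => Φ (x.1, -x.2)) (q, t) :=
        ContDiffAt.comp (g := Φ) (q, t) h1 (by fun_prop)
      have h3 : ContDiffAt ℝ ∞ (fun x : P × G => (χ (-x.2) : ℂ)) (q, t) :=
        (Complex.ofRealCLM.contDiff.comp (hχ.comp contDiff_snd.neg)).contDiffAt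
      exact h3.mul h2
    · have h4 : (↿g) =ᶠ[𝓝 (q, t)] fun _ => 0 := by
        have : ∀ᶠ x : P × G in 𝓝 (q, t), -x.2 ∉ tsupport χ :=
          (continuous_snd.neg.continuousAt (x := (q, t))).eventually
            ((isClosed_tsupport χ).isOpen_compl.mem_nhds ht)
        filter_upwards [this] with x hx
        change (χ (-x.2) : ℂ) * _ = 0
        rw [image_eq_zero_of_notMem_tsupport hx]; simp
      exact contDiffAt_const.congr_of_eventuallyEq h4
  have hcpt : IsCompact (-(tsupport χ)) := hχc.isCompact.neg
  have h := contDiffOn_convolution_right_with_param_comp (𝕜 := ℝ) (n := ⊤) (μ := μ)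
    (ContinuousLinearMap.mul ℝ ℂ) (v := fun _ : P => (0 : G)) (s := u) contDiffOn_const (f := w)
    (g := g) hu hcpt (fun q x _ hx => by
      have : -x ∉ tsupport χ := fun h => hx (by simpa using h)
      simp [g, image_eq_zero_of_notMem_tsupport this]) hw hg
  have h' := (h p hpu').contDiffAt (hu.mem_nhds hpu')
  refine ContDiffAt.contDiffWithinAt (h'.congr_of_eventuallyEq ?_)
  filter_upwards with q
  rw [convolution_def]
  refine integral_congr_ae (Eventually.of_forall fun t => ?_)
  simp only [ContinuousLinearMap.mul_apply', g, zero_sub, neg_neg]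
  by_cases ht : t ∈ k
  · rw [(subset_of_mem_nhdsSet hχ1 ht : χ t = 1)]; simp
  · simp [hwk t ht]

/-- Partial derivative in the last real variable. -/
def dlast {P : Type*} (Φ : P × ℝ → ℂ) (q : P × ℝ) : ℂ := deriv (fun h => Φ (q.1, h)) q.2

theorem dlast_eq {P : Type*} [NormedAddCommGroup P] [NormedSpace ℝ P] {Φ : P × ℝ → ℂ} {q : P × ℝ}
    (h : DifferentiableAt ℝ Φ q) : dlast Φ q = fderiv ℝ Φ q (0, 1) := by
  have h1 : HasDerivAt (fun h : ℝ => ((q.1, h) : P × ℝ)) (0, 1) q.2 :=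
    (hasDerivAt_const _ _).prodMk (hasDerivAt_id _)
  have h2 : HasFDerivAt Φ (fderiv ℝ Φ q) (q.1, q.2) := h.hasFDerivAt
  exact (h2.comp_hasDerivAt q.2 h1).deriv

theorem contDiffOn_dlast {P : Type*} [NormedAddCommGroup P] [NormedSpace ℝ P] {Φ : P × ℝ → ℂ}
    {U : Set (P × ℝ)} (hU : IsOpen U) (h : ContDiffOn ℝ ∞ Φ U) : ContDiffOn ℝ ∞ (dlast Φ) U := by
  have h1 : ContDiffOn ℝ ∞ (fun q => fderiv ℝ Φ q (0, 1)) U :=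
    (h.fderiv_of_isOpen hU (by simp)).clm_apply contDiffOn_const
  refine h1.congr fun q hq => dlast_eq ?_
  exact (h.contDiffAt (hU.mem_nhds hq)).differentiableAt (by simp)

theorem contDiffOn_iterate_dlast {P : Type*} [NormedAddCommGroup P] [NormedSpace ℝ P]
    {Φ : P × ℝ → ℂ} {U : Set (P × ℝ)} (hU : IsOpen U) (h : ContDiffOn ℝ ∞ Φ U) (j : ℕ) :
    ContDiffOn ℝ ∞ (dlast^[j] Φ) U := by
  induction j with
  | zero => exact h
  | succ j ih => rw [Function.iterate_succ_apply']; exact contDiffOn_dlast hU ih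

theorem dlast_congr {P : Type*} [TopologicalSpace P] {Φ Ψ : P × ℝ → ℂ} {q : P × ℝ}
    (h : Φ =ᶠ[𝓝 q] Ψ) : dlast Φ =ᶠ[𝓝 q] dlast Ψ := by
  filter_upwards [h.eventually_nhds] with p hp
  refine Filter.EventuallyEq.deriv_eq ?_
  have : Tendsto (fun h : ℝ => ((p.1, h) : P × ℝ)) (𝓝 p.2) (𝓝 p) := by
    have : Continuous (fun h : ℝ => ((p.1, h) : P × ℝ)) := by fun_prop
    exact this.tendsto p.2
  exact this.eventually hp

theorem iterate_dlast_eq_iteratedFDeriv {P : Type*} [NormedAddCommGroup P] [NormedSpace ℝ P]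
    {Φ : P × ℝ → ℂ} {U : Set (P × ℝ)} (hU : IsOpen U) (h : ContDiffOn ℝ ∞ Φ U) (j : ℕ) :
    ∀ q ∈ U, dlast^[j] Φ q = iteratedFDeriv ℝ j Φ q (fun _ => (0, 1)) := by
  induction j with
  | zero => intro q _; simp
  | succ j ih =>
    intro q hq
    rw [Function.iterate_succ_apply', iteratedFDeriv_succ_apply_left]
    have h1 : dlast^[j] Φ =ᶠ[𝓝 q] fun q => iteratedFDeriv ℝ j Φ q (fun _ => (0, 1)) := by
      filter_upwards [hU.mem_nhds hq] with p hp using ih p hp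
    have h2 : DifferentiableAt ℝ (iteratedFDeriv ℝ j Φ) q :=
      ((h.contDiffAt (hU.mem_nhds hq)).differentiableAt_iteratedFDeriv (m := j)
        (by exact_mod_cast WithTop.coe_lt_top _))
    rw [(dlast_congr h1).eq_of_nhds, dlast_eq]
    · have := (h2.hasFDerivAt.continuousMultilinear_apply_const (fun _ => ((0 : P), (1 : ℝ)))).fderiv
      rw [this]
      rfl
    · exact (h2.hasFDerivAt.continuousMultilinear_apply_const _).differentiableAt

theorem norm_iterate_dlast_le {P : Type*} [NormedAddCommGroup P] [NormedSpace ℝ P]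
    {Φ : P × ℝ → ℂ} {U : Set (P × ℝ)} (hU : IsOpen U) (h : ContDiffOn ℝ ∞ Φ U) (j : ℕ)
    {q : P × ℝ} (hq : q ∈ U) : ‖dlast^[j] Φ q‖ ≤ ‖iteratedFDeriv ℝ j Φ q‖ := by
  rw [iterate_dlast_eq_iteratedFDeriv hU h j q hq]
  refine (ContinuousMultilinearMap.le_opNorm _ _).trans ?_
  have : ‖((0 : P), (1 : ℝ))‖ = 1 := by simp [Prod.norm_def]
  simp [this]

end HCalc

namespace HCalc
open MeasureTheory Metric

/-! ### Holomorphic families of functions, and Mellin integrals -/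

/-- Holomorphy in `s` of integrals with a parameter, by domination on a disc. -/
theorem differentiableAt_integral_of_dominated {α : Type*} [MeasurableSpace α] {μ : Measure α}
    {F : ℂ → α → ℂ} {g : α → ℝ} {s₀ : ℂ} {r : ℝ} (hr : 0 < r)
    (hm : ∀ s ∈ ball s₀ r, AEStronglyMeasurable (F s) μ)
    (hb : ∀ᵐ t ∂μ, ∀ s ∈ ball s₀ r, ‖F s t‖ ≤ g t) (hg : Integrable g μ)
    (hd : ∀ᵐ t ∂μ, DifferentiableOn ℂ (fun s => F s t) (ball s₀ r)) :
    DifferentiableAt ℂ (fun s => ∫ t, F s t ∂μ) s₀ := by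
  have hr2 : 0 < r / 2 := by positivity
  have hsub : ∀ s ∈ ball s₀ (r / 2), closedBall s (r / 4) ⊆ ball s₀ r := fun s hs z hz => by
    rw [mem_closedBall] at hz; rw [mem_ball] at hs ⊢
    have := dist_triangle z s s₀; linarith
  -- Cauchy's estimate dominates the derivative by the function that dominates `F`
  have hderiv : ∀ᵐ t ∂μ, ∀ s ∈ ball s₀ (r / 2), ‖deriv (fun s => F s t) s‖ ≤ (r / 4)⁻¹ * g t := by
    filter_upwards [hb, hd] with t h1 h2 s hs
    have := Complex.norm_deriv_le_of_forall_mem_sphere_norm_le (f := fun s => F s t) (c := s)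
      (R := r / 4) (C := g t) (by positivity)
      ((h2.mono (hsub s hs)).diffContOnCl_ball subset_rfl)
      (fun z hz => h1 z (hsub s hs (sphere_subset_closedBall hz)))
    rwa [div_eq_inv_mul] at this
  -- the derivative is measurable as a limit of difference quotients
  have hmd : AEStronglyMeasurable (fun t => deriv (fun s => F s t) s₀) μ := by
    let q : ℕ → ℂ := fun n => ((r / 2 / (n + 1) : ℝ) : ℂ)
    have hq0 : ∀ n, q n ≠ 0 := fun n => by
      simp only [q]; exact_mod_cast (by positivity : (r / 2 / (n + 1) : ℝ) ≠ 0)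
    have hq : Tendsto q atTop (𝓝[≠] 0) := by
      refine tendsto_nhdsWithin_iff.2 ⟨?_, Eventually.of_forall hq0⟩
      have h1 : Tendsto (fun n : ℕ => r / 2 / ((n : ℝ) + 1)) atTop (𝓝 0) :=
        tendsto_const_div_atTop_nhds_zero_nat (r / 2) |>.comp (tendsto_add_atTop_nat 1) |>.congr
          fun n => by simp
      have := (Complex.continuous_ofReal.tendsto 0).comp h1
      simpa [q, Function.comp_def] using this
    refine aestronglyMeasurable_of_tendsto_ae atTop
      (f := fun n t => (q n)⁻¹ • (F (s₀ + q n) t - F s₀ t)) (fun n => ?_) ?_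
    · refine AEStronglyMeasurable.const_smul (AEStronglyMeasurable.sub (hm _ ?_)
        (hm s₀ (mem_ball_self hr))) ((q n)⁻¹)
      rw [mem_ball, dist_eq_norm, add_sub_cancel_left]
      simp only [q, Complex.norm_real, Real.norm_eq_abs]
      rw [abs_of_pos (by positivity)]
      have : r / 2 / ((n : ℝ) + 1) ≤ r / 2 := div_le_self hr2.le (by simp)
      linarith
    · filter_upwards [hd] with t ht
      have h1 : HasDerivAt (fun s => F s t) (deriv (fun s => F s t) s₀) s₀ :=
        (ht.differentiableAt (isOpen_ball.mem_nhds (by simpa using hr))).hasDerivAt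
      exact (hasDerivAt_iff_tendsto_slope_zero.1 h1).comp hq
  exact (hasDerivAt_integral_of_dominated_loc_of_deriv_le (F' := fun s t => deriv (fun s => F s t) s)
    (bound := fun t => (r / 4)⁻¹ * g t) (ball_mem_nhds s₀ hr2)
    (by filter_upwards [ball_mem_nhds s₀ hr] with s hs using hm s hs)
    (hg.mono' (hm s₀ (by simpa using hr)) (by
      filter_upwards [hb] with t ht using ht s₀ (by simpa using hr))) hmd hderiv (hg.const_mul _)
    (by
      filter_upwards [hd] with t ht s hs
      refine (ht.differentiableAt (isOpen_ball.mem_nhds ?_)).hasDerivAt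
      exact ball_subset_ball (by linarith) hs)).2.differentiableAt

/-- Families of functions of `b ∈ V` that are jointly continuous, and holomorphic in `s ∈ U`. -/
def HolC {B : Type*} [TopologicalSpace B] (U : Set ℂ) (V : Set B) (c : ℂ → B → ℂ) : Prop :=
  ContinuousOn (fun p : ℂ × B => c p.1 p.2) (U ×ˢ V) ∧ ∀ b ∈ V, DifferentiableOn ℂ (fun s => c s b) U

namespace HolC
variable {B : Type*} [TopologicalSpace B] {U : Set ℂ} {V : Set B} {c c' : ℂ → B → ℂ}

theorem mul (h : HolC U V c) (h' : HolC U V c') : HolC U V (fun s b => c s b * c' s b) :=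
  ⟨h.1.mul h'.1, fun b hb => (h.2 b hb).mul (h'.2 b hb)⟩
theorem sub (h : HolC U V c) (h' : HolC U V c') : HolC U V (fun s b => c s b - c' s b) :=
  ⟨h.1.sub h'.1, fun b hb => (h.2 b hb).sub (h'.2 b hb)⟩
theorem of_fst {e : ℂ → ℂ} (h : DifferentiableOn ℂ e U) : HolC U V (fun s _ => e s) :=
  ⟨h.continuousOn.comp continuousOn_fst fun _ hp => hp.1, fun _ _ => h⟩
theorem of_snd {f : B → ℂ} (h : ContinuousOn f V) : HolC U V (fun _ => f) :=
  ⟨h.comp continuousOn_snd fun _ hp => hp.2, fun _ _ => differentiableOn_const _⟩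
theorem mono {U' : Set ℂ} {V' : Set B} (h : HolC U V c) (hU : U' ⊆ U) (hV : V' ⊆ V) :
    HolC U' V' c := ⟨h.1.mono (prod_mono hU hV), fun b hb => (h.2 b (hV hb)).mono hU⟩
theorem congr (h : HolC U V c) (hc : ∀ s ∈ U, ∀ b ∈ V, c' s b = c s b) : HolC U V c' :=
  ⟨h.1.congr fun p hp => hc p.1 hp.1 p.2 hp.2, fun b hb => (h.2 b hb).congr fun s hs => hc s hs b hb⟩
theorem comp {B' : Type*} [TopologicalSpace B'] {V' : Set B'} {f : B' → B} (h : HolC U V c)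
    (hf : ContinuousOn f V') (hm : MapsTo f V' V) : HolC U V' (fun s b => c s (f b)) :=
  ⟨h.1.comp (f := fun p : ℂ × B' => (p.1, f p.2)) (continuousOn_fst.prodMk
    (hf.comp continuousOn_snd fun _ hp => hp.2)) fun _ hp => ⟨hp.1, hm hp.2⟩,
    fun _ hb => h.2 _ (hm hb)⟩

end HolC

/-- Families of smooth functions on `ℝ` with parameters, all of whose derivatives are jointly
continuous, and holomorphic in `s`. -/
def HolSmooth {A : Type*} [TopologicalSpace A] (U : Set ℂ) (V : Set A) (φ : ℂ → A → ℝ → ℂ) : Prop :=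
  (∀ s ∈ U, ∀ a ∈ V, ContDiff ℝ ∞ (φ s a)) ∧
    ∀ j : ℕ, HolC U (V ×ˢ univ) fun s (p : A × ℝ) => deriv^[j] (φ s p.1) p.2

theorem HolSmooth.deriv {A : Type*} [TopologicalSpace A] {U : Set ℂ} {V : Set A}
    {φ : ℂ → A → ℝ → ℂ} (h : HolSmooth U V φ) : HolSmooth U V (fun s a => deriv (φ s a)) :=
  ⟨fun s hs a ha => ((contDiff_infty_iff_deriv.1 (h.1 s hs a ha)).2), fun j => h.2 (j + 1)⟩

theorem HolSmooth.mono {A : Type*} [TopologicalSpace A] {U U' : Set ℂ} {V V' : Set A}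
    {φ : ℂ → A → ℝ → ℂ} (h : HolSmooth U V φ) (hU : U' ⊆ U) (hV : V' ⊆ V) : HolSmooth U' V' φ :=
  ⟨fun s hs a ha => h.1 s (hU hs) a (hV ha), fun j => (h.2 j).mono hU (prod_mono hV subset_rfl)⟩

/-- The analytic continuation in `e` from `Re e > 0` to `Re e > -J` of the Mellin type integral
`∫₀¹ t^{e-1} φ(th) dt`, by `J` integrations by parts. -/
def mellinCont : ℕ → ℂ → (ℝ → ℂ) → ℝ → ℂ
  | 0, e, φ, h => ∫ t in (0 : ℝ)..1, (t : ℂ) ^ (e - 1) * φ (t * h)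
  | J + 1, e, φ, h => e⁻¹ * (φ h - h * mellinCont J (e + 1) (deriv φ) h)

/-- The function `(e + j) * mellinCont (j + 1 + J) e`, with the factor `e + j` cancelled. -/
def mellinReg (J : ℕ) : ℕ → ℂ → (ℝ → ℂ) → ℝ → ℂ
  | 0, e, φ, h => φ h - h * mellinCont J (e + 1) (deriv φ) h
  | j + 1, e, φ, h => e⁻¹ * ((e + (j + 1)) * φ h - h * mellinReg J j (e + 1) (deriv φ) h)

theorem mellinCont_const_mul (J : ℕ) (e c : ℂ) (φ : ℝ → ℂ) (h : ℝ) :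
    mellinCont J e (fun t => c * φ t) h = c * mellinCont J e φ h := by
  induction J generalizing e φ with
  | zero =>
    simp only [mellinCont]
    rw [← intervalIntegral.integral_const_mul]
    congr 1; ext t; ring
  | succ J ih =>
    simp only [mellinCont]
    have : deriv (fun t => c * φ t) = fun t => c * deriv φ t := by
      ext t; exact deriv_const_mul_field c
    rw [this, ih]; ring

theorem mellinReg_const_mul (J j : ℕ) (e c : ℂ) (φ : ℝ → ℂ) (h : ℝ) :
    mellinReg J j e (fun t => c * φ t) h = c * mellinReg J j e φ h := by
  have hd : ∀ φ : ℝ → ℂ, deriv (fun t => c * φ t) = fun t => c * deriv φ t := fun φ => by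
    ext t; exact deriv_const_mul_field c
  induction j generalizing e φ with
  | zero => simp only [mellinReg]; rw [hd, mellinCont_const_mul]; ring
  | succ j ih => simp only [mellinReg]; rw [hd, ih]; ring

theorem mellinCont_eq_reg (J j : ℕ) (e : ℂ) (φ : ℝ → ℂ) (h : ℝ) (he : e + j ≠ 0) :
    mellinCont (j + 1 + J) e φ h = (e + j)⁻¹ * mellinReg J j e φ h := by
  induction j generalizing e φ with
  | zero => rw [show 0 + 1 + J = J + 1 by ring]; simp [mellinCont, mellinReg]
  | succ j ih =>
    have he' : e + 1 + j ≠ 0 := by push_cast at he; rwa [add_assoc, add_comm 1 (j : ℂ)]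
    rw [show j + 1 + 1 + J = (j + 1 + J) + 1 by ring]
    simp only [mellinCont, mellinReg]
    rw [ih _ _ he']
    have : e + 1 + j = e + (j + 1) := by ring
    rw [this] at he' ⊢
    push_cast
    field_simp

theorem intervalIntegrable_cpow_mul {e : ℂ} (he : 0 < e.re) {ψ : ℝ → ℂ} (hψ : Continuous ψ) :
    IntervalIntegrable (fun t : ℝ => (t : ℂ) ^ (e - 1) * ψ t) volume 0 1 := by
  refine IntervalIntegrable.mul_continuousOn ?_ hψ.continuousOn
  exact intervalIntegral.intervalIntegrable_cpow' (by simp; linarith)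

/-- Integration by parts. The boundary term at `t = 0` vanishes, as `Re e > 0`. -/
theorem mellinCont_zero_eq_one {e : ℂ} (he : 0 < e.re) {φ : ℝ → ℂ} (hφ : ContDiff ℝ ∞ φ) (h : ℝ) :
    mellinCont 0 e φ h = mellinCont 1 e φ h := by
  have he0 : e ≠ 0 := fun h0 => by simp [h0] at he
  have hφ' : Continuous (deriv φ) := hφ.continuous_deriv (by simp)
  have hi1 := intervalIntegrable_cpow_mul he (ψ := fun t => φ (t * h))
    (hφ.continuous.comp (continuous_mul_const h))
  have hi2 := intervalIntegrable_cpow_mul (e := e + 1) (by simp; linarith)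
    (ψ := fun t => deriv φ (t * h)) (hφ'.comp (continuous_mul_const h))
  have key : ∫ t in (0 : ℝ)..1, (e * ((t : ℂ) ^ (e - 1) * φ (t * h)) +
      h * ((t : ℂ) ^ (e + 1 - 1) * deriv φ (t * h))) = φ h := by
    have := intervalIntegral.integral_eq_sub_of_hasDerivAt_of_le (a := 0) (b := 1)
      (f := fun t : ℝ => (t : ℂ) ^ e * φ (t * h)) zero_le_one ?_ ?_
      ((hi1.const_mul e).add (hi2.const_mul h))
    · rw [this]; simp [Complex.zero_cpow he0]
    · refine (Continuous.mul ?_ (hφ.continuous.comp (continuous_mul_const h))).continuousOn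
      exact (Complex.continuous_ofReal_cpow_const he)
    · intro t ht
      have h1 : HasDerivAt (fun t : ℝ => (t : ℂ) ^ e) (e * (t : ℂ) ^ (e - 1)) t := by
        have := hasDerivAt_ofReal_cpow_const' (x := t) ht.1.ne' (r := e - 1)
          (fun hc => he0 (by simpa using hc))
        have h2 := this.const_mul e
        simp only [sub_add_cancel] at h2
        refine h2.congr_of_eventuallyEq (Eventually.of_forall fun y => ?_)
        simp only; field_simp
      have h2 : HasDerivAt (fun t : ℝ => φ (t * h)) (h * deriv φ (t * h)) t := by
        have hd : HasDerivAt φ (deriv φ (t * h)) (t * h) :=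
          ((hφ.differentiable (by simp)) _).hasDerivAt
        have := hd.scomp t ((hasDerivAt_id t).mul_const h)
        simpa [Function.comp_def] using this
      have := h1.mul h2
      refine this.congr_deriv ?_
      rw [add_sub_cancel_right]; ring
  rw [intervalIntegral.integral_add (hi1.const_mul e) (hi2.const_mul h),
    intervalIntegral.integral_const_mul, intervalIntegral.integral_const_mul] at key
  simp only [mellinCont]
  rw [eq_inv_mul_iff_mul_eq₀ he0]
  linear_combination key

theorem mellinCont_succ (J : ℕ) {e : ℂ} (he : 0 < e.re + J) {φ : ℝ → ℂ} (hφ : ContDiff ℝ ∞ φ)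
    (h : ℝ) : mellinCont J e φ h = mellinCont (J + 1) e φ h := by
  induction J generalizing e φ with
  | zero => exact mellinCont_zero_eq_one (by simpa using he) hφ h
  | succ J ih =>
    rw [mellinCont, ih (by simp; push_cast at he; linarith) ((contDiff_infty_iff_deriv.1 hφ).2)]
    rfl

theorem mellinCont_eq_of_le {J J' : ℕ} (hJ : J ≤ J') {e : ℂ} (he : 0 < e.re + J) {φ : ℝ → ℂ}
    (hφ : ContDiff ℝ ∞ φ) (h : ℝ) : mellinCont J e φ h = mellinCont J' e φ h := by
  induction J', hJ using Nat.le_induction with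
  | base => rfl
  | succ K hK ih =>
    rw [ih, mellinCont_succ K _ hφ]
    have : (J : ℝ) ≤ K := by exact_mod_cast hK
    linarith

/-- The residue of the continuation at `e = 0` is the value of `φ` at `0`. -/
theorem mellinReg_zero_zero (J : ℕ) {φ : ℝ → ℂ} (hφ : ContDiff ℝ ∞ φ) (h : ℝ) :
    mellinReg J 0 0 φ h = φ 0 := by
  have hφ' := (contDiff_infty_iff_deriv.1 hφ).2
  have h1 : mellinCont J (0 + 1) (deriv φ) h = mellinCont 0 (0 + 1) (deriv φ) h :=
    (mellinCont_eq_of_le (Nat.zero_le J) (by simp) hφ' h).symm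
  simp only [mellinReg]
  rw [h1]
  simp only [mellinCont, zero_add, sub_self, Complex.cpow_zero, one_mul]
  have h2 : ∫ t in (0 : ℝ)..1, h * deriv φ (t * h) = φ h - φ 0 := by
    have := intervalIntegral.integral_eq_sub_of_hasDerivAt (a := 0) (b := 1)
      (f := fun t : ℝ => φ (t * h)) (f' := fun t => h * deriv φ (t * h)) (fun t _ => by
        have hd : HasDerivAt φ (deriv φ (t * h)) (t * h) :=
          ((hφ.differentiable (by simp)) _).hasDerivAt
        have := hd.scomp t ((hasDerivAt_id t).mul_const h)
        simpa [Function.comp_def] using this)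
      ((continuous_const.mul (hφ'.continuous.comp (continuous_mul_const h))).intervalIntegrable _ _)
    simpa using this
  rw [intervalIntegral.integral_const_mul] at h2
  rw [h2]; ring

/-- Joint continuity along `{x} × k`, for compact `k`, gives a bound near `x` that is uniform on `k`. -/
theorem eventually_bound_of_compact {X T : Type*} [TopologicalSpace X] [TopologicalSpace T]
    {F : X → T → ℂ} {k : Set T} (hk : IsCompact k) {x : X}
    (hF : ∀ t ∈ k, ContinuousAt (fun p : X × T => F p.1 p.2) (x, t)) :
    ∃ C, ∀ᶠ y in 𝓝 x, ∀ t ∈ k, ‖F y t‖ ≤ C := by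
  have hb : BddAbove ((fun t => ‖F x t‖) '' k) := by
    refine (hk.image_of_continuousOn fun t ht => ?_).bddAbove
    have : ContinuousAt (fun t => F x t) t :=
      ContinuousAt.comp (f := fun t => (x, t)) (g := fun p : X × T => F p.1 p.2) (hF t ht)
        (by fun_prop)
    exact this.norm.continuousWithinAt
  obtain ⟨C, hC⟩ := hb
  refine ⟨C + 1, hk.eventually_forall_of_forall_eventually fun t ht => ?_⟩
  have h1 : ‖F x t‖ < C + 1 := by
    have := hC ⟨t, ht, rfl⟩
    simp only at this; linarith
  filter_upwards [(hF t ht).norm.eventually_lt continuousAt_const h1] with p hp using hp.le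

/-- Where the Mellin integral converges, it is holomorphic in the parameter. -/
theorem holC_mellin_zero {A : Type*} [TopologicalSpace A] [FirstCountableTopology A] {U : Set ℂ}
    (hU : IsOpen U) {V : Set A} (hV : IsOpen V) {φ : ℂ → A → ℝ → ℂ} (hφ : HolSmooth U V φ)
    {e : ℂ → ℂ} (he : DifferentiableOn ℂ e U) (hre : ∀ s ∈ U, 0 < (e s).re) :
    HolC U (V ×ˢ univ) fun s (p : A × ℝ) => mellinCont 0 (e s) (φ s p.1) p.2 := by
  have hW : IsOpen (U ×ˢ (V ×ˢ (univ : Set ℝ))) := hU.prod (hV.prod isOpen_univ)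
  -- continuity of the integrand
  have hc : ∀ q ∈ U ×ˢ (V ×ˢ (univ : Set ℝ)), ∀ t : ℝ, ContinuousAt
      (fun p : (ℂ × A × ℝ) × ℝ => φ p.1.1 p.1.2.1 (p.2 * p.1.2.2)) (q, t) := by
    rintro ⟨s, a, h⟩ ⟨hs, ha, -⟩ t
    have h1 : ContinuousAt (fun p : ℂ × A × ℝ => φ p.1 p.2.1 p.2.2) (s, a, t * h) :=
      (hφ.2 0).1.continuousAt (hW.mem_nhds ⟨hs, ha, trivial⟩)
    exact ContinuousAt.comp (f := fun p : (ℂ × A × ℝ) × ℝ => (p.1.1, p.1.2.1, p.2 * p.1.2.2))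
      (g := fun p : ℂ × A × ℝ => φ p.1 p.2.1 p.2.2) h1 (by fun_prop)
  -- domination
  have hdom : ∀ q ∈ U ×ˢ (V ×ˢ (univ : Set ℝ)), ∃ σ C : ℝ, 0 < σ ∧ ∀ᶠ p in 𝓝 q,
      p ∈ U ×ˢ (V ×ˢ (univ : Set ℝ)) ∧ ∀ t ∈ Ioc (0 : ℝ) 1,
        ‖(t : ℂ) ^ (e p.1 - 1) * φ p.1 p.2.1 (t * p.2.2)‖ ≤ t ^ (σ - 1) * C := by
    intro q hq
    obtain ⟨C, hC⟩ := eventually_bound_of_compact (F := fun (p : ℂ × A × ℝ) t =>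
      φ p.1 p.2.1 (t * p.2.2)) (isCompact_Icc (a := (0 : ℝ)) (b := 1)) fun t _ => hc q hq t
    have h1 : ContinuousAt (fun p : ℂ × A × ℝ => (e p.1).re) q := by
      have h2 : ContinuousAt e q.1 := (he.differentiableAt (hU.mem_nhds hq.1)).continuousAt
      exact Complex.continuous_re.continuousAt.comp
        (ContinuousAt.comp (g := e) (f := Prod.fst) h2 continuousAt_fst)
    refine ⟨(e q.1).re / 2, C, half_pos (hre _ hq.1), ?_⟩
    filter_upwards [hC, hW.mem_nhds hq, h1.eventually_const_lt (half_lt_self (hre _ hq.1))]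
      with p hp1 hp2 hp3
    refine ⟨hp2, fun t ht => ?_⟩
    rw [norm_mul, Complex.norm_cpow_eq_rpow_re_of_pos ht.1]
    refine mul_le_mul ?_ (hp1 t (Ioc_subset_Icc_self ht)) (norm_nonneg _)
      (Real.rpow_nonneg ht.1.le _)
    refine Real.rpow_le_rpow_of_exponent_ge ht.1 ht.2 ?_
    simp only [Complex.sub_re, Complex.one_re]; linarith
  have hgint : ∀ σ C : ℝ, 0 < σ →
      IntervalIntegrable (fun t : ℝ => t ^ (σ - 1) * C) volume 0 1 := fun σ C hσ =>
    (intervalIntegral.intervalIntegrable_rpow' (by linarith)).mul_const C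
  have hmeas : ∀ p ∈ U ×ˢ (V ×ˢ (univ : Set ℝ)), AEStronglyMeasurable
      (fun t : ℝ => (t : ℂ) ^ (e p.1 - 1) * φ p.1 p.2.1 (t * p.2.2)) (volume.restrict (Ioc 0 1)) := by
    intro p hp
    refine ContinuousOn.aestronglyMeasurable (ContinuousOn.mul ?_ ?_) measurableSet_Ioc
    · intro t ht
      exact (Complex.continuousAt_ofReal_cpow_const _ _ (Or.inr ht.1.ne')).continuousWithinAt
    · exact ((hφ.1 _ hp.1 _ hp.2.1).continuous.comp (continuous_mul_const _)).continuousOn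
  refine ⟨fun q hq => ContinuousAt.continuousWithinAt ?_, fun b hb s hs =>
    DifferentiableAt.differentiableWithinAt ?_⟩
  · obtain ⟨σ, C, hσ, hev⟩ := hdom q hq
    simp only [mellinCont]
    refine intervalIntegral.continuousAt_of_dominated_interval
      (bound := fun t => t ^ (σ - 1) * C) ?_ ?_ (hgint σ C hσ) ?_
    · rw [uIoc_of_le zero_le_one]
      filter_upwards [hev] with p hp using hmeas p hp.1
    · rw [uIoc_of_le zero_le_one]
      filter_upwards [hev] with p hp
      exact Eventually.of_forall fun t ht => hp.2 t ht
    · rw [uIoc_of_le zero_le_one]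
      refine Eventually.of_forall fun t ht => ContinuousAt.mul ?_ ?_
      · have h2 : ContinuousAt e q.1 := (he.differentiableAt (hU.mem_nhds hq.1)).continuousAt
        have h3 : ContinuousAt (fun p : ℂ × A × ℝ => e p.1 - 1) q :=
          (ContinuousAt.comp (g := e) (f := Prod.fst) h2 continuousAt_fst).sub continuousAt_const
        exact h3.const_cpow (Or.inl (by exact_mod_cast ht.1.ne'))
      · exact ContinuousAt.comp (f := fun p : ℂ × A × ℝ => (p, t))
          (g := fun p : (ℂ × A × ℝ) × ℝ => φ p.1.1 p.1.2.1 (p.2 * p.1.2.2)) (hc q hq t) (by fun_prop)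
  · obtain ⟨σ, C, hσ, hev⟩ := hdom (s, b) ⟨hs, hb⟩
    have hev' : ∀ᶠ z in 𝓝 s, (z, b) ∈ U ×ˢ (V ×ˢ (univ : Set ℝ)) ∧ ∀ t ∈ Ioc (0 : ℝ) 1,
        ‖(t : ℂ) ^ (e z - 1) * φ z b.1 (t * b.2)‖ ≤ t ^ (σ - 1) * C :=
      ((Continuous.prodMk_left b).tendsto s).eventually hev
    obtain ⟨r, hr, hball⟩ := Metric.eventually_nhds_iff_ball.1 hev'
    simp only [mellinCont, intervalIntegral.integral_of_le (zero_le_one' ℝ)]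
    refine differentiableAt_integral_of_dominated (g := fun t => t ^ (σ - 1) * C) hr
      (fun z hz => hmeas (z, b) (hball z hz).1) ?_ ?_ ?_
    · exact (ae_restrict_mem measurableSet_Ioc).mono fun t ht z hz => (hball z hz).2 t ht
    · have := hgint σ C hσ
      rwa [intervalIntegrable_iff_integrableOn_Ioc_of_le zero_le_one] at this
    · refine (ae_restrict_mem measurableSet_Ioc).mono fun t ht z hz => ?_
      have hzU := (hball z hz).1.1
      refine DifferentiableAt.differentiableWithinAt (DifferentiableAt.mul ?_ ?_)
      · exact ((he.differentiableAt (hU.mem_nhds hzU)).sub_const 1).const_cpow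
          (Or.inl (by exact_mod_cast ht.1.ne'))
      · exact ((hφ.2 0).2 (b.1, t * b.2) ⟨hb.1, trivial⟩).differentiableAt (hU.mem_nhds hzU)

/-- The continued Mellin integral is holomorphic where `e` avoids `0, -1, …, -(J - 1)`. -/
theorem holC_mellinCont {A : Type*} [TopologicalSpace A] [FirstCountableTopology A] {U : Set ℂ}
    (hU : IsOpen U) {V : Set A} (hV : IsOpen V) (J : ℕ) {φ : ℂ → A → ℝ → ℂ} (hφ : HolSmooth U V φ)
    {e : ℂ → ℂ} (he : DifferentiableOn ℂ e U) (hre : ∀ s ∈ U, 0 < (e s).re + J)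
    (h0 : ∀ s ∈ U, ∀ j < J, e s + j ≠ 0) :
    HolC U (V ×ˢ univ) fun s (p : A × ℝ) => mellinCont J (e s) (φ s p.1) p.2 := by
  induction J generalizing φ e with
  | zero => exact holC_mellin_zero hU hV hφ he (by simpa using hre)
  | succ J ih =>
    have h1 := ih hφ.deriv (e := fun s => e s + 1) (he.add_const 1)
      (fun s hs => by have := hre s hs; push_cast at this; simp; linarith)
      (fun s hs j hj => by
        have := h0 s hs (j + 1) (by omega)
        push_cast at this; rwa [add_assoc, add_comm 1 (j : ℂ)])
    exact (HolC.of_fst (he.inv fun s hs => by simpa using h0 s hs 0 (by omega))).mul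
      ((hφ.2 0).sub ((HolC.of_snd (by fun_prop)).mul h1))

/-- After multiplication by `e + j₀`, the continued Mellin integral is holomorphic also where
`e = -j₀`. -/
theorem holC_mellinReg {A : Type*} [TopologicalSpace A] [FirstCountableTopology A] {U : Set ℂ}
    (hU : IsOpen U) {V : Set A} (hV : IsOpen V) (J j₀ : ℕ) {φ : ℂ → A → ℝ → ℂ}
    (hφ : HolSmooth U V φ) {e : ℂ → ℂ} (he : DifferentiableOn ℂ e U)
    (hre : ∀ s ∈ U, 0 < (e s).re + j₀ + 1 + J)
    (h0 : ∀ s ∈ U, ∀ j < j₀ + 1 + J, j ≠ j₀ → e s + j ≠ 0) :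
    HolC U (V ×ˢ univ) fun s (p : A × ℝ) => mellinReg J j₀ (e s) (φ s p.1) p.2 := by
  induction j₀ generalizing φ e with
  | zero =>
    have h1 := holC_mellinCont hU hV J hφ.deriv (e := fun s => e s + 1) (he.add_const 1)
      (fun s hs => by have := hre s hs; push_cast at this; simp; linarith)
      (fun s hs j hj => by
        have := h0 s hs (j + 1) (by omega) (by omega)
        push_cast at this; rwa [add_assoc, add_comm 1 (j : ℂ)])
    exact (hφ.2 0).sub ((HolC.of_snd (by fun_prop)).mul h1)
  | succ j₀ ih =>
    have h1 := ih hφ.deriv (e := fun s => e s + 1) (he.add_const 1)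
      (fun s hs => by have := hre s hs; push_cast at this; simp; linarith)
      (fun s hs j hj hj' => by
        have := h0 s hs (j + 1) (by omega) (by omega)
        push_cast at this; rwa [add_assoc, add_comm 1 (j : ℂ)])
    exact (HolC.of_fst (he.inv fun s hs => by simpa using h0 s hs 0 (by omega) (by omega))).mul
      (((HolC.of_fst (he.add_const _)).mul (hφ.2 0)).sub ((HolC.of_snd (by fun_prop)).mul h1))

end HCalc

namespace HCalc
open Metric

/-! ### Difference quotients of holomorphic families -/

/-- An injective holomorphic function has no critical points: otherwise `f - f s₀` is the `n`-th power
of a local coordinate with `n ≥ 2`, and takes equal values at points where the coordinate differs by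
an `n`-th root of unity. -/
theorem deriv_ne_zero_of_injOn {f : ℂ → ℂ} {s₀ : ℂ} (hf : AnalyticAt ℂ f s₀)
    (hinj : ∃ U ∈ 𝓝 s₀, InjOn f U) : deriv f s₀ ≠ 0 := by
  obtain ⟨U, hU, hinj⟩ := hinj
  have hf' : AnalyticAt ℂ (fun z => f z - f s₀) s₀ := hf.sub analyticAt_const
  have hne : ¬ ∀ᶠ z in 𝓝 s₀, f z - f s₀ = 0 := fun h => by
    have h1 : ∀ᶠ z in 𝓝[≠] s₀, z ∈ U ∧ f z - f s₀ = 0 ∧ z ≠ s₀ :=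
      (eventually_nhdsWithin_of_eventually_nhds hU).and
        ((eventually_nhdsWithin_of_eventually_nhds h).and self_mem_nhdsWithin)
    obtain ⟨z, hzU, hz, hzs⟩ := h1.exists
    exact hzs (hinj hzU (mem_of_mem_nhds hU) (sub_eq_zero.1 hz))
  obtain ⟨n, g, hg, hg0, hfg⟩ := hf'.exists_eventuallyEq_pow_smul_nonzero_iff.2 hne
  have hn0 : n ≠ 0 := fun h => by
    have := hfg.self_of_nhds
    simp [h] at this; exact hg0 this.symm
  by_cases hn1 : n = 1
  · subst hn1
    have h1 : HasDerivAt (fun z => (z - s₀) * g z) (g s₀) s₀ := by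
      have := ((hasDerivAt_id s₀).sub_const s₀).mul hg.differentiableAt.hasDerivAt
      simpa [Pi.mul_def] using this
    have h2 : HasDerivAt (fun z => f z - f s₀) (g s₀) s₀ :=
      h1.congr_of_eventuallyEq (hfg.mono fun z hz => by simpa using hz)
    have h3 : deriv f s₀ = g s₀ := by
      have := h2.add_const (f s₀)
      simp only [sub_add_cancel] at this
      exact this.deriv
    rwa [h3]
  -- an `n`-th root `q` of `f - f s₀` is a local coordinate; `w` and `ζ w` have the same power
  exfalso
  obtain ⟨c, hc⟩ := IsAlgClosed.exists_pow_nat_eq (g s₀) (Nat.pos_of_ne_zero hn0)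
  have hc0 : c ≠ 0 := fun h => by rw [h, zero_pow hn0] at hc; exact hg0 hc.symm
  let q : ℂ → ℂ := fun z => (z - s₀) * (c * Complex.exp (Complex.log (g z / g s₀) / n))
  have hrt : AnalyticAt ℂ (fun z => c * Complex.exp (Complex.log (g z / g s₀) / n)) s₀ := by
    refine analyticAt_const.mul (AnalyticAt.cexp' ?_)
    refine AnalyticAt.div ?_ analyticAt_const (by exact_mod_cast hn0)
    exact (hg.div analyticAt_const hg0).clog (by change g s₀ / g s₀ ∈ _; rw [div_self hg0]; simp)
  have hq : AnalyticAt ℂ q s₀ := (analyticAt_id.sub analyticAt_const).mul hrt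
  have hqd : deriv q s₀ = c := by
    have := ((hasDerivAt_id s₀).sub_const s₀).mul hrt.differentiableAt.hasDerivAt
    have h2 := this.deriv
    simp only [id, sub_self, zero_mul, add_zero, one_mul, div_self hg0, Complex.log_one, zero_div,
      Complex.exp_zero, mul_one] at h2
    exact h2
  have hmap : map q (𝓝 s₀) = 𝓝 0 := by
    have := hq.hasStrictDerivAt.map_nhds_eq (by rwa [hqd])
    simpa [q] using this
  have hqn : ∀ᶠ z in 𝓝 s₀, f z - f s₀ = q z ^ n := by
    filter_upwards [hfg, hg.continuousAt.eventually_ne hg0] with z hz hgz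
    rw [hz, mul_pow, mul_pow, hc, ← Complex.exp_nat_mul, mul_div_cancel₀ _ (by exact_mod_cast hn0),
      Complex.exp_log (div_ne_zero hgz hg0), smul_eq_mul]
    field_simp
  have hζ := Complex.isPrimitiveRoot_exp n hn0
  set ζ := Complex.exp (2 * Real.pi * Complex.I / n)
  have hS : q '' (U ∩ {z | f z - f s₀ = q z ^ n}) ∈ 𝓝 (0 : ℂ) := by
    rw [← hmap]; exact image_mem_map (inter_mem hU hqn)
  have hS' : ∀ᶠ w in 𝓝 (0 : ℂ), ζ * w ∈ q '' (U ∩ {z | f z - f s₀ = q z ^ n}) := by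
    have : Tendsto (fun w => ζ * w) (𝓝 0) (𝓝 0) := by
      have := (continuous_const_mul ζ).tendsto (0 : ℂ)
      simpa [Pi.mul_def] using this
    exact this.eventually hS
  have h1 : ∀ᶠ w in 𝓝[≠] (0 : ℂ), w ≠ 0 ∧ w ∈ q '' (U ∩ {z | f z - f s₀ = q z ^ n}) ∧
      ζ * w ∈ q '' (U ∩ {z | f z - f s₀ = q z ^ n}) :=
    (eventually_mem_nhdsWithin (a := (0 : ℂ)) (s := {0}ᶜ)).and ((eventually_nhdsWithin_of_eventually_nhds hS).and
      (eventually_nhdsWithin_of_eventually_nhds hS'))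
  obtain ⟨w, hw0, ⟨z, ⟨hzU, hz⟩, hzw⟩, ⟨z', ⟨hzU', hz'⟩, hzw'⟩⟩ := h1.exists
  have h2 : f z = f z' := by
    simp only [mem_ofPred_eq] at hz hz'
    rw [hzw] at hz; rw [hzw', mul_pow, hζ.pow_eq_one, one_mul, ← hz] at hz'
    exact (sub_left_inj.1 hz').symm
  rw [hinj hzU hzU' h2, hzw'] at hzw
  refine hζ.ne_one (by omega) ?_
  exact mul_right_cancel₀ hw0 (by rw [hzw, one_mul])

/-- The remainder of the first order Taylor expansion of a bounded holomorphic function. -/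
theorem norm_slope_sub_deriv_le {g : ℂ → ℂ} {s z : ℂ} {r C : ℝ} (hr : 0 < r)
    (hg : DifferentiableOn ℂ g (ball s r)) (hC : ∀ z ∈ ball s r, ‖g z‖ ≤ C) (hz : z ∈ ball s r) :
    ‖dslope g s z - deriv g s‖ ≤ ((2 * ((2 * C + 1) / r) + 1) / r) * ‖z - s‖ := by
  have hs : s ∈ ball s r := mem_ball_self hr
  have hC0 : 0 ≤ C := (norm_nonneg _).trans (hC s hs)
  have hm : MapsTo g (ball s r) (ball (g s) (2 * C + 1)) := fun w hw => by
    rw [mem_ball, dist_eq_norm]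
    have := norm_sub_le (g w) (g s)
    have := hC w hw; have := hC s hs
    linarith
  have hk : ∀ w ∈ ball s r, ‖dslope g s w‖ ≤ (2 * C + 1) / r := fun w hw =>
    Complex.norm_dslope_le_div_of_mapsTo_ball hg (hm.mono_right ball_subset_closedBall) hw
  have hkd : DifferentiableOn ℂ (dslope g s) (ball s r) :=
    (Complex.differentiableOn_dslope (isOpen_ball.mem_nhds hs)).2 hg
  have hkm : MapsTo (dslope g s) (ball s r) (ball (dslope g s s) (2 * ((2 * C + 1) / r) + 1)) :=
    fun w hw => by
      rw [mem_ball, dist_eq_norm]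
      have := norm_sub_le (dslope g s w) (dslope g s s)
      have := hk w hw; have := hk s hs
      linarith
  have := Complex.dist_le_div_mul_dist_of_mapsTo_ball hkd
    (hkm.mono_right ball_subset_closedBall) hz
  rwa [dist_eq_norm, dist_eq_norm, dslope_same] at this

theorem HolC.eventually_bound_nhds {B : Type*} [TopologicalSpace B] {U : Set ℂ} {V : Set B}
    {c : ℂ → B → ℂ} (h : HolC U V c) (hU : IsOpen U) (hV : IsOpen V) {s : ℂ} (hs : s ∈ U)
    {b : B} (hb : b ∈ V) :
    ∃ r > 0, ball s r ⊆ U ∧ ∃ C, ∃ W ∈ 𝓝 b, W ⊆ V ∧ ∀ z ∈ ball s r, ∀ b' ∈ W, ‖c z b'‖ ≤ C := by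
  have h1 : ContinuousAt (fun p : ℂ × B => c p.1 p.2) (s, b) :=
    h.1.continuousAt ((hU.prod hV).mem_nhds ⟨hs, hb⟩)
  have h2 := h1.norm.eventually_lt continuousAt_const (lt_add_one ‖c s b‖)
  rw [nhds_prod_eq] at h2
  obtain ⟨p, hp, q, hq, hpq⟩ := eventually_prod_iff.1 h2
  obtain ⟨r, hr, h3⟩ := Metric.eventually_nhds_iff_ball.1 (hp.and (hU.mem_nhds hs))
  exact ⟨r, hr, fun z hz => (h3 z hz).2, ‖c s b‖ + 1, {b | q b} ∩ V, inter_mem hq (hV.mem_nhds hb),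
    inter_subset_right, fun z hz b' hb' => (hpq (h3 z hz).1 hb'.1).le⟩

/-- The difference quotients at `s₀`, completed by the derivative, are again jointly continuous and
holomorphic. Near `s₀` they are compared with the quotient at a fixed nearby point, by the estimate
`norm_slope_sub_deriv_le`, which is uniform in `b`. -/
theorem HolC.dslope {B : Type*} [TopologicalSpace B] {U : Set ℂ} {V : Set B}
    {c : ℂ → B → ℂ} (h : HolC U V c) (hU : IsOpen U) (hV : IsOpen V) {s₀ : ℂ} (hs : s₀ ∈ U) :
    HolC U V (fun s b => dslope (fun s => c s b) s₀ s) := by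
  refine ⟨?_, fun b hb => (Complex.differentiableOn_dslope (hU.mem_nhds hs)).2 (h.2 b hb)⟩
  -- continuity of the quotient at fixed `s ≠ s₀`
  have hq : ∀ s ∈ U, s ≠ s₀ → ∀ b ∈ V, ContinuousAt
      (fun p : ℂ × B => _root_.dslope (fun s => c s p.2) s₀ p.1) (s, b) := by
    intro s hsU hss b hb
    have h1 : ContinuousAt (fun p : ℂ × B => c p.1 p.2) (s, b) :=
      h.1.continuousAt ((hU.prod hV).mem_nhds ⟨hsU, hb⟩)
    have h2 : ContinuousAt (fun p : ℂ × B => c s₀ p.2) (s, b) :=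
      ContinuousAt.comp (f := fun p : ℂ × B => (s₀, p.2)) (g := fun p : ℂ × B => c p.1 p.2)
        (h.1.continuousAt ((hU.prod hV).mem_nhds ⟨hs, hb⟩)) (by fun_prop)
    have h3 : ContinuousAt (fun p : ℂ × B => (p.1 - s₀)⁻¹ * (c p.1 p.2 - c s₀ p.2)) (s, b) :=
      ((continuousAt_fst.sub continuousAt_const).inv₀ (sub_ne_zero.2 hss)).mul (h1.sub h2)
    refine h3.congr_of_eventuallyEq ?_
    have h4 : ∀ᶠ p : ℂ × B in 𝓝 (s, b), p.1 ≠ s₀ := continuousAt_fst.eventually_ne hss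
    filter_upwards [h4] with p hp
    rw [dslope_of_ne _ hp, slope_def_module, smul_eq_mul]
  rintro ⟨s, b⟩ ⟨hsU, hb⟩
  refine ContinuousAt.continuousWithinAt ?_
  by_cases hss : s = s₀
  · subst hss
    obtain ⟨r, hr, hrU, C, W, hW, hWV, hC⟩ := h.eventually_bound_nhds hU hV hs hb
    set D := (2 * ((2 * C + 1) / r) + 1) / r with hD
    have hest : ∀ z ∈ ball s r, ∀ b' ∈ W,
        ‖_root_.dslope (fun s => c s b') s z - deriv (fun s => c s b') s‖ ≤ D * ‖z - s‖ :=
      fun z hz b' hb' => norm_slope_sub_deriv_le hr ((h.2 b' (hWV hb')).mono hrU)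
        (fun z hz => hC z hz b' hb') hz
    have hC0 : 0 ≤ C := (norm_nonneg _).trans (hC s (mem_ball_self hr) b (mem_of_mem_nhds hW))
    have hD0 : 0 ≤ D := by positivity
    rw [Metric.continuousAt_iff']
    intro ε hε
    -- compare with a fixed `z` close to `s`
    obtain ⟨η, hη, hηr, hηD⟩ : ∃ η > 0, η < r ∧ D * η < ε / 4 := by
      refine ⟨min (r / 2) (ε / (8 * (D + 1))), by positivity, ?_, ?_⟩
      · exact (min_le_left _ _).trans_lt (by linarith)
      · calc D * min (r / 2) (ε / (8 * (D + 1))) ≤ D * (ε / (8 * (D + 1))) := by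
              gcongr; exact min_le_right _ _
          _ ≤ (D + 1) * (ε / (8 * (D + 1))) := by gcongr; linarith
          _ = ε / 8 := by field_simp
          _ < ε / 4 := by linarith
    let z₀ : ℂ := s + (η / 2 : ℝ)
    have hz₀n : ‖z₀ - s‖ = η / 2 := by
      simp only [z₀, add_sub_cancel_left, Complex.norm_real, Real.norm_eq_abs]
      exact abs_of_pos (by positivity)
    have hz₀ : z₀ ∈ ball s r := by rw [mem_ball, dist_eq_norm, hz₀n]; linarith
    have hz₀s : z₀ ≠ s := fun h => by
      rw [h, sub_self, norm_zero] at hz₀n; linarith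
    have hcont : ContinuousAt (fun b' => _root_.dslope (fun s => c s b') s z₀) b :=
      ContinuousAt.comp (f := fun b' => (z₀, b'))
        (g := fun p : ℂ × B => _root_.dslope (fun s => c s p.2) s p.1)
        (hq z₀ (hrU hz₀) hz₀s b hb) (by fun_prop)
    have e1 := Metric.continuousAt_iff'.1 hcont (ε / 4) (by linarith)
    rw [nhds_prod_eq]
    have e2 : ∀ᶠ p in 𝓝 s ×ˢ 𝓝 b, p.1 ∈ ball s η ∧ p.2 ∈ W ∧
        dist (_root_.dslope (fun s => c s p.2) s z₀) (_root_.dslope (fun s => c s b) s z₀) < ε / 4 :=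
      (Filter.Eventually.prod_inl (p := (· ∈ ball s η)) (ball_mem_nhds s hη) _).and
        ((Filter.Eventually.prod_inr (p := (· ∈ W)) hW _).and (e1.prod_inr _))
    filter_upwards [e2] with p hp
    obtain ⟨hp1, hp2, hp3⟩ := hp
    have hp1' : ‖p.1 - s‖ < η := by rwa [← dist_eq_norm]
    have f1 := hest p.1 (ball_subset_ball hηr.le hp1) p.2 hp2
    have f2 := hest z₀ hz₀ p.2 hp2
    have f3 := hest z₀ hz₀ b (mem_of_mem_nhds hW)
    have g1 : D * ‖p.1 - s‖ ≤ D * η := by gcongr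
    have g2 : D * ‖z₀ - s‖ ≤ D * η := by rw [hz₀n]; gcongr; linarith
    rw [dslope_same, dist_eq_norm]
    rw [dist_eq_norm] at hp3
    set A := _root_.dslope (fun s => c s p.2) s p.1
    set A' := deriv (fun s => c s p.2) s
    set E := _root_.dslope (fun s => c s p.2) s z₀
    set E' := _root_.dslope (fun s => c s b) s z₀
    set H' := deriv (fun s => c s b) s
    calc ‖A - H'‖ = ‖(A - A') - (E - A') + (E - E') + (E' - H')‖ := by congr 1; ring
      _ ≤ ‖A - A'‖ + ‖E - A'‖ + ‖E - E'‖ + ‖E' - H'‖ := by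
        refine (norm_add_le _ _).trans (add_le_add_left ((norm_add_le _ _).trans
          (add_le_add_left (norm_sub_le _ _) _)) _)
      _ < ε := by linarith
  · exact hq s hsU hss b hb

theorem HolC.deriv {B : Type*} [TopologicalSpace B] {U : Set ℂ} {V : Set B}
    {c : ℂ → B → ℂ} (h : HolC U V c) (hU : IsOpen U) (hV : IsOpen V) {s₀ : ℂ} (hs : s₀ ∈ U) :
    ContinuousOn (fun b => deriv (fun s => c s b) s₀) V := by
  have := (h.dslope hU hV hs).1.comp (f := fun b => (s₀, b)) (s := V) (by fun_prop)
    fun b hb => ⟨hs, hb⟩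
  simpa [Function.comp_def] using this

end HCalc

namespace HCalc

/-! ### Inverse functions, and the tangent bundle in coordinates -/

section InverseFunction

variable {F F' : Type*} [NormedAddCommGroup F] [NormedSpace ℝ F] [CompleteSpace F]
  [NormedAddCommGroup F'] [NormedSpace ℝ F'] {Ψ : F → F'} {O : Set F}

theorem isOpen_image_of_invertible (hO : IsOpen O) (hΨ : ContDiffOn ℝ ∞ Ψ O)
    (hd : ∀ p ∈ O, ∃ e : F ≃L[ℝ] F', HasFDerivAt Ψ (e : F →L[ℝ] F') p) : IsOpen (Ψ '' O) := by
  refine isOpen_iff_mem_nhds.2 ?_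
  rintro _ ⟨p, hp, rfl⟩
  obtain ⟨e, he⟩ := hd p hp
  have hc : ContDiffAt ℝ ∞ Ψ p := hΨ.contDiffAt (hO.mem_nhds hp)
  have hs := hc.hasStrictFDerivAt' he (by simp)
  rw [← hs.map_nhds_eq_of_equiv]
  exact image_mem_map (hO.mem_nhds hp)

/-- The inverse function theorem for an injective map with invertible derivatives. -/
theorem contDiffOn_invFunOn [Nonempty F] (hO : IsOpen O) (hΨ : ContDiffOn ℝ ∞ Ψ O)
    (hd : ∀ p ∈ O, ∃ e : F ≃L[ℝ] F', HasFDerivAt Ψ (e : F →L[ℝ] F') p) (hi : InjOn Ψ O) :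
    ContDiffOn ℝ ∞ (Function.invFunOn Ψ O) (Ψ '' O) := by
  rintro _ ⟨p, hp, rfl⟩
  obtain ⟨e, he⟩ := hd p hp
  have hc : ContDiffAt ℝ ∞ Ψ p := hΨ.contDiffAt (hO.mem_nhds hp)
  have hn : (∞ : WithTop ℕ∞) ≠ 0 := by simp
  have h1 := hc.to_localInverse he hn
  have hs := hc.hasStrictFDerivAt' he hn
  have h2 : hc.localInverse he hn (Ψ p) = p := hc.localInverse_apply_image he hn
  have h3 : ∀ᶠ y in 𝓝 (Ψ p), Ψ (hc.localInverse he hn y) = y := hs.eventually_right_inverse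
  have h4 : ∀ᶠ y in 𝓝 (Ψ p), hc.localInverse he hn y ∈ O :=
    h1.continuousAt.eventually (by rw [h2]; exact hO.mem_nhds hp)
  refine (h1.congr_of_eventuallyEq ?_).contDiffWithinAt
  filter_upwards [h3, h4] with y hy hyO
  have h5 : y ∈ Ψ '' O := ⟨_, hyO, hy⟩
  exact hi (Function.invFunOn_mem h5) hyO (by rw [Function.invFunOn_eq h5, hy])

end InverseFunction

section Tangent

variable {d N : ℕ} {M : Type u} [TopologicalSpace M] [ChartedSpace (Euc d) M]
  [IsManifold (𝓡 d) ∞ M]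

/-- The coordinates of tangent vectors at `x` in the chart of `M` centred at `x₀`. -/
def tcoord (x₀ x : M) : TangentSpace (𝓡 d) x →L[ℝ] Euc d :=
  mfderiv (𝓡 d) (𝓡 d) (chartAt (Euc d) x₀) x

theorem mdifferentiableAt_chart {x₀ x : M} (hx : x ∈ (chartAt (Euc d) x₀).source) :
    MDifferentiableAt (𝓡 d) (𝓡 d) (chartAt (Euc d) x₀) x :=
  (mdifferentiable_chart (I := 𝓡 d) x₀).mdifferentiableAt hx

theorem exists_tcoord_equiv {x₀ x : M} (hx : x ∈ (chartAt (Euc d) x₀).source) :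
    ∃ e : TangentSpace (𝓡 d) x ≃L[ℝ] Euc d,
      (e : TangentSpace (𝓡 d) x →L[ℝ] Euc d) = tcoord x₀ x ∧
      ∀ i, chartFrame x₀ x i = e.symm (EuclideanSpace.single i (1 : ℝ)) := by
  have h : (mfderiv (𝓡 d) (𝓡 d) (chartAt (Euc d) x₀) x).IsInvertible := by
    have := isInvertible_mfderiv_extChartAt (I := 𝓡 d) (x := x₀) (y := x)
      (by simpa using hx)
    exact this
  obtain ⟨e, he⟩ := h
  refine ⟨e, he, fun i => ?_⟩
  unfold chartFrame
  rw [← he, ContinuousLinearMap.inverse_equiv]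
  rfl

theorem sum_tcoord_smul_chartFrame {x₀ x : M} (hx : x ∈ (chartAt (Euc d) x₀).source)
    (v : TangentSpace (𝓡 d) x) : ∑ j, tcoord x₀ x v j • chartFrame x₀ x j = v := by
  obtain ⟨e, he, hf⟩ := exists_tcoord_equiv hx
  apply e.injective
  have h1 : ∀ j, e (chartFrame x₀ x j) = EuclideanSpace.single j (1 : ℝ) := fun j => by
    rw [hf, e.apply_symm_apply]
  rw [map_sum]
  simp only [map_smul, h1]
  have h2 : tcoord x₀ x v = e v := by rw [← he]; rfl
  rw [h2]
  ext i
  simp [Finset.sum_apply, Pi.single_apply]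

/-- A density is determined by its value on the coordinate frame. -/
theorem dens_eq_det {x₀ x : M} (hx : x ∈ (chartAt (Euc d) x₀).source)
    (ρ : Dens d (TangentSpace (𝓡 d) x)) (v : Fin d → TangentSpace (𝓡 d) x) :
    ρ.1 v = ((|(Matrix.of fun i j => tcoord x₀ x (v i) j).det| : ℝ) : ℂ) *
      ρ.1 (chartFrame x₀ x) := by
  rw [← ρ.2]
  refine congrArg ρ.1 (funext fun i => ?_)
  exact (sum_tcoord_smul_chartFrame hx (v i)).symm

/-- A map to the tangent bundle is smooth if its base point and its coordinates are. -/
theorem contMDiffAt_tangent_iff {F : Type*} [NormedAddCommGroup F] [NormedSpace ℝ F]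
    {f : F → TangentBundle (𝓡 d) M} {p : F} {x₀ : M}
    (hp : (f p).1 ∈ (chartAt (Euc d) x₀).source) :
    ContMDiffAt 𝓘(ℝ, F) (𝓡 d).tangent ∞ f p ↔
      ContMDiffAt 𝓘(ℝ, F) (𝓡 d) ∞ (fun q => (f q).1) p ∧
        ContDiffAt ℝ ∞ (fun q => tcoord x₀ (f q).1 (f q).2) p := by
  have h0 := (trivializationAt (Euc d) (TangentSpace (𝓡 d)) x₀).contMDiffAt_iff
    (IM := 𝓘(ℝ, F)) (IB := 𝓡 d) (n := ∞) (f := f) (x₀ := p)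
    (by rw [Bundle.Trivialization.mem_source]; simpa using hp)
  refine h0.trans (and_congr_right fun h1 => ?_)
  rw [contMDiffAt_iff_contDiffAt]
  suffices hs : _ =ᶠ[𝓝 p] _ from ⟨fun h => h.congr_of_eventuallyEq hs.symm, fun h => h.congr_of_eventuallyEq hs⟩
  filter_upwards [h1.continuousAt.eventually ((chartAt (Euc d) x₀).open_source.mem_nhds hp)]
    with q hq
  have h2 := TangentBundle.continuousLinearMapAt_trivializationAt (I := 𝓡 d) hq
  have h3 := congrArg (fun L => L (f q).2) h2
  have h4 : (f q).proj ∈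
      (trivializationAt (Euc d) (TangentSpace (𝓡 d)) x₀).baseSet := by
    rw [TangentBundle.trivializationAt_baseSet]; exact hq
  rw [Bundle.Trivialization.continuousLinearMapAt_apply,
    Bundle.Trivialization.linearMapAt_apply, if_pos h4] at h3
  exact h3

theorem contMDiffAt_chart_symm {x₀ : M} {a : Euc d} (ha : a ∈ (chartAt (Euc d) x₀).target) :
    ContMDiffAt 𝓘(ℝ, Euc d) (𝓡 d) ∞ (chartAt (Euc d) x₀).symm a :=
  (contMDiffOn_chart_symm (I := 𝓡 d) (n := ∞) (x := x₀)).contMDiffAt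
    ((chartAt (Euc d) x₀).open_target.mem_nhds ha)

theorem contMDiffAt_chart {x₀ x : M} (hx : x ∈ (chartAt (Euc d) x₀).source) :
    ContMDiffAt (𝓡 d) 𝓘(ℝ, Euc d) ∞ (chartAt (Euc d) x₀) x :=
  (contMDiffOn_chart (I := 𝓡 d) (n := ∞) (x := x₀)).contMDiffAt
    ((chartAt (Euc d) x₀).open_source.mem_nhds hx)

theorem SmoothField.contDiffAt_tcoord {X : ∀ x : M, TangentSpace (𝓡 d) x} {V : Set M}
    (hX : SmoothField X V) (hV : IsOpen V) {x₀ : M} {a : Euc d}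
    (ha : a ∈ (chartAt (Euc d) x₀).target) (haV : (chartAt (Euc d) x₀).symm a ∈ V) :
    ContDiffAt ℝ ∞ (fun b => tcoord x₀ ((chartAt (Euc d) x₀).symm b)
      (X ((chartAt (Euc d) x₀).symm b))) a := by
  have h1 : ContMDiffAt 𝓘(ℝ, Euc d) (𝓡 d).tangent ∞
      (fun b => (⟨(chartAt (Euc d) x₀).symm b, X ((chartAt (Euc d) x₀).symm b)⟩ :
        TangentBundle (𝓡 d) M)) a :=
    ContMDiffAt.comp (x := a) (g := fun x => (⟨x, X x⟩ : TangentBundle (𝓡 d) M))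
      (hX.contMDiffAt (hV.mem_nhds haV)) (contMDiffAt_chart_symm ha)
  exact ((contMDiffAt_tangent_iff ((chartAt (Euc d) x₀).map_target ha)).1 h1).2

end Tangent
end HCalc

namespace HCalc

/-! ### The exponential map in coordinates -/

section Exp

variable {d N : ℕ} {M : Type u} [TopologicalSpace M] [ChartedSpace (Euc d) M]
  [IsManifold (𝓡 d) ∞ M] {H : LieFiltration d N M} {ψ : H.Splitting}

open LieFiltration.Splitting

/-- The vector with coordinates `w` in the frame `X`. -/
def frameVec (X : ψ.GradedFrame) (x : M) (w : Euc d) : TangentSpace (𝓡 d) x :=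
  ∑ i, w i • X.vec i x

/-- The dilation `δ_h` in the coordinates of the frame `X`. -/
def scale (X : ψ.GradedFrame) (h : ℝ) (z : Euc d) : Euc d :=
  WithLp.toLp 2 fun i => h ^ ((X.weight i : ℕ) + 1) * z i

theorem point_eq (X : ψ.GradedFrame) (x : M) (z : Euc d) (h : ℝ) :
    X.point x z h = frameVec X x (scale X h z) := rfl

theorem scale_apply (X : ψ.GradedFrame) (h : ℝ) (z : Euc d) (i : Fin d) :
    scale X h z i = h ^ ((X.weight i : ℕ) + 1) * z i := rfl

theorem scale_scale (X : ψ.GradedFrame) (h h' : ℝ) (z : Euc d) :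
    scale X h (scale X h' z) = scale X (h * h') z := by
  ext i; simp only [scale_apply]; ring

theorem scale_one (X : ψ.GradedFrame) (z : Euc d) : scale X 1 z = z := by
  ext i; simp [scale_apply]

theorem scale_inv_scale (X : ψ.GradedFrame) {h : ℝ} (hh : h ≠ 0) (z : Euc d) :
    scale X h⁻¹ (scale X h z) = z := by
  rw [scale_scale, inv_mul_cancel₀ hh, scale_one]

theorem scale_scale_inv (X : ψ.GradedFrame) {h : ℝ} (hh : h ≠ 0) (z : Euc d) :
    scale X h (scale X h⁻¹ z) = z := by
  rw [scale_scale, mul_inv_cancel₀ hh, scale_one]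

theorem scale_zero_left (X : ψ.GradedFrame) (z : Euc d) : scale X 0 z = 0 := by
  ext i; simp [scale_apply]

theorem scale_zero_right (X : ψ.GradedFrame) (h : ℝ) : scale X h 0 = 0 := by
  ext i; simp [scale_apply]

theorem contDiff_scale (X : ψ.GradedFrame) :
    ContDiff ℝ ∞ (fun q : Euc d × ℝ => scale X q.2 q.1) := by
  rw [contDiff_euclidean]
  intro i
  simp only [scale_apply]
  have : ContDiff ℝ ∞ (fun q : Euc d × ℝ => q.1 i) :=
    (contDiff_euclidean.1 contDiff_id i).comp contDiff_fst
  exact (contDiff_snd.pow _).mul this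

theorem frameVec_zero (X : ψ.GradedFrame) (x : M) : frameVec X x 0 = 0 := by
  simp [frameVec]

theorem frameVec_smul (X : ψ.GradedFrame) (x : M) (t : ℝ) (w : Euc d) :
    frameVec X x (t • w) = t • frameVec X x w := by
  simp [frameVec, Finset.smul_sum, smul_smul]

theorem frameVec_add (X : ψ.GradedFrame) (x : M) (w w' : Euc d) :
    frameVec X x (w + w') = frameVec X x w + frameVec X x w' := by
  simp [frameVec, add_smul, Finset.sum_add_distrib]

theorem frameVec_single (X : ψ.GradedFrame) (x : M) (i : Fin d) :
    frameVec X x (EuclideanSpace.single i (1 : ℝ)) = X.vec i x := by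
  rw [frameVec, Finset.sum_eq_single i]
  · simp
  · intro j _ hj; simp [hj]
  · simp

theorem frameVec_injective (X : ψ.GradedFrame) {x : M} (hx : x ∈ X.carrier) :
    Function.Injective (frameVec X x) := by
  intro w w' h
  have h1 := X.linearIndependent x hx
  ext i
  have h2 := Fintype.linearIndependent_iff.1 h1 (fun j => w j - w' j) (by
    simp only [sub_smul, Finset.sum_sub_distrib]
    exact sub_eq_zero.2 h) i
  exact sub_eq_zero.1 h2

/-- `frameVec` as a linear equivalence. -/
def frameEquiv (X : ψ.GradedFrame) {x : M} (hx : x ∈ X.carrier) :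
    Euc d ≃ₗ[ℝ] TangentSpace (𝓡 d) x :=
  LinearEquiv.ofInjectiveEndo (V := Euc d)
    { toFun := frameVec X x
      map_add' := frameVec_add X x
      map_smul' := frameVec_smul X x } (frameVec_injective X hx)

theorem frameEquiv_apply (X : ψ.GradedFrame) {x : M} (hx : x ∈ X.carrier) (w : Euc d) :
    frameEquiv X hx w = frameVec X x w := rfl

/-- The points of the chart domain over which the frame `X` is defined, in coordinates. -/
def baseW (x₀ : M) (X : ψ.GradedFrame) : Set (Euc d) :=
  {a | a ∈ (chartAt (Euc d) x₀).target ∧ (chartAt (Euc d) x₀).symm a ∈ X.carrier}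

theorem isOpen_baseW (x₀ : M) (X : ψ.GradedFrame) : IsOpen (baseW x₀ X) :=
  (chartAt (Euc d) x₀).continuousOn_symm.isOpen_inter_preimage (chartAt (Euc d) x₀).open_target
    X.isOpen_carrier

/-- The point of the tangent bundle with coordinates `(a, w)`. -/
def tangentPt (x₀ : M) (X : ψ.GradedFrame) (p : Euc d × Euc d) : TangentBundle (𝓡 d) M :=
  ⟨(chartAt (Euc d) x₀).symm p.1, frameVec X _ p.2⟩

theorem contDiffAt_tcoord_vec {x₀ : M} {X : ψ.GradedFrame} {a : Euc d} (ha : a ∈ baseW x₀ X)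
    (i : Fin d) : ContDiffAt ℝ ∞ (fun b => tcoord x₀ ((chartAt (Euc d) x₀).symm b)
      (X.vec i ((chartAt (Euc d) x₀).symm b))) a :=
  (X.smooth i).contDiffAt_tcoord X.isOpen_carrier ha.1 ha.2

theorem tcoord_frameVec (x₀ x : M) (X : ψ.GradedFrame) (w : Euc d) :
    tcoord x₀ x (frameVec X x w) = ∑ i, w i • tcoord x₀ x (X.vec i x) := by
  simp only [frameVec, map_sum, map_smul]

theorem contDiffAt_coord {n : WithTop ℕ∞} (i : Fin d) (w : Euc d) :
    ContDiffAt ℝ n (fun w : Euc d => w i) w :=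
  (contDiff_euclidean.1 contDiff_id i).contDiffAt

theorem contMDiffAt_tangentPt {x₀ : M} {X : ψ.GradedFrame} {p : Euc d × Euc d}
    (hp : p.1 ∈ baseW x₀ X) :
    ContMDiffAt 𝓘(ℝ, Euc d × Euc d) (𝓡 d).tangent ∞ (tangentPt x₀ X) p := by
  refine (contMDiffAt_tangent_iff (x₀ := x₀) ((chartAt (Euc d) x₀).map_target hp.1)).2 ⟨?_, ?_⟩
  · exact ContMDiffAt.comp (x := p) (g := (chartAt (Euc d) x₀).symm)
      (contMDiffAt_chart_symm hp.1) contDiffAt_fst.contMDiffAt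
  · have he : (fun q => tcoord x₀ (tangentPt x₀ X q).1 (tangentPt x₀ X q).2) = fun q =>
        ∑ i, q.2 i • tcoord x₀ _ (X.vec i ((chartAt (Euc d) x₀).symm q.1)) :=
      funext fun q => tcoord_frameVec x₀ _ X q.2
    rw [he]
    refine ContDiffAt.sum fun i _ => ?_
    have h1 : ContDiffAt ℝ ∞ (fun q : Euc d × Euc d => q.2 i) p :=
      (contDiffAt_coord i p.2).comp p contDiffAt_snd
    have h2 : ContDiffAt ℝ ∞ (fun q : Euc d × Euc d =>
        (tcoord x₀ _ (X.vec i ((chartAt (Euc d) x₀).symm q.1)) : Euc d)) p :=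
      ContDiffAt.comp (g := fun b => (tcoord x₀ ((chartAt (Euc d) x₀).symm b)
        (X.vec i ((chartAt (Euc d) x₀).symm b)) : Euc d)) p (contDiffAt_tcoord_vec hp i)
        contDiffAt_fst
    exact h1.smul h2

variable (D : ψ.Exponential)

/-- The exponential map in the coordinates of a chart and of a frame. -/
def expW (x₀ : M) (X : ψ.GradedFrame) (p : Euc d × Euc d) : M := D.exp (tangentPt x₀ X p)

/-- The domain of `expW`. -/
def domW (x₀ : M) (X : ψ.GradedFrame) : Set (Euc d × Euc d) :=
  {p | p.1 ∈ baseW x₀ X ∧ tangentPt x₀ X p ∈ D.dom}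

variable {D} {x₀ y₀ : M} {X : ψ.GradedFrame}

theorem isOpen_domW : IsOpen (domW D x₀ X) := by
  have h1 : IsOpen (Prod.fst ⁻¹' baseW x₀ X : Set (Euc d × Euc d)) :=
    (isOpen_baseW x₀ X).preimage continuous_fst
  have h2 : ContinuousOn (tangentPt x₀ X) (Prod.fst ⁻¹' baseW x₀ X) := fun p hp =>
    (contMDiffAt_tangentPt hp).continuousAt.continuousWithinAt
  exact h2.isOpen_inter_preimage h1 D.isOpen_dom

theorem zero_mem_domW {a : Euc d} (ha : a ∈ baseW x₀ X) : (a, (0 : Euc d)) ∈ domW D x₀ X := by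
  refine ⟨ha, ?_⟩
  rw [tangentPt, frameVec_zero]
  exact D.zero_mem _

theorem contMDiffAt_expW {p : Euc d × Euc d} (hp : p ∈ domW D x₀ X) :
    ContMDiffAt 𝓘(ℝ, Euc d × Euc d) (𝓡 d) ∞ (expW D x₀ X) p :=
  ContMDiffAt.comp (x := p) (g := D.exp) (D.smooth_exp.contMDiffAt (D.isOpen_dom.mem_nhds hp.2))
    (contMDiffAt_tangentPt hp.1)

theorem continuousOn_expW : ContinuousOn (expW D x₀ X) (domW D x₀ X) := fun _ hp =>
  (contMDiffAt_expW hp).continuousAt.continuousWithinAt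

variable (D) in
/-- The part of the domain of `expW` that is mapped into the chart domain centred at `y₀`. -/
def chartW (x₀ : M) (X : ψ.GradedFrame) (y₀ : M) : Set (Euc d × Euc d) :=
  domW D x₀ X ∩ expW D x₀ X ⁻¹' (chartAt (Euc d) y₀).source

theorem isOpen_chartW : IsOpen (chartW D x₀ X y₀) :=
  continuousOn_expW.isOpen_inter_preimage isOpen_domW (chartAt (Euc d) y₀).open_source

variable (D) in
/-- `expW`, followed by the chart of `M` centred at `y₀`. -/
def coordW (x₀ : M) (X : ψ.GradedFrame) (y₀ : M) (p : Euc d × Euc d) : Euc d :=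
  chartAt (Euc d) y₀ (expW D x₀ X p)

theorem contDiffAt_coordW {p : Euc d × Euc d} (hp : p ∈ chartW D x₀ X y₀) :
    ContDiffAt ℝ ∞ (coordW D x₀ X y₀) p := by
  rw [← contMDiffAt_iff_contDiffAt]
  exact ContMDiffAt.comp (x := p) (g := chartAt (Euc d) y₀) (contMDiffAt_chart hp.2)
    (contMDiffAt_expW hp.1)

/-- The curve `t ↦ exp_x (t v)` starts at `x` with velocity `v`. -/
theorem expW_zero_aux {x : M} {v : TangentSpace (𝓡 d) x}
    (hv : (⟨x, v⟩ : TangentBundle (𝓡 d) M) ∈ D.dom) (hy : x ∈ (chartAt (Euc d) y₀).source) :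
    D.exp ⟨x, 0⟩ = x ∧
    HasDerivAt (fun t : ℝ => chartAt (Euc d) y₀ (D.exp ⟨x, t • v⟩)) (tcoord y₀ x v) 0 := by
  obtain ⟨Y, -, hY, hc, -⟩ := D.velocity x v hv
  dsimp only at hY
  have h0 : D.exp ⟨x, (0 : ℝ) • v⟩ = x := congrArg Bundle.TotalSpace.proj hY
  refine ⟨by rwa [zero_smul] at h0, ?_⟩
  have h1 := hc.hasMFDerivAt
  have hy' : D.exp ⟨x, (0 : ℝ) • v⟩ ∈ (chartAt (Euc d) y₀).source := by rwa [h0]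
  have h2 := HasMFDerivAt.comp (0 : ℝ) (mdifferentiableAt_chart hy').hasMFDerivAt h1
  have h3 : HasFDerivAt (fun t : ℝ => chartAt (Euc d) y₀ (D.exp ⟨x, t • v⟩))
      ((tcoord y₀ (D.exp ⟨x, (0 : ℝ) • v⟩) : Euc d →L[ℝ] Euc d).comp
        ((1 : ℝ →L[ℝ] ℝ).smulRight (Y (D.exp ⟨x, (0 : ℝ) • v⟩) : Euc d))) 0 := h2.hasFDerivAt
  have h5 := h3.hasDerivAt
  have h4 : (tcoord y₀ (D.exp ⟨x, (0 : ℝ) • v⟩) (Y (D.exp ⟨x, (0 : ℝ) • v⟩)) : Euc d) =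
      tcoord y₀ x v :=
    congrArg (fun q : TangentBundle (𝓡 d) M => (tcoord y₀ q.1 q.2 : Euc d)) hY
  rw [← h4]
  refine h5.congr_deriv ?_
  simp only [ContinuousLinearMap.comp_apply, ContinuousLinearMap.smulRight_apply,
    one_apply_eq_self, one_smul]

theorem expW_zero {a : Euc d} (ha : a ∈ baseW x₀ X) :
    expW D x₀ X (a, 0) = (chartAt (Euc d) x₀).symm a := by
  rw [expW, tangentPt, frameVec_zero]
  exact (expW_zero_aux (D.zero_mem _) ((chartAt (Euc d) x₀).map_target ha.1)).1

theorem zero_mem_chartW {a : Euc d} (ha : a ∈ baseW x₀ X)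
    (hy : (chartAt (Euc d) x₀).symm a ∈ (chartAt (Euc d) y₀).source) :
    (a, (0 : Euc d)) ∈ chartW D x₀ X y₀ :=
  ⟨zero_mem_domW ha, by rwa [mem_preimage, expW_zero ha]⟩

/-- Along the zero section, the derivative of the exponential map in the fibre is the identity. -/
theorem fderiv_coordW_zero {a : Euc d} (ha : a ∈ baseW x₀ X)
    (hy : (chartAt (Euc d) x₀).symm a ∈ (chartAt (Euc d) y₀).source) (w : Euc d) :
    fderiv ℝ (coordW D x₀ X y₀) (a, 0) (0, w) =
      tcoord y₀ ((chartAt (Euc d) x₀).symm a) (frameVec X _ w) := by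
  -- a small multiple of `w` lies in the domain of the exponential map
  obtain ⟨ε, hε, hεw⟩ : ∃ ε : ℝ, ε ≠ 0 ∧ (a, ε • w) ∈ domW D x₀ X := by
    have hc : Continuous (fun ε : ℝ => (a, ε • w)) := by fun_prop
    have h1 : ∀ᶠ ε : ℝ in 𝓝[≠] 0, (a, ε • w) ∈ domW D x₀ X :=
      eventually_nhdsWithin_of_eventually_nhds (hc.continuousAt.eventually
        (isOpen_domW.mem_nhds (by dsimp only; rw [zero_smul]; exact zero_mem_domW ha)))
    obtain ⟨ε, h2, h3⟩ := (h1.and self_mem_nhdsWithin).exists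
    exact ⟨ε, h3, h2⟩
  have h1 := (expW_zero_aux hεw.2 hy).2
  have h2 : HasDerivAt (fun t : ℝ => coordW D x₀ X y₀ (a, t • ε • w))
      (fderiv ℝ (coordW D x₀ X y₀) (a, 0) (0, ε • w)) 0 := by
    have h3 : HasDerivAt (fun t : ℝ => (a, t • ε • w)) ((0 : Euc d), ε • w) 0 := by
      have := (hasDerivAt_const (0 : ℝ) a).prodMk
        ((hasDerivAt_id (0 : ℝ)).smul_const (ε • w))
      simpa using this
    have h4 : HasFDerivAt (coordW D x₀ X y₀) (fderiv ℝ (coordW D x₀ X y₀) (a, 0))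
        ((fun t : ℝ => (a, t • ε • w)) 0) := by
      simp only [zero_smul]
      exact ((contDiffAt_coordW (zero_mem_chartW ha hy)).differentiableAt (by simp)).hasFDerivAt
    exact h4.comp_hasDerivAt (0 : ℝ) h3
  have h5 : (fun t : ℝ => coordW D x₀ X y₀ (a, t • ε • w)) =
      fun t : ℝ => chartAt (Euc d) y₀ (D.exp ⟨(chartAt (Euc d) x₀).symm a,
        t • frameVec X _ (ε • w)⟩) := by
    funext t
    rw [coordW, expW, tangentPt, frameVec_smul]
  rw [h5] at h2
  have h6 := h2.unique h1
  rw [frameVec_smul, map_smul] at h6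
  have h7 : ((0 : Euc d), ε • w) = ε • ((0 : Euc d), w) := by simp
  rw [h7, map_smul] at h6
  exact smul_right_injective _ hε h6

/-- The exponential map is immersive along the fibres of the tangent bundle, as part of the
diffeomorphism `(x, v) ↦ (x, exp_x v)`. -/
theorem injective_fderiv_coordW {p : Euc d × Euc d} (hp : p ∈ chartW D x₀ X y₀) :
    Function.Injective fun w : Euc d => fderiv ℝ (coordW D x₀ X y₀) p (0, w) := by
  obtain ⟨a, w₀⟩ := p
  set x := (chartAt (Euc d) x₀).symm a with hx
  have hi := D.immersive x (frameVec X x w₀) hp.1.2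
  have hxc : x ∈ X.carrier := hp.1.1.2
  let L : Euc d →L[ℝ] Euc d := LinearMap.toContinuousLinearMap
    { toFun := fun w => (frameVec X x w : Euc d)
      map_add' := frameVec_add X x
      map_smul' := frameVec_smul X x }
  have hL : ∀ w, L w = frameVec X x w := fun w => rfl
  have h1 : ContMDiffAt 𝓘(ℝ, Euc d) (𝓡 d).tangent ∞
      (fun v : Euc d => (⟨x, v⟩ : TangentBundle (𝓡 d) M)) (L w₀) := by
    refine (contMDiffAt_tangent_iff (x₀ := x) (mem_chart_source _ _)).2
      ⟨contMDiffAt_const, ?_⟩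
    let T : Euc d →L[ℝ] Euc d := tcoord x x
    exact T.contDiff.contDiffAt
  have h2 : ContMDiffAt 𝓘(ℝ, Euc d) (𝓡 d) ∞ (fun v : Euc d => D.exp ⟨x, v⟩) (L w₀) :=
    ContMDiffAt.comp (x := L w₀) (g := D.exp)
      (D.smooth_exp.contMDiffAt (D.isOpen_dom.mem_nhds hp.1.2)) h1
  have h3 : HasMFDerivAt 𝓘(ℝ, Euc d) (𝓡 d) (fun v : Euc d => D.exp ⟨x, v⟩) (L w₀)
      (mfderiv 𝓘(ℝ, Euc d) (𝓡 d) (fun v : Euc d => D.exp ⟨x, v⟩) (L w₀)) :=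
    (h2.mdifferentiableAt (by simp)).hasMFDerivAt
  have h4 := HasMFDerivAt.comp w₀ h3 L.hasMFDerivAt
  have h5 := HasMFDerivAt.comp w₀ (mdifferentiableAt_chart hp.2).hasMFDerivAt h4
  have h6 := h5.hasFDerivAt
  have h7 : HasFDerivAt (fun w : Euc d => coordW D x₀ X y₀ (a, w))
      ((fderiv ℝ (coordW D x₀ X y₀) (a, w₀)).comp (ContinuousLinearMap.inr ℝ (Euc d) (Euc d))) w₀ :=
    ((contDiffAt_coordW hp).differentiableAt (by simp)).hasFDerivAt.comp w₀
      (hasFDerivAt_prodMk_right a w₀)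
  have h8 := h7.unique h6
  have h9 : Function.Injective (mfderiv (𝓡 d) (𝓡 d) (chartAt (Euc d) y₀) (expW D x₀ X (a, w₀))) :=
    (mdifferentiable_chart (I := 𝓡 d) y₀).mfderiv_injective hp.2
  have h10 : (fun w : Euc d => fderiv ℝ (coordW D x₀ X y₀) (a, w₀) (0, w)) =
      fun w => mfderiv (𝓡 d) (𝓡 d) (chartAt (Euc d) y₀) (expW D x₀ X (a, w₀))
        (mfderiv 𝓘(ℝ, Euc d) (𝓡 d) (fun v : Euc d => D.exp ⟨x, v⟩) (L w₀) (L w)) :=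
    funext fun w => congrArg (fun A : Euc d →L[ℝ] Euc d => A w) h8
  rw [h10]
  exact h9.comp (hi.comp (frameVec_injective X hxc))

variable (D) in
/-- `(x, v) ↦ (x, exp_x v)` in coordinates. -/
def graphW (x₀ : M) (X : ψ.GradedFrame) (y₀ : M) (p : Euc d × Euc d) : Euc d × Euc d :=
  (p.1, coordW D x₀ X y₀ p)

theorem contDiffOn_graphW : ContDiffOn ℝ ∞ (graphW D x₀ X y₀) (chartW D x₀ X y₀) := fun _ hp =>
  (contDiffAt_fst.prodMk (contDiffAt_coordW hp)).contDiffWithinAt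

theorem expW_injective {a w w' : Euc d} (h : (a, w) ∈ domW D x₀ X) (h' : (a, w') ∈ domW D x₀ X)
    (he : expW D x₀ X (a, w) = expW D x₀ X (a, w')) : w = w' :=
  frameVec_injective X h.1.2 (D.injective _ _ _ h.2 h'.2 he)

theorem injOn_graphW : InjOn (graphW D x₀ X y₀) (chartW D x₀ X y₀) := by
  rintro ⟨a, w⟩ hp ⟨a', w'⟩ hp' h
  obtain ⟨h1, h2⟩ := Prod.ext_iff.1 h
  change a = a' at h1
  subst h1
  have h3 := (chartAt (Euc d) y₀).injOn hp.2 hp'.2 h2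
  rw [expW_injective hp.1 hp'.1 h3]

theorem exists_graphW_equiv {p : Euc d × Euc d} (hp : p ∈ chartW D x₀ X y₀) :
    ∃ e : (Euc d × Euc d) ≃L[ℝ] (Euc d × Euc d),
      HasFDerivAt (graphW D x₀ X y₀) (e : (Euc d × Euc d) →L[ℝ] (Euc d × Euc d)) p := by
  set f' := fderiv ℝ (coordW D x₀ X y₀) p with hf'
  let A := (ContinuousLinearMap.fst ℝ (Euc d) (Euc d)).prod f'
  have hA : HasFDerivAt (graphW D x₀ X y₀) A p :=
    hasFDerivAt_fst.prodMk ((contDiffAt_coordW hp).differentiableAt (by simp)).hasFDerivAt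
  have hinj : Function.Injective A.toLinearMap := by
    rw [← LinearMap.ker_eq_bot, LinearMap.ker_eq_bot']
    rintro ⟨u, w⟩ h
    obtain ⟨h1, h2⟩ := Prod.ext_iff.1 h
    change u = 0 at h1
    subst h1
    change f' (0, w) = 0 at h2
    have h3 : w = 0 := injective_fderiv_coordW hp (by
      change f' (0, w) = f' (0, 0)
      rw [h2, ← Prod.zero_eq_mk, map_zero])
    rw [h3]; rfl
  refine ⟨(LinearEquiv.ofInjectiveEndo A.toLinearMap hinj).toContinuousLinearEquiv, ?_⟩
  exact hA

theorem isOpen_graphW_image {O : Set (Euc d × Euc d)} (hO : IsOpen O)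
    (hOW : O ⊆ chartW D x₀ X y₀) : IsOpen (graphW D x₀ X y₀ '' O) :=
  isOpen_image_of_invertible hO (contDiffOn_graphW.mono hOW) fun _ hp =>
    exists_graphW_equiv (hOW hp)

variable (D) in
/-- The inverse of `graphW`. -/
def logW (x₀ : M) (X : ψ.GradedFrame) (y₀ : M) : Euc d × Euc d → Euc d × Euc d :=
  Function.invFunOn (graphW D x₀ X y₀) (chartW D x₀ X y₀)

theorem contDiffOn_logW :
    ContDiffOn ℝ ∞ (logW D x₀ X y₀) (graphW D x₀ X y₀ '' chartW D x₀ X y₀) :=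
  contDiffOn_invFunOn isOpen_chartW contDiffOn_graphW (fun _ hp => exists_graphW_equiv hp)
    injOn_graphW

theorem logW_graphW {p : Euc d × Euc d} (hp : p ∈ chartW D x₀ X y₀) :
    logW D x₀ X y₀ (graphW D x₀ X y₀ p) = p :=
  injOn_graphW (Function.invFunOn_mem ⟨p, hp, rfl⟩) hp (Function.invFunOn_eq ⟨p, hp, rfl⟩)

end Exp
end HCalc

namespace HCalc

/-! ### Exponential coordinates on the groupoid -/

section Coordinates

variable {d N : ℕ} {M : Type u} [TopologicalSpace M] [ChartedSpace (Euc d) M]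
  [IsManifold (𝓡 d) ∞ M] {H : LieFiltration d N M} {ψ : H.Splitting}

open LieFiltration.Splitting TGroupoid

/-- The space of the parametrizations of the groupoid. -/
abbrev Par (d : ℕ) : Type := Euc d × Euc d × ℝ

section

variable (D : ψ.Exponential) (x₀ : M) (X : ψ.GradedFrame)

/-- The largest domain of exponential coordinates. -/
def domO : Set (Par d) := {p | (p.1, scale X p.2.2 p.2.1) ∈ domW D x₀ X}

/-- The part of `domO` that is mapped into the chart domain centred at `y₀` by the source map. -/
def chartO (y₀ : M) : Set (Par d) := {p | (p.1, scale X p.2.2 p.2.1) ∈ chartW D x₀ X y₀}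

end

variable {D : ψ.Exponential} {x₀ y₀ : M} {X : ψ.GradedFrame}

theorem contDiff_toW (X : ψ.GradedFrame) :
    ContDiff ℝ ∞ (fun p : Par d => (p.1, scale X p.2.2 p.2.1)) :=
  contDiff_fst.prodMk ((contDiff_scale X).comp
    ((contDiff_fst.comp contDiff_snd).prodMk (contDiff_snd.comp contDiff_snd)))

theorem isOpen_domO : IsOpen (domO D x₀ X) := isOpen_domW.preimage (contDiff_toW X).continuous

theorem isOpen_chartO : IsOpen (chartO D x₀ X y₀) :=
  isOpen_chartW.preimage (contDiff_toW X).continuous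

theorem chartO_subset : chartO D x₀ X y₀ ⊆ domO D x₀ X := fun _ h => h.1

theorem zero_mem_chartO {a : Euc d} (ha : a ∈ baseW x₀ X) (h : ℝ) :
    (a, (0 : Euc d), h) ∈ chartO D x₀ X x₀ := by
  change (a, scale X h 0) ∈ chartW D x₀ X x₀
  rw [scale_zero_right]
  exact zero_mem_chartW ha ((chartAt (Euc d) x₀).map_target ha.1)

theorem height_zero_mem_chartO {a : Euc d} (ha : a ∈ baseW x₀ X) (z : Euc d) :
    (a, z, (0 : ℝ)) ∈ chartO D x₀ X x₀ := by
  change (a, scale X 0 z) ∈ chartW D x₀ X x₀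
  rw [scale_zero_left]
  exact zero_mem_chartW ha ((chartAt (Euc d) x₀).map_target ha.1)

theorem zoom_mem_domO_iff {a z : Euc d} {t h : ℝ} (ht : t ≠ 0) :
    (a, scale X t⁻¹ z, t * h) ∈ domO D x₀ X ↔ (a, z, h) ∈ domO D x₀ X := by
  change (a, scale X (t * h) (scale X t⁻¹ z)) ∈ domW D x₀ X ↔ (a, scale X h z) ∈ domW D x₀ X
  rw [scale_scale, mul_comm t h, mul_assoc, mul_inv_cancel₀ ht, mul_one]

variable (D x₀ X) in
/-- The exponential parametrization on its largest domain. -/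
def maxIndex : ParamIndex D :=
  .exp x₀ X (domO D x₀ X) isOpen_domO fun _ hp => ⟨hp.1.1, hp.1.2, hp.2⟩

theorem subset_domO {O : Set (Par d)}
    (hO : ∀ p ∈ O, p.1 ∈ (chartAt (Euc d) x₀).target ∧
        (chartAt (Euc d) x₀).symm p.1 ∈ X.carrier ∧
        (⟨_, X.point ((chartAt (Euc d) x₀).symm p.1) p.2.1 p.2.2⟩ : TangentBundle (𝓡 d) M)
          ∈ D.dom) : O ⊆ domO D x₀ X := fun p hp => ⟨⟨(hO p hp).1, (hO p hp).2.1⟩, (hO p hp).2.2⟩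

theorem expParam_zero (a z : Euc d) : expParam D x₀ X (a, z, 0) =
    osc ((chartAt (Euc d) x₀).symm a)
      ((ψ.iso _).symm (frameVec X ((chartAt (Euc d) x₀).symm a) z)) := dif_pos rfl

theorem expParam_ne_zero (a z : Euc d) {h : ℝ} (hh : h ≠ 0) : expParam D x₀ X (a, z, h) =
    pair ((chartAt (Euc d) x₀).symm a) (expW D x₀ X (a, scale X h z)) h hh := dif_neg hh

theorem r_expParam (p : Par d) :
    TGroupoid.r D (expParam D x₀ X p) = ((chartAt (Euc d) x₀).symm p.1, p.2.2) := by
  obtain ⟨a, z, h⟩ := p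
  by_cases hh : h = 0
  · subst hh; rw [expParam_zero]; rfl
  · rw [expParam_ne_zero _ _ hh]; rfl

theorem s_expParam {p : Par d} (hp : p ∈ domO D x₀ X) :
    TGroupoid.s D (expParam D x₀ X p) = (expW D x₀ X (p.1, scale X p.2.2 p.2.1), p.2.2) := by
  obtain ⟨a, z, h⟩ := p
  by_cases hh : h = 0
  · subst hh
    rw [expParam_zero, scale_zero_left, expW_zero hp.1]; rfl
  · rw [expParam_ne_zero _ _ hh]; rfl

theorem injOn_expParam : InjOn (expParam D x₀ X) (domO D x₀ X) := by
  rintro ⟨a, z, h⟩ hp ⟨a', z', h'⟩ hp' he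
  have hr := congrArg (TGroupoid.r D) he
  rw [r_expParam, r_expParam] at hr
  obtain ⟨h1, h2⟩ := Prod.ext_iff.1 hr
  have h3 := (chartAt (Euc d) x₀).symm.injOn hp.1.1 hp'.1.1 h1
  change a = a' at h3
  change h = h' at h2
  subst h3 h2
  by_cases hh : h = 0
  · subst hh
    rw [expParam_zero, expParam_zero] at he
    have h4 := (TGroupoid.osc.inj he).2
    have h5 := (ψ.iso _).symm.injective (eq_of_heq h4)
    rw [frameVec_injective X hp.1.2 h5]
  · have hs := congrArg (fun q => (TGroupoid.s D q).1) he
    simp only [s_expParam hp, s_expParam hp'] at hs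
    have h4 := expW_injective hp hp' hs
    have h5 := congrArg (scale X h⁻¹) h4
    rw [scale_inv_scale X hh, scale_inv_scale X hh] at h5
    rw [show z = z' from h5]

theorem zoom_expParam {a z : Euc d} {h t : ℝ} (ht : 0 < t)
    (ha : (chartAt (Euc d) x₀).symm a ∈ X.carrier) :
    zoom D t ht (expParam D x₀ X (a, z, h)) = expParam D x₀ X (a, scale X t z, t⁻¹ * h) := by
  by_cases hh : h = 0
  · subst hh
    rw [mul_zero, expParam_zero, expParam_zero]
    change osc _ (H.dil t _) = _
    unfold frameVec
    rw [dil_symm_sum X _ ha]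
    rfl
  · have h1 : scale X (t⁻¹ * h) (scale X t z) = scale X h z := by
      rw [scale_scale, mul_comm t⁻¹, mul_assoc, inv_mul_cancel₀ ht.ne', mul_one]
    rw [expParam_ne_zero _ _ hh, expParam_ne_zero _ _ (mul_ne_zero (inv_ne_zero ht.ne') hh), h1]
    rfl

/-! ### Change of exponential coordinates -/

/-- The matrix of the frame `X` in the coordinates of the chart. -/
def frameMat (x₀ : M) (X : ψ.GradedFrame) (x : M) : Euc d →L[ℝ] Euc d :=
  ∑ i, (EuclideanSpace.proj i : Euc d →L[ℝ] ℝ).smulRight (tcoord x₀ x (X.vec i x) : Euc d)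

theorem frameMat_apply (x₀ x : M) (w : Euc d) :
    frameMat x₀ X x w = tcoord x₀ x (frameVec X x w) := by
  rw [tcoord_frameVec, frameMat]
  simp

theorem exists_frameMat_equiv {x : M} (hx : x ∈ (chartAt (Euc d) x₀).source)
    (hxc : x ∈ X.carrier) : ∃ e : Euc d ≃L[ℝ] Euc d, (e : Euc d →L[ℝ] Euc d) = frameMat x₀ X x := by
  have hinj : Function.Injective (frameMat x₀ X x).toLinearMap := by
    intro w w' h
    have h' : frameMat x₀ X x w = frameMat x₀ X x w' := h
    rw [frameMat_apply, frameMat_apply] at h'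
    obtain ⟨e, he, -⟩ := exists_tcoord_equiv hx
    rw [← he] at h'
    exact frameVec_injective X hxc (e.injective h')
  exact ⟨(LinearEquiv.ofInjectiveEndo _ hinj).toContinuousLinearEquiv, rfl⟩

/-- The coordinates of `v` in the frame `X`. -/
def frameCoord (x₀ : M) (X : ψ.GradedFrame) (x : M) (v : TangentSpace (𝓡 d) x) : Euc d :=
  (frameMat x₀ X x).inverse (tcoord x₀ x v)

theorem frameVec_frameCoord {x : M} (hx : x ∈ (chartAt (Euc d) x₀).source)
    (hxc : x ∈ X.carrier) (v : TangentSpace (𝓡 d) x) :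
    frameVec X x (frameCoord x₀ X x v) = v := by
  obtain ⟨e, he⟩ := exists_frameMat_equiv hx hxc
  obtain ⟨e', he', -⟩ := exists_tcoord_equiv hx
  apply e'.injective
  have h1 : e' (frameVec X x (frameCoord x₀ X x v)) = e (frameCoord x₀ X x v) := by
    have := frameMat_apply (X := X) x₀ x (frameCoord x₀ X x v)
    rw [← he, ← he'] at this
    exact this.symm
  rw [h1, frameCoord, ← he, ContinuousLinearMap.inverse_equiv, ← he']
  exact e.apply_symm_apply _

theorem contDiffAt_frameMat {a : Euc d} (ha : a ∈ baseW x₀ X) :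
    ContDiffAt ℝ ∞ (fun b => frameMat x₀ X ((chartAt (Euc d) x₀).symm b)) a := by
  unfold frameMat
  refine ContDiffAt.sum fun i _ => ?_
  exact contDiffAt_const.smulRight (contDiffAt_tcoord_vec ha i)

/-- The change of exponential coordinates. -/
def transO (x₁ : M) (X₁ : ψ.GradedFrame) (x₀ : M) (X : ψ.GradedFrame) (p : Par d) : Par d :=
  (chartAt (Euc d) x₀ ((chartAt (Euc d) x₁).symm p.1),
    frameCoord x₀ X ((chartAt (Euc d) x₁).symm p.1) (frameVec X₁ _ p.2.1), p.2.2)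

variable {x₁ : M} {X₁ : ψ.GradedFrame}

/-- The change of exponential coordinates is smooth, since the dilations commute with the change of
frames; it is the same linear map on all fibres over `x`, whatever the height. -/
theorem contDiffAt_transO {p : Par d} (hp : p.1 ∈ baseW x₁ X₁)
    (hx : (chartAt (Euc d) x₁).symm p.1 ∈ (chartAt (Euc d) x₀).source)
    (hxc : (chartAt (Euc d) x₁).symm p.1 ∈ X.carrier) :
    ContDiffAt ℝ ∞ (transO x₁ X₁ x₀ X) p := by
  have h1 : ContDiffAt ℝ ∞ (fun b => chartAt (Euc d) x₀ ((chartAt (Euc d) x₁).symm b)) p.1 := by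
    rw [← contMDiffAt_iff_contDiffAt]
    exact ContMDiffAt.comp (x := p.1) (contMDiffAt_chart hx) (contMDiffAt_chart_symm hp.1)
  have h2 : ContDiffAt ℝ ∞ (fun q : Par d => (tcoord x₀ ((chartAt (Euc d) x₁).symm q.1)
      (frameVec X₁ _ q.2.1) : Euc d)) p :=
    ContDiffAt.comp (f := fun q : Par d => (q.1, q.2.1)) p
      ((contMDiffAt_tangent_iff (x₀ := x₀) (f := tangentPt x₁ X₁) (p := (p.1, p.2.1)) hx).1
        (contMDiffAt_tangentPt hp)).2 (by fun_prop)
  have hb : chartAt (Euc d) x₀ ((chartAt (Euc d) x₁).symm p.1) ∈ baseW x₀ X :=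
    ⟨(chartAt (Euc d) x₀).map_source hx, by
      rwa [(chartAt (Euc d) x₀).left_inv hx]⟩
  have h3 : ContDiffAt ℝ ∞ (fun q : Par d => frameMat x₀ X ((chartAt (Euc d) x₁).symm q.1)) p := by
    have h4 := ContDiffAt.comp p.1 (contDiffAt_frameMat hb) h1
    have h5 : ContDiffAt ℝ ∞ (fun b => frameMat x₀ X ((chartAt (Euc d) x₁).symm b)) p.1 := by
      refine h4.congr_of_eventuallyEq ?_
      have hc := (contMDiffAt_chart_symm hp.1).continuousAt
      filter_upwards [hc.preimage_mem_nhds ((chartAt (Euc d) x₀).open_source.mem_nhds hx)] with b hb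
      simp only [Function.comp]
      rw [(chartAt (Euc d) x₀).left_inv hb]
    exact h5.comp p contDiffAt_fst
  obtain ⟨e, he⟩ := exists_frameMat_equiv (X := X) hx hxc
  have h4 : ContDiffAt ℝ ∞ (fun q : Par d =>
      (frameMat x₀ X ((chartAt (Euc d) x₁).symm q.1)).inverse) p := by
    refine ContDiffAt.comp (g := ContinuousLinearMap.inverse) p ?_ h3
    rw [← he]
    exact contDiffAt_map_inverse e
  exact (h1.comp p contDiffAt_fst).prodMk ((h4.clm_apply h2).prodMk (by fun_prop))

theorem point_eq_dil {x : M} (hx : x ∈ X.carrier) (z : Euc d) (h : ℝ) :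
    X.point x z h = ψ.dil h x (frameVec X x z) := by
  unfold LieFiltration.Splitting.dil frameVec
  rw [dil_symm_sum X x hx, LinearEquiv.apply_symm_apply]
  rfl

theorem expParam_transO {p : Par d} (hp : p.1 ∈ baseW x₁ X₁)
    (hx : (chartAt (Euc d) x₁).symm p.1 ∈ (chartAt (Euc d) x₀).source)
    (hxc : (chartAt (Euc d) x₁).symm p.1 ∈ X.carrier) :
    expParam D x₀ X (transO x₁ X₁ x₀ X p) = expParam D x₁ X₁ p ∧
      (transO x₁ X₁ x₀ X p ∈ domO D x₀ X ↔ p ∈ domO D x₁ X₁) := by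
  obtain ⟨a, z, h⟩ := p
  dsimp only at hx hxc hp
  have h1 : (chartAt (Euc d) x₀).symm (chartAt (Euc d) x₀ ((chartAt (Euc d) x₁).symm a)) =
    (chartAt (Euc d) x₁).symm a := (chartAt (Euc d) x₀).left_inv hx
  have h2 := frameVec_frameCoord (X := X) hx hxc (frameVec X₁ _ z)
  set w := frameCoord x₀ X ((chartAt (Euc d) x₁).symm a) (frameVec X₁ _ z) with hw
  have h3 : tangentPt x₀ X (chartAt (Euc d) x₀ ((chartAt (Euc d) x₁).symm a), scale X h w) =
      tangentPt x₁ X₁ (a, scale X₁ h z) := by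
    unfold tangentPt
    dsimp only
    rw [h1, ← point_eq, ← point_eq, point_eq_dil hxc, point_eq_dil hp.2, h2]
  have h4 : transO x₁ X₁ x₀ X (a, z, h) =
    (chartAt (Euc d) x₀ ((chartAt (Euc d) x₁).symm a), w, h) := rfl
  constructor
  · rw [h4]
    by_cases hh : h = 0
    · subst hh
      rw [expParam_zero, expParam_zero, h1, h2]
    · rw [expParam_ne_zero _ _ hh, expParam_ne_zero _ _ hh, expW, expW, h3, h1]
  · rw [h4]
    change (_ ∧ tangentPt x₀ X _ ∈ D.dom) ↔ (_ ∧ _)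
    rw [h3]
    refine and_congr_left fun _ => ⟨fun _ => hp, fun _ => ⟨(chartAt (Euc d) x₀).map_source hx, ?_⟩⟩
    change (chartAt (Euc d) x₀).symm (chartAt (Euc d) x₀ _) ∈ _
    rwa [h1]

theorem map_pair {c : M × M} {q : Par d} (hq : q.2.2 ≠ 0) :
    (atlas D).map (.pair c.1 c.2) q =
      pair ((chartAt (Euc d) c.1).symm q.1) ((chartAt (Euc d) c.2).symm q.2.1) q.2.2 hq :=
  dif_neg hq

/-- Any parametrization of the groupoid factors smoothly through exponential coordinates near a
point in the range of the latter. -/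
theorem exists_lift (i : (atlas D).ι) {y : Par d} (hy : y ∈ (atlas D).dom i) {p : Par d}
    (hp : p ∈ domO D x₀ X) (hyp : (atlas D).map i y = expParam D x₀ X p) :
    ∃ ι : Par d → Par d, ContDiffAt ℝ ∞ ι y ∧ ι y = p ∧
      ∀ᶠ y' in 𝓝 y, (atlas D).map i y' = expParam D x₀ X (ι y') := by
  have hr := congrArg (TGroupoid.r D) hyp
  rw [r_expParam] at hr
  cases i with
  | exp x₁ X₁ O hO hsub =>
    have hyO : y ∈ domO D x₁ X₁ := subset_domO hsub hy
    change TGroupoid.r D (expParam D x₁ X₁ y) = _ at hr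
    rw [r_expParam] at hr
    obtain ⟨h1, h2⟩ := Prod.ext_iff.1 hr
    dsimp only at h1 h2
    have hx : (chartAt (Euc d) x₁).symm y.1 ∈ (chartAt (Euc d) x₀).source := by
      rw [h1]; exact (chartAt (Euc d) x₀).map_target hp.1.1
    have hxc : (chartAt (Euc d) x₁).symm y.1 ∈ X.carrier := by rw [h1]; exact hp.1.2
    refine ⟨transO x₁ X₁ x₀ X, contDiffAt_transO hyO.1 hx hxc, ?_, ?_⟩
    · have h3 := expParam_transO (D := D) hyO.1 hx hxc
      exact injOn_expParam (h3.2.2 hyO) hp (h3.1.trans hyp)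
    · have hc := (contMDiffAt_chart_symm hyO.1.1).continuousAt
      have hc' : ContinuousAt (fun q : Par d => (chartAt (Euc d) x₁).symm q.1) y :=
        ContinuousAt.comp (f := fun q : Par d => q.1) hc continuousAt_fst
      filter_upwards [hc'.preimage_mem_nhds ((chartAt (Euc d) x₀).open_source.mem_nhds hx),
        hc'.preimage_mem_nhds (X.isOpen_carrier.mem_nhds hxc), isOpen_domO.mem_nhds hyO]
        with q h3 h4 h5
      exact (expParam_transO h5.1 h3 h4).1.symm
  | pair x₁ y₁ =>
    obtain ⟨a, b, h⟩ := y
    obtain ⟨hya, hyb, hyh⟩ := hy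
    have hh : h ≠ 0 := hyh
    obtain ⟨a', z', h'⟩ := p
    have hs := congrArg (TGroupoid.s D) hyp
    rw [s_expParam hp] at hs
    rw [map_pair (c := (x₁, y₁)) hh] at hr hs
    obtain ⟨h1, h2⟩ := Prod.ext_iff.1 hr
    obtain ⟨h3, -⟩ := Prod.ext_iff.1 hs
    change h = h' at h2
    subst h2
    change (chartAt (Euc d) x₁).symm a = (chartAt (Euc d) x₀).symm a' at h1
    change (chartAt (Euc d) y₁).symm b = expW D x₀ X (a', scale X h z') at h3
    have hx : (chartAt (Euc d) x₁).symm a ∈ (chartAt (Euc d) x₀).source := by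
      rw [h1]; exact (chartAt (Euc d) x₀).map_target hp.1.1
    -- the chart of the target space centred at the image point
    set y₀ := (chartAt (Euc d) y₁).symm b with hy₀
    have hpW : (a', scale X h z') ∈ chartW D x₀ X y₀ := ⟨hp, by
      rw [mem_preimage, ← h3]; exact mem_chart_source _ _⟩
    let κ : Par d → Euc d × Euc d := fun q =>
      (chartAt (Euc d) x₀ ((chartAt (Euc d) x₁).symm q.1),
        chartAt (Euc d) y₀ ((chartAt (Euc d) y₁).symm q.2.1))
    have hκ : ContDiffAt ℝ ∞ κ (a, b, h) := by
      have e1 : ContDiffAt ℝ ∞ (fun b => chartAt (Euc d) x₀ ((chartAt (Euc d) x₁).symm b)) a := by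
        rw [← contMDiffAt_iff_contDiffAt]
        exact ContMDiffAt.comp (x := a) (contMDiffAt_chart hx) (contMDiffAt_chart_symm hya)
      have e2 : ContDiffAt ℝ ∞ (fun b => chartAt (Euc d) y₀ ((chartAt (Euc d) y₁).symm b)) b := by
        rw [← contMDiffAt_iff_contDiffAt]
        exact ContMDiffAt.comp (x := b) (contMDiffAt_chart (mem_chart_source _ _))
          (contMDiffAt_chart_symm hyb)
      exact (e1.comp (a, b, h) contDiffAt_fst).prodMk
        (ContDiffAt.comp (f := fun q : Par d => q.2.1) (a, b, h) e2 (by fun_prop))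
    have hκ0 : κ (a, b, h) = graphW D x₀ X y₀ (a', scale X h z') := by
      change (_, _) = (a', chartAt (Euc d) y₀ (expW D x₀ X (a', scale X h z')))
      rw [← h3, h1, (chartAt (Euc d) x₀).right_inv hp.1.1]
    have hV : IsOpen (graphW D x₀ X y₀ '' chartW D x₀ X y₀) :=
      isOpen_graphW_image isOpen_chartW Subset.rfl
    have hκV : κ (a, b, h) ∈ graphW D x₀ X y₀ '' chartW D x₀ X y₀ := by
      rw [hκ0]; exact mem_image_of_mem _ hpW
    have hl : ContDiffAt ℝ ∞ (fun q => logW D x₀ X y₀ (κ q)) (a, b, h) :=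
      ContDiffAt.comp (a, b, h) (contDiffOn_logW.contDiffAt (hV.mem_nhds hκV)) hκ
    have hinv : ContDiffAt ℝ ∞ (fun q : Par d => q.2.2⁻¹) (a, b, h) :=
      ContDiffAt.inv (by fun_prop) hh
    refine ⟨fun q => (chartAt (Euc d) x₀ ((chartAt (Euc d) x₁).symm q.1),
      scale X q.2.2⁻¹ (logW D x₀ X y₀ (κ q)).2, q.2.2), ?_, ?_, ?_⟩
    · refine hκ.fst.prodMk (ContDiffAt.prodMk ?_ (by fun_prop))
      exact ContDiffAt.comp (g := fun q : Euc d × ℝ => scale X q.2 q.1) (a, b, h)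
        (contDiff_scale X).contDiffAt (hl.snd.prodMk hinv)
    · dsimp only
      rw [hκ0, logW_graphW hpW, scale_inv_scale X hh, h1, (chartAt (Euc d) x₀).right_inv hp.1.1]
    · have hc := (contMDiffAt_chart_symm hya).continuousAt
      have hc' : ContinuousAt (fun q : Par d => (chartAt (Euc d) x₁).symm q.1) (a, b, h) :=
        ContinuousAt.comp (f := fun q : Par d => q.1) hc continuousAt_fst
      have hd := (contMDiffAt_chart_symm hyb).continuousAt
      have hd' : ContinuousAt (fun q : Par d => (chartAt (Euc d) y₁).symm q.2.1) (a, b, h) :=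
        ContinuousAt.comp (f := fun q : Par d => q.2.1) hd (by fun_prop)
      have hne : ∀ᶠ q : Par d in 𝓝 (a, b, h), q.2.2 ≠ 0 :=
        (continuous_snd.comp continuous_snd).continuousAt.eventually_ne hh
      filter_upwards [hc'.preimage_mem_nhds ((chartAt (Euc d) x₀).open_source.mem_nhds hx),
        hd'.preimage_mem_nhds ((chartAt (Euc d) y₀).open_source.mem_nhds (mem_chart_source _ _)),
        hκ.continuousAt.preimage_mem_nhds (hV.mem_nhds hκV), hne] with q e1 e2 e3 e4
      rw [map_pair (c := (x₁, y₁)) e4, expParam_ne_zero _ _ e4, scale_scale_inv X e4]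
      obtain ⟨w, hw, hwq⟩ := e3
      rw [← hwq, logW_graphW hw]
      obtain ⟨f1, f2⟩ := Prod.ext_iff.1 hwq
      change w.1 = _ at f1
      change chartAt (Euc d) y₀ (expW D x₀ X w) = _ at f2
      have f3 := (chartAt (Euc d) y₀).injOn hw.2 e2 f2
      have f4 : (chartAt (Euc d) x₀ ((chartAt (Euc d) x₁).symm q.1), w.2) = w :=
        Prod.ext f1.symm rfl
      rw [(chartAt (Euc d) x₀).left_inv e1, f4, f3]

/-- The topology of the groupoid is the final one for the parametrizations of the atlas. -/
theorem isOpen_groupoid_iff {A : Set (TGroupoid D)} :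
    IsOpen A ↔ ∀ i, ∀ y ∈ (atlas D).dom i, (atlas D).map i y ∈ A →
      ∀ᶠ y' in 𝓝 y, (atlas D).map i y' ∈ A := by
  have h1 : IsOpen A ↔ ∀ i, IsOpen[TopologicalSpace.coinduced
      (fun y : (atlas D).dom i => (atlas D).map i y) inferInstance] A := isOpen_iSup_iff
  rw [h1]
  refine forall_congr' fun i => ?_
  rw [isOpen_coinduced, isOpen_iff_mem_nhds]
  constructor
  · intro h y hy hyA
    have := h ⟨y, hy⟩ hyA
    rw [nhds_subtype_eq_comap, mem_comap] at this
    obtain ⟨U, hU, hUA⟩ := this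
    filter_upwards [hU, ((atlas D).isOpen_dom i).mem_nhds hy] with y' h1 h2
    exact hUA (show (⟨y', h2⟩ : (atlas D).dom i) ∈ Subtype.val ⁻¹' U from h1)
  · rintro h ⟨y, hy⟩ hyA
    rw [nhds_subtype_eq_comap]
    exact preimage_mem_comap (h y hy hyA)

theorem continuous_map (i : (atlas D).ι) :
    ContinuousOn ((atlas D).map i) ((atlas D).dom i) := by
  rw [continuousOn_iff_continuous_domRestrict]
  exact continuous_iff_coinduced_le.2 (le_iSup (fun i => TopologicalSpace.coinduced
    (fun y : (atlas D).dom i => (atlas D).map i y) inferInstance) i)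

theorem isOpen_expParam_image {O : Set (Par d)} (hO : IsOpen O) (hOD : O ⊆ domO D x₀ X) :
    IsOpen (expParam D x₀ X '' O) := by
  rw [isOpen_groupoid_iff]
  rintro i y hy ⟨p, hp, hpy⟩
  obtain ⟨ι, hι, hιy, hev⟩ := exists_lift i hy (hOD hp) hpy.symm
  filter_upwards [hev, hι.continuousAt.preimage_mem_nhds (by rw [hιy]; exact hO.mem_nhds hp)]
    with y' h1 h2
  exact ⟨_, h2, h1.symm⟩

end Coordinates
end HCalc

namespace HCalc

/-! ### Smooth functions on the groupoid -/

section Functions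

variable {d N : ℕ} {M : Type u} [TopologicalSpace M] [ChartedSpace (Euc d) M]
  [IsManifold (𝓡 d) ∞ M] {H : LieFiltration d N M} {ψ : H.Splitting}

open LieFiltration.Splitting TGroupoid

variable (D : ψ.Exponential) (x₀ : M) (X : ψ.GradedFrame)

open Classical in
/-- Extension by zero of a function of exponential coordinates to the groupoid. -/
def extFun (φ : Par d → ℂ) (q : TGroupoid D) : ℂ :=
  if h : ∃ p ∈ domO D x₀ X, expParam D x₀ X p = q then φ h.choose else 0

variable {D x₀ X}

theorem extFun_expParam {φ : Par d → ℂ} {p : Par d} (hp : p ∈ domO D x₀ X) :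
    extFun D x₀ X φ (expParam D x₀ X p) = φ p := by
  have h : ∃ p' ∈ domO D x₀ X, expParam D x₀ X p' = expParam D x₀ X p := ⟨p, hp, rfl⟩
  rw [extFun, dif_pos h]
  exact congrArg φ (injOn_expParam h.choose_spec.1 hp h.choose_spec.2)

theorem extFun_eq_zero {φ : Par d → ℂ} {S : Set (Par d)} (hφ : ∀ p, p ∉ S → φ p = 0)
    {q : TGroupoid D} (hq : q ∉ expParam D x₀ X '' S) : extFun D x₀ X φ q = 0 := by
  unfold extFun
  split_ifs with h
  · exact hφ _ fun hS => hq ⟨_, hS, h.choose_spec.2⟩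
  · rfl

/-- The image of a compact set of exponential coordinates is closed in the groupoid. -/
theorem eventually_notMem_image [T2Space M] {S : Set (Par d)} (hS : IsCompact S)
    (hSD : S ⊆ domO D x₀ X) (i : (atlas D).ι) {y : Par d} (hy : y ∈ (atlas D).dom i)
    (hyS : (atlas D).map i y ∉ expParam D x₀ X '' domO D x₀ X) :
    ∀ᶠ y' in 𝓝 y, (atlas D).map i y' ∉ expParam D x₀ X '' S := by
  cases i with
  | exp x₁ X₁ O hO hsub =>
    have hyO : y ∈ domO D x₁ X₁ := subset_domO hsub hy
    have hK : IsCompact ((fun p : Par d => (chartAt (Euc d) x₀).symm p.1) '' S) :=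
      hS.image_of_continuousOn fun p hp =>
        (ContinuousAt.comp (f := fun q : Par d => q.1)
          (contMDiffAt_chart_symm (hSD hp).1.1).continuousAt continuousAt_fst).continuousWithinAt
    -- the base point of `y` is not one of `S`, as otherwise a change of coordinates would apply
    have hn : (chartAt (Euc d) x₁).symm y.1 ∉
        (fun p : Par d => (chartAt (Euc d) x₀).symm p.1) '' S := by
      rintro ⟨p, hp, hpy⟩
      have hx : (chartAt (Euc d) x₁).symm y.1 ∈ (chartAt (Euc d) x₀).source := by
        rw [← hpy]; exact (chartAt (Euc d) x₀).map_target (hSD hp).1.1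
      have hxc : (chartAt (Euc d) x₁).symm y.1 ∈ X.carrier := by rw [← hpy]; exact (hSD hp).1.2
      have h3 := expParam_transO (D := D) hyO.1 hx hxc
      exact hyS ⟨_, h3.2.2 hyO, h3.1⟩
    have hc : ContinuousAt (fun q : Par d => (chartAt (Euc d) x₁).symm q.1) y :=
      ContinuousAt.comp (f := fun q : Par d => q.1)
        (contMDiffAt_chart_symm hyO.1.1).continuousAt continuousAt_fst
    filter_upwards [hc.preimage_mem_nhds (hK.isClosed.isOpen_compl.mem_nhds hn)]
      with y' hy' ⟨p, hp, hpy⟩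
    refine hy' ⟨p, hp, ?_⟩
    have := congrArg (fun q => (TGroupoid.r D q).1) hpy
    change (TGroupoid.r D (expParam D x₀ X p)).1 = (TGroupoid.r D (expParam D x₁ X₁ y')).1 at this
    rwa [r_expParam, r_expParam] at this
  | pair x₁ y₁ =>
    obtain ⟨hya, hyb, hyh⟩ := hy
    have hh : y.2.2 ≠ 0 := hyh
    -- range, source and height map `S` to a compact set, and determine points of non-zero height
    let f : Par d → M × M × ℝ := fun p =>
      ((chartAt (Euc d) x₀).symm p.1, expW D x₀ X (p.1, scale X p.2.2 p.2.1), p.2.2)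
    have hf : ContinuousOn f S := fun p hp => by
      have h1 := ContinuousAt.comp (f := fun q : Par d => q.1) (x := p)
          (contMDiffAt_chart_symm (hSD hp).1.1).continuousAt continuousAt_fst
      have h2 := ContinuousAt.comp (f := fun q : Par d => (q.1, scale X q.2.2 q.2.1)) (x := p)
        (contMDiffAt_expW (hSD hp)).continuousAt (contDiff_toW X).continuous.continuousAt
      exact (h1.prodMk (h2.prodMk (by fun_prop))).continuousWithinAt
    have hK := (hS.image_of_continuousOn hf).isClosed
    let g : Par d → M × M × ℝ := fun q =>
      ((chartAt (Euc d) x₁).symm q.1, (chartAt (Euc d) y₁).symm q.2.1, q.2.2)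
    have hg : ContinuousAt g y := by
      have h1 := ContinuousAt.comp (f := fun q : Par d => q.1) (x := y)
          (contMDiffAt_chart_symm hya).continuousAt continuousAt_fst
      have h2 : ContinuousAt (fun q : Par d => (chartAt (Euc d) y₁).symm q.2.1) y :=
        ContinuousAt.comp (f := fun q : Par d => q.2.1) (x := y)
          (contMDiffAt_chart_symm hyb).continuousAt (by fun_prop)
      exact h1.prodMk (h2.prodMk (by fun_prop))
    have hn : g y ∉ f '' S := by
      rintro ⟨⟨a, z, h⟩, hp, hpy⟩
      obtain ⟨e1, e2⟩ := Prod.ext_iff.1 hpy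
      obtain ⟨e2, e3⟩ := Prod.ext_iff.1 e2
      change h = y.2.2 at e3
      refine hyS ⟨(a, z, h), hSD hp, ?_⟩
      subst e3
      rw [expParam_ne_zero _ _ hh, map_pair (c := (x₁, y₁)) hh]
      exact (TGroupoid.pair.injEq ..).mpr ⟨e1, e2, rfl⟩
    have hne : ∀ᶠ q : Par d in 𝓝 y, q.2.2 ≠ 0 :=
      (continuous_snd.comp continuous_snd).continuousAt.eventually_ne hh
    filter_upwards [hg.preimage_mem_nhds (hK.isOpen_compl.mem_nhds hn), hne]
      with y' hy' hy'h ⟨⟨a, z, h⟩, hp, hpy⟩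
    refine hy' ⟨(a, z, h), hp, ?_⟩
    rw [map_pair (c := (x₁, y₁)) hy'h] at hpy
    have hr := congrArg (TGroupoid.r D) hpy
    have hs := congrArg (TGroupoid.s D) hpy
    rw [r_expParam] at hr
    rw [s_expParam (hSD hp)] at hs
    obtain ⟨e1, e2⟩ := Prod.ext_iff.1 hr
    obtain ⟨e3, -⟩ := Prod.ext_iff.1 hs
    exact Prod.ext e1 (Prod.ext e3 e2)

/-- Extensions by zero of functions with support in a fixed compact set are, in any
parametrization, locally pullbacks by a fixed smooth map. -/
theorem exists_local_pullback [T2Space M] {S : Set (Par d)} (hS : IsCompact S)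
    (hSD : S ⊆ domO D x₀ X) (i : (atlas D).ι) {y : Par d} (hy : y ∈ (atlas D).dom i) :
    ∃ ι : Par d → Par d, ContDiffAt ℝ ∞ ι y ∧ ∀ᶠ y' in 𝓝 y, ∀ φ : Par d → ℂ,
      (∀ p, p ∉ S → φ p = 0) → extFun D x₀ X φ ((atlas D).map i y') = φ (ι y') := by
  by_cases h : (atlas D).map i y ∈ expParam D x₀ X '' domO D x₀ X
  · obtain ⟨p, hp, hpy⟩ := h
    obtain ⟨ι, hι, hιy, hev⟩ := exists_lift i hy hp hpy.symm
    refine ⟨ι, hι, ?_⟩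
    filter_upwards [hev, hι.continuousAt.preimage_mem_nhds
      (by rw [hιy]; exact isOpen_domO.mem_nhds hp)] with y' h1 h2 φ _
    rw [h1, extFun_expParam h2]
  · obtain ⟨p, hp⟩ : ∃ p, p ∉ S := by
      by_contra hcon
      push Not at hcon
      exact hS.ne_univ (eq_univ_of_forall hcon)
    refine ⟨fun _ => p, contDiffAt_const, ?_⟩
    filter_upwards [eventually_notMem_image hS hSD i hy h] with y' h1 φ hφ
    rw [extFun_eq_zero hφ h1, hφ p hp]

/-- The extension by zero of a smooth function with compact support in exponential coordinates. -/
def ext [T2Space M] (φ : Par d → ℂ) (hφ : ContDiff ℝ ∞ φ) (hc : HasCompactSupport φ)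
    (hs : tsupport φ ⊆ domO D x₀ X) : (atlas D).Smooth :=
  ⟨extFun D x₀ X φ, fun i y hy => by
    obtain ⟨ι, hι, hev⟩ := exists_local_pullback (D := D) hc.isCompact hs i hy
    refine ((hφ.contDiffAt.comp y hι).congr_of_eventuallyEq ?_).contDiffWithinAt
    filter_upwards [hev] with y' h
    exact h φ fun p hp => image_eq_zero_of_notMem_tsupport hp⟩

theorem seminorm_le {F : Type} [NormedAddCommGroup F] [NormedSpace ℝ F] {Y : Type u}
    (A : ParamAtlas F Y) (j : A.SeminormIndex) (f : A.Smooth) {C : ℝ} (hC : 0 ≤ C)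
    (h : ∀ y ∈ j.2.2.1, ‖iteratedFDeriv ℝ j.2.1 (fun z => f (A.map j.1 z)) y‖ ≤ C) :
    A.seminorm j f ≤ C := Real.iSup_le (fun y => h y.1 y.2) hC

theorem le_seminorm {F : Type} [NormedAddCommGroup F] [NormedSpace ℝ F] {Y : Type u}
    (A : ParamAtlas F Y) (j : A.SeminormIndex) (f : A.Smooth) {y : F} (hy : y ∈ j.2.2.1) :
    ‖iteratedFDeriv ℝ j.2.1 (fun z => f (A.map j.1 z)) y‖ ≤ A.seminorm j f :=
  le_ciSup (ParamAtlas.bddAbove_iteratedFDeriv j f) ⟨y, hy⟩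

/-- The seminorms of the extension by zero are bounded by the derivatives of the function, with a
constant that depends on the support only. -/
theorem exists_seminorm_ext_le [T2Space M] {S : Set (Par d)} (hS : IsCompact S)
    (hSD : S ⊆ domO D x₀ X) (j : (atlas D).SeminormIndex) :
    ∃ C : ℝ, 0 ≤ C ∧ ∀ (φ : Par d → ℂ) (hφ : ContDiff ℝ ∞ φ) (hc : HasCompactSupport φ)
      (hs : tsupport φ ⊆ domO D x₀ X), tsupport φ ⊆ S → ∀ B : ℝ,
      (∀ n ≤ j.2.1, ∀ p, ‖iteratedFDeriv ℝ n φ p‖ ≤ B) →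
        (atlas D).seminorm j (ext φ hφ hc hs) ≤ C * B := by
  obtain ⟨i, n, K, hK, hKi⟩ := j
  -- locally, the function is the composition of `φ` with a fixed smooth map
  have hloc : ∀ y ∈ K, ∃ U ∈ 𝓝 y, ∃ C : ℝ, 0 ≤ C ∧ ∀ (φ : Par d → ℂ), ContDiff ℝ ∞ φ →
      tsupport φ ⊆ S → ∀ B : ℝ, (∀ k ≤ n, ∀ p, ‖iteratedFDeriv ℝ k φ p‖ ≤ B) →
        ∀ y' ∈ U, ‖iteratedFDeriv ℝ n
          (fun z => extFun D x₀ X φ ((atlas D).map i z)) y'‖ ≤ C * B := by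
    intro y hy
    obtain ⟨ι, hι, hev⟩ := exists_local_pullback (D := D) hS hSD i (hKi hy)
    obtain ⟨u, hu, hιu⟩ := hι.contDiffOn (m := n) (by exact_mod_cast le_top) (by simp)
    have hb : ∀ᶠ y' in 𝓝 y, ∀ k ∈ Finset.range (n + 1),
        ‖iteratedFDeriv ℝ k ι y'‖ < ‖iteratedFDeriv ℝ k ι y‖ + 1 := by
      rw [eventually_all_finset]
      intro k hk
      have : ContinuousAt (iteratedFDeriv ℝ k ι) y :=
        hι.continuousAt_iteratedFDeriv (by exact_mod_cast le_top)
      exact this.norm.eventually_lt continuousAt_const (lt_add_one _)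
    set E : ℝ := 1 + ∑ k ∈ Finset.range (n + 1), (‖iteratedFDeriv ℝ k ι y‖ + 1) with hE
    have hE1 : 1 ≤ E := le_add_of_nonneg_right (Finset.sum_nonneg fun _ _ => by positivity)
    obtain ⟨V, hVsub, hVo, hyV⟩ := mem_nhds_iff.1 (inter_mem hu (inter_mem hev hb))
    refine ⟨V, hVo.mem_nhds hyV, n.factorial * E ^ n, by positivity, fun φ hφ hφS B hB y' hy' => ?_⟩
    have h1 : (fun z => extFun D x₀ X φ ((atlas D).map i z)) =ᶠ[𝓝 y'] φ ∘ ι := by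
      filter_upwards [hVo.mem_nhds hy'] with z hz
      exact (hVsub hz).2.1 φ fun p hp => image_eq_zero_of_notMem_tsupport fun h => hp (hφS h)
    rw [(h1.iteratedFDeriv ℝ n).eq_of_nhds]
    have h2 := norm_iteratedFDerivWithin_comp_le (𝕜 := ℝ) (g := φ) (f := ι) (n := n)
      (N := n) (t := univ) (s := V) (x := y') (hφ.of_le (by exact_mod_cast le_top)).contDiffOn
      (hιu.mono fun z hz => (hVsub hz).1) le_rfl uniqueDiffOn_univ hVo.uniqueDiffOn
      (mapsTo_univ _ _) hy' (C := B) (D := E) (fun k hk => by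
        rw [iteratedFDerivWithin_univ]; exact hB k hk _) (fun k hk1 hk => by
        rw [iteratedFDerivWithin_of_isOpen k hVo hy']
        have h3 := (hVsub hy').2.2 k (Finset.mem_range.2 (by omega))
        have h4 : ‖iteratedFDeriv ℝ k ι y‖ + 1 ≤
            ∑ k ∈ Finset.range (n + 1), (‖iteratedFDeriv ℝ k ι y‖ + 1) :=
          Finset.single_le_sum (f := fun k => ‖iteratedFDeriv ℝ k ι y‖ + 1)
            (fun _ _ => by positivity) (Finset.mem_range.2 (by omega))
        calc ‖iteratedFDeriv ℝ k ι y'‖ ≤ E := by rw [hE]; linarith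
          _ ≤ E ^ k := le_self_pow₀ hE1 (by omega))
    rw [iteratedFDerivWithin_of_isOpen n hVo hy'] at h2
    linarith
  choose! U hU C hC0 hC using hloc
  obtain ⟨t, htK, hKt⟩ := hK.elim_nhds_subcover U hU
  refine ⟨∑ y ∈ t, C y, Finset.sum_nonneg fun y hy => hC0 y (htK y hy),
    fun φ hφ hc hs hφS B hB => ?_⟩
  have hB0 : 0 ≤ B := (norm_nonneg _).trans (hB 0 (Nat.zero_le _) 0)
  refine seminorm_le _ _ _ (mul_nonneg (Finset.sum_nonneg fun y hy => hC0 y (htK y hy)) hB0)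
    fun y hy => ?_
  obtain ⟨y₁, hy₁, hyU⟩ := mem_iUnion₂.1 (hKt hy)
  refine (hC y₁ (htK y₁ hy₁) φ hφ hφS B hB y hyU).trans ?_
  exact mul_le_mul_of_nonneg_right
    (Finset.single_le_sum (f := C) (fun y hy => hC0 y (htK y hy)) hy₁) hB0

/-! ### Functions pulled back along the range and source maps -/

variable (D) in
/-- The product of a function pulled back from `M × ℝ` along `r` and a function on `𝕋_H M`. -/
def rMul (g : (cylinderAtlas d M).Smooth) (u : (atlas D).Smooth) : (atlas D).Smooth :=
  ⟨fun q => g (TGroupoid.r D q) * u q, fun i => by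
    have hu := (atlas D).contDiffOn u i
    suffices h : ContDiffOn ℝ ∞ (fun y => g (TGroupoid.r D ((atlas D).map i y)))
        ((atlas D).dom i) from h.mul hu
    cases i with
    | pair x₁ y₁ =>
      have h1 := (cylinderAtlas d M).contDiffOn g x₁
      have h2 : ContDiffOn ℝ ∞ (fun y : Par d => g ((chartAt (Euc d) x₁).symm y.1, y.2.2))
          ((atlas D).dom (.pair x₁ y₁)) :=
        h1.comp (f := fun y : Par d => (y.1, y.2.2)) (by fun_prop) fun y hy => ⟨hy.1, trivial⟩
      refine h2.congr fun y hy => ?_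
      rw [map_pair (c := (x₁, y₁)) hy.2.2]
      rfl
    | exp x₁ X₁ O hO hsub =>
      have h1 := (cylinderAtlas d M).contDiffOn g x₁
      have h2 : ContDiffOn ℝ ∞ (fun y : Par d => g ((chartAt (Euc d) x₁).symm y.1, y.2.2)) O :=
        h1.comp (f := fun y : Par d => (y.1, y.2.2)) (by fun_prop)
          fun y hy => ⟨(hsub y hy).1, trivial⟩
      refine h2.congr fun y hy => ?_
      change g (TGroupoid.r D (expParam D x₁ X₁ y)) = _
      rw [r_expParam]⟩

theorem contDiffAt_cylinder (w : (cylinderAtlas d M).Smooth) {f : Par d → M} {h : Par d → ℝ}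
    {y : Par d} (hf : ContMDiffAt 𝓘(ℝ, Par d) (𝓡 d) ∞ f y) (hh : ContDiffAt ℝ ∞ h y) :
    ContDiffAt ℝ ∞ (fun y => w (f y, h y)) y := by
  have h1 : ContDiffAt ℝ ∞ (fun z => chartAt (Euc d) (f y) (f z)) y := by
    rw [← contMDiffAt_iff_contDiffAt]
    exact ContMDiffAt.comp (x := y) (contMDiffAt_chart (mem_chart_source _ _)) hf
  have h2 := ((cylinderAtlas d M).contDiffOn w (f y)).contDiffAt (x := (chartAt (Euc d) (f y) (f y), h y))
    (((cylinderAtlas d M).isOpen_dom (f y)).mem_nhds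
      ⟨(chartAt (Euc d) (f y)).map_source (mem_chart_source _ _), trivial⟩)
  have h3 := ContDiffAt.comp y h2 (h1.prodMk hh)
  refine h3.congr_of_eventuallyEq ?_
  filter_upwards [hf.continuousAt.preimage_mem_nhds
    ((chartAt (Euc d) (f y)).open_source.mem_nhds (mem_chart_source _ _))] with z hz
  change _ = w ((chartAt (Euc d) (f y)).symm (chartAt (Euc d) (f y) (f z)), h z)
  rw [(chartAt (Euc d) (f y)).left_inv hz]

variable (D) in
/-- A function pulled back from `M × ℝ` along `s`. -/
def sPull (w : (cylinderAtlas d M).Smooth) : (atlas D).Smooth :=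
  ⟨fun q => w (TGroupoid.s D q), fun i y hy => by
    refine ContDiffAt.contDiffWithinAt ?_
    cases i with
    | pair x₁ y₁ =>
      have h1 : ContDiffAt ℝ ∞ (fun y : Par d => w ((chartAt (Euc d) y₁).symm y.2.1, y.2.2)) y :=
        contDiffAt_cylinder w
          (ContMDiffAt.comp (x := y) (g := (chartAt (Euc d) y₁).symm) (f := fun y : Par d => y.2.1)
            (contMDiffAt_chart_symm hy.2.1)
            (by rw [contMDiffAt_iff_contDiffAt]; fun_prop)) (by fun_prop)
      refine h1.congr_of_eventuallyEq ?_
      filter_upwards [((atlas D).isOpen_dom (.pair x₁ y₁)).mem_nhds hy] with z hz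
      rw [map_pair (c := (x₁, y₁)) hz.2.2]
      rfl
    | exp x₁ X₁ O hO hsub =>
      have hyD : y ∈ domO D x₁ X₁ := subset_domO hsub hy
      have h1 : ContDiffAt ℝ ∞ (fun y : Par d =>
          w (expW D x₁ X₁ (y.1, scale X₁ y.2.2 y.2.1), y.2.2)) y :=
        contDiffAt_cylinder w
          (ContMDiffAt.comp (x := y) (g := expW D x₁ X₁) (contMDiffAt_expW hyD)
            (contDiff_toW X₁).contDiffAt.contMDiffAt) (by fun_prop)
      refine h1.congr_of_eventuallyEq ?_
      filter_upwards [isOpen_domO.mem_nhds hyD] with z hz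
      change w (TGroupoid.s D (expParam D x₁ X₁ z)) = _
      rw [s_expParam hz]⟩

/-- A function on the part `h ≠ 0` of the groupoid that vanishes near `h = 0`. -/
def ofPair (u : M → M → ℝ → ℂ) {δ : ℝ} (hδ : 0 < δ) (hu0 : ∀ x y h, |h| < δ → u x y h = 0)
    (hu : ∀ x₁ y₁ : M, ContDiffOn ℝ ∞ (fun p : Par d => u ((chartAt (Euc d) x₁).symm p.1)
      ((chartAt (Euc d) y₁).symm p.2.1) p.2.2) ((atlas D).dom (.pair x₁ y₁))) : (atlas D).Smooth :=
  ⟨fun q => match q with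
    | .osc _ _ => 0
    | .pair x y h _ => u x y h, fun i => by
    cases i with
    | pair x₁ y₁ =>
      refine (hu x₁ y₁).congr fun y hy => ?_
      rw [map_pair (c := (x₁, y₁)) hy.2.2]
    | exp x₁ X₁ O hO hsub =>
      intro y hy
      refine ContDiffAt.contDiffWithinAt ?_
      have hyD : y ∈ domO D x₁ X₁ := subset_domO hsub hy
      have hcont : Continuous fun z : Par d => |z.2.2| := by fun_prop
      by_cases hyδ : |y.2.2| < δ
      · refine contDiffAt_const (c := (0 : ℂ)).congr_of_eventuallyEq ?_
        filter_upwards [hcont.continuousAt.eventually_lt continuousAt_const hyδ] with z hz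
        change (match expParam D x₁ X₁ z with
          | .osc _ _ => (0 : ℂ)
          | .pair x y h _ => u x y h) = 0
        obtain ⟨a, b, h⟩ := z
        by_cases hh : h = 0
        · subst hh; rw [expParam_zero]
        · rw [expParam_ne_zero _ _ hh]; exact hu0 _ _ _ hz
      · have hne : y.2.2 ≠ 0 := fun h => hyδ (by rw [h, abs_zero]; exact hδ)
        set y₁ := expW D x₁ X₁ (y.1, scale X₁ y.2.2 y.2.1) with hy₁
        have hyC : (y.1, scale X₁ y.2.2 y.2.1) ∈ chartW D x₁ X₁ y₁ :=
          ⟨hyD, mem_chart_source _ _⟩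
        let κ : Par d → Par d := fun z =>
          (z.1, coordW D x₁ X₁ y₁ (z.1, scale X₁ z.2.2 z.2.1), z.2.2)
        have hκ : ContDiffAt ℝ ∞ κ y :=
          contDiffAt_fst.prodMk ((ContDiffAt.comp y (contDiffAt_coordW hyC)
            (contDiff_toW X₁).contDiffAt).prodMk (by fun_prop))
        have hκy : κ y ∈ (atlas D).dom (.pair x₁ y₁) :=
          ⟨hyD.1.1, (chartAt (Euc d) y₁).map_source (mem_chart_source _ _), hne⟩
        have h1 := ContDiffAt.comp y ((hu x₁ y₁).contDiffAt
          (((atlas D).isOpen_dom (.pair x₁ y₁)).mem_nhds hκy)) hκ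
        refine h1.congr_of_eventuallyEq ?_
        have hne' : ∀ᶠ q : Par d in 𝓝 y, q.2.2 ≠ 0 :=
          (continuous_snd.comp continuous_snd).continuousAt.eventually_ne hne
        filter_upwards [hne', (contDiff_toW X₁).continuous.continuousAt.preimage_mem_nhds
          (isOpen_chartW.mem_nhds hyC)] with z hz hzC
        change (match expParam D x₁ X₁ z with
          | .osc _ _ => (0 : ℂ)
          | .pair x y h _ => u x y h) = u _ ((chartAt (Euc d) y₁).symm
            (chartAt (Euc d) y₁ (expW D x₁ X₁ (z.1, scale X₁ z.2.2 z.2.1)))) z.2.2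
        rw [(chartAt (Euc d) y₁).left_inv hzC.2]
        obtain ⟨a, b, h⟩ := z
        rw [expParam_ne_zero _ _ hz]⟩

end Functions
end HCalc

namespace HCalc

/-! ### Graded frames and the homogeneous dimension -/

section Frames

variable {d N : ℕ} {M : Type u} [TopologicalSpace M] [ChartedSpace (Euc d) M]
  [IsManifold (𝓡 d) ∞ M] {H : LieFiltration d N M}

/-- The images under the splitting of the classes of an adapted frame of the filtration form a graded
frame. -/
theorem exists_gradedFrame (ψ : H.Splitting) (x : M) : ∃ X : ψ.GradedFrame, x ∈ X.carrier := by
  classical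
  obtain ⟨V, hV, hxV, w, X, hX, hsp⟩ := H.exists_frame x
  have hmem : ∀ i, ∀ y ∈ V, X i y ∈ H.H (w i + 1) y := fun i y hy => by
    rw [(hsp y hy).2]
    exact Submodule.subset_span ⟨i, Nat.lt_succ_self _, rfl⟩
  let Y : ∀ i, ∀ y, H.H (w i + 1) y := fun i y =>
    if hy : y ∈ V then ⟨X i y, hmem i y hy⟩ else 0
  have hY : ∀ i, ∀ y ∈ V, (Y i y : TangentSpace (𝓡 d) y) = X i y := fun i y hy => by
    simp only [Y, dif_pos hy]
  have hYs : ∀ i, SmoothField (fun y => (Y i y : TangentSpace (𝓡 d) y)) V := fun i =>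
    ContMDiffOn.congr (hX i) fun y hy => by dsimp only; rw [hY i y hy]
  refine ⟨⟨V, hV, w, fun i y => ψ.iso y (Pi.single (w i) (Submodule.Quotient.mk (Y i y))),
    fun i => ψ.smooth (w i) (Y i) V hV (hYs i), fun y hy => ?_, fun i y _ => ⟨_, rfl⟩⟩, hxV⟩
  obtain ⟨hli, hspan⟩ := hsp y hy
  rw [Fintype.linearIndependent_iff]
  intro c hc i
  have h1 : ∑ i, c i • (Pi.single (w i) (Submodule.Quotient.mk (Y i y)) : H.Osc y) = 0 := by
    apply (ψ.iso y).injective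
    rw [map_sum, map_zero, ← hc]
    simp only [map_smul]
  -- the component of weight `k` of the relation
  obtain ⟨k, hk⟩ : ∃ k, k = w i := ⟨_, rfl⟩
  let Z : H.H (k + 1) y := ∑ j ∈ Finset.univ.filter (fun j => w j = k), c j •
    (if h : w j = k then ⟨X j y, h ▸ hmem j y hy⟩ else 0)
  have hZc : (Z : TangentSpace (𝓡 d) y) = ∑ j ∈ Finset.univ.filter (fun j => w j = k), c j • X j y := by
    simp only [Z, AddSubmonoidClass.coe_finsetSum, Submodule.coe_smul]
    refine Finset.sum_congr rfl fun j hj => ?_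
    rw [dif_pos (Finset.mem_filter.1 hj).2]
  have hZ : (Submodule.Quotient.mk Z : H.Piece k y) = 0 := by
    have h2 := congrFun h1 k
    rw [Finset.sum_apply] at h2
    refine Eq.trans ?_ h2
    simp only [Z]
    rw [← Submodule.mkQ_apply, map_sum, Finset.sum_filter]
    refine Finset.sum_congr rfl fun j _ => ?_
    rw [Pi.smul_apply]
    split_ifs with h
    · rw [map_smul]
      congr 1
      obtain rfl : k = w j := h.symm
      rw [Pi.single_eq_same]
      simp only [Y, dif_pos hy]
      rfl
    · rw [Pi.single_eq_of_ne (fun h' => h h'.symm), smul_zero]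
  rw [Submodule.Quotient.mk_eq_zero] at hZ
  have hZk : (Z : TangentSpace (𝓡 d) y) ∈ H.H k y := hZ
  rw [hspan, hZc] at hZk
  have hZk' : ∑ j ∈ Finset.univ.filter (fun j => w j = k), c j • X j y ∈
      Submodule.span ℝ ((fun i => X i y) '' {i | w i = k}) :=
    Submodule.sum_mem _ fun j hj => Submodule.smul_mem _ _
      (Submodule.subset_span ⟨j, (Finset.mem_filter.1 hj).2, rfl⟩)
  have hdis : Disjoint {i | (w i : ℕ) < k} {i | w i = k} := by
    rw [Set.disjoint_left]
    intro j hj hj'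
    have h1 : (w j : ℕ) < k := hj
    have h2 : w j = k := hj'
    rw [h2] at h1
    exact lt_irrefl _ h1
  have hzero := Submodule.disjoint_def.1 (hli.disjoint_span_image hdis) _ hZk hZk'
  rw [Finset.sum_filter] at hzero
  have h3 := Fintype.linearIndependent_iff.1 hli (fun j => if w j = k then c j else 0) (by
    rw [← hzero]
    refine Finset.sum_congr rfl fun j _ => ?_
    split_ifs <;> simp) i
  simpa [hk] using h3

variable {ψ : H.Splitting}

open LieFiltration.Splitting

theorem finrank_piece (x : M) (k : Fin N) : Module.finrank ℝ (H.Piece k x) = H.rank k := by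
  have : FiniteDimensional ℝ (TangentSpace (𝓡 d) x) := inferInstanceAs (FiniteDimensional ℝ (Euc d))
  have h1 := Submodule.finrank_quotient_add_finrank ((H.H k x).submoduleOf (H.H (k + 1) x))
  have h2 := (Submodule.submoduleOfEquivOfLe (H.mono x (Nat.le_succ k))).finrank_eq
  have h3 := H.finrank_eq x k
  have h4 : Module.finrank ℝ (H.Piece k x) +
    Module.finrank ℝ ((H.H k x).submoduleOf (H.H (k + 1) x)) = Module.finrank ℝ (H.H (k + 1) x) := h1
  have h5 : Module.finrank ℝ ((H.H k x).submoduleOf (H.H (k + 1) x)) = Module.finrank ℝ (H.H k x) := h2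
  omega

theorem sum_rank (H : LieFiltration d N M) (x : M) : ∑ k : Fin N, H.rank k = d := by
  have h : ∀ j (hj : j ≤ N), Module.finrank ℝ (H.H j x) = ∑ k : Fin j, H.rank (Fin.castLE hj k) := by
    intro j
    induction j with
    | zero => intro _; rw [H.zero]; simp
    | succ j ih =>
      intro hj
      have h1 := H.finrank_eq x ⟨j, hj⟩
      rw [Fin.sum_univ_castSucc]
      rw [ih (by omega)] at h1
      exact h1
  have h1 := h N le_rfl
  rw [H.top x N le_rfl, finrank_top] at h1
  have h2 : Module.finrank ℝ (TangentSpace (𝓡 d) x) = d := finrank_euclideanSpace_fin (𝕜 := ℝ)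
  exact (h1.symm.trans h2)

/-- The frame has `rank k` members of weight `k`: it has at most that many, by linear independence,
and the ranks add up to `d`. -/
theorem sum_weight (X : ψ.GradedFrame) {x : M} (hx : x ∈ X.carrier) :
    ∑ i, ((X.weight i : ℕ) + 1) = H.homDim := by
  classical
  have : FiniteDimensional ℝ (TangentSpace (𝓡 d) x) := inferInstanceAs (FiniteDimensional ℝ (Euc d))
  let cnt : Fin N → ℕ := fun k => (Finset.univ.filter fun i => X.weight i = k).card
  have hle : ∀ k, cnt k ≤ H.rank k := by
    intro k
    rw [← finrank_piece x k]
    choose q hq using fun i => X.graded i x hx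
    let q' : {i // X.weight i = k} → H.Piece k x := fun i => i.2 ▸ q i.1
    have hq' : ∀ i : {i // X.weight i = k}, X.vec i x = ψ.iso x (Pi.single k (q' i)) := by
      rintro ⟨i, rfl⟩
      exact hq i
    have hli : LinearIndependent ℝ q' := by
      have h1 : LinearIndependent ℝ (fun i : {i // X.weight i = k} => X.vec i x) :=
        (X.linearIndependent x hx).comp _ Subtype.val_injective
      have h2 : (fun i : {i // X.weight i = k} => X.vec i x) =
          ((ψ.iso x : H.Osc x →ₗ[ℝ] TangentSpace (𝓡 d) x) ∘ₗ
            LinearMap.single ℝ (fun k => H.Piece k x) k) ∘ q' := by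
        funext i
        exact hq' i
      rw [h2] at h1
      exact LinearIndependent.of_comp _ h1
    have h3 := hli.fintype_card_le_finrank
    rwa [Fintype.card_subtype] at h3
  have hsum : ∑ k, cnt k = ∑ k, H.rank k := by
    rw [sum_rank H x]
    have := Finset.card_eq_sum_card_fiberwise (s := (Finset.univ : Finset (Fin d)))
      (t := (Finset.univ : Finset (Fin N))) (f := X.weight) (fun _ _ => Finset.mem_univ _)
    rw [Finset.card_univ, Fintype.card_fin] at this
    exact this.symm
  have heq := (Finset.sum_eq_sum_iff_of_le (fun k _ => hle k)).1 hsum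
  unfold LieFiltration.homDim
  rw [← Finset.sum_fiberwise (s := Finset.univ) (g := X.weight)]
  refine Finset.sum_congr rfl fun k _ => ?_
  rw [← heq k (Finset.mem_univ k)]
  rw [Finset.sum_congr rfl (g := fun _ => (k : ℕ) + 1) fun i hi => by rw [(Finset.mem_filter.1 hi).2]]
  rw [Finset.sum_const, smul_eq_mul, mul_comm]

theorem prod_pow_weight (X : ψ.GradedFrame) {x : M} (hx : x ∈ X.carrier) (h : ℝ) :
    ∏ i, h ^ ((X.weight i : ℕ) + 1) = h ^ H.homDim := by
  rw [Finset.prod_pow_eq_pow_sum, sum_weight X hx]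

end Frames
end HCalc

namespace HCalc
open MeasureTheory

/-! ### Coefficients of fibred densities -/

section Coefficients

variable {d N : ℕ} {M : Type u} [TopologicalSpace M] [ChartedSpace (Euc d) M]
  [IsManifold (𝓡 d) ∞ M] {H : LieFiltration d N M} {ψ : H.Splitting}

open LieFiltration.Splitting TGroupoid

theorem det_eq_det_of (L : Euc d →L[ℝ] Euc d) :
    L.det = (Matrix.of fun i j => L (EuclideanSpace.single i (1 : ℝ)) j).det := by
  have h := LinearMap.det_toMatrix (EuclideanSpace.basisFun (Fin d) ℝ).toBasis (L : Euc d →ₗ[ℝ] Euc d)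
  rw [ContinuousLinearMap.det, ← h, ← Matrix.det_transpose]
  congr 1

variable {D : ψ.Exponential} {x₀ y₀ : M} {X : ψ.GradedFrame}

variable (D) in
/-- The Jacobian determinant of the exponential map in coordinates. -/
def jacW (x₀ : M) (X : ψ.GradedFrame) (y₀ : M) (p : Euc d × Euc d) : ℝ :=
  (Matrix.of fun i j =>
    fderiv ℝ (coordW D x₀ X y₀) p (0, EuclideanSpace.single i (1 : ℝ)) j).det

theorem jacW_eq_det (p : Euc d × Euc d) : jacW D x₀ X y₀ p =
    ((fderiv ℝ (coordW D x₀ X y₀) p).comp (ContinuousLinearMap.inr ℝ (Euc d) (Euc d))).det := by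
  rw [det_eq_det_of]; rfl

theorem jacW_ne_zero {p : Euc d × Euc d} (hp : p ∈ chartW D x₀ X y₀) : jacW D x₀ X y₀ p ≠ 0 := by
  rw [jacW_eq_det]
  intro h0
  have h1 := LinearMap.bot_lt_ker_of_det_eq_zero h0
  have h2 : LinearMap.ker ((fderiv ℝ (coordW D x₀ X y₀) p).comp
      (ContinuousLinearMap.inr ℝ (Euc d) (Euc d)) : Euc d →ₗ[ℝ] Euc d) = ⊥ :=
    LinearMap.ker_eq_bot.2 (injective_fderiv_coordW hp)
  exact absurd h2 h1.ne'

theorem continuousOn_jacW : ContinuousOn (jacW D x₀ X y₀) (chartW D x₀ X y₀) := by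
  have h1 : ContinuousOn (fderiv ℝ (coordW D x₀ X y₀)) (chartW D x₀ X y₀) := fun p hp =>
    (((contDiffAt_coordW hp).fderiv_right (m := ∞) (by simp)).continuousAt).continuousWithinAt
  have h2 : ContinuousOn (fun p => (fderiv ℝ (coordW D x₀ X y₀) p).comp
      (ContinuousLinearMap.inr ℝ (Euc d) (Euc d))) (chartW D x₀ X y₀) :=
    h1.clm_comp continuousOn_const
  refine (ContinuousLinearMap.continuous_det.comp_continuousOn h2).congr fun p _ => ?_
  rw [jacW_eq_det]; rfl

/-- The dilation contributes the factor `h ^ d_H` to the Jacobian determinant. -/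
theorem hasFDerivAt_coordW_scale {a z : Euc d} {h : ℝ}
    (hp : (a, scale X h z) ∈ chartW D x₀ X y₀) :
    ∃ L : Euc d →L[ℝ] Euc d, HasFDerivAt (fun z => coordW D x₀ X y₀ (a, scale X h z)) L z ∧
      (∀ i, L (EuclideanSpace.single i (1 : ℝ)) = h ^ ((X.weight i : ℕ) + 1) •
        fderiv ℝ (coordW D x₀ X y₀) (a, scale X h z) (0, EuclideanSpace.single i (1 : ℝ))) ∧
      L.det = h ^ H.homDim * jacW D x₀ X y₀ (a, scale X h z) := by
  let S : Euc d →L[ℝ] Euc d := LinearMap.toContinuousLinearMap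
    { toFun := scale X h
      map_add' := fun z z' => by ext i; simp [scale_apply, mul_add]
      map_smul' := fun c z => by ext i; simp [scale_apply, mul_left_comm] }
  have hS : ∀ z, S z = scale X h z := fun z => rfl
  set f' := fderiv ℝ (coordW D x₀ X y₀) (a, scale X h z) with hf'
  have h1 : HasFDerivAt (fun z => coordW D x₀ X y₀ (a, scale X h z))
      ((f'.comp (ContinuousLinearMap.inr ℝ (Euc d) (Euc d))).comp S) z := by
    have h2 : HasFDerivAt (coordW D x₀ X y₀) f' (a, scale X h z) :=
      ((contDiffAt_coordW hp).differentiableAt (by simp)).hasFDerivAt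
    have h3 := h2.comp (S z) (hasFDerivAt_prodMk_right a (S z))
    exact h3.comp z S.hasFDerivAt
  have h4 : ∀ i, ((f'.comp (ContinuousLinearMap.inr ℝ (Euc d) (Euc d))).comp S)
      (EuclideanSpace.single i (1 : ℝ)) = h ^ ((X.weight i : ℕ) + 1) •
        f' (0, EuclideanSpace.single i (1 : ℝ)) := fun i => by
    have h5 : S (EuclideanSpace.single i (1 : ℝ)) =
        h ^ ((X.weight i : ℕ) + 1) • EuclideanSpace.single i (1 : ℝ) := by
      ext j
      rw [hS, scale_apply]
      by_cases hj : j = i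
      · subst hj; simp
      · simp [hj]
    rw [ContinuousLinearMap.comp_apply, h5, map_smul]
    rfl
  refine ⟨_, h1, h4, ?_⟩
  rw [det_eq_det_of, jacW, ← prod_pow_weight X hp.1.1.2, ← Matrix.det_mul_column]
  congr 1
  ext i j
  rw [Matrix.of_apply, Matrix.of_apply, h4]
  rfl

namespace FibredDensity

theorem coeff_maxIndex_zero (f : FibredDensity D) (a z : Euc d) :
    f.coeff (maxIndex D x₀ X) (a, z, 0) =
      (f.osc ((chartAt (Euc d) x₀).symm a) ((ψ.iso _).symm (frameVec X _ z))).1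
        (fun i => (ψ.iso _).symm (X.vec i _)) := if_pos rfl

/-- The coefficient of a fibred density in exponential coordinates, in terms of the coefficient in
a chart of `M`. -/
theorem coeff_maxIndex_ne_zero (f : FibredDensity D) {a z : Euc d} {h : ℝ} (hh : h ≠ 0)
    (hp : (a, scale X h z) ∈ chartW D x₀ X y₀) :
    f.coeff (maxIndex D x₀ X) (a, z, h) =
      ((|h ^ H.homDim * jacW D x₀ X y₀ (a, scale X h z)| : ℝ) : ℂ) *
        (f.pair ((chartAt (Euc d) x₀).symm a) (expW D x₀ X (a, scale X h z)) h).1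
          (chartFrame y₀ _) := by
  obtain ⟨L, hL, hLe, hLd⟩ := hasFDerivAt_coordW_scale hp
  have h1 : f.coeff (maxIndex D x₀ X) (a, z, h) =
      (f.pair ((chartAt (Euc d) x₀).symm a) (expW D x₀ X (a, scale X h z)) h).1
        (fun i => mfderiv (𝓡 d) (𝓡 d) (fun z : Euc d => expW D x₀ X (a, scale X h z)) z
          (EuclideanSpace.single i (1 : ℝ))) := if_neg hh
  rw [h1, dens_eq_det hp.2, ← hLd, det_eq_det_of]
  congr 4
  funext i j
  -- the derivative of the composition with the chart
  have h2 : ContMDiffAt 𝓘(ℝ, Euc d) (𝓡 d) ∞ (fun z => expW D x₀ X (a, scale X h z)) z :=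
    ContMDiffAt.comp (x := z) (g := expW D x₀ X) (f := fun z => (a, scale X h z))
      (contMDiffAt_expW hp.1) (ContDiffAt.contMDiffAt (contDiffAt_const.prodMk
        ((contDiff_scale X).comp (contDiff_prodMk_left h)).contDiffAt))
  have h3 := HasMFDerivAt.comp z (mdifferentiableAt_chart hp.2).hasMFDerivAt
    (h2.mdifferentiableAt (by simp)).hasMFDerivAt
  let A : Euc d →L[ℝ] Euc d := (tcoord y₀ (expW D x₀ X (a, scale X h z)) : Euc d →L[ℝ] Euc d).comp
    (mfderiv (𝓡 d) (𝓡 d) (fun z : Euc d => expW D x₀ X (a, scale X h z)) z : Euc d →L[ℝ] Euc d)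
  have h5 : HasFDerivAt (fun z => coordW D x₀ X y₀ (a, scale X h z)) A z := h3.hasFDerivAt
  have h4 := h5.unique hL
  exact congrArg (fun A : Euc d →L[ℝ] Euc d => A (EuclideanSpace.single i (1 : ℝ)) j) h4

end FibredDensity

/-- The identity of the second clause of `FibredDensity.Represents`. -/
def RepresentsPair (f : FibredDensity D) (T : GroupoidDist D) : Prop :=
  ∀ (x : M) (h : ℝ) (hh : h ≠ 0) (y₀ : M) (u : (TGroupoid.atlas D).Smooth),
    HasCompactSupport (fun y => u (.pair x y h hh)) →
    tsupport (fun y => u (.pair x y h hh)) ⊆ (chartAt (Euc d) y₀).source →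
      T.1 u (x, h) = ∫ y in (chartAt (Euc d) y₀).target,
        u (.pair x ((chartAt (Euc d) y₀).symm y) h hh) *
          (f.pair x ((chartAt (Euc d) y₀).symm y) h).1 (chartFrame y₀ _)

/-- A fibred distribution that is represented by a density, in exponential coordinates. -/
theorem RepresentsPair.apply_ext [T2Space M] {f : FibredDensity D} {T : GroupoidDist D}
    (hT : RepresentsPair f T) {φ : Par d → ℂ} (hφ : ContDiff ℝ ∞ φ) (hc : HasCompactSupport φ)
    (hs : tsupport φ ⊆ domO D x₀ X) {a : Euc d} (ha : a ∈ baseW x₀ X) {h : ℝ} (hh : h ≠ 0)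
    (hsh : ∀ z, (a, z, h) ∈ tsupport φ → (a, z, h) ∈ chartO D x₀ X y₀) :
    T.1 (ext φ hφ hc hs) ((chartAt (Euc d) x₀).symm a, h) =
      ∫ z, φ (a, z, h) * f.coeff (maxIndex D x₀ X) (a, z, h) := by
  set x := (chartAt (Euc d) x₀).symm a with hx
  set u := ext φ hφ hc hs with hu
  -- the support in the fibre
  set Kz : Set (Euc d) := {z | (a, z, h) ∈ tsupport φ} with hKz
  have hKzc : IsCompact Kz := by
    have h1 : IsCompact (tsupport φ ∩ {p : Par d | p.1 = a ∧ p.2.2 = h}) :=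
      hc.isCompact.inter_right ((isClosed_eq (by fun_prop) (by fun_prop)).inter
        (isClosed_eq (by fun_prop) (by fun_prop)))
    convert h1.image (f := fun p : Par d => p.2.1) (by fun_prop) using 1
    ext z
    constructor
    · exact fun hz => ⟨(a, z, h), ⟨hz, rfl, rfl⟩, rfl⟩
    · rintro ⟨⟨a', z', h'⟩, ⟨hz, h2, h3⟩, h4⟩
      dsimp only at h2 h3 h4
      rwa [h2, h3, h4] at hz
  have hKy : IsCompact ((fun z => expW D x₀ X (a, scale X h z)) '' Kz) := by
    refine hKzc.image_of_continuousOn fun z hz => ?_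
    have h2 : (a, z, h) ∈ domO D x₀ X := hs hz
    exact (ContinuousAt.comp (g := expW D x₀ X) (f := fun z => (a, scale X h z)) (x := z)
      (contMDiffAt_expW h2).continuousAt (by
        have := ((contDiff_scale X).comp (contDiff_prodMk_left h)).continuous
        exact (continuous_const.prodMk this).continuousAt)).continuousWithinAt
  have hpair : ∀ z, (a, z, h) ∈ domO D x₀ X →
      u (.pair x (expW D x₀ X (a, scale X h z)) h hh) = φ (a, z, h) := fun z hz => by
    have := extFun_expParam (φ := φ) hz
    rwa [expParam_ne_zero _ _ hh] at this
  have hzero : ∀ y, y ∉ (fun z => expW D x₀ X (a, scale X h z)) '' Kz → u (.pair x y h hh) = 0 := by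
    intro y hy
    refine extFun_eq_zero (S := tsupport φ) (fun p hp => image_eq_zero_of_notMem_tsupport hp) ?_
    rintro ⟨⟨a', z, h'⟩, hp, hpy⟩
    have hr := congrArg (TGroupoid.r D) hpy
    rw [r_expParam] at hr
    obtain ⟨e1, e2⟩ := Prod.ext_iff.1 hr
    change h' = h at e2
    subst e2
    obtain rfl : a' = a := (chartAt (Euc d) x₀).symm.injOn (hs hp).1.1 ha.1 e1
    rw [expParam_ne_zero _ _ hh] at hpy
    exact hy ⟨z, hp, (TGroupoid.pair.inj hpy).2.1⟩
  have hsupp : tsupport (fun y => u (.pair x y h hh)) ⊆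
      (fun z => expW D x₀ X (a, scale X h z)) '' Kz := by
    refine closure_minimal (fun y hy => ?_) hKy.isClosed
    by_contra hcon
    exact hy (hzero y hcon)
  have hKsrc : (fun z => expW D x₀ X (a, scale X h z)) '' Kz ⊆ (chartAt (Euc d) y₀).source := by
    rintro _ ⟨z, hz, rfl⟩
    exact (hsh z hz).2
  rw [hT x h hh y₀ u (HasCompactSupport.of_support_subset_isCompact hKy
    (subset_closure.trans hsupp)) (hsupp.trans hKsrc)]
  -- change of variables
  set Z : Set (Euc d) := {z | (a, z, h) ∈ chartO D x₀ X y₀} with hZ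
  have hZo : IsOpen Z := isOpen_chartO.preimage (by fun_prop : Continuous fun z : Euc d => ((a, z, h) : Par d))
  set g : Euc d → Euc d := fun z => coordW D x₀ X y₀ (a, scale X h z) with hg
  have hder : ∀ z ∈ Z, ∃ L : Euc d →L[ℝ] Euc d, HasFDerivAt g L z ∧
      L.det = h ^ H.homDim * jacW D x₀ X y₀ (a, scale X h z) := fun z hz => by
    obtain ⟨L, h1, -, h2⟩ := hasFDerivAt_coordW_scale (D := D) hz
    exact ⟨L, h1, h2⟩
  choose! g' hg' hgd using hder
  have hginj : InjOn g Z := by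
    intro z hz z' hz' he
    have h1 := injOn_graphW (D := D) hz hz' (Prod.ext rfl he)
    have h2 := congrArg (fun p : Euc d × Euc d => scale X h⁻¹ p.2) h1
    simpa only [scale_inv_scale X hh] using h2
  have hgsymm : ∀ z ∈ Z, (chartAt (Euc d) y₀).symm (g z) = expW D x₀ X (a, scale X h z) :=
    fun z hz => (chartAt (Euc d) y₀).left_inv hz.2
  set F : Euc d → ℂ := fun y => u (.pair x ((chartAt (Euc d) y₀).symm y) h hh) *
          (f.pair x ((chartAt (Euc d) y₀).symm y) h).1 (chartFrame y₀ _) with hF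
  have hgZ : g '' Z ⊆ (chartAt (Euc d) y₀).target := by
    rintro _ ⟨z, hz, rfl⟩
    exact (chartAt (Euc d) y₀).map_source hz.2
  have h1 : ∫ y in (chartAt (Euc d) y₀).target, F y = ∫ y in g '' Z, F y := by
    refine setIntegral_eq_of_subset_of_forall_sdiff_eq_zero
      (chartAt (Euc d) y₀).open_target.measurableSet hgZ fun y hy => ?_
    have : u (.pair x ((chartAt (Euc d) y₀).symm y) h hh) = 0 := by
      refine hzero _ ?_
      rintro ⟨z, hz, hzy⟩
      refine hy.2 ⟨z, hsh z hz, ?_⟩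
      change chartAt (Euc d) y₀ (expW D x₀ X (a, scale X h z)) = y
      dsimp only at hzy
      rw [hzy, (chartAt (Euc d) y₀).right_inv hy.1]
    rw [hF]
    dsimp only
    rw [this, zero_mul]
  change ∫ y in (chartAt (Euc d) y₀).target, F y = _
  rw [h1, integral_image_eq_integral_abs_det_fderiv_smul volume hZo.measurableSet
    (fun z hz => (hg' z hz).hasFDerivWithinAt) hginj]
  have h2 : ∀ z ∈ Z, |(g' z).det| • F (g z) = φ (a, z, h) * f.coeff (maxIndex D x₀ X) (a, z, h) := by
    intro z hz
    have h3 : (a, z, h) ∈ domO D x₀ X := hz.1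
    rw [f.coeff_maxIndex_ne_zero hh hz, hgd z hz, ← hpair z h3]
    simp only [hF]
    rw [hgsymm z hz, Complex.real_smul]
    ring
  rw [setIntegral_congr_fun hZo.measurableSet h2]
  refine setIntegral_eq_integral_of_forall_compl_eq_zero fun z hz => ?_
  have : (a, z, h) ∉ tsupport φ := fun hcon => hz (hsh z hcon)
  rw [image_eq_zero_of_notMem_tsupport this, zero_mul]

end Coefficients
end HCalc

namespace HCalc
open MeasureTheory

/-! ### Passage to the fibre at height zero -/

section Fibre

variable {d N : ℕ} {M : Type u} [TopologicalSpace M] [ChartedSpace (Euc d) M]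

theorem norm_apply_le_seminorm {F : Type} [NormedAddCommGroup F] [NormedSpace ℝ F] {Y : Type u}
    (A : ParamAtlas F Y) (i : A.ι) {y : F} (hy : y ∈ A.dom i) (f : A.Smooth) :
    ‖f (A.map i y)‖ ≤ A.seminorm ⟨i, 0, {y}, isCompact_singleton, singleton_subset_iff.2 hy⟩ f := by
  have h := le_seminorm A ⟨i, 0, {y}, isCompact_singleton, singleton_subset_iff.2 hy⟩ f
    (y := y) rfl
  rwa [norm_iteratedFDeriv_zero] at h

theorem exists_cylinder_param (b : M × ℝ) :
    ∃ y ∈ (cylinderAtlas d M).dom b.1, (cylinderAtlas d M).map b.1 y = b :=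
  ⟨(chartAt (Euc d) b.1 b.1, b.2), ⟨mem_chart_target _ _, trivial⟩,
    Prod.ext ((chartAt (Euc d) b.1).left_inv (mem_chart_source _ _)) rfl⟩

theorem continuous_cylinder_eval (b : M × ℝ) :
    ∃ q : Seminorm ℂ (cylinderAtlas d M).Smooth, Continuous q ∧ ∀ g, ‖g b‖ ≤ q g := by
  obtain ⟨y, hy, hyb⟩ := exists_cylinder_param (d := d) b
  refine ⟨_, (cylinderAtlas d M).withSeminorms.continuous_seminorm
    ⟨b.1, 0, {y}, isCompact_singleton, singleton_subset_iff.2 hy⟩, fun g => ?_⟩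
  have := norm_apply_le_seminorm (cylinderAtlas d M) b.1 hy g
  rwa [hyb] at this

theorem continuous_cylinder_apply (g : (cylinderAtlas d M).Smooth) (x : M) :
    ContDiff ℝ ∞ fun h : ℝ => g (x, h) := by
  have h1 := (cylinderAtlas d M).contDiffOn g x
  have h2 : ContDiffOn ℝ ∞ (fun h : ℝ => g ((chartAt (Euc d) x).symm (chartAt (Euc d) x x), h)) univ :=
    h1.comp (f := fun h : ℝ => (chartAt (Euc d) x x, h)) (by fun_prop)
      fun h _ => ⟨mem_chart_target _ _, trivial⟩
  rw [contDiffOn_univ] at h2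
  rwa [(chartAt (Euc d) x).left_inv (mem_chart_source _ _)] at h2

variable [IsManifold (𝓡 d) ∞ M]

/-- A cut-off function on `M × ℝ`. -/
theorem exists_cylinder_bump [T2Space M] (x : M) (h₀ : ℝ) {U : Set M} (hU : U ∈ 𝓝 x) {δ : ℝ}
    (hδ : 0 < δ) : ∃ (g : (cylinderAtlas d M).Smooth) (Z : Set M), IsClosed Z ∧ Z ⊆ U ∧
      g (x, h₀) = 1 ∧ ∀ y h, (y ∉ Z ∨ δ ≤ |h - h₀|) → g (y, h) = 0 := by
  obtain ⟨f, -, hf⟩ := (SmoothBumpFunction.nhds_basis_tsupport (I := 𝓡 d) x).mem_iff.1 hU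
  let b : ContDiffBump h₀ := ⟨δ / 2, δ, by positivity, by linarith⟩
  refine ⟨⟨fun p => ((f p.1 * b p.2 : ℝ) : ℂ), fun (x₁ : M) => ?_⟩, tsupport f, isClosed_tsupport _, hf, ?_, ?_⟩
  · refine Complex.ofRealCLM.contDiff.comp_contDiffOn ?_
    intro y hy
    have h1 : ContMDiffAt 𝓘(ℝ, Euc d) 𝓘(ℝ, ℝ) ∞ (fun a => f ((chartAt (Euc d) x₁).symm a)) y.1 :=
      ContMDiffAt.comp (x := y.1) (f.contMDiff _) (contMDiffAt_chart_symm hy.1)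
    rw [contMDiffAt_iff_contDiffAt] at h1
    have h2 : ContDiffAt ℝ ∞ (fun p : Euc d × ℝ => b p.2) y := b.contDiff.contDiffAt.comp y contDiffAt_snd
    exact ((h1.comp y contDiffAt_fst).mul h2).contDiffWithinAt
  · change ((f x * b h₀ : ℝ) : ℂ) = 1
    rw [f.eq_one, b.one_of_mem_closedBall (Metric.mem_closedBall_self (by positivity))]
    simp
  · intro y h hyh
    change ((f y * b h : ℝ) : ℂ) = 0
    rcases hyh with hy | hh
    · rw [image_eq_zero_of_notMem_tsupport hy]; simp
    · rw [b.zero_of_le_dist (by rwa [Real.dist_eq])]; simp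

variable {H : LieFiltration d N M} {ψ : H.Splitting} {D : ψ.Exponential}

open LieFiltration.Splitting TGroupoid

theorem continuous_r : Continuous (TGroupoid.r D) := by
  rw [continuous_iSup_dom]
  intro i
  rw [continuous_coinduced_dom]
  have h : ContinuousOn (fun y => TGroupoid.r D ((atlas D).map i y)) ((atlas D).dom i) := by
    cases i with
    | pair x₁ y₁ =>
      have h2 : ContinuousOn (fun y : Par d => ((chartAt (Euc d) x₁).symm y.1, y.2.2))
          ((atlas D).dom (.pair x₁ y₁)) := fun y hy =>
        ((ContinuousAt.comp (f := fun y : Par d => y.1) (contMDiffAt_chart_symm hy.1).continuousAt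
          continuousAt_fst).prodMk (by fun_prop)).continuousWithinAt
      exact h2.congr fun y hy => by rw [map_pair (c := (x₁, y₁)) hy.2.2]; rfl
    | exp x₁ X₁ O hO hsub =>
      have h2 : ContinuousOn (fun y : Par d => ((chartAt (Euc d) x₁).symm y.1, y.2.2)) O :=
        fun y hy => ((ContinuousAt.comp (f := fun y : Par d => y.1)
          (contMDiffAt_chart_symm (hsub y hy).1).continuousAt
          continuousAt_fst).prodMk (by fun_prop)).continuousWithinAt
      exact h2.congr fun y _ => r_expParam y
  exact continuousOn_iff_continuous_domRestrict.1 h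

theorem exists_seminorm_bound (T : GroupoidDist D) (b : M × ℝ) :
    ∃ (s : Finset (atlas D).SeminormIndex) (C : ℝ), 0 ≤ C ∧
      ∀ u, ‖T.1 u b‖ ≤ C * s.sup (atlas D).seminorm u := by
  obtain ⟨q, hq, hqb⟩ := continuous_cylinder_eval (d := d) b
  obtain ⟨s, C, -, hC⟩ := Seminorm.bound_of_continuous (atlas D).withSeminorms
    (q.comp T.1.toLinearMap) (hq.comp T.1.continuous)
  exact ⟨s, C, C.2, fun u => (hqb _).trans (hC u)⟩

/-- The values of a fibred distribution at a point depend on the germ of the function along a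
compact set only. -/
theorem exists_compact_germ (T : GroupoidDist D) (b : M × ℝ) :
    ∃ s : Finset (atlas D).SeminormIndex, ∀ u : (atlas D).Smooth,
      (∀ j ∈ s, ∀ y ∈ j.2.2.1, ∀ᶠ y' in 𝓝 y, u ((atlas D).map j.1 y') = 0) → T.1 u b = 0 := by
  obtain ⟨s, C, hC, h⟩ := exists_seminorm_bound T b
  refine ⟨s, fun u hu => ?_⟩
  have h1 : s.sup (atlas D).seminorm u ≤ 0 := by
    refine Seminorm.finset_sup_apply_le le_rfl fun j hj => seminorm_le _ _ _ le_rfl fun y hy => ?_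
    have h2 : (fun z => u ((atlas D).map j.1 z)) =ᶠ[𝓝 y] fun _ => 0 := hu j hj y hy
    rw [(h2.iteratedFDeriv ℝ j.2.1).eq_of_nhds]
    simp
  have h2 := (h u).trans (mul_le_mul_of_nonneg_left h1 hC)
  rw [mul_zero] at h2
  exact norm_le_zero_iff.1 h2

/-- Near the fibre over `(x, 0)`, a compact subset of the groupoid is covered by a bounded set of
exponential coordinates. -/
theorem exists_bound_of_isCompact [T2Space M] {C : Set (TGroupoid D)} (hC : IsCompact C) {x x₀ : M}
    {X : ψ.GradedFrame} (hx : x ∈ (chartAt (Euc d) x₀).source) (hxc : x ∈ X.carrier) :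
    ∃ n : ℝ, ∃ δ > 0, ∃ W ∈ 𝓝 x, ∀ q ∈ C, (TGroupoid.r D q).1 ∈ W → |(TGroupoid.r D q).2| < δ →
      ∃ p ∈ domO D x₀ X, expParam D x₀ X p = q ∧ ‖p.2.1‖ < n := by
  refine hC.induction_on (p := fun C => ∃ n : ℝ, ∃ δ > 0, ∃ W ∈ 𝓝 x, ∀ q ∈ C,
    (TGroupoid.r D q).1 ∈ W → |(TGroupoid.r D q).2| < δ →
      ∃ p ∈ domO D x₀ X, expParam D x₀ X p = q ∧ ‖p.2.1‖ < n) ?_ ?_ ?_ ?_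
  · exact ⟨0, 1, one_pos, univ, univ_mem, fun q hq => hq.elim⟩
  · intro s t hst ht
    obtain ⟨n, δ, hδ, W, hW, h⟩ := ht
    exact ⟨n, δ, hδ, W, hW, fun q hq => h q (hst hq)⟩
  · intro s t hs ht
    obtain ⟨n, δ, hδ, W, hW, h⟩ := hs
    obtain ⟨n', δ', hδ', W', hW', h'⟩ := ht
    refine ⟨max n n', min δ δ', lt_min hδ hδ', W ∩ W', inter_mem hW hW', ?_⟩
    rintro q (hq | hq) hqW hqδ
    · obtain ⟨p, hp, hpq, hpn⟩ := h q hq hqW.1 (hqδ.trans_le (min_le_left _ _))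
      exact ⟨p, hp, hpq, hpn.trans_le (le_max_left _ _)⟩
    · obtain ⟨p, hp, hpq, hpn⟩ := h' q hq hqW.2 (hqδ.trans_le (min_le_right _ _))
      exact ⟨p, hp, hpq, hpn.trans_le (le_max_right _ _)⟩
  · intro q hq
    -- a point over `(x, 0)` has a bounded coordinate neighbourhood; points over other `(x', 0)`, and
    -- points of non-zero height, have neighbourhoods that do not meet the fibres near `(x, 0)`
    by_cases h0 : (TGroupoid.r D q).2 = 0
    · by_cases hqx : (TGroupoid.r D q).1 = x
      · have hq' : ∃ z : Euc d, expParam D x₀ X (chartAt (Euc d) x₀ x, z, 0) = q := by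
          cases q with
          | pair x' y' h hh => exact absurd h0 hh
          | osc x' ζ =>
            obtain rfl : x' = x := hqx
            refine ⟨frameCoord x₀ X x' (ψ.iso x' ζ), ?_⟩
            rw [expParam_zero, (chartAt (Euc d) x₀).left_inv hx, frameVec_frameCoord hx hxc,
              LinearEquiv.symm_apply_apply]
        obtain ⟨z, hz⟩ := hq'
        have hb : chartAt (Euc d) x₀ x ∈ baseW x₀ X :=
          ⟨(chartAt (Euc d) x₀).map_source hx, by rwa [(chartAt (Euc d) x₀).left_inv hx]⟩
        have hzO : (chartAt (Euc d) x₀ x, z, (0 : ℝ)) ∈ domO D x₀ X :=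
          chartO_subset (height_zero_mem_chartO hb z)
        have hop : IsOpen (expParam D x₀ X '' (domO D x₀ X ∩ {p | ‖p.2.1‖ < ‖z‖ + 1})) :=
          isOpen_expParam_image (isOpen_domO.inter (isOpen_lt (by fun_prop) (by fun_prop)))
            inter_subset_left
        refine ⟨_, mem_nhdsWithin_of_mem_nhds (hop.mem_nhds ⟨_, ⟨hzO, show ‖z‖ < ‖z‖ + 1 from lt_add_one _⟩, hz⟩),
          ‖z‖ + 1, 1, one_pos, univ, univ_mem, ?_⟩
        rintro _ ⟨p, ⟨hp, hpn⟩, rfl⟩ _ _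
        exact ⟨p, hp, rfl, hpn⟩
      · obtain ⟨V, W, hV, hW, hqV, hxW, hVW⟩ := t2_separation hqx
        refine ⟨_, mem_nhdsWithin_of_mem_nhds ((continuous_fst.comp
          continuous_r).continuousAt.preimage_mem_nhds (hV.mem_nhds hqV)), 0, 1, one_pos, W,
          hW.mem_nhds hxW, fun q' hq' hq'W => ?_⟩
        exact (hVW.le_bot ⟨hq', hq'W⟩).elim
    · refine ⟨{q' | |(TGroupoid.r D q).2| / 2 < |(TGroupoid.r D q').2|},
        mem_nhdsWithin_of_mem_nhds ?_, 0, |(TGroupoid.r D q).2| / 2, by positivity, univ, univ_mem,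
        fun q' hq' _ hlt => absurd hlt (not_lt.2 (le_of_lt hq'))⟩
      have hc : Continuous fun q' : TGroupoid D => |(TGroupoid.r D q').2| :=
        continuous_abs.comp (continuous_snd.comp continuous_r)
      exact hc.continuousAt.eventually (lt_mem_nhds (half_lt_self (abs_pos.2 h0)))

/-- A compact neighbourhood of a part of the fibre at height zero in exponential coordinates. -/
theorem exists_tube_of_isOpen {x x₀ : M} (hx : x ∈ (chartAt (Euc d) x₀).source)
    {O : Set (Par d)} (hO : IsOpen O) (hO0 : ∀ z, (chartAt (Euc d) x₀ x, z, (0 : ℝ)) ∈ O)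
    (n : ℝ) {W : Set M} (hW : W ∈ 𝓝 x) {δ : ℝ} (hδ : 0 < δ) :
    ∃ ρ > 0, ∃ δ' > 0, δ' < δ ∧ (chartAt (Euc d) x₀).symm ''
      Metric.closedBall (chartAt (Euc d) x₀ x) ρ ⊆ W ∧
      (Metric.closedBall (chartAt (Euc d) x₀ x) ρ) ×ˢ (Metric.closedBall (0 : Euc d) n ×ˢ
        Metric.closedBall (0 : ℝ) δ') ⊆ O := by
  set a₀ := chartAt (Euc d) x₀ x with ha₀
  have hb : a₀ ∈ (chartAt (Euc d) x₀).target := (chartAt (Euc d) x₀).map_source hx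
  obtain ⟨U, V, hU, hV, haU, hnV, hUV⟩ := generalized_tube_lemma (s := {a₀}) isCompact_singleton
    (t := Metric.closedBall (0 : Euc d) n ×ˢ ({0} : Set ℝ))
    ((isCompact_closedBall _ _).prod isCompact_singleton) hO (by
        rintro ⟨a, z, h⟩ ⟨ha, -, hh⟩
        obtain rfl : a = a₀ := ha
        obtain rfl : h = 0 := hh
        exact hO0 z)
  obtain ⟨V₁, V₂, hV₁, hV₂, hnV₁, h0V₂, hV₁₂⟩ := generalized_tube_lemma
    (isCompact_closedBall (0 : Euc d) n) (isCompact_singleton (x := (0 : ℝ))) hV hnV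
  have hc := ((chartAt (Euc d) x₀).continuousAt_symm hb)
  have hW' : (chartAt (Euc d) x₀).symm ⁻¹' W ∈ 𝓝 a₀ := hc.preimage_mem_nhds (by
    rwa [ha₀, (chartAt (Euc d) x₀).left_inv hx])
  obtain ⟨ρ, hρ, hρU⟩ := Metric.nhds_basis_closedBall.mem_iff.1
    (inter_mem hW' (hU.mem_nhds (haU rfl)))
  obtain ⟨ε, hε, hεV⟩ := Metric.nhds_basis_closedBall.mem_iff.1 (hV₂.mem_nhds (h0V₂ rfl))
  refine ⟨ρ, hρ, min ε (δ / 2), by positivity, (min_le_right _ _).trans_lt (by linarith), ?_, ?_⟩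
  · rintro _ ⟨a, ha, rfl⟩
    exact (hρU ha).1
  · rintro ⟨a, z, h⟩ ⟨ha, hz, hh⟩
    exact hUV ⟨(hρU ha).2, hV₁₂ ⟨hnV₁ hz, hεV (Metric.closedBall_subset_closedBall
      (min_le_left _ _) hh)⟩⟩

theorem exists_tube {x x₀ : M} {X : ψ.GradedFrame} (hx : x ∈ (chartAt (Euc d) x₀).source)
    (hxc : x ∈ X.carrier) (n : ℝ) {W : Set M} (hW : W ∈ 𝓝 x) {δ : ℝ} (hδ : 0 < δ) :
    ∃ ρ > 0, ∃ δ' > 0, δ' < δ ∧ (chartAt (Euc d) x₀).symm ''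
      Metric.closedBall (chartAt (Euc d) x₀ x) ρ ⊆ W ∧
      (Metric.closedBall (chartAt (Euc d) x₀ x) ρ) ×ˢ (Metric.closedBall (0 : Euc d) n ×ˢ
        Metric.closedBall (0 : ℝ) δ') ⊆ chartO D x₀ X x₀ :=
  exists_tube_of_isOpen hx isOpen_chartO (fun z => height_zero_mem_chartO
    ⟨(chartAt (Euc d) x₀).map_source hx, by rwa [(chartAt (Euc d) x₀).left_inv hx]⟩ z) n hW hδ

/-- At a point of height zero, any test function may be replaced by one that is supported in
exponential coordinates and agrees with it on a prescribed part of the fibre. -/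
theorem exists_ext_eq [T2Space M] (T : GroupoidDist D) {x x₀ : M} {X : ψ.GradedFrame}
    (hx : x ∈ (chartAt (Euc d) x₀).source) (hxc : x ∈ X.carrier) (u : (atlas D).Smooth) (n₀ : ℝ) :
    ∃ (φ : Par d → ℂ) (hφ : ContDiff ℝ ∞ φ) (hc : HasCompactSupport φ)
      (hs : tsupport φ ⊆ domO D x₀ X), tsupport φ ⊆ chartO D x₀ X x₀ ∧
      T.1 u (x, 0) = T.1 (ext φ hφ hc hs) (x, 0) ∧
      ∃ θ : Euc d → ℂ, (∀ z, ‖z‖ ≤ n₀ → θ z = 1) ∧ ∀ z, φ (chartAt (Euc d) x₀ x, z, 0) =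
        θ z * u (expParam D x₀ X (chartAt (Euc d) x₀ x, z, 0)) := by
  obtain ⟨s, hs⟩ := exists_compact_germ T (x, 0)
  have hC : IsCompact (⋃ j ∈ s, (atlas D).map j.1 '' j.2.2.1) :=
    s.isCompact_biUnion fun j _ => j.2.2.2.1.image_of_continuousOn
      ((continuous_map j.1).mono j.2.2.2.2)
  obtain ⟨n, δ, hδ, W, hW, hCn⟩ := exists_bound_of_isCompact hC hx hxc
  obtain ⟨ρ, hρ, δ', hδ', hδδ', hρW, htube⟩ := exists_tube (D := D) hx hxc (max n n₀) hW hδ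
  obtain ⟨χ, hχ, hχc, hχs, hχ1, -⟩ := exists_bump (((isCompact_closedBall (chartAt (Euc d) x₀ x)
    ρ).prod ((isCompact_closedBall (0 : Euc d) (max n n₀)).prod
      (isCompact_closedBall (0 : ℝ) δ')))) isOpen_chartO htube
  rw [eventually_nhdsSet_iff_forall] at hχ1
  let φ : Par d → ℂ := fun p => χ p * u (expParam D x₀ X p)
  have hφs : tsupport φ ⊆ tsupport χ := by
    refine closure_mono fun p hp hp0 => hp ?_
    simp only [φ, hp0, Complex.ofReal_zero, zero_mul]
  have hφc : HasCompactSupport φ := hχc.of_isClosed_subset (isClosed_tsupport _) hφs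
  have hφ : ContDiff ℝ ∞ φ := by
    rw [contDiff_iff_contDiffAt]
    intro p
    by_cases hp : p ∈ tsupport χ
    · have h1 : ContDiffAt ℝ ∞ (fun p => u (expParam D x₀ X p)) p :=
        ((atlas D).contDiffOn u (maxIndex D x₀ X)).contDiffAt
          (isOpen_domO.mem_nhds (chartO_subset (hχs hp)))
      exact (Complex.ofRealCLM.contDiff.contDiffAt.comp p hχ.contDiffAt).mul h1
    · refine contDiffAt_const (c := (0 : ℂ)).congr_of_eventuallyEq ?_
      filter_upwards [(isClosed_tsupport χ).isOpen_compl.mem_nhds hp] with p' hp'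
      simp only [φ, image_eq_zero_of_notMem_tsupport hp', Complex.ofReal_zero, zero_mul]
  have hφO : tsupport φ ⊆ domO D x₀ X := (hφs.trans hχs).trans chartO_subset
  have hxa : (chartAt (Euc d) x₀).symm (chartAt (Euc d) x₀ x) = x := (chartAt (Euc d) x₀).left_inv hx
  -- a cut-off function on the base, supported near `(x, 0)`
  have hUx : (chartAt (Euc d) x₀).source ∩ chartAt (Euc d) x₀ ⁻¹'
      Metric.ball (chartAt (Euc d) x₀ x) ρ ∈ 𝓝 x :=
    inter_mem ((chartAt (Euc d) x₀).open_source.mem_nhds hx)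
      (((chartAt (Euc d) x₀).continuousAt hx).preimage_mem_nhds (Metric.ball_mem_nhds _ hρ))
  obtain ⟨g, Z, hZ, hZU, hg1, hg0⟩ := exists_cylinder_bump (d := d) x 0 hUx hδ'
  refine ⟨φ, hφ, hφc, hφO, hφs.trans hχs, ?_, fun z => χ (chartAt (Euc d) x₀ x, z, 0), ?_,
    fun z => rfl⟩
  · have h1 := T.2 g (u - ext φ hφ hφc hφO) (rMul D g (u - ext φ hφ hφc hφO)) (fun _ => rfl) (x, 0)
    have h2 : T.1 (rMul D g (u - ext φ hφ hφc hφO)) (x, 0) = 0 := by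
      refine hs _ fun j hj y hy => ?_
      have hyd := j.2.2.2.2 hy
      have hrc : ContinuousAt (fun y' => TGroupoid.r D ((atlas D).map j.1 y')) y :=
        continuous_r.continuousAt.comp ((continuous_map j.1).continuousAt
          (((atlas D).isOpen_dom j.1).mem_nhds hyd))
      set q := (atlas D).map j.1 y with hq
      by_cases hqZ : (TGroupoid.r D q).1 ∈ Z ∧ |(TGroupoid.r D q).2| ≤ δ'
      · have hqU := hZU hqZ.1
        have hqW : (TGroupoid.r D q).1 ∈ W := hρW ⟨_, Metric.ball_subset_closedBall hqU.2,
          (chartAt (Euc d) x₀).left_inv hqU.1⟩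
        obtain ⟨p, hp, hpq, hpn⟩ := hCn q (mem_iUnion₂.2 ⟨j, hj, y, hy, rfl⟩) hqW
          (hqZ.2.trans_lt hδδ')
        have hpK : p ∈ (Metric.closedBall (chartAt (Euc d) x₀ x) ρ) ×ˢ
            (Metric.closedBall (0 : Euc d) (max n n₀) ×ˢ Metric.closedBall (0 : ℝ) δ') := by
          have hr : TGroupoid.r D q = ((chartAt (Euc d) x₀).symm p.1, p.2.2) := by
            rw [← hpq, r_expParam]
          refine ⟨?_, ?_, ?_⟩
          · have h3 := hqU.2
            rw [hr, mem_preimage, (chartAt (Euc d) x₀).right_inv hp.1.1] at h3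
            exact Metric.ball_subset_closedBall h3
          · rw [mem_closedBall_zero_iff]; exact hpn.le.trans (le_max_left _ _)
          · have h3 := hqZ.2
            rw [hr] at h3
            rwa [mem_closedBall_zero_iff]
        obtain ⟨ι, hι, hιy, hev⟩ := exists_lift j.1 hyd hp hpq.symm
        have h3 : ∀ᶠ y' in 𝓝 y, χ (ι y') = 1 ∧ ι y' ∈ domO D x₀ X :=
          (hι.continuousAt.eventually (by rw [hιy]; exact hχ1 p hpK)).and
            (hι.continuousAt.eventually (by rw [hιy]; exact isOpen_domO.mem_nhds hp))
        filter_upwards [hev, h3] with y' h4 h5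
        change g _ * (u ((atlas D).map j.1 y') - extFun D x₀ X φ ((atlas D).map j.1 y')) = 0
        rw [h4, extFun_expParam h5.2]
        simp only [φ, h5.1, Complex.ofReal_one, one_mul, sub_self, mul_zero]
      · have hopen : IsOpen {b : M × ℝ | b.1 ∉ Z ∨ δ' < |b.2|} :=
          (hZ.isOpen_compl.preimage continuous_fst).union
            (isOpen_lt (continuous_const (y := δ')) (continuous_abs.comp continuous_snd))
        have hmem : TGroupoid.r D q ∈ {b : M × ℝ | b.1 ∉ Z ∨ δ' < |b.2|} := by
          by_contra hcon
          simp only [mem_ofPred_eq, not_or, not_not, not_lt] at hcon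
          exact hqZ hcon
        filter_upwards [hrc.preimage_mem_nhds (hopen.mem_nhds hmem)] with y' hy'
        change g (TGroupoid.r D ((atlas D).map j.1 y')) * _ = 0
        rw [hg0 _ _ (hy'.imp id fun h => by rw [sub_zero]; exact h.le), zero_mul]
    rw [h2, hg1, one_mul, map_sub] at h1
    exact (sub_eq_zero.1 h1.symm)
  · intro z hz
    have := (hχ1 (chartAt (Euc d) x₀ x, z, 0) ⟨Metric.mem_closedBall_self hρ.le,
      by rw [mem_closedBall_zero_iff]; exact hz.trans (le_max_right _ _),
      Metric.mem_closedBall_self hδ'.le⟩).self_of_nhds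
    dsimp only
    rw [this, Complex.ofReal_one]

/-- A continuous density that represents `T` on the fibres of non-zero height represents `T`. -/
theorem RepresentsPair.represents [T2Space M] {f : FibredDensity D} {T : GroupoidDist D}
    (hT : RepresentsPair f T) (hf : f.IsContinuous) : f.Represents T := by
  refine ⟨fun x L u hu => ?_, hT⟩
  obtain ⟨X, hxc⟩ := exists_gradedFrame ψ x
  have hx := mem_chart_source (Euc d) x
  set a₀ := chartAt (Euc d) x x with ha₀
  have hxa : (chartAt (Euc d) x).symm a₀ = x := (chartAt (Euc d) x).left_inv hx
  have hb : a₀ ∈ baseW x X := ⟨(chartAt (Euc d) x).map_source hx, by rwa [hxa]⟩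
  let A : Euc d ≃ₗ[ℝ] Euc d := (L.trans (ψ.iso x)).trans (frameEquiv X hxc).symm
  have hA : ∀ z, (ψ.iso x).symm (frameVec X x (A z)) = L z := fun z => by
    have h1 : frameVec X x (A z) = ψ.iso x (L z) :=
      (frameEquiv X hxc).apply_symm_apply (ψ.iso x (L z))
    rw [h1, LinearEquiv.symm_apply_apply]
  let A' : Euc d ≃L[ℝ] Euc d := A.toContinuousLinearEquiv
  obtain ⟨n₀, hn₀⟩ := (hu.isCompact.image A'.continuous).isBounded.exists_norm_le
  obtain ⟨φ, hφ, hφc, hφO, hφC, hTφ, θ, hθ, hφθ⟩ := exists_ext_eq T hx hxc u n₀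
  -- the limit at height zero
  have hcont : Continuous fun p => φ p * f.coeff (maxIndex D x X) p := by
    rw [continuous_iff_continuousAt]
    intro p
    by_cases hp : p ∈ tsupport φ
    · exact hφ.continuous.continuousAt.mul ((hf (maxIndex D x X)).continuousAt
        (isOpen_domO.mem_nhds (hφO hp)))
    · refine continuousAt_const (y := (0 : ℂ)).congr ?_
      filter_upwards [(isClosed_tsupport φ).isOpen_compl.mem_nhds hp] with p' hp'
      rw [image_eq_zero_of_notMem_tsupport hp', zero_mul]
  have hint : Continuous fun h : ℝ => ∫ z, φ (a₀, z, h) * f.coeff (maxIndex D x X) (a₀, z, h) := by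
    rw [← continuousOn_univ]
    refine continuousOn_integral_of_compact_support (k := (fun p : Par d => p.2.1) '' tsupport φ)
      (hφc.isCompact.image (by fun_prop)) ?_ ?_
    · have h1 : Continuous fun q : ℝ × Euc d => ((a₀, q.2, q.1) : Par d) := by fun_prop
      exact (hcont.comp h1).continuousOn
    · intro h z _ hz
      have : (a₀, z, h) ∉ tsupport φ := fun hcon => hz ⟨_, hcon, rfl⟩
      rw [image_eq_zero_of_notMem_tsupport this, zero_mul]
  have hlim : T.1 (ext φ hφ hφc hφO) (x, 0) =
      ∫ z, φ (a₀, z, 0) * f.coeff (maxIndex D x X) (a₀, z, 0) := by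
    have h1 := (continuous_cylinder_apply (T.1 (ext φ hφ hφc hφO)) x).continuous.tendsto 0
    have h2 := hint.tendsto 0
    have h3 : ∀ᶠ h : ℝ in 𝓝[≠] 0, T.1 (ext φ hφ hφc hφO) (x, h) =
        ∫ z, φ (a₀, z, h) * f.coeff (maxIndex D x X) (a₀, z, h) := by
      filter_upwards [self_mem_nhdsWithin] with h hh
      have := hT.apply_ext hφ hφc hφO hb hh (y₀ := x) fun z hz => hφC hz
      rwa [hxa] at this
    exact tendsto_nhds_unique ((h1.mono_left nhdsWithin_le_nhds).congr' h3)
      (h2.mono_left nhdsWithin_le_nhds)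
  have hexp : ∀ z, expParam D x X (a₀, z, 0) = osc x ((ψ.iso x).symm (frameVec X x z)) := fun z => by
    rw [expParam_zero, hxa]
  have hcoeff : ∀ z, f.coeff (maxIndex D x X) (a₀, z, 0) =
      (f.osc x ((ψ.iso x).symm (frameVec X x z))).1 (fun i => (ψ.iso x).symm (X.vec i x)) := fun z => by
    rw [FibredDensity.coeff_maxIndex_zero, hxa]
  rw [hTφ, hlim]
  -- linear change of variables
  have hcv := integral_image_eq_integral_abs_det_fderiv_smul volume (f := A') (s := univ)
    (f' := fun _ => (A' : Euc d →L[ℝ] Euc d)) MeasurableSet.univ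
    (fun z _ => A'.hasFDerivAt.hasFDerivWithinAt) A'.injective.injOn
    (fun z => φ (a₀, z, 0) * f.coeff (maxIndex D x X) (a₀, z, 0))
  rw [image_univ, A'.surjective.range_eq, Measure.restrict_univ] at hcv
  rw [hcv]
  refine integral_congr_ae (Eventually.of_forall fun z => ?_)
  dsimp only
  rw [hφθ, hexp, hcoeff]
  have h1 : (ψ.iso x).symm (frameVec X x (A' z)) = L z := hA z
  rw [h1]
  have h2 : (fun i => L (EuclideanSpace.single i (1 : ℝ))) = fun i => ∑ j,
      (Matrix.of fun i j => A' (EuclideanSpace.single i (1 : ℝ)) j) i j •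
        (ψ.iso x).symm (X.vec j x) := by
    funext i
    rw [← hA, frameVec, map_sum]
    simp only [map_smul]
    rfl
  rw [h2, (f.osc x (L z)).2, det_eq_det_of]
  by_cases hz : z ∈ tsupport fun z => u (osc x (L z))
  · rw [hθ _ (hn₀ _ (mem_image_of_mem _ hz)), one_mul, Complex.real_smul]
    simp only [ContinuousLinearEquiv.coe_coe]
    ring
  · rw [image_eq_zero_of_notMem_tsupport hz]
    simp

end Fibre
end HCalc

namespace HCalc
open MeasureTheory

/-! ### Locality on the fibres of non-zero height -/

section Locality

variable {d N : ℕ} {M : Type u} [TopologicalSpace M] [ChartedSpace (Euc d) M]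
  [IsManifold (𝓡 d) ∞ M] {H : LieFiltration d N M} {ψ : H.Splitting} {D : ψ.Exponential}

open LieFiltration.Splitting TGroupoid

/-- The product of a cut-off function on `M × ℝ` and a function of the coordinates of a chart. -/
def chartMul (g : (cylinderAtlas d M).Smooth) (x₀ : M) {Z : Set M} (hZ : IsClosed Z)
    {U : Set (Euc d × ℝ)} (hU : IsOpen U) {δ h₀ : ℝ}
    (hZU : ∀ y ∈ Z, y ∈ (chartAt (Euc d) x₀).source ∧
      ∀ h, |h - h₀| ≤ δ → (chartAt (Euc d) x₀ y, h) ∈ U)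
    (hg : ∀ y h, (y ∉ Z ∨ δ ≤ |h - h₀|) → g (y, h) = 0) (F : Euc d × ℝ → ℂ)
    (hF : ContDiffOn ℝ ∞ F U) : (cylinderAtlas d M).Smooth :=
  ⟨fun p => g p * F (chartAt (Euc d) x₀ p.1, p.2), fun (x₁ : M) p hp => by
    refine ContDiffAt.contDiffWithinAt ?_
    have hg1 : ContDiffAt ℝ ∞ (fun p : Euc d × ℝ => g ((chartAt (Euc d) x₁).symm p.1, p.2)) p :=
      ((cylinderAtlas d M).contDiffOn g x₁).contDiffAt
        (((cylinderAtlas d M).isOpen_dom x₁).mem_nhds hp)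
    have hc : ContinuousAt (fun p : Euc d × ℝ => (chartAt (Euc d) x₁).symm p.1) p :=
      ContinuousAt.comp (f := fun p : Euc d × ℝ => p.1) (contMDiffAt_chart_symm hp.1).continuousAt
        continuousAt_fst
    by_cases hpZ : (chartAt (Euc d) x₁).symm p.1 ∈ Z ∧ |p.2 - h₀| ≤ δ
    · obtain ⟨h1, h2⟩ := hZU _ hpZ.1
      have h3 : ContDiffAt ℝ ∞ (fun b => chartAt (Euc d) x₀ ((chartAt (Euc d) x₁).symm b)) p.1 := by
        rw [← contMDiffAt_iff_contDiffAt]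
        exact ContMDiffAt.comp (x := p.1) (contMDiffAt_chart h1) (contMDiffAt_chart_symm hp.1)
      exact hg1.mul (ContDiffAt.comp (f := fun p : Euc d × ℝ =>
        (chartAt (Euc d) x₀ ((chartAt (Euc d) x₁).symm p.1), p.2)) p
        (hF.contDiffAt (hU.mem_nhds (h2 _ hpZ.2))) ((h3.comp p contDiffAt_fst).prodMk contDiffAt_snd))
    · refine contDiffAt_const (c := (0 : ℂ)).congr_of_eventuallyEq ?_
      have hev : ∀ᶠ q : Euc d × ℝ in 𝓝 p, (chartAt (Euc d) x₁).symm q.1 ∉ Z ∨ δ < |q.2 - h₀| := by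
        rw [not_and_or, not_le] at hpZ
        rcases hpZ with h | h
        · filter_upwards [hc.preimage_mem_nhds (hZ.isOpen_compl.mem_nhds h)] with q hq
          exact Or.inl hq
        · have h1 : Continuous fun q : Euc d × ℝ => |q.2 - h₀| := by fun_prop
          filter_upwards [h1.continuousAt.eventually (lt_mem_nhds h)] with q hq
          exact Or.inr hq
      filter_upwards [hev] with q hq
      change g ((chartAt (Euc d) x₁).symm q.1, q.2) * _ = 0
      rw [hg _ _ (hq.imp id le_of_lt), zero_mul]⟩

/-- A function on the part of the groupoid of non-zero height, where the range is given by its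
coordinates in a chart. -/
def pairVal (u : (atlas D).Smooth) (x₀ : M) (b : Euc d × ℝ) (y : M) : ℂ :=
  if hh : b.2 = 0 then 0 else u (.pair ((chartAt (Euc d) x₀).symm b.1) y b.2 hh)

theorem contDiffOn_pairVal (u : (atlas D).Smooth) (x₀ y₁ : M) :
    ContDiffOn ℝ ∞ (fun p : Par d => pairVal u x₀ (p.1, p.2.2) ((chartAt (Euc d) y₁).symm p.2.1))
      ((atlas D).dom (.pair x₀ y₁)) := by
  refine ((atlas D).contDiffOn u (.pair x₀ y₁)).congr fun p hp => ?_
  have h : p.2.2 ≠ 0 := hp.2.2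
  rw [map_pair (c := (x₀, y₁)) h, pairVal, dif_neg h]

/-- **Hadamard's lemma**: the mean of the derivative of `pairVal` in the direction `v` along the
segment from `b₀` to `b`. -/
def hadamard (u : (atlas D).Smooth) (x₀ : M) (b₀ v : Euc d × ℝ) (b : Euc d × ℝ) (y : M) : ℂ :=
  ∫ θ in Icc (0 : ℝ) 1, fderiv ℝ (fun b' => pairVal u x₀ b' y) (b₀ + θ • (b - b₀)) v

variable {x₀ : M} {b₀ : Euc d × ℝ} {U : Set (Euc d × ℝ)}

theorem segment_mem (hc : Convex ℝ U) (hb₀ : b₀ ∈ U) {b : Euc d × ℝ} (hb : b ∈ U) {θ : ℝ}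
    (hθ : θ ∈ Icc (0 : ℝ) 1) : b₀ + θ • (b - b₀) ∈ U := hc.add_smul_sub_mem hb₀ hb hθ

theorem differentiableAt_pairVal (u : (atlas D).Smooth) {b : Euc d × ℝ}
    (hb : b.1 ∈ (chartAt (Euc d) x₀).target ∧ b.2 ≠ 0) (y : M) :
    ContDiffAt ℝ ∞ (fun b' => pairVal u x₀ b' y) b := by
  have h1 := (contDiffOn_pairVal u x₀ y).contDiffAt (x := (b.1, chartAt (Euc d) y y, b.2))
    (((atlas D).isOpen_dom _).mem_nhds ⟨hb.1, mem_chart_target _ _, hb.2⟩)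
  have h2 := ContDiffAt.comp (f := fun b : Euc d × ℝ => (b.1, chartAt (Euc d) y y, b.2)) b h1
    (by fun_prop)
  refine h2.congr_of_eventuallyEq (Eventually.of_forall fun b' => ?_)
  simp only [Function.comp]
  rw [(chartAt (Euc d) y).left_inv (mem_chart_source _ _)]

theorem contDiffOn_hadamard (u : (atlas D).Smooth) (hc : Convex ℝ U) (hb₀ : b₀ ∈ U)
    (hUt : ∀ b ∈ U, b.1 ∈ (chartAt (Euc d) x₀).target ∧ b.2 ≠ 0) (v : Euc d × ℝ) (y₁ : M) :
    ContDiffOn ℝ ∞ (fun p : Par d => hadamard u x₀ b₀ v (p.1, p.2.2) ((chartAt (Euc d) y₁).symm p.2.1))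
      {p : Par d | (p.1, p.2.2) ∈ U ∧ p.2.1 ∈ (chartAt (Euc d) y₁).target} := by
  set G : Par d → ℂ := fun p => pairVal u x₀ (p.1, p.2.2) ((chartAt (Euc d) y₁).symm p.2.1) with hG
  have hGs := contDiffOn_pairVal u x₀ y₁
  have hdo := (atlas D).isOpen_dom (.pair x₀ y₁)
  let sft : Par d × ℝ → Par d := fun q =>
    ((b₀ + q.2 • ((q.1.1, q.1.2.2) - b₀)).1, q.1.2.1, (b₀ + q.2 • ((q.1.1, q.1.2.2) - b₀)).2)
  have hsft : ContDiff ℝ ∞ sft := by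
    simp only [sft, Prod.fst_add, Prod.snd_add, Prod.smul_fst, Prod.smul_snd, Prod.fst_sub,
      Prod.snd_sub]
    fun_prop
  have hfd : ContDiffOn ℝ ∞ (fun p => fderiv ℝ G p (v.1, 0, v.2)) ((atlas D).dom (.pair x₀ y₁)) :=
    (hGs.fderiv_of_isOpen hdo (m := ∞) (by simp)).clm_apply contDiffOn_const
  have hW : IsOpen (sft ⁻¹' (atlas D).dom (.pair x₀ y₁)) := hdo.preimage hsft.continuous
  have hmem : ∀ p ∈ {p : Par d | (p.1, p.2.2) ∈ U ∧ p.2.1 ∈ (chartAt (Euc d) y₁).target},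
      ∀ t ∈ Icc (0 : ℝ) 1, (p, t) ∈ sft ⁻¹' (atlas D).dom (.pair x₀ y₁) := by
    intro p hp t ht
    have h1 := hUt _ (segment_mem hc hb₀ hp.1 ht)
    exact ⟨h1.1, hp.2, h1.2⟩
  have hfdW : ContDiffOn ℝ ∞ (fun q => fderiv ℝ G (sft q) (v.1, 0, v.2))
      (sft ⁻¹' (atlas D).dom (.pair x₀ y₁)) :=
    hfd.comp hsft.contDiffOn fun q hq => hq
  have hloc : LocallyIntegrable ((Icc (0 : ℝ) 1).indicator fun _ => (1 : ℂ)) volume :=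
    ((integrable_indicator_iff measurableSet_Icc).2
      (integrableOn_const (by simp))).locallyIntegrable
  have key := contDiffOn_parametric_integral (μ := volume) hloc isCompact_Icc
    (fun t ht => indicator_of_notMem ht _) hW hfdW hmem
  refine key.congr fun p hp => ?_
  rw [hadamard, ← integral_indicator measurableSet_Icc]
  refine integral_congr_ae (Eventually.of_forall fun θ => ?_)
  by_cases hθ : θ ∈ Icc (0 : ℝ) 1
  · simp only [indicator_of_mem hθ, one_mul]
    have h1 : sft (p, θ) ∈ (atlas D).dom (.pair x₀ y₁) := hmem p hp θ hθ
    have h2 : HasFDerivAt G (fderiv ℝ G (sft (p, θ))) (sft (p, θ)) :=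
      ((hGs.contDiffAt (hdo.mem_nhds h1)).differentiableAt (by simp)).hasFDerivAt
    set b := b₀ + θ • ((p.1, p.2.2) - b₀) with hb
    have h3 : HasFDerivAt (fun b' : Euc d × ℝ => (b'.1, p.2.1, b'.2))
        ((ContinuousLinearMap.fst ℝ (Euc d) ℝ).prod
          ((0 : Euc d × ℝ →L[ℝ] Euc d).prod (ContinuousLinearMap.snd ℝ (Euc d) ℝ))) b :=
      hasFDerivAt_fst.prodMk ((hasFDerivAt_const _ _).prodMk hasFDerivAt_snd)
    have h4 := HasFDerivAt.comp (g := G) b h2 h3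
    have h5 : fderiv ℝ (fun b' => pairVal u x₀ b' ((chartAt (Euc d) y₁).symm p.2.1)) b = _ :=
      h4.fderiv
    rw [h5]
    rfl
  · simp only [indicator_of_notMem hθ, zero_mul]

theorem pairVal_sub_eq_hadamard (u : (atlas D).Smooth) (hc : Convex ℝ U) (hb₀ : b₀ ∈ U)
    (hUt : ∀ b ∈ U, b.1 ∈ (chartAt (Euc d) x₀).target ∧ b.2 ≠ 0) {b : Euc d × ℝ} (hb : b ∈ U)
    (y : M) : pairVal u x₀ b y - pairVal u x₀ b₀ y = hadamard u x₀ b₀ (b - b₀) b y := by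
  have hd : ∀ θ ∈ Icc (0 : ℝ) 1, ContDiffAt ℝ ∞ (fun b' => pairVal u x₀ b' y)
      (b₀ + θ • (b - b₀)) := fun θ hθ =>
    differentiableAt_pairVal u (hUt _ (segment_mem hc hb₀ hb hθ)) y
  have hl : ∀ θ : ℝ, HasDerivAt (fun θ : ℝ => b₀ + θ • (b - b₀)) (b - b₀) θ := fun θ => by
    simpa using ((hasDerivAt_id θ).smul_const (b - b₀)).const_add b₀
  have h1 := intervalIntegral.integral_eq_sub_of_hasDerivAt
    (f := fun θ : ℝ => pairVal u x₀ (b₀ + θ • (b - b₀)) y)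
    (f' := fun θ : ℝ => fderiv ℝ (fun b' => pairVal u x₀ b' y) (b₀ + θ • (b - b₀)) (b - b₀))
    (a := 0) (b := 1) ?_ ?_
  · rw [intervalIntegral.integral_of_le zero_le_one, ← integral_Icc_eq_integral_Ioc] at h1
    rw [hadamard, h1]
    simp
  · intro θ hθ
    rw [uIcc_of_le zero_le_one] at hθ
    exact ((hd θ hθ).differentiableAt (by simp)).hasFDerivAt.comp_hasDerivAt θ (hl θ)
  · refine ContinuousOn.intervalIntegrable ?_
    rw [uIcc_of_le zero_le_one]
    intro θ hθ
    refine ContinuousAt.continuousWithinAt ?_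
    have h2 := ((hd θ hθ).fderiv_right (m := ∞) (by simp)).continuousAt
    exact (ContinuousAt.comp (f := fun θ : ℝ => b₀ + θ • (b - b₀)) h2
      (hl θ).continuousAt).clm_apply continuousAt_const

theorem hadamard_eq_sum {κ : Type*} [Fintype κ] (e : Module.Basis κ ℝ (Euc d × ℝ))
    (u : (atlas D).Smooth) (hc : Convex ℝ U) (hb₀ : b₀ ∈ U)
    (hUt : ∀ b ∈ U, b.1 ∈ (chartAt (Euc d) x₀).target ∧ b.2 ≠ 0) {b : Euc d × ℝ} (hb : b ∈ U)
    (v : Euc d × ℝ) (y : M) :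
    hadamard u x₀ b₀ v b y = ∑ k, (e.repr v k : ℂ) * hadamard u x₀ b₀ (e k) b y := by
  have hint : ∀ v : Euc d × ℝ, IntegrableOn (fun θ : ℝ =>
      fderiv ℝ (fun b' => pairVal u x₀ b' y) (b₀ + θ • (b - b₀)) v) (Icc 0 1) := fun v => by
    refine ContinuousOn.integrableOn_Icc fun θ hθ => ContinuousAt.continuousWithinAt ?_
    have h2 := ((differentiableAt_pairVal u (hUt _ (segment_mem hc hb₀ hb hθ)) y).fderiv_right
      (m := ∞) (by simp)).continuousAt
    have h3 : Continuous fun θ : ℝ => b₀ + θ • (b - b₀) := by fun_prop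
    exact (ContinuousAt.comp (f := fun θ : ℝ => b₀ + θ • (b - b₀)) h2
      h3.continuousAt).clm_apply continuousAt_const
  simp only [hadamard, ← integral_const_mul]
  rw [← integral_finsetSum _ fun k _ => (hint (e k)).const_mul _]
  refine integral_congr_ae (Eventually.of_forall fun θ => ?_)
  refine (congrArg (fderiv ℝ (fun b' => pairVal u x₀ b' y) (b₀ + θ • (b - b₀)))
    (e.sum_repr v).symm).trans ?_
  rw [map_sum]
  exact Finset.sum_congr rfl fun k _ => by rw [map_smul, Complex.real_smul]

/-- **Locality**: at a point of non-zero height, the value of a fibred distribution depends only on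
the restriction of the test function to the fibre of `r`. -/
theorem apply_eq_zero_of_fibre [T2Space M] (T : GroupoidDist D) (u : (atlas D).Smooth) {x : M}
    {h₀ : ℝ} (hh : h₀ ≠ 0) (hu : ∀ y, u (.pair x y h₀ hh) = 0) : T.1 u (x, h₀) = 0 := by
  set b₀ : Euc d × ℝ := (chartAt (Euc d) x x, h₀) with hb₀
  have hopen : IsOpen ((chartAt (Euc d) x).target ×ˢ {h : ℝ | h ≠ 0}) :=
    (chartAt (Euc d) x).open_target.prod isOpen_ne
  obtain ⟨ε, hε, hball⟩ := Metric.isOpen_iff.1 hopen b₀ ⟨mem_chart_target _ _, hh⟩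
  have hUt : ∀ b ∈ Metric.ball b₀ ε, b.1 ∈ (chartAt (Euc d) x).target ∧ b.2 ≠ 0 := fun b hb =>
    hball hb
  have hmem : ∀ y : M, chartAt (Euc d) x y ∈ Metric.ball (chartAt (Euc d) x x) ε → ∀ h : ℝ,
      |h - h₀| ≤ ε / 2 → (chartAt (Euc d) x y, h) ∈ Metric.ball b₀ ε := fun y hy h hh' => by
    rw [hb₀, ← ball_prod_same]
    refine ⟨hy, ?_⟩
    rw [Metric.mem_ball, Real.dist_eq]
    linarith
  have hh₀ : ε ≤ |h₀| := by
    by_contra! hlt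
    have h1 : ((chartAt (Euc d) x x, (0 : ℝ)) : Euc d × ℝ) ∈ Metric.ball b₀ ε := by
      rw [hb₀, ← ball_prod_same]
      refine ⟨Metric.mem_ball_self hε, ?_⟩
      rw [Metric.mem_ball, Real.dist_eq, zero_sub, abs_neg]
      exact hlt
    exact (hUt _ h1).2 rfl
  have hV : (chartAt (Euc d) x).source ∩ chartAt (Euc d) x ⁻¹' Metric.ball (chartAt (Euc d) x x) ε
      ∈ 𝓝 x := ((chartAt (Euc d) x).isOpen_inter_preimage Metric.isOpen_ball).mem_nhds
        ⟨mem_chart_source _ _, Metric.mem_ball_self hε⟩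
  obtain ⟨g, Z, hZ, hZV, hg1, hg0⟩ := exists_cylinder_bump (d := d) x h₀ hV (half_pos hε)
  have hZU : ∀ y ∈ Z, y ∈ (chartAt (Euc d) x).source ∧
      ∀ h, |h - h₀| ≤ ε / 2 → (chartAt (Euc d) x y, h) ∈ Metric.ball b₀ ε := fun y hy =>
    ⟨(hZV hy).1, hmem y (hZV hy).2⟩
  have hcv : Convex ℝ (Metric.ball b₀ ε) := convex_ball _ _
  have hb₀U : b₀ ∈ Metric.ball b₀ ε := Metric.mem_ball_self hε
  let e := Module.finBasis ℝ (Euc d × ℝ)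
  have hF : ∀ k, ContDiffOn ℝ ∞ (fun b : Euc d × ℝ => (e.repr (b - b₀) k : ℂ))
      (Metric.ball b₀ ε) := fun k => by
    have h1 : ContDiff ℝ ∞ fun b : Euc d × ℝ =>
        Complex.ofRealCLM ((e.coord k).toContinuousLinearMap (b - b₀)) := by fun_prop
    exact h1.contDiffOn
  let c := fun k => chartMul g x hZ Metric.isOpen_ball hZU hg0 _ (hF k)
  have hw0 : ∀ k, ∀ (y' y : M) (h : ℝ), |h| < ε / 2 →
      g (y', h) * hadamard u x b₀ (e k) (chartAt (Euc d) x y', h) y = 0 := fun k y' y h hlt => by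
    rw [hg0 _ _ (Or.inr _), zero_mul]
    have := abs_sub_abs_le_abs_sub h₀ h
    rw [abs_sub_comm] at this
    linarith
  let w := fun k => ofPair (D := D) (fun y' y h =>
    g (y', h) * hadamard u x b₀ (e k) (chartAt (Euc d) x y', h) y) (half_pos hε) (hw0 k)
    (fun (x₁ y₁ : M) p hp => by
      refine ContDiffAt.contDiffWithinAt ?_
      have hsm : ContMDiffAt 𝓘(ℝ, Par d) (𝓡 d) ∞
          (fun p : Par d => (chartAt (Euc d) x₁).symm p.1) p :=
        ContMDiffAt.comp (x := p) (g := (chartAt (Euc d) x₁).symm) (f := fun p : Par d => p.1)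
          (contMDiffAt_chart_symm hp.1) (contMDiffAt_iff_contDiffAt.2 contDiffAt_fst)
      have hg' : ContDiffAt ℝ ∞ (fun p : Par d => g ((chartAt (Euc d) x₁).symm p.1, p.2.2)) p :=
        contDiffAt_cylinder g hsm (by fun_prop)
      by_cases hpZ : (chartAt (Euc d) x₁).symm p.1 ∈ Z ∧ |p.2.2 - h₀| ≤ ε / 2
      · obtain ⟨h1, h2⟩ := hZU _ hpZ.1
        have h3 : ContDiffAt ℝ ∞
            (fun p : Par d => chartAt (Euc d) x ((chartAt (Euc d) x₁).symm p.1)) p := by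
          rw [← contMDiffAt_iff_contDiffAt]
          exact ContMDiffAt.comp (x := p) (contMDiffAt_chart h1) hsm
        have hop : IsOpen {p : Par d | (p.1, p.2.2) ∈ Metric.ball b₀ ε ∧
            p.2.1 ∈ (chartAt (Euc d) y₁).target} :=
          (Metric.isOpen_ball.preimage (by fun_prop)).inter
            ((chartAt (Euc d) y₁).open_target.preimage (by fun_prop))
        have h4 := (contDiffOn_hadamard u hcv hb₀U hUt (e k) y₁).contDiffAt
          (x := (chartAt (Euc d) x ((chartAt (Euc d) x₁).symm p.1), p.2.1, p.2.2))
          (hop.mem_nhds ⟨h2 _ hpZ.2, hp.2.1⟩)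
        exact hg'.mul (ContDiffAt.comp (f := fun p : Par d =>
          (chartAt (Euc d) x ((chartAt (Euc d) x₁).symm p.1), p.2.1, p.2.2)) p h4
          (h3.prodMk (by fun_prop)))
      · refine contDiffAt_const (c := (0 : ℂ)).congr_of_eventuallyEq ?_
        have hev : ∀ᶠ q : Par d in 𝓝 p, (chartAt (Euc d) x₁).symm q.1 ∉ Z ∨
            ε / 2 < |q.2.2 - h₀| := by
          rw [not_and_or, not_le] at hpZ
          rcases hpZ with h | h
          · filter_upwards [hsm.continuousAt.preimage_mem_nhds (hZ.isOpen_compl.mem_nhds h)]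
              with q hq
            exact Or.inl hq
          · have h1 : Continuous fun q : Par d => |q.2.2 - h₀| := by fun_prop
            filter_upwards [h1.continuousAt.eventually (lt_mem_nhds h)] with q hq
            exact Or.inr hq
        filter_upwards [hev] with q hq
        rw [hg0 _ _ (hq.imp id le_of_lt), zero_mul])
  -- `g² u = ∑ (g c_k) w_k`, where the functions `c_k` vanish at the given point
  have key : rMul D g (rMul D g u) = ∑ k, rMul D (c k) (w k) := by
    apply DFunLike.coe_injective
    have hsum : ∀ q, (∑ k, rMul D (c k) (w k)) q = ∑ k, (rMul D (c k) (w k)) q := fun q => by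
      let ev : (atlas D).Smooth →+ ℂ := ⟨⟨fun f => f q, rfl⟩, fun _ _ => rfl⟩
      exact map_sum ev _ _
    funext q
    rw [hsum]
    cases q with
    | osc y z =>
      have h0 : g (y, 0) = 0 := hg0 _ _ (Or.inr (by rw [zero_sub, abs_neg]; linarith))
      change g (y, 0) * (g (y, 0) * _) = ∑ k, (g (y, 0) * _) * _
      simp only [h0, zero_mul, Finset.sum_const_zero]
    | pair y' y h hh' =>
      change g (y', h) * (g (y', h) * u (.pair y' y h hh')) = ∑ k, (g (y', h) *
        (e.repr ((chartAt (Euc d) x y', h) - b₀) k : ℂ)) *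
        (g (y', h) * hadamard u x b₀ (e k) (chartAt (Euc d) x y', h) y)
      by_cases hy : y' ∉ Z ∨ ε / 2 ≤ |h - h₀|
      · simp only [hg0 _ _ hy, zero_mul, Finset.sum_const_zero]
      · push Not at hy
        obtain ⟨h1, h2⟩ := hZU y' hy.1
        have h3 := h2 h hy.2.le
        have h4 := pairVal_sub_eq_hadamard u hcv hb₀U hUt h3 y
        rw [hadamard_eq_sum e u hcv hb₀U hUt h3] at h4
        have h5 : pairVal u x b₀ y = 0 := by
          rw [pairVal, dif_neg hh]
          have := hu y
          rw [← (chartAt (Euc d) x).left_inv (mem_chart_source _ x)] at this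
          exact this
        have h6 : pairVal u x (chartAt (Euc d) x y', h) y = u (.pair y' y h hh') := by
          rw [pairVal, dif_neg hh']
          simp only [(chartAt (Euc d) x).left_inv h1]
        rw [h5, h6, sub_zero] at h4
        rw [h4, Finset.mul_sum, Finset.mul_sum]
        exact Finset.sum_congr rfl fun k _ => by ring
  have h1 : T.1 (rMul D g (rMul D g u)) (x, h₀) = T.1 u (x, h₀) := by
    rw [T.2 g _ (rMul D g (rMul D g u)) fun _ => rfl, T.2 g u (rMul D g u) fun _ => rfl, hg1,
      one_mul, one_mul]
  rw [← h1, key, map_sum]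
  let ev : (cylinderAtlas d M).Smooth →+ ℂ := ⟨⟨fun f => f (x, h₀), rfl⟩, fun _ _ => rfl⟩
  refine (map_sum ev _ _).trans (Finset.sum_eq_zero fun k _ => ?_)
  change T.1 (rMul D (c k) (w k)) (x, h₀) = 0
  rw [T.2 (c k) (w k) (rMul D (c k) (w k)) fun _ => rfl]
  change (g (x, h₀) * (e.repr ((chartAt (Euc d) x x, h₀) - b₀) k : ℂ)) * _ = 0
  rw [← hb₀, sub_self]
  simp

theorem apply_eq_of_fibre [T2Space M] (T : GroupoidDist D) {u v : (atlas D).Smooth} {x : M}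
    {h₀ : ℝ} (hh : h₀ ≠ 0) (huv : ∀ y, u (.pair x y h₀ hh) = v (.pair x y h₀ hh)) :
    T.1 u (x, h₀) = T.1 v (x, h₀) := by
  have h := apply_eq_zero_of_fibre T (u - v) hh fun y => by
    change u _ - v _ = 0
    rw [huv, sub_self]
  rw [map_sub] at h
  exact sub_eq_zero.1 h

/-- The restriction of a test function to the fibre of `r` over `(x, h)`, extended to a function on
`M × ℝ` that does not depend on the height. -/
def fibrePull (u : (atlas D).Smooth) (x : M) {h : ℝ} (hh : h ≠ 0) : (cylinderAtlas d M).Smooth :=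
  ⟨fun p => u (.pair x p.1 h hh), fun (y₁ : M) => by
    have h1 : ContDiffOn ℝ ∞ (fun p : Euc d × ℝ => u ((atlas D).map (.pair x y₁)
        (chartAt (Euc d) x x, p.1, h))) ((cylinderAtlas d M).dom y₁) :=
      ((atlas D).contDiffOn u (.pair x y₁)).comp
        (f := fun p : Euc d × ℝ => (chartAt (Euc d) x x, p.1, h)) (by fun_prop)
        fun p hp => ⟨mem_chart_target _ _, hp.1, hh⟩
    refine h1.congr fun p hp => ?_
    rw [map_pair (c := (x, y₁)) (q := (chartAt (Euc d) x x, p.1, h)) hh]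
    simp only [(chartAt (Euc d) x).left_inv (mem_chart_source _ x)]
    rfl⟩

theorem push_apply_eq [T2Space M] (P : GroupoidDist D) (u : (atlas D).Smooth) (x : M) {h : ℝ}
    (hh : h ≠ 0) {t : ℝ} (ht : 0 < t) :
    (GroupoidDist.push t ht P).1 u (x, h) = P.1 (sPull D (fibrePull u x hh)) (x, t * h) := by
  refine apply_eq_of_fibre P (mul_ne_zero ht.ne' hh) fun y => ?_
  change u (.pair x y (t⁻¹ * (t * h)) _) = u (.pair x y h hh)
  simp only [inv_mul_cancel_left₀ ht.ne']

theorem zoom_zoom {t l : ℝ} (ht : 0 < t) (hl : 0 < l) (q : TGroupoid D) :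
    zoom D t ht (zoom D l hl q) = zoom D (t * l) (mul_pos ht hl) q := by
  cases q with
  | osc x z =>
    simp only [zoom]
    congr 1
    funext k
    simp only [LieFiltration.dil, smul_smul, mul_pow]
  | pair x y h hh => simp only [zoom, mul_inv, mul_assoc]

theorem push_push (P : GroupoidDist D) (u : (atlas D).Smooth) (b : M × ℝ) {t l : ℝ} (ht : 0 < t)
    (hl : 0 < l) : (GroupoidDist.push l hl P).1 (zoomPullback D t ht u) (b.1, t * b.2) =
      (GroupoidDist.push (t * l) (mul_pos ht hl) P).1 u b := by
  change P.1 (zoomPullback D l hl (zoomPullback D t ht u)) (b.1, l * (t * b.2)) =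
    P.1 (zoomPullback D (t * l) (mul_pos ht hl) u) (b.1, t * l * b.2)
  have h1 : zoomPullback D l hl (zoomPullback D t ht u) =
      zoomPullback D (t * l) (mul_pos ht hl) u := by
    apply DFunLike.coe_injective
    funext q
    exact congrArg u (zoom_zoom ht hl q)
  rw [h1, mul_left_comm, mul_assoc]

theorem continuous_dist_eval (u : (atlas D).Smooth) (b : M × ℝ) :
    Continuous fun T : GroupoidDist D => T.1 u b := by
  obtain ⟨q, hq, hqb⟩ := continuous_cylinder_eval (d := d) b
  let ev : (cylinderAtlas d M).Smooth →ₗ[ℂ] ℂ := ⟨⟨fun f => f b, fun _ _ => rfl⟩, fun _ _ => rfl⟩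
  have hev : Continuous ev := by
    refine continuous_of_continuousAt_zero ev ?_
    rw [ContinuousAt, map_zero]
    refine squeeze_zero_norm hqb ?_
    simpa using hq.tendsto 0
  exact hev.comp ((continuous_eval_const u).comp continuous_subtype_val)

/-- The function `t ↦ ((α_t)_* ℙ, u)(x, h)`. -/
def pushEval (P : GroupoidDist D) (u : (atlas D).Smooth) (b : M × ℝ) (t : ℝ) : ℂ :=
  if ht : 0 < t then (GroupoidDist.push t ht P).1 u b else 0

theorem pushEval_of_pos (P : GroupoidDist D) (u : (atlas D).Smooth) (b : M × ℝ) {t : ℝ}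
    (ht : 0 < t) : pushEval P u b t = (GroupoidDist.push t ht P).1 u b := dif_pos ht

theorem push_one (P : GroupoidDist D) (u : (atlas D).Smooth) (b : M × ℝ) :
    (GroupoidDist.push 1 one_pos P).1 u b = P.1 u b := by
  change P.1 (zoomPullback D 1 one_pos u) (b.1, 1 * b.2) = _
  have h5 : zoomPullback D 1 one_pos u = u := by
    apply DFunLike.coe_injective
    funext q
    refine congrArg u ?_
    cases q with
    | osc x z =>
      simp only [zoom]
      congr 1
      funext k
      simp only [LieFiltration.dil, one_pow, one_smul]
    | pair x y h hh => simp only [zoom, inv_one, one_mul]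
  rw [h5, one_mul]

theorem hasDerivAt_pushEval_one {P L : GroupoidDist D} (hL : GroupoidDist.IsLieDeriv P L)
    (u : (atlas D).Smooth) (b : M × ℝ) : HasDerivAt (pushEval P u b) (L.1 u b) 1 := by
  rw [hasDerivAt_iff_tendsto_slope]
  let g : ℝ → {l : ℝ // 0 < l} := fun l => ⟨max l (1 / 2), lt_max_of_lt_right (by norm_num)⟩
  have hg : Continuous g := by fun_prop
  have hg1 : g 1 = ⟨1, one_pos⟩ := Subtype.ext (max_eq_left (by norm_num))
  have hev : ∀ᶠ l in 𝓝[≠] (1 : ℝ), (1 / 2 : ℝ) < l :=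
    eventually_nhdsWithin_of_eventually_nhds (lt_mem_nhds (by norm_num))
  have h1 : Tendsto g (𝓝[≠] 1) (𝓝[≠] ⟨1, one_pos⟩) := by
    refine tendsto_nhdsWithin_of_tendsto_nhds_of_eventually_within _ ?_ ?_
    · rw [← hg1]
      exact hg.continuousAt.tendsto.mono_left nhdsWithin_le_nhds
    · filter_upwards [hev, self_mem_nhdsWithin] with l hl hl1 h
      have h2 := congrArg Subtype.val h
      simp only [g, max_eq_left hl.le] at h2
      exact hl1 h2
  have h2 := ((continuous_dist_eval u b).tendsto L).comp (hL.comp h1)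
  refine h2.congr' ?_
  filter_upwards [hev] with l hl
  have hl0 : 0 < l := by linarith
  have h3 : g l = ⟨l, hl0⟩ := Subtype.ext (max_eq_left hl.le)
  simp only [Function.comp, h3, slope, vsub_eq_sub, pushEval_of_pos P u b hl0,
    pushEval_of_pos P u b one_pos]
  rw [push_one, ← Complex.ofReal_inv]
  change ((l - 1)⁻¹ : ℝ) * ((GroupoidDist.push l hl0 P).1 u b - P.1 u b) = _
  rw [Complex.real_smul]

/-- The Lie derivative along the zoom action at time `t`, from that at time `1` by the group law. -/
theorem hasDerivAt_pushEval {P L : GroupoidDist D} (hL : GroupoidDist.IsLieDeriv P L)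
    (u : (atlas D).Smooth) (b : M × ℝ) {t : ℝ} (ht : 0 < t) :
    HasDerivAt (pushEval P u b) ((t : ℂ)⁻¹ * pushEval L u b t) t := by
  have h1 := hasDerivAt_pushEval_one hL (zoomPullback D t ht u) (b.1, t * b.2)
  have h2 : HasDerivAt (fun s : ℝ => t⁻¹ * s) t⁻¹ t := by
    simpa using (hasDerivAt_id t).const_mul t⁻¹
  have h3 : t⁻¹ * t = 1 := inv_mul_cancel₀ ht.ne'
  rw [← h3] at h1
  have h4 := h1.scomp t h2
  rw [pushEval_of_pos L u b ht]
  rw [Complex.real_smul, Complex.ofReal_inv] at h4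
  refine h4.congr_of_eventuallyEq ?_
  filter_upwards [lt_mem_nhds ht] with s hs
  have hs' : 0 < t⁻¹ * s := mul_pos (inv_pos.2 ht) hs
  rw [Function.comp, pushEval_of_pos _ _ _ hs', push_push P u b ht hs', pushEval_of_pos _ _ _ hs]
  simp only [mul_inv_cancel_left₀ ht.ne']

/-- The equation `(L_Z - m) ℙ = 𝔽` says that `t^{-m} (α_t)_* ℙ` has the derivative
`t^{-m-1} (α_t)_* 𝔽`. -/
theorem hasDerivAt_cpow_mul_pushEval {P L : GroupoidDist D} (hL : GroupoidDist.IsLieDeriv P L)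
    (m : ℂ) (u : (atlas D).Smooth) (b : M × ℝ) {t : ℝ} (ht : 0 < t) :
    HasDerivAt (fun t : ℝ => (t : ℂ) ^ (-m) * pushEval P u b t)
      ((t : ℂ) ^ (-m - 1) * pushEval (L - m • P) u b t) t := by
  have ht' : (t : ℂ) ≠ 0 := Complex.ofReal_ne_zero.2 ht.ne'
  have h1 : HasDerivAt (fun t : ℝ => (t : ℂ) ^ (-m)) (-m * (t : ℂ) ^ (-m - 1)) t := by
    have h := (hasDerivAt_id (t : ℂ)).cpow_const (c := -m) (Complex.ofReal_mem_slitPlane.2 ht)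
    simpa using h.comp_ofReal
  refine (h1.mul (hasDerivAt_pushEval hL u b ht)).congr_deriv ?_
  have h2 : pushEval (L - m • P) u b t = pushEval L u b t - m * pushEval P u b t := by
    simp only [pushEval_of_pos _ _ _ ht]
    rfl
  have h3 : (t : ℂ) ^ (-m) = (t : ℂ) ^ (-m - 1) * t := by
    rw [Complex.cpow_sub _ _ ht', Complex.cpow_one, div_mul_cancel₀ _ ht']
  rw [h2, h3]
  field_simp
  ring

/-- The integrated form of the equation `(L_Z - m) ℙ = 𝔽` on a fibre of `r` of non-zero height. -/
theorem integral_fibre_eq [T2Space M] {P L : GroupoidDist D} (hL : GroupoidDist.IsLieDeriv P L)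
    (m : ℂ) (u : (atlas D).Smooth) (x : M) {h : ℝ} (hh : h ≠ 0) {α β : ℝ} (hα : 0 < α)
    (hβ : 0 < β) :
    ∫ t in α..β, (t : ℂ) ^ (-m - 1) * (L - m • P).1 (sPull D (fibrePull u x hh)) (x, t * h) =
      (β : ℂ) ^ (-m) * (GroupoidDist.push β hβ P).1 u (x, h) -
        (α : ℂ) ^ (-m) * (GroupoidDist.push α hα P).1 u (x, h) := by
  have hpos : ∀ t ∈ uIcc α β, 0 < t := fun t ht => lt_of_lt_of_le (lt_min hα hβ) ht.1
  have h1 : ∀ t ∈ uIcc α β, HasDerivAt (fun t : ℝ => (t : ℂ) ^ (-m) * pushEval P u (x, h) t)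
      ((t : ℂ) ^ (-m - 1) * (L - m • P).1 (sPull D (fibrePull u x hh)) (x, t * h)) t :=
    fun t ht => by
      have h2 := hasDerivAt_cpow_mul_pushEval hL m u (x, h) (hpos t ht)
      rwa [pushEval_of_pos _ _ _ (hpos t ht), push_apply_eq _ u x hh (hpos t ht)] at h2
  rw [intervalIntegral.integral_eq_sub_of_hasDerivAt h1, pushEval_of_pos _ _ _ hα,
    pushEval_of_pos _ _ _ hβ]
  refine ContinuousOn.intervalIntegrable fun t ht => ContinuousAt.continuousWithinAt ?_
  have h3 := continuous_cylinder_apply ((L - m • P).1 (sPull D (fibrePull u x hh))) x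
  refine ContinuousAt.mul ?_ (h3.continuous.comp (by fun_prop : Continuous fun t => t * h)).continuousAt
  exact Complex.continuousAt_ofReal_cpow_const _ _ (Or.inr (hpos t ht).ne')

/-- For `Re m < 0`, the term at `t = 0` of the integrated equation vanishes. -/
theorem integral_fibre_eq_of_neg [T2Space M] {P L : GroupoidDist D}
    (hL : GroupoidDist.IsLieDeriv P L) {m : ℂ} (hm : m.re < 0) (u : (atlas D).Smooth) (x : M)
    {h : ℝ} (hh : h ≠ 0) {β : ℝ} (hβ : 0 < β) :
    ∫ t in (0 : ℝ)..β, (t : ℂ) ^ (-m - 1) *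
        (L - m • P).1 (sPull D (fibrePull u x hh)) (x, t * h) =
      (β : ℂ) ^ (-m) * (GroupoidDist.push β hβ P).1 u (x, h) := by
  set g := (L - m • P).1 (sPull D (fibrePull u x hh)) with hg
  set p := P.1 (sPull D (fibrePull u x hh)) with hp
  have hgc : Continuous fun t : ℝ => g (x, t * h) :=
    (continuous_cylinder_apply g x).continuous.comp (by fun_prop : Continuous fun t => t * h)
  have hpc : Continuous fun t : ℝ => p (x, t * h) :=
    (continuous_cylinder_apply p x).continuous.comp (by fun_prop : Continuous fun t => t * h)
  have hint : IntervalIntegrable (fun t : ℝ => (t : ℂ) ^ (-m - 1) * g (x, t * h)) volume 0 β :=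
    (intervalIntegral.intervalIntegrable_cpow' (by simpa using hm)).mul_continuousOn
      hgc.continuousOn
  have hcont := intervalIntegral.continuousOn_primitive_interval_left (a := 0) (b := β)
    ((intervalIntegrable_iff_integrableOn_Icc_of_le hβ.le).1 hint |> fun h => by
      rwa [uIcc_of_le hβ.le])
  rw [uIcc_of_le hβ.le] at hcont
  have h1 : Tendsto (fun α => ∫ t in α..β, (t : ℂ) ^ (-m - 1) * g (x, t * h)) (𝓝[>] 0)
      (𝓝 (∫ t in (0 : ℝ)..β, (t : ℂ) ^ (-m - 1) * g (x, t * h))) :=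
    (hcont 0 (left_mem_Icc.2 hβ.le)).tendsto.mono_left
      (nhdsWithin_le_of_mem (mem_of_superset (Ioo_mem_nhdsGT hβ) Ioo_subset_Icc_self))
  have h2 : Tendsto (fun α : ℝ => (β : ℂ) ^ (-m) * (GroupoidDist.push β hβ P).1 u (x, h) -
      (α : ℂ) ^ (-m) * p (x, α * h)) (𝓝[>] 0)
      (𝓝 ((β : ℂ) ^ (-m) * (GroupoidDist.push β hβ P).1 u (x, h) - 0 * p (x, 0 * h))) := by
    refine tendsto_const_nhds.sub (Tendsto.mul ?_ ?_)
    · have h3 : ContinuousAt (fun α : ℝ => (α : ℂ) ^ (-m)) 0 :=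
        Complex.continuousAt_ofReal_cpow_const _ _ (Or.inl (by simpa using hm))
      have h4 := h3.tendsto.mono_left (nhdsWithin_le_nhds (s := Ioi 0))
      rwa [Complex.ofReal_zero, Complex.zero_cpow] at h4
      intro h0
      rw [neg_eq_zero] at h0
      rw [h0] at hm
      simp at hm
    · exact (hpc.tendsto 0).mono_left nhdsWithin_le_nhds
  rw [zero_mul, sub_zero] at h2
  refine tendsto_nhds_unique (h1.congr' ?_) h2
  filter_upwards [self_mem_nhdsWithin] with α hα
  rw [hg, integral_fibre_eq hL m u x hh hα hβ, push_apply_eq P u x hh hα]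

end Locality
end HCalc

namespace HCalc
open MeasureTheory

/-! ### Mellin integrals of densities along the zoom action -/

section MellinDens

variable {d N : ℕ} {M : Type u} [TopologicalSpace M] [ChartedSpace (Euc d) M]
  [IsManifold (𝓡 d) ∞ M] {H : LieFiltration d N M} {ψ : H.Splitting} {D : ψ.Exponential}
  {x₀ y₀ : M} {X : ψ.GradedFrame}

open LieFiltration.Splitting TGroupoid

theorem IsProper.compactSpace_inter {f : FibredDensity D} (hp : f.IsProper) (a₀ : Euc d)
    (ha : a₀ ∈ (chartAt (Euc d) x₀).target) :
    ∃ ρ > 0, Metric.closedBall a₀ ρ ⊆ (chartAt (Euc d) x₀).target ∧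
      IsCompact (f.support ∩ TGroupoid.r D ⁻¹'
        (((chartAt (Euc d) x₀).symm '' Metric.closedBall a₀ ρ) ×ˢ Icc (-1) 1)) := by
  obtain ⟨ρ, hρ, hsub⟩ := Metric.nhds_basis_closedBall.mem_iff.1
    ((chartAt (Euc d) x₀).open_target.mem_nhds ha)
  exact ⟨ρ, hρ, hsub, (hp _ (((isCompact_closedBall a₀ ρ).image_of_continuousOn
    ((chartAt (Euc d) x₀).continuousOn_symm.mono hsub)).prod isCompact_Icc)).1⟩

theorem coeff_ne_zero_mem_support {f : FibredDensity D} {p : Par d}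
    (hf : f.coeff (maxIndex D x₀ X) p ≠ 0) : expParam D x₀ X p ∈ f.support := by
  obtain ⟨a, z, h⟩ := p
  refine subset_closure ?_
  by_cases hh : h = 0
  · subst hh
    rw [expParam_zero]
    intro h0
    rw [FibredDensity.coeff_maxIndex_zero, h0] at hf
    exact hf rfl
  · rw [expParam_ne_zero _ _ hh]
    intro h0
    refine hf ?_
    change (if h = 0 then _ else (f.pair _ (expW D x₀ X (a, scale X h z)) h).1 _) = _
    rw [if_neg hh, h0]
    rfl

theorem FibredDensity.continuousOn_coeff {f : FibredDensity D} (hc : f.IsContinuous) :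
    ContinuousOn (f.coeff (maxIndex D x₀ X)) (domO D x₀ X) := hc (maxIndex D x₀ X)

theorem continuousAt_coeff_zoom {f : FibredDensity D} (hc : f.IsContinuous) {p : Par d}
    (hp : p ∈ domO D x₀ X) {t : ℝ} (ht : t ≠ 0) :
    ContinuousAt (fun q : Par d × ℝ => f.coeff (maxIndex D x₀ X)
      (q.1.1, scale X q.2⁻¹ q.1.2.1, q.2 * q.1.2.2)) (p, t) := by
  have h1 := (FibredDensity.continuousOn_coeff (x₀ := x₀) (X := X) hc).continuousAt
    (isOpen_domO.mem_nhds ((zoom_mem_domO_iff ht).2 hp))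
  refine ContinuousAt.comp (f := fun q : Par d × ℝ =>
    (q.1.1, scale X q.2⁻¹ q.1.2.1, q.2 * q.1.2.2)) h1 ?_
  have h2 : ContinuousAt (fun q : Par d × ℝ => ((q.1.2.1, q.2⁻¹) : Euc d × ℝ)) (p, t) :=
    ContinuousAt.prodMk (by fun_prop) (continuousAt_snd.inv₀ ht)
  refine ContinuousAt.prodMk (by fun_prop) (ContinuousAt.prodMk ?_ (by fun_prop))
  exact ContinuousAt.comp (g := fun q : Euc d × ℝ => scale X q.2 q.1)
    (f := fun q : Par d × ℝ => ((q.1.2.1, q.2⁻¹) : Euc d × ℝ))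
    (contDiff_scale X).continuous.continuousAt h2

/-- The zooms of a properly supported continuous density are locally bounded in exponential
coordinates. -/
theorem exists_bound_coeff_zoom [T2Space M] {f : FibredDensity D} (hc : f.IsContinuous)
    (hp : f.IsProper) {p₀ : Par d} (hp₀ : p₀ ∈ domO D x₀ X) (β : ℝ) :
    ∃ C, ∀ᶠ p in 𝓝 p₀, ∀ t ∈ Ioc 0 β,
      ‖f.coeff (maxIndex D x₀ X) (p.1, scale X t⁻¹ p.2.1, t * p.2.2)‖ ≤ C := by
  have ha : p₀.1 ∈ baseW x₀ X := hp₀.1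
  set x := (chartAt (Euc d) x₀).symm p₀.1 with hx
  have hxs : x ∈ (chartAt (Euc d) x₀).source := (chartAt (Euc d) x₀).map_target ha.1
  have hxa : chartAt (Euc d) x₀ x = p₀.1 := (chartAt (Euc d) x₀).right_inv ha.1
  obtain ⟨ρ₀, hρ₀, -, hcomp⟩ := IsProper.compactSpace_inter hp p₀.1 ha.1
  obtain ⟨n, δ, hδ, W, hW, hbd⟩ := exists_bound_of_isCompact hcomp hxs ha.2
  obtain ⟨ρ, hρ, δ', hδ', hδδ, hρW, htube⟩ := exists_tube (D := D) hxs ha.2 n hW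
    (lt_min hδ one_pos)
  rw [hxa] at hρW htube
  have hcpt : IsCompact (Metric.closedBall p₀.1 ρ ×ˢ (Metric.closedBall (0 : Euc d) n ×ˢ
      Metric.closedBall (0 : ℝ) δ')) :=
    (isCompact_closedBall _ _).prod ((isCompact_closedBall _ _).prod (isCompact_closedBall _ _))
  obtain ⟨C₁, hC₁⟩ := hcpt.exists_bound_of_continuousOn
    ((FibredDensity.continuousOn_coeff (x₀ := x₀) (X := X) hc).mono
      (htube.trans chartO_subset))
  -- times `t ≥ t₁` form a compact interval; for `t ≤ t₁`, the point lies in the tube around the zero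
  -- fibre, or outside of the support
  set t₁ := δ' / (|p₀.2.2| + 1) with ht₁
  have ht₁0 : 0 < t₁ := by positivity
  obtain ⟨C₂, hC₂⟩ := eventually_bound_of_compact (k := Icc t₁ β) isCompact_Icc (x := p₀)
    (F := fun p t => f.coeff (maxIndex D x₀ X) (p.1, scale X t⁻¹ p.2.1, t * p.2.2))
    fun t ht => continuousAt_coeff_zoom hc hp₀ (ht₁0.trans_le ht.1).ne'
  have h1 : ∀ᶠ p : Par d in 𝓝 p₀, p.1 ∈ Metric.closedBall p₀.1 (min ρ ρ₀) :=
    continuousAt_fst.eventually (Metric.closedBall_mem_nhds _ (lt_min hρ hρ₀))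
  have h2 : ∀ᶠ p : Par d in 𝓝 p₀, |p.2.2| < |p₀.2.2| + 1 :=
    (by fun_prop : Continuous fun p : Par d => |p.2.2|).continuousAt.eventually
      (gt_mem_nhds (lt_add_one _))
  refine ⟨max (max C₁ C₂) 0, ?_⟩
  filter_upwards [hC₂, h1, h2, isOpen_domO.mem_nhds hp₀] with p hp2 hpa hph hpD t ht
  rcases le_total t₁ t with htt | htt
  · exact (hp2 t ⟨htt, ht.2⟩).trans ((le_max_right _ _).trans (le_max_left _ _))
  by_cases h0 : f.coeff (maxIndex D x₀ X) (p.1, scale X t⁻¹ p.2.1, t * p.2.2) = 0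
  · rw [h0, norm_zero]
    exact le_max_right _ _
  have hth : |t * p.2.2| ≤ δ' := by
    rw [abs_mul, abs_of_pos ht.1]
    calc t * |p.2.2| ≤ t₁ * (|p₀.2.2| + 1) :=
          mul_le_mul htt hph.le (abs_nonneg _) ht₁0.le
      _ = δ' := div_mul_cancel₀ _ (by positivity)
  have hthδ : |t * p.2.2| < δ := (hth.trans_lt hδδ).trans_le (min_le_left _ _)
  have hth1 : |t * p.2.2| ≤ 1 := ((hth.trans_lt hδδ).trans_le (min_le_right _ _)).le
  have hpa' : p.1 ∈ Metric.closedBall p₀.1 ρ :=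
    Metric.closedBall_subset_closedBall (min_le_left _ _) hpa
  have hmem := (zoom_mem_domO_iff (D := D) (x₀ := x₀) (X := X) (a := p.1) (z := p.2.1)
    (h := p.2.2) ht.1.ne').2 hpD
  obtain ⟨p', hp', hpp', hn⟩ := hbd (expParam D x₀ X (p.1, scale X t⁻¹ p.2.1, t * p.2.2))
    ⟨coeff_ne_zero_mem_support h0, by
      rw [mem_preimage, r_expParam]
      exact ⟨⟨p.1, Metric.closedBall_subset_closedBall (min_le_right _ _) hpa, rfl⟩,
        abs_le.1 hth1⟩⟩
    (by rw [r_expParam]; exact hρW ⟨p.1, hpa', rfl⟩) (by rw [r_expParam]; exact hthδ)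
  rw [injOn_expParam hp' hmem hpp'] at hn
  refine (hC₁ (p.1, scale X t⁻¹ p.2.1, t * p.2.2) ⟨hpa', ?_, ?_⟩).trans
    ((le_max_left _ _).trans (le_max_left _ _))
  · simpa using hn.le
  · simpa using hth

/-- In product coordinates, the zooms of a properly supported continuous density grow at most like
`t ^ (-d_H)`: near height zero the density is bounded in exponential coordinates, and the change of
coordinates has the Jacobian determinant `(t h) ^ d_H`, up to a factor bounded from below. -/
theorem exists_bound_pairCoeff_zoom [T2Space M] {f : FibredDensity D} (hc : f.IsContinuous)
    (hp : f.IsProper) {x₁ y₁ : M} {p₀ : Par d} (hp₀ : p₀ ∈ (atlas D).dom (.pair x₁ y₁)) (β : ℝ) :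
    ∃ C, ∀ᶠ p in 𝓝 p₀, ∀ t ∈ Ioc 0 β,
      ‖f.coeff (.pair x₁ y₁) (p.1, p.2.1, t * p.2.2)‖ ≤ C * (t ^ H.homDim)⁻¹ := by
  obtain ⟨ha, hb, hh⟩ := hp₀
  replace hh : p₀.2.2 ≠ 0 := hh
  set x := (chartAt (Euc d) x₁).symm p₀.1 with hx
  set y := (chartAt (Euc d) y₁).symm p₀.2.1 with hy
  have hxs : x ∈ (chartAt (Euc d) x₁).source := (chartAt (Euc d) x₁).map_target ha
  have hys : y ∈ (chartAt (Euc d) y₁).source := (chartAt (Euc d) y₁).map_target hb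
  have hxa : chartAt (Euc d) x₁ x = p₀.1 := (chartAt (Euc d) x₁).right_inv ha
  obtain ⟨X, hxX⟩ := exists_gradedFrame ψ x
  have hbase : p₀.1 ∈ baseW x₁ X := ⟨ha, hxX⟩
  obtain ⟨ρ₀, hρ₀, -, hcomp⟩ := IsProper.compactSpace_inter hp p₀.1 ha
  obtain ⟨n, δ, hδ, W, hW, hbd⟩ := exists_bound_of_isCompact hcomp hxs hxX
  -- near height zero the two points are close to each other
  obtain ⟨V, hVo, hyV, O, hO, hOD, hO0, hOV⟩ : ∃ V : Set M, IsOpen V ∧ y ∈ V ∧ ∃ O : Set (Par d),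
      IsOpen O ∧ O ⊆ domO D x₁ X ∧ (∀ z, (chartAt (Euc d) x₁ x, z, (0 : ℝ)) ∈ O) ∧
      (O ⊆ chartO D x₁ X y₁ ∨ ∀ p ∈ O, expW D x₁ X (p.1, scale X p.2.2 p.2.1) ∉ V) := by
    have hz0 : ∀ z, ((p₀.1, scale X 0 z) : Euc d × Euc d) = (p₀.1, 0) := fun z => by
      rw [scale_zero_left]
    by_cases hxy : x = y
    · refine ⟨univ, isOpen_univ, mem_univ _, chartO D x₁ X y₁, isOpen_chartO, chartO_subset,
        fun z => ?_, Or.inl subset_rfl⟩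
      rw [hxa]
      change (p₀.1, scale X 0 z) ∈ chartW D x₁ X y₁
      rw [hz0]
      exact zero_mem_chartW hbase (by rw [← hx, hxy]; exact hys)
    · obtain ⟨V', V, h1, h2, h3, h4, h5⟩ := t2_separation hxy
      refine ⟨V, h2, h4, {p | (p.1, scale X p.2.2 p.2.1) ∈ domW D x₁ X ∩ expW D x₁ X ⁻¹' V'},
        (continuousOn_expW.isOpen_inter_preimage isOpen_domW h1).preimage
          (contDiff_toW X).continuous, fun p hp => hp.1, fun z => ?_,
        Or.inr fun p hp hpV => h5.le_bot ⟨hp.2, hpV⟩⟩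
      rw [hxa]
      change (p₀.1, scale X 0 z) ∈ domW D x₁ X ∩ expW D x₁ X ⁻¹' V'
      rw [hz0]
      exact ⟨zero_mem_domW hbase, by rwa [mem_preimage, expW_zero hbase]⟩
  obtain ⟨ρ, hρ, δ', hδ', hδδ, hρW, htube⟩ := exists_tube_of_isOpen hxs hO hO0 n hW
    (lt_min hδ one_pos)
  rw [hxa] at hρW htube
  set K := Metric.closedBall p₀.1 ρ ×ˢ (Metric.closedBall (0 : Euc d) n ×ˢ
      Metric.closedBall (0 : ℝ) δ') with hK
  have hcpt : IsCompact K :=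
    (isCompact_closedBall _ _).prod ((isCompact_closedBall _ _).prod (isCompact_closedBall _ _))
  obtain ⟨C₁, hC₁⟩ := hcpt.exists_bound_of_continuousOn
    ((FibredDensity.continuousOn_coeff (x₀ := x₁) (X := X) hc).mono (htube.trans hOD))
  obtain ⟨c, hc0, hcK⟩ : ∃ c > 0, ∀ p ∈ K, expW D x₁ X (p.1, scale X p.2.2 p.2.1) ∈ V →
      p ∈ chartO D x₁ X y₁ ∧ c ≤ |jacW D x₁ X y₁ (p.1, scale X p.2.2 p.2.1)| := by
    rcases hOV with hOV | hOV
    · have hcont : ContinuousOn (fun p : Par d => |jacW D x₁ X y₁ (p.1, scale X p.2.2 p.2.1)|) K :=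
        (continuousOn_jacW.comp (contDiff_toW X).continuous.continuousOn
          fun p hp => hOV (htube hp)).abs
      obtain ⟨c, hc0, h⟩ := hcpt.exists_forall_le' hcont (a := 0) fun p hp =>
        abs_pos.2 (jacW_ne_zero (hOV (htube hp)))
      exact ⟨c, hc0, fun p hp _ => ⟨hOV (htube hp), h p hp⟩⟩
    · exact ⟨1, one_pos, fun p hp h => absurd h (hOV p (htube hp))⟩
  set t₁ := δ' / (|p₀.2.2| + 1) with ht₁
  have ht₁0 : 0 < t₁ := by positivity
  obtain ⟨C₂, hC₂⟩ := eventually_bound_of_compact (k := Icc t₁ β) isCompact_Icc (x := p₀)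
    (F := fun p t => f.coeff (.pair x₁ y₁) (p.1, p.2.1, t * p.2.2)) fun t ht => by
      have ht0 : t * p₀.2.2 ≠ 0 := mul_ne_zero (ht₁0.trans_le ht.1).ne' hh
      exact ContinuousAt.comp (f := fun q : Par d × ℝ => (q.1.1, q.1.2.1, q.2 * q.1.2.2))
        ((hc (.pair x₁ y₁)).continuousAt (((atlas D).isOpen_dom _).mem_nhds ⟨ha, hb, ht0⟩))
        (by fun_prop)
  have h1 : ∀ᶠ p : Par d in 𝓝 p₀, p.1 ∈ Metric.closedBall p₀.1 (min ρ ρ₀) :=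
    continuousAt_fst.eventually (Metric.closedBall_mem_nhds _ (lt_min hρ hρ₀))
  have habs : Continuous fun p : Par d => |p.2.2| := by fun_prop
  have h2 : ∀ᶠ p : Par d in 𝓝 p₀, |p.2.2| < |p₀.2.2| + 1 :=
    habs.continuousAt.eventually (gt_mem_nhds (lt_add_one _))
  have h3 : ∀ᶠ p : Par d in 𝓝 p₀, |p₀.2.2| / 2 < |p.2.2| :=
    habs.continuousAt.eventually (lt_mem_nhds (half_lt_self (abs_pos.2 hh)))
  have h4 : ∀ᶠ p : Par d in 𝓝 p₀, (chartAt (Euc d) y₁).symm p.2.1 ∈ V := by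
    have hcy : ContinuousAt (fun p : Par d => (chartAt (Euc d) y₁).symm p.2.1) p₀ :=
      ContinuousAt.comp (f := fun p : Par d => p.2.1)
        ((chartAt (Euc d) y₁).continuousAt_symm hb) (by fun_prop)
    exact hcy.eventually (hVo.mem_nhds hyV)
  have hh2 : 0 < |p₀.2.2| / 2 := half_pos (abs_pos.2 hh)
  set C₃ := max C₁ 0 / ((|p₀.2.2| / 2) ^ H.homDim * c) with hC₃
  have hC₃0 : 0 ≤ C₃ := by positivity
  refine ⟨C₃ + max C₂ 0 * β ^ H.homDim, ?_⟩
  filter_upwards [hC₂, h1, h2, h3, h4, ((atlas D).isOpen_dom (.pair x₁ y₁)).mem_nhds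
    (show p₀ ∈ (atlas D).dom (.pair x₁ y₁) from ⟨ha, hb, hh⟩)] with p hp2 hpa hph hph' hpV hpD t ht
  have htq : 0 < t ^ H.homDim := pow_pos ht.1 _
  have hβ0 : 0 < β := ht.1.trans_le ht.2
  rcases le_total t₁ t with htt | htt
  · refine (hp2 t ⟨htt, ht.2⟩).trans ((le_max_left C₂ 0).trans ?_)
    rw [← div_eq_mul_inv, le_div_iff₀ htq]
    refine (mul_le_mul_of_nonneg_left (pow_le_pow_left₀ ht.1.le ht.2 H.homDim)
      (le_max_right C₂ 0)).trans ?_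
    linarith
  have hthq : t * p.2.2 ≠ 0 := mul_ne_zero ht.1.ne' hpD.2.2
  by_cases h0 : f.coeff (.pair x₁ y₁) (p.1, p.2.1, t * p.2.2) = 0
  · rw [h0, norm_zero]
    positivity
  have hth : |t * p.2.2| ≤ δ' := by
    rw [abs_mul, abs_of_pos ht.1]
    calc t * |p.2.2| ≤ t₁ * (|p₀.2.2| + 1) :=
          mul_le_mul htt hph.le (abs_nonneg _) ht₁0.le
      _ = δ' := div_mul_cancel₀ _ (by positivity)
  have hthδ : |t * p.2.2| < δ := (hth.trans_lt hδδ).trans_le (min_le_left _ _)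
  have hth1 : |t * p.2.2| ≤ 1 := ((hth.trans_lt hδδ).trans_le (min_le_right _ _)).le
  have hpa' : p.1 ∈ Metric.closedBall p₀.1 ρ :=
    Metric.closedBall_subset_closedBall (min_le_left _ _) hpa
  have hsupp : (TGroupoid.pair ((chartAt (Euc d) x₁).symm p.1) ((chartAt (Euc d) y₁).symm p.2.1)
      (t * p.2.2) hthq : TGroupoid D) ∈ f.support := by
    refine subset_closure fun h5 => h0 ?_
    change (f.pair _ _ _).1 _ = 0
    rw [h5]
    rfl
  obtain ⟨⟨a', z', h'⟩, hp', hpp', hn⟩ := hbd _ ⟨hsupp, ⟨⟨p.1,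
    Metric.closedBall_subset_closedBall (min_le_right _ _) hpa, rfl⟩, abs_le.1 hth1⟩⟩
    (hρW ⟨p.1, hpa', rfl⟩) hthδ
  have hr := congrArg (TGroupoid.r D) hpp'
  rw [r_expParam] at hr
  have hr1 : a' = p.1 := (chartAt (Euc d) x₁).symm.injOn hp'.1.1 hpD.1 (congrArg Prod.fst hr)
  have hr2 : h' = t * p.2.2 := congrArg Prod.snd hr
  subst hr1 hr2
  rw [expParam_ne_zero _ _ hthq] at hpp'
  have hy' : expW D x₁ X (p.1, scale X (t * p.2.2) z') = (chartAt (Euc d) y₁).symm p.2.1 := by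
    injection hpp'
  have hpK : (p.1, z', t * p.2.2) ∈ K := ⟨hpa', by simpa using hn.le, by simpa using hth⟩
  obtain ⟨hch, hjac⟩ := hcK _ hpK (by rw [hy']; exact hpV)
  have h6 := FibredDensity.coeff_maxIndex_ne_zero f hthq hch
  have h7 : f.coeff (.pair x₁ y₁) (p.1, p.2.1, t * p.2.2) =
      (f.pair ((chartAt (Euc d) x₁).symm p.1) (expW D x₁ X (p.1, scale X (t * p.2.2) z'))
        (t * p.2.2)).1 (chartFrame y₁ _) := by
    rw [hy']
    rfl
  have h8 := hC₁ _ hpK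
  rw [h6, ← h7, norm_mul, Complex.norm_real, Real.norm_eq_abs, abs_abs, abs_mul, abs_pow, abs_mul,
    abs_of_pos ht.1, mul_pow] at h8
  have h9 : t ^ H.homDim * ((|p₀.2.2| / 2) ^ H.homDim * c) ≤
      t ^ H.homDim * |p.2.2| ^ H.homDim * |jacW D x₁ X y₁ (p.1, scale X (t * p.2.2) z')| := by
    rw [mul_assoc]
    refine mul_le_mul_of_nonneg_left (mul_le_mul (pow_le_pow_left₀ hh2.le hph'.le _) hjac hc0.le
      (by positivity)) htq.le
  have h10 : ‖f.coeff (.pair x₁ y₁) (p.1, p.2.1, t * p.2.2)‖ ≤ C₃ * (t ^ H.homDim)⁻¹ := by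
    rw [hC₃, ← div_eq_mul_inv, div_div, le_div_iff₀ (by positivity)]
    calc _ ≤ ‖f.coeff (.pair x₁ y₁) (p.1, p.2.1, t * p.2.2)‖ *
          (t ^ H.homDim * |p.2.2| ^ H.homDim *
            |jacW D x₁ X y₁ (p.1, scale X (t * p.2.2) z')|) := by
          refine mul_le_mul_of_nonneg_left ?_ (norm_nonneg _)
          rw [mul_comm _ (t ^ H.homDim)]
          exact h9
      _ ≤ C₁ := by rw [mul_comm]; exact h8
      _ ≤ max C₁ 0 := le_max_left _ _
  refine h10.trans (mul_le_mul_of_nonneg_right ?_ (by positivity))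
  have : 0 ≤ max C₂ 0 * β ^ H.homDim := by positivity
  linarith

variable (H) in
theorem dil_linear (t : ℝ) {x : M} {ι : Type*} [Fintype ι] (c : ι → ℝ) (ζ : ι → H.Osc x) :
    H.dil t (∑ j, c j • ζ j) = ∑ j, c j • H.dil t (ζ j) := by
  funext k
  simp only [LieFiltration.dil, Finset.sum_apply, Pi.smul_apply, Finset.smul_sum]
  exact Finset.sum_congr rfl fun j _ => smul_comm _ _ _

theorem dil_symm_vec {x : M} (hx : x ∈ X.carrier) (t : ℝ) (i : Fin d) :
    H.dil t ((ψ.iso x).symm (X.vec i x)) =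
      t ^ ((X.weight i : ℕ) + 1) • (ψ.iso x).symm (X.vec i x) := by
  have h := dil_symm_sum X x hx t (EuclideanSpace.single i (1 : ℝ))
  simpa [PiLp.single_apply, Finset.sum_ite_eq'] using h

theorem dens_dil (ψ : H.Splitting) {x : M} (ρ : Dens d (H.Osc x)) (t : ℝ) (v : Fin d → H.Osc x) :
    ρ.1 (fun i => H.dil t (v i)) = ((|t| ^ H.homDim : ℝ) : ℂ) * ρ.1 v := by
  obtain ⟨X, hx⟩ := exists_gradedFrame ψ x
  set e : Fin d → H.Osc x := fun i => (ψ.iso x).symm (X.vec i x) with he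
  have hspan : ∀ ζ : H.Osc x, ∃ c : Fin d → ℝ, ∑ j, c j • e j = ζ := fun ζ => by
    obtain ⟨w, hw⟩ := (frameEquiv X hx).surjective (ψ.iso x ζ)
    refine ⟨w, ?_⟩
    rw [← (ψ.iso x).symm_apply_apply ζ, ← hw, frameEquiv_apply, frameVec, map_sum]
    exact Finset.sum_congr rfl fun j _ => (map_smul _ _ _).symm
  choose c hc using hspan
  have hv : v = fun i => ∑ j, Matrix.of (fun i => c (v i)) i j • e j := funext fun i => (hc _).symm
  have h1 : ρ.1 (fun i => H.dil t (e i)) = ((|t| ^ H.homDim : ℝ) : ℂ) * ρ.1 e := by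
    have h2 := ρ.2 (Matrix.diagonal fun i => t ^ ((X.weight i : ℕ) + 1)) e
    rw [Matrix.det_diagonal, prod_pow_weight X hx, abs_pow] at h2
    rw [← h2]
    refine congrArg ρ.1 (funext fun i => ?_)
    rw [he, dil_symm_vec hx, Finset.sum_eq_single i]
    · rw [Matrix.diagonal_apply_eq]
    · intro j _ hj
      rw [Matrix.diagonal_apply_ne _ hj.symm]
      exact zero_smul ℝ (e j)
    · simp
  rw [hv, ρ.2]
  simp only [dil_linear]
  rw [ρ.2, h1]
  ring

/-- The density `∫ t^{-m-1} (α_t)_* f dt` over `[α, β]`. -/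
def mellinDens (f : FibredDensity D) (m : ℂ) (α β : ℝ) : FibredDensity D where
  osc x ζ := ⟨fun v => ∫ t in α..β, (t : ℂ) ^ (-m - 1) *
      (f.osc x (H.dil t⁻¹ ζ)).1 (fun i => H.dil t⁻¹ (v i)), fun A v => by
    rw [← intervalIntegral.integral_const_mul]
    beta_reduce
    congr 1
    funext t
    simp only [dil_linear]
    rw [(f.osc x (H.dil t⁻¹ ζ)).2]
    ring⟩
  pair x y h := ⟨fun v => ∫ t in α..β, (t : ℂ) ^ (-m - 1) * (f.pair x y (t * h)).1 v,
    fun A v => by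
      rw [← intervalIntegral.integral_const_mul]
      beta_reduce
      congr 1
      funext t
      rw [(f.pair x y (t * h)).2]
      ring⟩

theorem cpow_sub_natCast {t : ℝ} (ht : 0 < t) (m : ℂ) (q : ℕ) :
    (t : ℂ) ^ (-m - 1 - q) = (t : ℂ) ^ (-m - 1) * ((t : ℂ) ^ q)⁻¹ := by
  rw [Complex.cpow_sub _ _ (Complex.ofReal_ne_zero.2 ht.ne'), Complex.cpow_natCast, div_eq_mul_inv]

theorem mellinDens_coeff {f : FibredDensity D} {m : ℂ} {α β : ℝ} (hα : 0 ≤ α) (hαβ : α ≤ β)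
    {a z : Euc d} {h : ℝ} (hp : (a, z, h) ∈ domO D x₀ X) :
    (mellinDens f m α β).coeff (maxIndex D x₀ X) (a, z, h) =
      ∫ t in α..β, (t : ℂ) ^ (-m - 1 - H.homDim) *
        f.coeff (maxIndex D x₀ X) (a, scale X t⁻¹ z, t * h) := by
  have hpos : ∀ t ∈ uIoc α β, 0 < t := fun t ht => by
    rw [uIoc_of_le hαβ] at ht
    exact hα.trans_lt ht.1
  have hX : (chartAt (Euc d) x₀).symm a ∈ X.carrier := hp.1.2
  by_cases hh : h = 0
  · subst hh
    rw [FibredDensity.coeff_maxIndex_zero]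
    refine intervalIntegral.integral_congr_ae (Eventually.of_forall fun t ht => ?_)
    have ht0 := hpos t ht
    rw [mul_zero, FibredDensity.coeff_maxIndex_zero]
    have h1 : H.dil t⁻¹ ((ψ.iso _).symm (frameVec X ((chartAt (Euc d) x₀).symm a) z)) =
        (ψ.iso _).symm (frameVec X ((chartAt (Euc d) x₀).symm a) (scale X t⁻¹ z)) :=
      dil_symm_sum X _ hX t⁻¹ z
    rw [dens_dil ψ, h1, cpow_sub_natCast ht0, abs_inv, abs_of_pos ht0, inv_pow]
    push_cast
    ring
  · set y := expW D x₀ X (a, scale X h z) with hy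
    have hch : (a, scale X h z) ∈ chartW D x₀ X y := ⟨hp, mem_chart_source _ _⟩
    rw [FibredDensity.coeff_maxIndex_ne_zero _ hh hch]
    change _ * (∫ t in α..β, _) = _
    rw [← intervalIntegral.integral_const_mul]
    refine intervalIntegral.integral_congr_ae (Eventually.of_forall fun t ht => ?_)
    have ht0 := hpos t ht
    have h1 : scale X (t * h) (scale X t⁻¹ z) = scale X h z := by
      rw [scale_scale, mul_comm t h, mul_assoc, mul_inv_cancel₀ ht0.ne', mul_one]
    rw [FibredDensity.coeff_maxIndex_ne_zero (y₀ := y) _ (mul_ne_zero ht0.ne' hh)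
      (by rw [h1]; exact hch), h1, cpow_sub_natCast ht0, mul_pow, mul_assoc (t ^ H.homDim),
      abs_mul (t ^ H.homDim), abs_of_pos (pow_pos ht0 _)]
    have : (t : ℂ) ≠ 0 := Complex.ofReal_ne_zero.2 ht0.ne'
    push_cast
    field_simp

theorem continuousAt_coeff_zoom_right {f : FibredDensity D} (hc : f.IsContinuous) {p : Par d}
    (hp : p ∈ domO D x₀ X) {t : ℝ} (ht : t ≠ 0) :
    ContinuousAt (fun t => f.coeff (maxIndex D x₀ X) (p.1, scale X t⁻¹ p.2.1, t * p.2.2)) t :=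
  ContinuousAt.comp (f := fun t => (p, t)) (continuousAt_coeff_zoom hc hp ht) (by fun_prop)

theorem continuousAt_coeff_zoom_left {f : FibredDensity D} (hc : f.IsContinuous) {p : Par d}
    (hp : p ∈ domO D x₀ X) {t : ℝ} (ht : t ≠ 0) : ContinuousAt (fun p : Par d =>
      f.coeff (maxIndex D x₀ X) (p.1, scale X t⁻¹ p.2.1, t * p.2.2)) p :=
  ContinuousAt.comp (f := fun p => (p, t)) (continuousAt_coeff_zoom hc hp ht) (by fun_prop)

theorem continuousAt_pairCoeff_zoom {f : FibredDensity D} (hc : f.IsContinuous) {x₁ y₁ : M}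
    {p : Par d} (hp : p ∈ (atlas D).dom (.pair x₁ y₁)) {t : ℝ} (ht : t ≠ 0) :
    ContinuousAt (fun q : Par d × ℝ => f.coeff (.pair x₁ y₁) (q.1.1, q.1.2.1, q.2 * q.1.2.2))
      (p, t) :=
  ContinuousAt.comp (f := fun q : Par d × ℝ => (q.1.1, q.1.2.1, q.2 * q.1.2.2))
    ((hc (.pair x₁ y₁)).continuousAt (((atlas D).isOpen_dom _).mem_nhds
      ⟨hp.1, hp.2.1, mul_ne_zero ht hp.2.2⟩)) (by fun_prop)

theorem norm_cpow_sub {t : ℝ} (ht : 0 < t) (m : ℂ) (q : ℕ) :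
    ‖(t : ℂ) ^ (-m - 1)‖ * (t ^ q)⁻¹ = ‖(t : ℂ) ^ (-m - 1 - q)‖ := by
  rw [cpow_sub_natCast ht, norm_mul, norm_inv, norm_pow, Complex.norm_real, Real.norm_eq_abs,
    abs_of_pos ht]

/-- Continuity of Mellin integrals, by dominated convergence. -/
theorem mellinDens_isContinuous [T2Space M] {f : FibredDensity D} (hc : f.IsContinuous)
    (hp : f.IsProper) {m : ℂ} {α β : ℝ} (hα : 0 ≤ α) (hαβ : α ≤ β)
    (hI : IntervalIntegrable (fun t : ℝ => (t : ℂ) ^ (-m - 1 - H.homDim)) volume α β) :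
    (mellinDens f m α β).IsContinuous := by
  have hpos : ∀ t ∈ uIoc α β, 0 < t := fun t ht => by
    rw [uIoc_of_le hαβ] at ht
    exact hα.trans_lt ht.1
  have hcp : ∀ w : ℂ, ContinuousOn (fun t : ℝ => (t : ℂ) ^ w) (uIoc α β) := fun w t ht =>
    (Complex.continuousAt_ofReal_cpow_const _ _ (Or.inr (hpos t ht).ne')).continuousWithinAt
  intro i
  cases i with
  | pair x₁ y₁ =>
    intro p₀ hp₀
    refine ContinuousAt.continuousWithinAt ?_
    obtain ⟨C, hC⟩ := exists_bound_pairCoeff_zoom hc hp hp₀ β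
    change ContinuousAt (fun p : Par d => ∫ t in α..β, (t : ℂ) ^ (-m - 1) *
      f.coeff (.pair x₁ y₁) (p.1, p.2.1, t * p.2.2)) p₀
    refine intervalIntegral.continuousAt_of_dominated_interval
      (bound := fun t : ℝ => ‖(t : ℂ) ^ (-m - 1 - H.homDim)‖ * C) ?_ ?_ (hI.norm.mul_const C) ?_
    · filter_upwards [((atlas D).isOpen_dom (.pair x₁ y₁)).mem_nhds hp₀] with p hpD
      refine ContinuousOn.aestronglyMeasurable ((hcp _).mul fun t ht =>
        ContinuousAt.continuousWithinAt ?_) measurableSet_uIoc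
      exact ContinuousAt.comp (f := fun t => (p, t))
        (continuousAt_pairCoeff_zoom hc hpD (hpos t ht).ne') (by fun_prop)
    · filter_upwards [hC] with p hpC
      refine Eventually.of_forall fun t ht => ?_
      have ht0 := hpos t ht
      rw [uIoc_of_le hαβ] at ht
      rw [norm_mul, ← norm_cpow_sub ht0, mul_assoc, mul_comm _ C]
      exact mul_le_mul_of_nonneg_left (hpC t ⟨ht0, ht.2⟩) (norm_nonneg _)
    · refine Eventually.of_forall fun t ht => continuousAt_const.mul ?_
      exact ContinuousAt.comp (f := fun p => (p, t))
        (continuousAt_pairCoeff_zoom hc hp₀ (hpos t ht).ne') (by fun_prop)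
  | exp x₁ X₁ O hO hsub =>
    intro p₀ hp₀
    refine ContinuousAt.continuousWithinAt ?_
    have hp₀D : p₀ ∈ domO D x₁ X₁ := subset_domO hsub hp₀
    change ContinuousAt ((mellinDens f m α β).coeff (maxIndex D x₁ X₁)) p₀
    obtain ⟨C, hC⟩ := exists_bound_coeff_zoom hc hp hp₀D β
    have hev : (mellinDens f m α β).coeff (maxIndex D x₁ X₁) =ᶠ[𝓝 p₀] fun p => ∫ t in α..β,
        (t : ℂ) ^ (-m - 1 - H.homDim) *
          f.coeff (maxIndex D x₁ X₁) (p.1, scale X₁ t⁻¹ p.2.1, t * p.2.2) := by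
      filter_upwards [isOpen_domO.mem_nhds hp₀D] with p hpD
      exact mellinDens_coeff hα hαβ hpD
    refine ContinuousAt.congr ?_ hev.symm
    refine intervalIntegral.continuousAt_of_dominated_interval
      (bound := fun t : ℝ => ‖(t : ℂ) ^ (-m - 1 - H.homDim)‖ * C) ?_ ?_ (hI.norm.mul_const C) ?_
    · filter_upwards [isOpen_domO.mem_nhds hp₀D] with p hpD
      exact ContinuousOn.aestronglyMeasurable ((hcp _).mul fun t ht =>
        (continuousAt_coeff_zoom_right hc hpD (hpos t ht).ne').continuousWithinAt)
        measurableSet_uIoc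
    · filter_upwards [hC] with p hpC
      refine Eventually.of_forall fun t ht => ?_
      have ht0 := hpos t ht
      rw [uIoc_of_le hαβ] at ht
      rw [norm_mul]
      exact mul_le_mul_of_nonneg_left (hpC t ⟨ht0, ht.2⟩) (norm_nonneg _)
    · exact Eventually.of_forall fun t ht => continuousAt_const.mul
        (continuousAt_coeff_zoom_left hc hp₀D (hpos t ht).ne')

/-- Fubini's theorem on a fibre of `r` of non-zero height. -/
theorem representsPair_mellinDens [T2Space M] {f : FibredDensity D} {F T : GroupoidDist D}
    (hF : RepresentsPair f F) (hc : f.IsContinuous) (hp : f.IsProper) {m : ℂ} {α β : ℝ}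
    (hα : 0 ≤ α) (hαβ : α ≤ β)
    (hI : IntervalIntegrable (fun t : ℝ => (t : ℂ) ^ (-m - 1 - H.homDim)) volume α β)
    (hT : ∀ (u : (atlas D).Smooth) (x : M) (h : ℝ) (hh : h ≠ 0), T.1 u (x, h) =
      ∫ t in α..β, (t : ℂ) ^ (-m - 1) * F.1 (sPull D (fibrePull u x hh)) (x, t * h)) :
    RepresentsPair (mellinDens f m α β) T := by
  intro x h hh y₀ u hu hus
  set c := chartAt (Euc d) y₀ with hcdef
  set v : Euc d → ℂ := fun b => u (.pair x (c.symm b) h hh) with hv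
  set a := chartAt (Euc d) x x with ha
  have hxa : (chartAt (Euc d) x).symm a = x := (chartAt (Euc d) x).left_inv (mem_chart_source _ _)
  set G : ℝ → Euc d → ℂ := fun t b => f.coeff (.pair x y₀) (a, b, t * h) with hG
  have hGe : ∀ t b, (f.pair x (c.symm b) (t * h)).1 (chartFrame y₀ _) = G t b := fun t b => by
    change _ = (f.pair ((chartAt (Euc d) x).symm a) _ _).1 _
    rw [hxa]
  have hpos : ∀ t ∈ Ioc α β, 0 < t := fun t ht => hα.trans_lt ht.1
  have hGdom : ∀ t ∈ Ioc α β, ∀ b ∈ c.target,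
      (a, b, t * h) ∈ (atlas D).dom (.pair x y₀) := fun t ht b hb =>
    ⟨mem_chart_target _ _, hb, mul_ne_zero (hpos t ht).ne' hh⟩
  set K := c '' tsupport (fun y => u (.pair x y h hh)) with hK
  have hKc : IsCompact K := hu.isCompact.image_of_continuousOn (c.continuousOn.mono hus)
  have hKt : K ⊆ c.target := by
    rintro _ ⟨y, hy, rfl⟩
    exact c.map_source (hus hy)
  have hv0 : ∀ b ∈ c.target, b ∉ K → v b = 0 := fun b hb hbK => by
    by_contra h0
    exact hbK ⟨c.symm b, subset_closure h0, c.right_inv hb⟩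
  have hvc : ContinuousOn v c.target :=
    ((cylinderAtlas d M).contDiffOn (fibrePull u x hh) y₀).continuousOn.comp
      (f := fun b : Euc d => (b, (0 : ℝ))) (by fun_prop) fun b hb => ⟨hb, trivial⟩
  -- a uniform bound on the compact support of the test function
  obtain ⟨C, hC0, hC⟩ : ∃ C, 0 ≤ C ∧ ∀ b ∈ K, ∀ t ∈ Ioc 0 β, ‖G t b‖ ≤ C * (t ^ H.homDim)⁻¹ := by
    refine hKc.induction_on (p := fun K => ∃ C, 0 ≤ C ∧ ∀ b ∈ K, ∀ t ∈ Ioc 0 β,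
      ‖G t b‖ ≤ C * (t ^ H.homDim)⁻¹) ⟨0, le_rfl, fun b hb => hb.elim⟩ ?_ ?_ ?_
    · rintro s t hst ⟨C, hC0, hC⟩
      exact ⟨C, hC0, fun b hb => hC b (hst hb)⟩
    · rintro s t ⟨C, hC0, hC⟩ ⟨C', hC0', hC'⟩
      refine ⟨max C C', hC0.trans (le_max_left _ _), ?_⟩
      rintro b (hb | hb) τ hτ
      · exact (hC b hb τ hτ).trans (mul_le_mul_of_nonneg_right (le_max_left _ _)
          (inv_nonneg.2 (pow_nonneg hτ.1.le _)))
      · exact (hC' b hb τ hτ).trans (mul_le_mul_of_nonneg_right (le_max_right _ _)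
          (inv_nonneg.2 (pow_nonneg hτ.1.le _)))
    · intro b hb
      obtain ⟨C, hC⟩ := exists_bound_pairCoeff_zoom hc hp
        (show (a, b, h) ∈ (atlas D).dom (.pair x y₀) from ⟨mem_chart_target _ _, hKt hb, hh⟩) β
      have h1 : ContinuousAt (fun b : Euc d => ((a, b, h) : Par d)) b := by fun_prop
      refine ⟨_, mem_nhdsWithin_of_mem_nhds (h1.eventually hC), max C 0, le_max_right _ _,
        fun b' hb' t ht => (hb' t ht).trans (mul_le_mul_of_nonneg_right (le_max_left _ _)
          (inv_nonneg.2 (pow_nonneg ht.1.le _)))⟩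
  obtain ⟨B, hB⟩ := hKc.exists_bound_of_continuousOn (hvc.mono hKt)
  have hFt : ∀ t ∈ Ioc α β, F.1 (sPull D (fibrePull u x hh)) (x, t * h) =
      ∫ b in c.target, v b * G t b := fun t ht => by
    have hth : t * h ≠ 0 := mul_ne_zero (hpos t ht).ne' hh
    rw [hF x (t * h) hth y₀ (sPull D (fibrePull u x hh)) hu hus]
    refine setIntegral_congr_fun c.open_target.measurableSet fun b _ => ?_
    change v b * (f.pair x (c.symm b) (t * h)).1 (chartFrame y₀ _) = _
    rw [hGe]
  have hint : Integrable (Function.uncurry fun (t : ℝ) b => (t : ℂ) ^ (-m - 1) * (v b * G t b))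
      ((volume.restrict (Ioc α β)).prod (volume.restrict c.target)) := by
    have hbd : Integrable (fun p : ℝ × Euc d =>
        (‖(p.1 : ℂ) ^ (-m - 1 - H.homDim)‖ * (K.indicator (fun _ => |B| * C) p.2)))
        ((volume.restrict (Ioc α β)).prod (volume.restrict c.target)) := by
      refine Integrable.mul_prod (f := fun t : ℝ => ‖(t : ℂ) ^ (-m - 1 - H.homDim)‖)
        (g := K.indicator (fun _ => |B| * C)) ?_ ?_
      · exact ((intervalIntegrable_iff_integrableOn_Ioc_of_le hαβ).1 hI).norm
      · exact ((integrable_indicator_iff hKc.measurableSet).2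
          (integrableOn_const hKc.measure_lt_top.ne)).integrableOn
    have hmeas : MeasurableSet (Ioc α β ×ˢ c.target) :=
      measurableSet_Ioc.prod c.open_target.measurableSet
    rw [Measure.prod_restrict] at hbd ⊢
    refine hbd.mono' (ContinuousOn.aestronglyMeasurable ?_ hmeas) ?_
    · rintro ⟨t, b⟩ ⟨ht, hb⟩
      refine ContinuousWithinAt.mul ?_ (ContinuousWithinAt.mul ?_ ?_)
      · exact (ContinuousAt.comp (x := (t, b)) (f := fun p : ℝ × Euc d => p.1)
          (Complex.continuousAt_ofReal_cpow_const t (-m - 1) (Or.inr (hpos t ht).ne'))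
          continuousAt_fst).continuousWithinAt
      · exact ContinuousWithinAt.comp (x := (t, b)) (g := v) (f := fun p : ℝ × Euc d => p.2)
          (hvc b hb) continuousWithinAt_snd fun p hp => hp.2
      · refine ContinuousAt.continuousWithinAt ?_
        exact ContinuousAt.comp (f := fun p : ℝ × Euc d => (a, p.2, p.1 * h))
          ((hc (.pair x y₀)).continuousAt (((atlas D).isOpen_dom _).mem_nhds (hGdom t ht b hb)))
          (by fun_prop)
    · refine (ae_restrict_iff' hmeas).2 (Eventually.of_forall ?_)
      rintro ⟨t, b⟩ ⟨ht, hb⟩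
      have ht0 := hpos t ht
      change ‖(t : ℂ) ^ (-m - 1) * (v b * G t b)‖ ≤ _
      by_cases hbK : b ∈ K
      · rw [indicator_of_mem hbK, ← norm_cpow_sub ht0, norm_mul, norm_mul]
        have h1 := hC b hbK t ⟨ht0, ht.2⟩
        have h2 := (hB b hbK).trans (le_abs_self B)
        calc _ ≤ ‖(t : ℂ) ^ (-m - 1)‖ * (|B| * (C * (t ^ H.homDim)⁻¹)) := by gcongr
          _ = _ := by ring
      · rw [hv0 b hb hbK, zero_mul, mul_zero, norm_zero, indicator_of_notMem hbK, mul_zero]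
  rw [hT u x h hh, intervalIntegral.integral_of_le hαβ]
  rw [setIntegral_congr_fun measurableSet_Ioc (g := fun t : ℝ =>
    ∫ b in c.target, (t : ℂ) ^ (-m - 1) * (v b * G t b)) fun t ht => by
      simp only [hFt t ht, integral_const_mul]]
  rw [integral_integral_swap hint]
  refine setIntegral_congr_fun c.open_target.measurableSet fun b _ => ?_
  change _ = v b * ∫ t in α..β, (t : ℂ) ^ (-m - 1) * (f.pair x (c.symm b) (t * h)).1
    (chartFrame y₀ _)
  rw [intervalIntegral.integral_of_le hαβ, ← integral_const_mul]
  refine setIntegral_congr_fun measurableSet_Ioc fun t _ => ?_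
  simp only [hGe]
  ring

theorem represents_mellinDens [T2Space M] {f : FibredDensity D} {F T : GroupoidDist D}
    (hF : f.Represents F) (hc : f.IsContinuous) (hp : f.IsProper) {m : ℂ} {α β : ℝ}
    (hα : 0 ≤ α) (hαβ : α ≤ β)
    (hI : IntervalIntegrable (fun t : ℝ => (t : ℂ) ^ (-m - 1 - H.homDim)) volume α β)
    (hT : ∀ (u : (atlas D).Smooth) (x : M) (h : ℝ) (hh : h ≠ 0), T.1 u (x, h) =
      ∫ t in α..β, (t : ℂ) ^ (-m - 1) * F.1 (sPull D (fibrePull u x hh)) (x, t * h)) :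
    (mellinDens f m α β).Represents T :=
  (representsPair_mellinDens hF.2 hc hp hα hαβ hI hT).represents
    (mellinDens_isContinuous hc hp hα hαβ hI)

end MellinDens
end HCalc

namespace HCalc
open MeasureTheory

/-! ### The trace of a continuous density -/

section Trace

variable {d N : ℕ} {M : Type u} [TopologicalSpace M] [ChartedSpace (Euc d) M]
  [IsManifold (𝓡 d) ∞ M] {H : LieFiltration d N M} {ψ : H.Splitting} {D : ψ.Exponential}
  {x₀ y₀ : M} {X : ψ.GradedFrame}

open LieFiltration.Splitting TGroupoid

/-- The restriction of a density along the fibres of `r` to the unit space, as a density on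
`T_x M`. -/
def FibredDensity.unitDens (f : FibredDensity D) (b : M × ℝ) :
    Dens d (TangentSpace (𝓡 d) b.1) :=
  if b.2 = 0 then ⟨fun v => (f.osc b.1 0).1 (fun i => (ψ.iso b.1).symm (v i)), fun A v => by
    rw [← (f.osc b.1 0).2]
    simp only [map_sum, map_smul]⟩
  else ((|b.2| ^ H.homDim : ℝ) : ℂ) • f.pair b.1 b.1 b.2

theorem FibredDensity.unitDens_zero (f : FibredDensity D) (x : M)
    (v : Fin d → TangentSpace (𝓡 d) x) :
    (f.unitDens (x, 0)).1 v = (f.osc x 0).1 (fun i => (ψ.iso x).symm (v i)) := by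
  rw [FibredDensity.unitDens, if_pos rfl]

theorem FibredDensity.unitDens_ne_zero (f : FibredDensity D) (x : M) {h : ℝ} (hh : h ≠ 0)
    (v : Fin d → TangentSpace (𝓡 d) x) :
    (f.unitDens (x, h)).1 v = ((|h| ^ H.homDim : ℝ) : ℂ) * (f.pair x x h).1 v := by
  rw [FibredDensity.unitDens, if_neg hh]
  rfl

/-- In exponential coordinates, the trace is the coefficient at `z = 0`. -/
theorem FibredDensity.coeff_unit (f : FibredDensity D) {a : Euc d} (ha : a ∈ baseW x₀ X) (h : ℝ) :
    f.coeff (maxIndex D x₀ X) (a, 0, h) = ((|jacW D x₀ X x₀ (a, 0)| : ℝ) : ℂ) *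
      (f.unitDens ((chartAt (Euc d) x₀).symm a, h)).1 (chartFrame x₀ _) := by
  set x := (chartAt (Euc d) x₀).symm a with hx
  have hxs : x ∈ (chartAt (Euc d) x₀).source := (chartAt (Euc d) x₀).map_target ha.1
  have hjac : jacW D x₀ X x₀ (a, 0) =
      (Matrix.of fun i j => tcoord x₀ x (X.vec i x) j).det := by
    rw [jacW]
    congr 1
    ext i j
    simp only [Matrix.of_apply]
    rw [fderiv_coordW_zero ha hxs, frameVec_single]
  by_cases hh : h = 0
  · subst hh
    rw [coeff_maxIndex_zero, frameVec_zero, map_zero, hjac, ← dens_eq_det hxs,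
      unitDens_zero]
  · have hch : (a, scale X h 0) ∈ chartW D x₀ X x₀ := by
      rw [scale_zero_right]
      exact zero_mem_chartW ha hxs
    rw [coeff_maxIndex_ne_zero f hh hch, scale_zero_right, expW_zero ha, unitDens_ne_zero _ _ hh,
      abs_mul, abs_pow]
    push_cast
    ring

theorem FibredDensity.unitDens_chartFrame (f : FibredDensity D) {a : Euc d} (ha : a ∈ baseW x₀ X)
    (h : ℝ) : (f.unitDens ((chartAt (Euc d) x₀).symm a, h)).1 (chartFrame x₀ _) =
      ((|jacW D x₀ X x₀ (a, 0)| : ℝ) : ℂ)⁻¹ * f.coeff (maxIndex D x₀ X) (a, 0, h) := by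
  have hj : ((|jacW D x₀ X x₀ (a, 0)| : ℝ) : ℂ) ≠ 0 := Complex.ofReal_ne_zero.2 (abs_ne_zero.2
    (jacW_ne_zero (zero_mem_chartW ha ((chartAt (Euc d) x₀).map_target ha.1))))
  rw [coeff_unit f ha, inv_mul_cancel_left₀ hj]

theorem zero_mem_domO {a : Euc d} (ha : a ∈ baseW x₀ X) (h : ℝ) :
    (a, (0 : Euc d), h) ∈ domO D x₀ X := chartO_subset (zero_mem_chartO ha h)

/-- The trace of a continuous density. -/
def FibredDensity.trace (f : FibredDensity D) (hc : f.IsContinuous) :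
    ContDens (d := d) (Prod.fst : M × ℝ → M) :=
  ⟨f.unitDens, fun x₀ b hb => by
    obtain ⟨X, hX⟩ := exists_gradedFrame ψ b.1
    refine ContinuousAt.continuousWithinAt ?_
    set c := chartAt (Euc d) x₀ with hc'
    have hbs : b.1 ∈ c.source := hb
    have ha : c b.1 ∈ baseW x₀ X := ⟨c.map_source hbs, by rwa [c.left_inv hbs]⟩
    have h1 : ContinuousAt (fun b : M × ℝ => c b.1) b :=
      ContinuousAt.comp (f := fun b : M × ℝ => b.1) (c.continuousAt hbs) continuousAt_fst
    have h2 : ContinuousAt (fun b : M × ℝ => ((|jacW D x₀ X x₀ (c b.1, 0)| : ℝ) : ℂ)⁻¹ *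
        f.coeff (maxIndex D x₀ X) (c b.1, 0, b.2)) b := by
      have hz := zero_mem_chartW (D := D) ha (y₀ := x₀) (c.map_target ha.1)
      have h3 : ContinuousAt (fun b : M × ℝ => jacW D x₀ X x₀ (c b.1, 0)) b :=
        ContinuousAt.comp (g := jacW D x₀ X x₀) (f := fun b : M × ℝ => (c b.1, (0 : Euc d)))
          (continuousOn_jacW.continuousAt (isOpen_chartW.mem_nhds hz)) (h1.prodMk continuousAt_const)
      refine ContinuousAt.mul (ContinuousAt.inv₀ ?_ ?_) ?_
      · exact (Complex.continuous_ofReal.continuousAt).comp h3.abs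
      · exact Complex.ofReal_ne_zero.2 (abs_ne_zero.2 (jacW_ne_zero hz))
      · exact ContinuousAt.comp (f := fun b : M × ℝ => (c b.1, (0 : Euc d), b.2))
          ((continuousOn_coeff hc).continuousAt (isOpen_domO.mem_nhds (zero_mem_domO ha b.2)))
          (h1.prodMk (continuousAt_const.prodMk continuousAt_snd))
    refine h2.congr ?_
    filter_upwards [(c.open_source.preimage continuous_fst).mem_nhds hbs,
      (X.isOpen_carrier.preimage continuous_fst).mem_nhds hX] with b' hb' hb'X
    have ha' : c b'.1 ∈ baseW x₀ X :=
      ⟨c.map_source hb', by rw [c.left_inv hb']; exact hb'X⟩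
    have h3 := f.unitDens_chartFrame ha' b'.2
    rw [c.left_inv hb'] at h3
    exact h3.symm⟩

theorem hasLocalTrace_of_represents {f : FibredDensity D} (hc : f.IsContinuous)
    {T : GroupoidDist D} (hT : f.Represents T) : GroupoidDist.HasLocalTrace T (f.trace hc) :=
  ⟨f, hc, hT, fun x v => f.unitDens_zero x v, fun x _ hh v => f.unitDens_ne_zero x hh v⟩

/-- The trace of a Mellin integral of densities is the Mellin integral of the traces. -/
theorem unitDens_mellinDens (f : FibredDensity D) (m : ℂ) {α β : ℝ} (hα : 0 ≤ α) (hαβ : α ≤ β)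
    (x : M) (h : ℝ) (v : Fin d → TangentSpace (𝓡 d) x) :
    ((mellinDens f m α β).unitDens (x, h)).1 v =
      ∫ t in α..β, (t : ℂ) ^ (-m - 1 - H.homDim) * (f.unitDens (x, t * h)).1 v := by
  have hpos : ∀ t ∈ uIoc α β, 0 < t := fun t ht => by
    rw [uIoc_of_le hαβ] at ht
    exact hα.trans_lt ht.1
  by_cases hh : h = 0
  · subst hh
    rw [FibredDensity.unitDens_zero]
    refine intervalIntegral.integral_congr_ae (Eventually.of_forall fun t ht => ?_)
    have ht0 := hpos t ht
    have h0 : H.dil t⁻¹ (0 : H.Osc x) = 0 := by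
      funext k
      simp [LieFiltration.dil]
    rw [mul_zero, FibredDensity.unitDens_zero, dens_dil ψ, h0, cpow_sub_natCast ht0, abs_inv,
      abs_of_pos ht0, inv_pow]
    push_cast
    ring
  · rw [FibredDensity.unitDens_ne_zero _ _ hh]
    change _ * (∫ t in α..β, _) = _
    rw [← intervalIntegral.integral_const_mul]
    refine intervalIntegral.integral_congr_ae (Eventually.of_forall fun t ht => ?_)
    have ht0 := hpos t ht
    have : (t : ℂ) ≠ 0 := Complex.ofReal_ne_zero.2 ht0.ne'
    rw [FibredDensity.unitDens_ne_zero _ _ (mul_ne_zero ht0.ne' hh), cpow_sub_natCast ht0, abs_mul,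
      mul_pow, abs_of_pos ht0]
    push_cast
    field_simp

theorem dens_ext {x : M} (hx : x ∈ (chartAt (Euc d) x₀).source)
    {ρ η : Dens d (TangentSpace (𝓡 d) x)} (h : ρ.1 (chartFrame x₀ x) = η.1 (chartFrame x₀ x)) :
    ρ = η := by
  apply Subtype.ext
  funext v
  rw [dens_eq_det hx, dens_eq_det hx η, h]

theorem unitDens_eq_of_coeff_eq {f f' : FibredDensity D} {x : M}
    (hx : x ∈ (chartAt (Euc d) x₀).source) (hxX : x ∈ X.carrier) {h : ℝ}
    (he : f.coeff (maxIndex D x₀ X) (chartAt (Euc d) x₀ x, 0, h) =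
      f'.coeff (maxIndex D x₀ X) (chartAt (Euc d) x₀ x, 0, h)) :
    f.unitDens (x, h) = f'.unitDens (x, h) := by
  have ha : chartAt (Euc d) x₀ x ∈ baseW x₀ X :=
    ⟨(chartAt (Euc d) x₀).map_source hx, by rwa [(chartAt (Euc d) x₀).left_inv hx]⟩
  have h1 := f.unitDens_chartFrame ha h
  have h2 := f'.unitDens_chartFrame ha h
  rw [he, ← h2, (chartAt (Euc d) x₀).left_inv hx] at h1
  exact dens_ext hx h1

/-- A test function in exponential coordinates with a prescribed restriction to a fibre of `r`. -/
theorem exists_test_function {a : Euc d} {h : ℝ} {g : Euc d → ℝ} (hg : ContDiff ℝ ∞ g)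
    (hgc : HasCompactSupport g) (hgs : ∀ z ∈ tsupport g, (a, z, h) ∈ chartO D x₀ X y₀) :
    ∃ φ : Par d → ℂ, ContDiff ℝ ∞ φ ∧ HasCompactSupport φ ∧ tsupport φ ⊆ chartO D x₀ X y₀ ∧
      ∀ z, φ (a, z, h) = (g z : ℂ) := by
  have hK : IsCompact (({a} : Set (Euc d)) ×ˢ (tsupport g ×ˢ ({h} : Set ℝ))) :=
    isCompact_singleton.prod (hgc.isCompact.prod isCompact_singleton)
  obtain ⟨χ, hχ, hχc, hχs, hχ1, -⟩ := exists_bump hK (isOpen_chartO (D := D) (x₀ := x₀) (X := X)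
    (y₀ := y₀)) (by
      rintro ⟨a', z, h'⟩ ⟨ha, hz, hh⟩
      obtain rfl : a' = a := ha
      obtain rfl : h' = h := hh
      exact hgs z hz)
  have hsub : tsupport (fun p : Par d => ((χ p * g p.2.1 : ℝ) : ℂ)) ⊆ tsupport χ := by
    refine closure_mono fun p hp hp0 => hp ?_
    simp only [hp0, zero_mul, Complex.ofReal_zero]
  refine ⟨fun p => ((χ p * g p.2.1 : ℝ) : ℂ), ?_, hχc.isCompact.of_isClosed_subset
    (isClosed_tsupport _) hsub, hsub.trans hχs, fun z => ?_⟩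
  · exact Complex.ofRealCLM.contDiff.comp (hχ.mul (hg.comp (by fun_prop)))
  · by_cases hz : z ∈ tsupport g
    · have h1 : χ (a, z, h) = 1 := (hχ1.self_of_nhdsSet) _ ⟨rfl, hz, rfl⟩
      simp only [h1, one_mul]
    · simp only [image_eq_zero_of_notMem_tsupport hz, mul_zero]

theorem continuous_mul_coeff {f : FibredDensity D} (hc : f.IsContinuous) {φ : Par d → ℂ}
    (hφ : ContDiff ℝ ∞ φ) (hφs : tsupport φ ⊆ domO D x₀ X) (a : Euc d) (h : ℝ) :
    Continuous fun z => φ (a, z, h) * f.coeff (maxIndex D x₀ X) (a, z, h) := by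
  refine continuous_iff_continuousAt.2 fun z => ?_
  have hι : Continuous fun z : Euc d => ((a, z, h) : Par d) := by fun_prop
  by_cases hz : (a, z, h) ∈ tsupport φ
  · exact (hφ.continuous.comp hι).continuousAt.mul (ContinuousAt.comp (f := fun z => (a, z, h))
      ((FibredDensity.continuousOn_coeff hc).continuousAt (isOpen_domO.mem_nhds (hφs hz)))
      hι.continuousAt)
  · refine continuousAt_const (y := (0 : ℂ)).congr ?_
    filter_upwards [hι.continuousAt.eventually ((isClosed_tsupport φ).isOpen_compl.mem_nhds hz)]
      with z' hz'
    rw [image_eq_zero_of_notMem_tsupport hz', zero_mul]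

theorem hasCompactSupport_fibre {φ : Par d → ℂ} (hφc : HasCompactSupport φ) (a : Euc d) (h : ℝ) :
    IsCompact ((fun p : Par d => p.2.1) '' tsupport φ) ∧
      ∀ z, z ∉ (fun p : Par d => p.2.1) '' tsupport φ → φ (a, z, h) = 0 :=
  ⟨hφc.isCompact.image (by fun_prop), fun z hz => image_eq_zero_of_notMem_tsupport fun hz' =>
    hz ⟨_, hz', rfl⟩⟩

theorem integrable_mul_coeff {f : FibredDensity D} (hc : f.IsContinuous) {φ : Par d → ℂ}
    (hφ : ContDiff ℝ ∞ φ) (hφc : HasCompactSupport φ) (hφs : tsupport φ ⊆ domO D x₀ X) (a : Euc d)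
    (h : ℝ) : Integrable fun z => φ (a, z, h) * f.coeff (maxIndex D x₀ X) (a, z, h) := by
  refine (continuous_mul_coeff hc hφ hφs a h).integrable_of_hasCompactSupport ?_
  obtain ⟨h1, h2⟩ := hasCompactSupport_fibre hφc a h
  exact HasCompactSupport.intro h1 fun z hz => by rw [h2 z hz, zero_mul]

/-- Two continuous densities that represent fibred distributions with the same restriction to
height `h ≠ 0` have the same trace at height `h`. -/
theorem unitDens_eq_of_apply_eq [T2Space M] {f f' : FibredDensity D} {T T' : GroupoidDist D}
    (hT : RepresentsPair f T) (hT' : RepresentsPair f' T') (hc : f.IsContinuous)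
    (hc' : f'.IsContinuous) {h : ℝ} (hh : h ≠ 0) {x : M}
    (he : ∀ u, T.1 u (x, h) = T'.1 u (x, h)) : f.unitDens (x, h) = f'.unitDens (x, h) := by
  obtain ⟨X, hX⟩ := exists_gradedFrame ψ x
  have hxs := mem_chart_source (Euc d) x
  set a := chartAt (Euc d) x x with ha'
  have hxa : (chartAt (Euc d) x).symm a = x := (chartAt (Euc d) x).left_inv hxs
  have ha : a ∈ baseW x X := ⟨mem_chart_target _ _, by rwa [hxa]⟩
  refine unitDens_eq_of_coeff_eq hxs hX ?_
  rw [← ha']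
  set U := {z : Euc d | (a, z, h) ∈ chartO D x X x} with hU
  have hUo : IsOpen U := isOpen_chartO.preimage (by fun_prop)
  have hcont : ∀ {f : FibredDensity D}, f.IsContinuous →
      ContinuousOn (fun z => f.coeff (maxIndex D x X) (a, z, h)) U := fun hc =>
    (FibredDensity.continuousOn_coeff hc).comp (f := fun z : Euc d => (a, z, h)) (by fun_prop)
      fun z hz => chartO_subset hz
  have hG := (hcont hc).sub (hcont hc')
  have hae := hUo.ae_eq_zero_of_integral_contDiff_smul_eq_zero (μ := volume)
    (hG.locallyIntegrableOn hUo.measurableSet) fun g hg hgc hgs => by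
      obtain ⟨φ, hφ, hφc, hφs, hφg⟩ := exists_test_function (D := D) (x₀ := x) (X := X) (y₀ := x)
        hg hgc hgs
      have h1 := hT.apply_ext hφ hφc (hφs.trans chartO_subset) ha hh fun z hz => hφs hz
      have h2 := hT'.apply_ext hφ hφc (hφs.trans chartO_subset) ha hh fun z hz => hφs hz
      rw [hxa] at h2
      rw [hxa, he, h2] at h1
      have h3 := integral_sub (integrable_mul_coeff hc hφ hφc (hφs.trans chartO_subset) a h)
        (integrable_mul_coeff hc' hφ hφc (hφs.trans chartO_subset) a h)
      rw [h1, sub_self] at h3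
      rw [← h3]
      refine integral_congr_ae (Eventually.of_forall fun z => ?_)
      simp only [Pi.sub_apply, hφg, Complex.real_smul]
      ring
  have h4 : EqOn (fun z => f.coeff (maxIndex D x X) (a, z, h) -
      f'.coeff (maxIndex D x X) (a, z, h)) (fun _ => (0 : ℂ)) U :=
    Measure.eqOn_open_of_ae_eq ((ae_restrict_iff' hUo.measurableSet).2 hae) hUo hG
      continuousOn_const
  exact sub_eq_zero.1 (h4 (zero_mem_chartO ha h))

end Trace
end HCalc

namespace HCalc
open MeasureTheory

/-! ### The residue density -/

section Residue

variable {d N : ℕ} {M : Type u} [TopologicalSpace M] [ChartedSpace (Euc d) M]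
  [IsManifold (𝓡 d) ∞ M] {H : LieFiltration d N M} {ψ : H.Splitting} {D : ψ.Exponential}
  {x₀ y₀ : M} {X : ψ.GradedFrame}

open LieFiltration.Splitting TGroupoid

theorem FibredDensity.IsSmooth.isContinuous {f : FibredDensity D} (hf : f.IsSmooth) :
    f.IsContinuous := fun i => (hf i).continuousOn

/-- A kernel of order `m` with `Re m < -d_H` is a continuous density. -/
theorem represents_of_re_lt [T2Space M] {m : ℂ} (hm : m.re < -(H.homDim : ℝ))
    {P L : GroupoidDist D} (hL : GroupoidDist.IsLieDeriv P L) {f : FibredDensity D}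
    (hf : f.IsSmooth) (hp : f.IsProper) (hF : f.Represents (L - m • P)) :
    (mellinDens f m 0 1).IsContinuous ∧ (mellinDens f m 0 1).Represents P := by
  have hI : IntervalIntegrable (fun t : ℝ => (t : ℂ) ^ (-m - 1 - H.homDim)) volume 0 1 :=
    intervalIntegral.intervalIntegrable_cpow' (by simp; linarith)
  have hm0 : m.re < 0 := hm.trans_le (by simp)
  refine ⟨mellinDens_isContinuous hf.isContinuous hp le_rfl zero_le_one hI,
    represents_mellinDens hF hf.isContinuous hp le_rfl zero_le_one hI fun u x h hh => ?_⟩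
  rw [integral_fibre_eq_of_neg hL hm0 u x hh one_pos, Complex.ofReal_one, Complex.one_cpow, one_mul,
    push_one]

/-- The negative of a density along the fibres of `r`. -/
def FibredDensity.neg (f : FibredDensity D) : FibredDensity D where
  osc x z := -f.osc x z
  pair x y h := -f.pair x y h

theorem FibredDensity.neg_coeff (f : FibredDensity D) (i : ParamIndex D) (p : Par d) :
    f.neg.coeff i p = -f.coeff i p := by
  cases i with
  | pair x₁ y₁ => rfl
  | exp x₁ X₁ O hO hsub =>
    change (if p.2.2 = 0 then _ else _) = -(if p.2.2 = 0 then _ else _)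
    split_ifs <;> rfl

theorem FibredDensity.neg_isContinuous {f : FibredDensity D} (hc : f.IsContinuous) :
    f.neg.IsContinuous := fun i => (hc i).neg.congr fun p _ => f.neg_coeff i p

theorem FibredDensity.neg_isProper {f : FibredDensity D} (hp : f.IsProper) : f.neg.IsProper := by
  have h : f.neg.support = f.support := by
    unfold FibredDensity.support
    congr 1
    ext p
    cases p with
    | osc x z => exact neg_ne_zero
    | pair x y h hh => exact neg_ne_zero
  intro K hK
  rw [h]
  exact hp K hK

theorem FibredDensity.neg_representsPair {f : FibredDensity D} {T : GroupoidDist D}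
    (hT : RepresentsPair f T) : RepresentsPair f.neg (-T) := by
  intro x h hh y₀ u hu hus
  change -(T.1 u (x, h)) = ∫ y in (chartAt (Euc d) y₀).target, _ * -(_)
  rw [hT x h hh y₀ u hu hus, ← integral_neg]
  simp only [mul_neg]

theorem FibredDensity.unitDens_mul_zero (f : FibredDensity D) (x : M) (t : ℝ)
    (v : Fin d → TangentSpace (𝓡 d) x) : (f.unitDens (x, t * 0)).1 v = (f.unitDens (x, 0)).1 v := by
  have key : ∀ h : ℝ, h = 0 → (f.unitDens (x, h)).1 v = (f.unitDens (x, 0)).1 v := by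
    rintro _ rfl
    rfl
  exact key _ (mul_zero t)

/-- The integrated equation for a kernel of order `-d_H`. -/
theorem push_sub_apply [T2Space M] {P L : GroupoidDist D} (hL : GroupoidDist.IsLieDeriv P L)
    (l : ℝ) (hl : 0 < l) (u : (atlas D).Smooth) (x : M) (h : ℝ) (hh : h ≠ 0) :
    (((l : ℂ) ^ H.homDim) • GroupoidDist.push l hl P - P).1 u (x, h) =
      ∫ t in (1 : ℝ)..l, (t : ℂ) ^ (-(-(H.homDim : ℂ)) - 1) *
        (L - (-(H.homDim : ℂ)) • P).1 (sPull D (fibrePull u x hh)) (x, t * h) := by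
  rw [integral_fibre_eq hL _ u x hh one_pos hl, neg_neg, Complex.cpow_natCast, Complex.ofReal_one,
    Complex.one_cpow, one_mul, push_one]
  rfl

/-- For a kernel of order `-d_H`, and `λ > 0`, the distribution `λ^{d_H} (α_λ)_* ℙ - ℙ` is given by a
continuous density, the trace of which at `h = 0` is `log λ` times that of `(L_Z + d_H) ℙ`. -/
theorem hasLocalTrace_push_sub [T2Space M] {P L : GroupoidDist D}
    (hL : GroupoidDist.IsLieDeriv P L) {f : FibredDensity D} (hf : f.IsSmooth) (hp : f.IsProper)
    (hF : f.Represents (L - (-(H.homDim : ℂ)) • P)) (l : ℝ) (hl : 0 < l) :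
    ∃ σ, GroupoidDist.HasLocalTrace (((l : ℂ) ^ H.homDim) • GroupoidDist.push l hl P - P) σ ∧
      ∀ (x : M) (v : Fin d → TangentSpace (𝓡 d) x),
        σ.eval (x, 0) v = (Real.log l : ℂ) * (f.unitDens (x, 0)).1 v := by
  set m : ℂ := -(H.homDim : ℂ) with hm
  have hexp : -m - 1 - H.homDim = -1 := by rw [hm]; ring
  have hI : ∀ {α β : ℝ}, 0 < α → 0 < β →
      IntervalIntegrable (fun t : ℝ => (t : ℂ) ^ (-m - 1 - H.homDim)) volume α β := fun hα hβ =>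
    ContinuousOn.intervalIntegrable fun t ht => (Complex.continuousAt_ofReal_cpow_const _ _
      (Or.inr (lt_of_lt_of_le (lt_min hα hβ) ht.1).ne')).continuousWithinAt
  have hT := push_sub_apply hL l hl
  have hlog : ∫ t in (1 : ℝ)..l, (t : ℂ) ^ (-1 : ℂ) = (Real.log l : ℂ) := by
    have h1 : ∫ t in (1 : ℝ)..l, (t : ℂ) ^ (-1 : ℂ) = ∫ t in (1 : ℝ)..l, ((t⁻¹ : ℝ) : ℂ) := by
      refine intervalIntegral.integral_congr fun t _ => ?_
      simp only [Complex.cpow_neg_one, Complex.ofReal_inv]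
    rw [h1, intervalIntegral.integral_ofReal, integral_inv_of_pos one_pos hl, div_one]
  rcases le_total 1 l with h1l | hl1
  · have hc := mellinDens_isContinuous (m := m) hf.isContinuous hp zero_le_one h1l (hI one_pos hl)
    refine ⟨_, hasLocalTrace_of_represents hc (represents_mellinDens hF hf.isContinuous hp
      zero_le_one h1l (hI one_pos hl) hT), fun x v => ?_⟩
    change ((mellinDens f m 1 l).unitDens (x, 0)).1 v = _
    rw [unitDens_mellinDens f m zero_le_one h1l]
    simp only [FibredDensity.unitDens_mul_zero, hexp]
    rw [intervalIntegral.integral_mul_const, hlog]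
  · have hcn := FibredDensity.neg_isContinuous hf.isContinuous
    have hpn := FibredDensity.neg_isProper hp
    have hc := mellinDens_isContinuous (m := m) hcn hpn hl.le hl1 (hI hl one_pos)
    refine ⟨_, hasLocalTrace_of_represents hc ((representsPair_mellinDens
      (FibredDensity.neg_representsPair hF.2) hcn hpn hl.le hl1 (hI hl one_pos)
      fun u x h hh => ?_).represents hc), fun x v => ?_⟩
    · rw [hT u x h hh, intervalIntegral.integral_symm, ← intervalIntegral.integral_neg]
      refine intervalIntegral.integral_congr fun t _ => ?_
      exact (mul_neg _ _).symm
    · change ((mellinDens f.neg m l 1).unitDens (x, 0)).1 v = _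
      rw [unitDens_mellinDens f.neg m hl.le hl1]
      simp only [FibredDensity.unitDens_mul_zero, hexp]
      rw [intervalIntegral.integral_mul_const, intervalIntegral.integral_symm, hlog]
      have h2 : (f.neg.unitDens (x, 0)).1 v = -(f.unitDens (x, 0)).1 v := by
        rw [FibredDensity.unitDens_zero, FibredDensity.unitDens_zero]
        rfl
      rw [h2]
      ring

/-- The substitution `t = exp (n θ)` in the logarithmic integral. -/
theorem mellinDens_coeff_exp {f : FibredDensity D} (hc : f.IsContinuous) {a z : Euc d} {n : ℝ}
    (hn : 0 ≤ n) (hz : (a, z, Real.exp (-n)) ∈ domO D x₀ X) :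
    (mellinDens f (-(H.homDim : ℂ)) 1 (Real.exp n)).coeff (maxIndex D x₀ X)
        (a, z, Real.exp (-n)) =
      n * ∫ θ in (0 : ℝ)..1, f.coeff (maxIndex D x₀ X)
        (a, scale X (Real.exp (n * θ))⁻¹ z, Real.exp (n * θ) * Real.exp (-n)) := by
  rw [mellinDens_coeff zero_le_one (Real.one_le_exp hn) hz]
  have hexp : -(-(H.homDim : ℂ)) - 1 - H.homDim = -1 := by ring
  rw [hexp]
  set g : ℝ → ℂ := fun t => (t : ℂ) ^ (-1 : ℂ) * f.coeff (maxIndex D x₀ X)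
    (a, scale X t⁻¹ z, t * Real.exp (-n)) with hg
  have hd : ∀ θ ∈ uIcc (0 : ℝ) 1, HasDerivAt (fun θ => Real.exp (n * θ)) (n * Real.exp (n * θ)) θ := by
    intro θ _
    have := ((hasDerivAt_id θ).const_mul n).exp
    simpa [mul_comm] using this
  have hgc : ContinuousOn g ((fun θ => Real.exp (n * θ)) '' uIcc (0 : ℝ) 1) := by
    rintro _ ⟨θ, -, rfl⟩
    have hpos := Real.exp_pos (n * θ)
    refine ContinuousAt.continuousWithinAt (ContinuousAt.mul ?_ ?_)
    · exact Complex.continuousAt_ofReal_cpow_const _ _ (Or.inr hpos.ne')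
    · exact continuousAt_coeff_zoom_right hc hz hpos.ne'
  have h1 := intervalIntegral.integral_deriv_smul_comp' hd (by fun_prop) hgc
  rw [mul_zero, Real.exp_zero, mul_one] at h1
  rw [← h1, ← intervalIntegral.integral_const_mul]
  refine intervalIntegral.integral_congr fun θ _ => ?_
  have hpos := Real.exp_pos (n * θ)
  have hne : ((Real.exp (n * θ) : ℝ) : ℂ) ≠ 0 := Complex.ofReal_ne_zero.2 hpos.ne'
  simp only [hg, Function.comp, Complex.real_smul, Complex.cpow_neg_one]
  push_cast
  push_cast at hne
  field_simp

/-- The logarithmic averages of a density along the zoom orbits which tend to a point of the zero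
fibre converge to the value of the density at the unit. -/
theorem tendsto_log_average [T2Space M] {f : FibredDensity D} (hc : f.IsContinuous)
    (hp : f.IsProper) {a : Euc d} (ha : a ∈ baseW x₀ X) {φ : Par d → ℂ} (hφ : ContDiff ℝ ∞ φ)
    (hφc : HasCompactSupport φ) (hφs : tsupport φ ⊆ domO D x₀ X) :
    Tendsto (fun n : ℝ => (n : ℂ)⁻¹ * ∫ z, φ (a, z, Real.exp (-n)) *
      (mellinDens f (-(H.homDim : ℂ)) 1 (Real.exp n)).coeff (maxIndex D x₀ X)
        (a, z, Real.exp (-n))) atTop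
      (𝓝 (∫ z, φ (a, z, 0) * f.coeff (maxIndex D x₀ X) (a, 0, 0))) := by
  set F := f.coeff (maxIndex D x₀ X) with hF
  have hFc := FibredDensity.continuousOn_coeff (x₀ := x₀) (X := X) hc
  obtain ⟨hK, hK0⟩ := hasCompactSupport_fibre hφc a
    (0 : ℝ)
  set K := (fun p : Par d => p.2.1) '' tsupport φ with hKd
  have hK0' : ∀ (h : ℝ) (z : Euc d), z ∉ K → φ (a, z, h) = 0 := fun h =>
    (hasCompactSupport_fibre hφc a h).2
  obtain ⟨B, hB⟩ := hφc.exists_bound_of_continuous hφ.continuous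
  have hB0 : 0 ≤ B := (norm_nonneg _).trans (hB 0)
  have h1D : ((a, 0, 1) : Par d) ∈ domO D x₀ X := zero_mem_domO ha 1
  obtain ⟨C, hC⟩ := exists_bound_coeff_zoom hc hp h1D 1
  have hexp0 : Tendsto (fun n : ℝ => Real.exp (-n)) atTop (𝓝 0) :=
    Real.tendsto_exp_neg_atTop_nhds_zero
  have hsc : Continuous fun q : ℝ × Euc d => scale X q.1 q.2 := by
    have := (contDiff_scale X).continuous
    exact this.comp (f := fun q : ℝ × Euc d => (q.2, q.1)) (by fun_prop)
  -- the bound and the domain, uniformly for `z ∈ K`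
  have hbound : ∀ᶠ n : ℝ in atTop, ∀ z ∈ K, (a, z, Real.exp (-n)) ∈ domO D x₀ X ∧
      ∀ θ ∈ Ioc (0 : ℝ) 1,
        ‖F (a, scale X (Real.exp (n * θ))⁻¹ z, Real.exp (n * θ) * Real.exp (-n))‖ ≤ C := by
    have h2 : ∀ᶠ h : ℝ in 𝓝 0, ∀ z ∈ K, ((a, scale X h z, 1) : Par d) ∈ domO D x₀ X ∧
        ∀ t ∈ Ioc (0 : ℝ) 1, ‖F (a, scale X t⁻¹ (scale X h z), t * 1)‖ ≤ C := by
      refine hK.eventually_forall_of_forall_eventually fun z _ => ?_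
      have h3 : Tendsto (fun q : ℝ × Euc d => ((a, scale X q.1 q.2, 1) : Par d))
          (𝓝 (0, z)) (𝓝 (a, 0, 1)) := by
        have h := hsc.tendsto (0, z)
        rw [scale_zero_left] at h
        exact tendsto_const_nhds.prodMk_nhds (h.prodMk_nhds tendsto_const_nhds)
      exact (h3.eventually (isOpen_domO.mem_nhds h1D)).and (h3.eventually hC)
    filter_upwards [hexp0.eventually h2, eventually_ge_atTop (0 : ℝ)] with n hn hn0 z hz
    refine ⟨?_, fun θ hθ => ?_⟩
    · have h5 : (a, scale X 1 (scale X (Real.exp (-n)) z)) ∈ domW D x₀ X := (hn z hz).1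
      rwa [scale_one] at h5
    · have h4 := (hn z hz).2 (Real.exp (n * θ) * Real.exp (-n)) ⟨by positivity, by
        rw [← Real.exp_add]
        exact Real.exp_le_one_iff.2 (by nlinarith [hθ.2])⟩
      rw [scale_scale, mul_one, mul_inv, inv_mul_cancel_right₀ (Real.exp_pos _).ne'] at h4
      exact h4
  -- the inner integrals
  have hinner : ∀ z ∈ K, Tendsto (fun n : ℝ => ∫ θ in (0 : ℝ)..1,
      F (a, scale X (Real.exp (n * θ))⁻¹ z, Real.exp (n * θ) * Real.exp (-n))) atTop
      (𝓝 (F (a, 0, 0))) := by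
    intro z hz
    have hlim : (F (a, 0, 0)) = ∫ _θ in (0 : ℝ)..1, F (a, 0, 0) := by simp
    rw [hlim]
    refine intervalIntegral.tendsto_integral_filter_of_dominated_convergence (fun _ => C) ?_ ?_
      intervalIntegrable_const ?_
    · filter_upwards [hbound] with n hn
      refine Continuous.aestronglyMeasurable (continuous_iff_continuousAt.2 fun θ => ?_)
      exact ContinuousAt.comp (g := fun t : ℝ => F (a, scale X t⁻¹ z, t * Real.exp (-n)))
        (f := fun θ : ℝ => Real.exp (n * θ)) (x := θ)
        (continuousAt_coeff_zoom_right hc (hn z hz).1 (Real.exp_pos _).ne') (by fun_prop)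
    · filter_upwards [hbound] with n hn
      refine Eventually.of_forall fun θ hθ => ?_
      rw [uIoc_of_le zero_le_one] at hθ
      exact (hn z hz).2 θ hθ
    -- for `0 < θ < 1`, both the dilation factor `exp (-n θ)` and the height `exp (-n (1 - θ))` tend
    -- to zero
    · have h1 : ∀ᵐ θ : ℝ, θ ≠ 1 := by
        simp [ae_iff]
      filter_upwards [h1] with θ hθ1 hθ
      rw [uIoc_of_le zero_le_one] at hθ
      have hθ1' : θ < 1 := lt_of_le_of_ne hθ.2 hθ1
      have h2 : ContinuousAt F (a, 0, 0) := hFc.continuousAt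
        (isOpen_domO.mem_nhds (zero_mem_domO ha 0))
      refine h2.tendsto.comp (tendsto_const_nhds.prodMk_nhds (Tendsto.prodMk_nhds ?_ ?_))
      · have h3 : Tendsto (fun n : ℝ => (Real.exp (n * θ))⁻¹) atTop (𝓝 0) := by
          simp_rw [← Real.exp_neg]
          exact hexp0.comp (tendsto_id.atTop_mul_const hθ.1)
        have h4 := (hsc.tendsto (0, z)).comp (h3.prodMk_nhds
          (tendsto_const_nhds (x := z) (f := atTop)))
        rwa [scale_zero_left] at h4
      · have h3 : ∀ n : ℝ, Real.exp (n * θ) * Real.exp (-n) = Real.exp (-(n * (1 - θ))) := fun n => by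
          rw [← Real.exp_add]
          congr 1
          ring
        simp_rw [h3]
        exact hexp0.comp (tendsto_id.atTop_mul_const (by linarith))
  -- the outer integral
  have hstep : ∀ᶠ n : ℝ in atTop, ∀ z, (n : ℂ)⁻¹ * (φ (a, z, Real.exp (-n)) *
      (mellinDens f (-(H.homDim : ℂ)) 1 (Real.exp n)).coeff (maxIndex D x₀ X)
        (a, z, Real.exp (-n))) = φ (a, z, Real.exp (-n)) * ∫ θ in (0 : ℝ)..1,
      F (a, scale X (Real.exp (n * θ))⁻¹ z, Real.exp (n * θ) * Real.exp (-n)) := by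
    filter_upwards [eventually_gt_atTop (0 : ℝ)] with n hn z
    by_cases hz : (a, z, Real.exp (-n)) ∈ tsupport φ
    · rw [mellinDens_coeff_exp hc hn.le (hφs hz)]
      have : (n : ℂ) ≠ 0 := Complex.ofReal_ne_zero.2 hn.ne'
      rw [mul_left_comm, inv_mul_cancel_left₀ this]
    · rw [image_eq_zero_of_notMem_tsupport hz, zero_mul, zero_mul, mul_zero]
  have hI : ∀ β : ℝ, 0 < β → IntervalIntegrable
      (fun t : ℝ => (t : ℂ) ^ (-(-(H.homDim : ℂ)) - 1 - H.homDim)) volume 1 β := fun β hβ =>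
    ContinuousOn.intervalIntegrable fun t ht => (Complex.continuousAt_ofReal_cpow_const _ _
      (Or.inr (lt_of_lt_of_le (lt_min one_pos hβ) ht.1).ne')).continuousWithinAt
  simp_rw [← integral_const_mul]
  refine tendsto_integral_filter_of_dominated_convergence (K.indicator fun _ => B * C) ?_ ?_ ?_ ?_
  · filter_upwards [eventually_gt_atTop (0 : ℝ)] with n hn
    have hcm := mellinDens_isContinuous (m := -(H.homDim : ℂ)) hc hp zero_le_one
      (Real.one_le_exp hn.le) (hI _ (Real.exp_pos n))
    exact (continuous_const.mul (continuous_mul_coeff hcm hφ hφs a _)).aestronglyMeasurable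
  · filter_upwards [hstep, hbound] with n hn hb
    refine Eventually.of_forall fun z => ?_
    rw [hn z]
    by_cases hz : z ∈ K
    · rw [indicator_of_mem hz, norm_mul]
      refine mul_le_mul (hB _) ?_ (norm_nonneg _) hB0
      have := intervalIntegral.norm_integral_le_of_norm_le_const (a := (0 : ℝ)) (b := 1) (C := C)
        (f := fun θ => F (a, scale X (Real.exp (n * θ))⁻¹ z, Real.exp (n * θ) * Real.exp (-n)))
        fun θ hθ => (hb z hz).2 θ (by rwa [uIoc_of_le zero_le_one] at hθ)
      simpa using this
    · rw [hK0' _ _ hz, zero_mul, norm_zero, indicator_of_notMem hz]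
  · exact (integrable_indicator_iff hK.measurableSet).2
      (integrableOn_const (hs := hK.measure_lt_top.ne))
  · refine Eventually.of_forall fun z => ?_
    have h1 : Tendsto (fun n : ℝ => φ (a, z, Real.exp (-n)) * ∫ θ in (0 : ℝ)..1,
        F (a, scale X (Real.exp (n * θ))⁻¹ z, Real.exp (n * θ) * Real.exp (-n))) atTop
        (𝓝 (φ (a, z, 0) * F (a, 0, 0))) := by
      by_cases hz : z ∈ K
      · refine Tendsto.mul ?_ (hinner z hz)
        exact (hφ.continuous.tendsto (a, z, 0)).comp (tendsto_const_nhds.prodMk_nhds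
          (tendsto_const_nhds.prodMk_nhds hexp0))
      · simp only [hK0' _ _ hz, zero_mul]
        exact tendsto_const_nhds
    refine h1.congr' ?_
    filter_upwards [hstep] with n hn
    exact (hn z).symm

/-- The functions on `M × M` that are restrictions of smooth functions on the groupoid. -/
def restrictOne (u : (atlas D).Smooth) : (pairAtlas d M).Smooth :=
  ⟨fun p => u (.pair p.1 p.2 1 one_ne_zero), fun (c : M × M) => by
    have h1 : ContDiffOn ℝ ∞ (fun p : Euc d × Euc d => u ((atlas D).map (.pair c.1 c.2)
        (p.1, p.2, 1))) ((pairAtlas d M).dom c) :=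
      ((atlas D).contDiffOn u (.pair c.1 c.2)).comp
        (f := fun p : Euc d × Euc d => (p.1, p.2, (1 : ℝ))) (by fun_prop)
        fun p hp => ⟨hp.1, hp.2, one_ne_zero⟩
    refine h1.congr fun p hp => ?_
    rw [map_pair (c := c) (q := (p.1, p.2, 1)) one_ne_zero]
    rfl⟩

theorem apply_one_eq_of_restriction {P₁ : PairDist d M} {Q Q' : GroupoidDist D}
    (h : GroupoidDist.IsRestrictionAtOne Q P₁) (h' : GroupoidDist.IsRestrictionAtOne Q' P₁)
    (u : (atlas D).Smooth) (x : M) : Q.1 u (x, 1) = Q'.1 u (x, 1) := by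
  rw [← h u (restrictOne u) (fun _ _ => rfl) x, ← h' u (restrictOne u) (fun _ _ => rfl) x]

/-- The trace at `h = 0` of `(L_Z + d_H) ℚ`, for a kernel `ℚ` of order `-d_H`, is determined by the
restriction of `ℚ` to `h = 1`. For two kernels with the same restriction, the distributions
`λ^{d_H} (α_λ)_* ℚ - ℚ` differ by a bounded amount at `h = λ⁻¹`, while their densities there grow
like `log λ` times the trace. -/
theorem unitDens_zero_eq_of_restriction [T2Space M] {Q Q' L L' : GroupoidDist D}
    (hL : GroupoidDist.IsLieDeriv Q L) (hL' : GroupoidDist.IsLieDeriv Q' L')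
    {f f' : FibredDensity D} (hf : f.IsSmooth) (hf' : f'.IsSmooth) (hp : f.IsProper)
    (hp' : f'.IsProper) (hF : f.Represents (L - (-(H.homDim : ℂ)) • Q))
    (hF' : f'.Represents (L' - (-(H.homDim : ℂ)) • Q'))
    (he : ∀ u x, Q.1 u (x, 1) = Q'.1 u (x, 1)) (x : M) :
    f.unitDens (x, 0) = f'.unitDens (x, 0) := by
  obtain ⟨X, hX⟩ := exists_gradedFrame ψ x
  have hxs := mem_chart_source (Euc d) x
  set a := chartAt (Euc d) x x with ha'
  have hxa : (chartAt (Euc d) x).symm a = x := (chartAt (Euc d) x).left_inv hxs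
  have ha : a ∈ baseW x X := ⟨mem_chart_target _ _, by rwa [hxa]⟩
  refine unitDens_eq_of_coeff_eq hxs hX ?_
  -- a test function with non-zero integral along the fibre over `(x, 0)`
  let g : ContDiffBump (0 : Euc d) := ⟨1, 2, one_pos, by norm_num⟩
  obtain ⟨φ, hφ, hφc, hφs, hφg⟩ := exists_test_function (D := D) (x₀ := x) (X := X) (y₀ := x)
    (a := a) (h := 0) g.contDiff g.hasCompactSupport
    fun z _ => height_zero_mem_chartO ha z
  have hφD := hφs.trans chartO_subset
  set u := ext φ hφ hφc hφD with hu
  -- the integrated equation at the height `exp (-n)`, which the zoom by `exp n` moves to `1`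
  have key : ∀ {P L : GroupoidDist D} {f : FibredDensity D}, GroupoidDist.IsLieDeriv P L →
      f.IsSmooth → f.IsProper → f.Represents (L - (-(H.homDim : ℂ)) • P) → ∀ n : ℝ, 0 < n →
      ∫ z, φ (a, z, Real.exp (-n)) * (mellinDens f (-(H.homDim : ℂ)) 1 (Real.exp n)).coeff
        (maxIndex D x X) (a, z, Real.exp (-n)) =
      ((Real.exp n : ℝ) : ℂ) ^ H.homDim *
        P.1 (sPull D (fibrePull u x (Real.exp_pos (-n)).ne')) (x, 1) -
          P.1 u (x, Real.exp (-n)) := by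
    intro P L f hL hf hp hF n hn
    have hI : IntervalIntegrable (fun t : ℝ => (t : ℂ) ^ (-(-(H.homDim : ℂ)) - 1 - H.homDim))
        volume 1 (Real.exp n) :=
      ContinuousOn.intervalIntegrable fun t ht => (Complex.continuousAt_ofReal_cpow_const _ _
        (Or.inr (lt_of_lt_of_le (lt_min one_pos (Real.exp_pos n)) ht.1).ne')).continuousWithinAt
    have h1 := (representsPair_mellinDens hF.2 hf.isContinuous hp zero_le_one
      (Real.one_le_exp hn.le) hI (push_sub_apply hL (Real.exp n) (Real.exp_pos n))).apply_ext
      hφ hφc hφD ha (Real.exp_pos (-n)).ne' (fun z hz => hφs hz)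
    rw [← h1, hxa]
    change _ * (GroupoidDist.push _ _ P).1 u (x, Real.exp (-n)) - _ = _
    rw [push_apply_eq P u x (Real.exp_pos (-n)).ne', ← Real.exp_add, add_neg_cancel, Real.exp_zero]
    rfl
  -- in the difference of the two equations, the terms at height `1` cancel, and the terms at height
  -- `exp (-n)` converge, so that division by `n` gives the limit zero
  have hlim := (tendsto_log_average hf.isContinuous hp ha hφ hφc hφD).sub
    (tendsto_log_average hf'.isContinuous hp' ha hφ hφc hφD)
  have hlim0 : Tendsto (fun n : ℝ => (n : ℂ)⁻¹ *
      (Q'.1 u (x, Real.exp (-n)) - Q.1 u (x, Real.exp (-n)))) atTop (𝓝 0) := by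
    have h1 : Tendsto (fun n : ℝ => (n : ℂ)⁻¹) atTop (𝓝 0) := by
      simp_rw [← Complex.ofReal_inv]
      exact (Complex.continuous_ofReal.tendsto' 0 0 Complex.ofReal_zero).comp
        tendsto_inv_atTop_zero
    have h2 : ∀ P : GroupoidDist D, Tendsto (fun n : ℝ => P.1 u (x, Real.exp (-n))) atTop
        (𝓝 (P.1 u (x, 0))) := fun P =>
      ((continuous_cylinder_apply (P.1 u) x).continuous.tendsto 0).comp
        Real.tendsto_exp_neg_atTop_nhds_zero
    simpa using h1.mul ((h2 Q').sub (h2 Q))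
  have h0 := tendsto_nhds_unique (hlim.congr' (by
    filter_upwards [eventually_gt_atTop (0 : ℝ)] with n hn
    rw [key hL hf hp hF n hn, key hL' hf' hp' hF' n hn, he, ← mul_sub]
    congr 1
    ring)) hlim0
  rw [sub_eq_zero, integral_mul_const, integral_mul_const] at h0
  refine mul_left_cancel₀ ?_ h0
  simp_rw [hφg]
  rw [integral_complex_ofReal]
  exact Complex.ofReal_ne_zero.2 g.integral_pos.ne'

/-- The trace at `h = 0` of `(L_Z + d_H) ℚ` is the residue density of the restriction of `ℚ`. -/
theorem isResidueDensity [T2Space M] {P₁ : PairDist d M} {Q L : GroupoidDist D}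
    (hL : GroupoidDist.IsLieDeriv Q L) {f : FibredDensity D} (hf : f.IsSmooth) (hp : f.IsProper)
    (hF : f.Represents (L - (-(H.homDim : ℂ)) • Q)) (hQ : GroupoidDist.IsRestrictionAtOne Q P₁)
    {ρ : ContDens (d := d) (id : M → M)}
    (hρ : ∀ (x : M) (v : Fin d → TangentSpace (𝓡 d) x), ρ.eval x v = (f.unitDens (x, 0)).1 v) :
    PairDist.IsResidueDensity D P₁ ρ := by
  refine ⟨⟨Q, ⟨L, hL, f, hf, hp, hF⟩, hQ⟩, fun Q' hQ' hr' l hl => ?_⟩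
  obtain ⟨L', hL', f', hf', hp', hF'⟩ := hQ'
  obtain ⟨σ, hσ, hσv⟩ := hasLocalTrace_push_sub hL' hf' hp' hF' l hl
  refine ⟨σ, hσ, fun x v => ?_⟩
  rw [hσv x v, hρ x v, unitDens_zero_eq_of_restriction hL hL' hf hf' hp hp' hF hF'
    (apply_one_eq_of_restriction hQ hr') x]

end Residue
end HCalc

namespace HCalc
open MeasureTheory

/-! ### Holomorphic dependence of the values of a density on the parameter -/

/-- A family `F` of continuous functions is holomorphic in `s` and jointly continuous if locally,
for each `s` separately, it is the limit, at rate `2⁻ᵏ`, of families `c k` which are holomorphic in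
`s` and locally uniformly of polynomial growth in `2ᵏ`. -/
theorem holC_of_hartogs {B : Type*} [TopologicalSpace B] {U : Set ℂ} {V : Set B} (hV : IsOpen V)
    {F : ℂ → B → ℂ} (hF : ∀ s ∈ U, ContinuousOn (F s) V)
    (hloc : ∀ s₀ ∈ U, ∀ b₀ ∈ V, ∃ R > 0, Metric.ball s₀ (2 * R) ⊆ U ∧ ∃ V' ∈ 𝓝 b₀,
      ∃ (c : ℕ → ℂ → B → ℂ) (A C : ℝ), 0 ≤ A ∧ 0 ≤ C ∧
        (∀ k, ∀ b ∈ V', DifferentiableOn ℂ (fun s => c k s b) (Metric.ball s₀ (2 * R))) ∧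
        (∀ k, ∀ s ∈ Metric.ball s₀ (2 * R), ∀ b ∈ V',
          ‖c k s b‖ ≤ C * Real.exp (A * (k * Real.log 2))) ∧
        ∀ s ∈ Metric.ball s₀ (2 * R), ∃ n, ∀ k, ∀ b ∈ V',
          ‖c k s b - F s b‖ ≤ n * Real.exp (-(k * Real.log 2))) : HolC U V F := by
  have hlog : 0 < Real.log 2 := Real.log_pos one_lt_two
  -- local holomorphy and local bounds
  have key : ∀ s₀ ∈ U, ∀ b₀ ∈ V, ∃ R > 0, ∃ V' ∈ 𝓝 b₀, ∃ C : ℝ,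
      (∀ b ∈ V', DifferentiableOn ℂ (fun s => F s b) (Metric.ball s₀ R)) ∧
        ∀ s ∈ Metric.ball s₀ R, ∀ b ∈ V', ‖F s b‖ ≤ C := by
    intro s₀ hs₀ b₀ hb₀
    obtain ⟨R, hR, hRU, V', hV', c, A, C, hA, hC, hcd, hcC, hcF⟩ := hloc s₀ hs₀ b₀ hb₀
    -- Hartogs' lemma for the consecutive differences gives convergence that is uniform in `s` and `b`
    obtain ⟨C', hC'⟩ := hartogs (ι := ℕ × V') (g := fun i s => c (i.1 + 1) s i.2 - c i.1 s i.2)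
      (L := fun i => i.1 * Real.log 2) (s₀ := s₀) (A := A)
      (C := C * Real.exp (A * Real.log 2) + C) hR (fun i => by positivity) hA
      (fun i => (hcd _ _ i.2.2).sub (hcd _ _ i.2.2))
      (fun i s hs => by
        refine (norm_sub_le _ _).trans ((add_le_add (hcC _ s hs _ i.2.2) (hcC _ s hs _ i.2.2)).trans
          (le_of_eq ?_))
        have : A * (((i.1 + 1 : ℕ) : ℝ) * Real.log 2) = A * Real.log 2 + A * (i.1 * Real.log 2) := by
          push_cast
          ring
        rw [this, Real.exp_add]
        ring)
      (fun s hs => by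
        obtain ⟨n, hn⟩ := hcF s hs
        refine ⟨n * Real.exp (-Real.log 2) + n, fun i => ?_⟩
        have h1 : c (i.1 + 1) s i.2 - c i.1 s i.2 =
          (c (i.1 + 1) s i.2 - F s i.2) - (c i.1 s i.2 - F s i.2) := by ring
        rw [h1]
        refine (norm_sub_le _ _).trans ((add_le_add (hn _ _ i.2.2) (hn _ _ i.2.2)).trans
          (le_of_eq ?_))
        have : -(((i.1 + 1 : ℕ) : ℝ) * Real.log 2) = -Real.log 2 + -(i.1 * Real.log 2) := by
          push_cast
          ring
        rw [this, Real.exp_add]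
        ring)
    set ρ := Real.exp (-Real.log 2 / 2) with hρ
    have hρ1 : ρ < 1 := Real.exp_lt_one_iff.2 (by linarith)
    have hρ0 : 0 < ρ := Real.exp_pos _
    have hsub : Metric.ball s₀ R ⊆ Metric.ball s₀ (2 * R) := Metric.ball_subset_ball (by linarith)
    have hlim : ∀ s ∈ Metric.ball s₀ R, ∀ b ∈ V', Tendsto (fun k => c k s b) atTop (𝓝 (F s b)) := by
      intro s hs b hb
      obtain ⟨n, hn⟩ := hcF s (hsub hs)
      rw [tendsto_iff_norm_sub_tendsto_zero]
      refine squeeze_zero (fun _ => norm_nonneg _) (fun k => hn k b hb) ?_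
      have h2 : Tendsto (fun k : ℕ => Real.exp (-(k * Real.log 2))) atTop (𝓝 0) :=
        Real.tendsto_exp_neg_atTop_nhds_zero.comp
          (tendsto_natCast_atTop_atTop.atTop_mul_const hlog)
      simpa using h2.const_mul n
    have hgeo : ∀ s ∈ Metric.ball s₀ R, ∀ b ∈ V', ∀ k,
        dist (c k s b) (F s b) ≤ C' * ρ ^ k / (1 - ρ) := by
      intro s hs b hb k
      refine dist_le_of_le_geometric_of_tendsto ρ C' hρ1 (fun k => ?_) (hlim s hs b hb) k
      rw [dist_comm, dist_eq_norm]
      refine (hC' s hs (k, ⟨b, hb⟩)).trans (le_of_eq ?_)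
      rw [hρ, ← Real.exp_nat_mul]
      congr 2
      ring
    refine ⟨R, hR, V', hV', C + C' / (1 - ρ), fun b hb => ?_, fun s hs b hb => ?_⟩
    · have hu : TendstoUniformlyOn (fun k s => c k s b) (fun s => F s b) atTop
          (Metric.ball s₀ R) := by
        rw [Metric.tendstoUniformlyOn_iff]
        intro ε hε
        have h3 : Tendsto (fun k => C' * ρ ^ k / (1 - ρ)) atTop (𝓝 0) := by
          simpa using ((tendsto_pow_atTop_nhds_zero_of_lt_one hρ0.le hρ1).const_mul C').div_const
            (1 - ρ)
        filter_upwards [h3.eventually_lt_const hε] with k hk s hs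
        rw [dist_comm]
        exact (hgeo s hs b hb k).trans_lt hk
      exact hu.tendstoLocallyUniformlyOn.differentiableOn
        (Eventually.of_forall fun k => (hcd k b hb).mono hsub) Metric.isOpen_ball
    · have h1 := hgeo s hs b hb 0
      have h2 := hcC 0 s (hsub hs) b hb
      rw [dist_comm, dist_eq_norm] at h1
      simp only [pow_zero, mul_one] at h1
      simp only [Nat.cast_zero, zero_mul, mul_zero, Real.exp_zero, mul_one] at h2
      have h3 := norm_sub_norm_le (F s b) (c 0 s b)
      linarith
  refine ⟨fun p hp => ?_, fun b hb s hs => ?_⟩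
  · obtain ⟨s₀, b₀⟩ := p
    obtain ⟨R, hR, V', hV', C, hd, hC⟩ := key s₀ hp.1 b₀ hp.2
    have hcb := (hF s₀ hp.1).continuousAt (hV.mem_nhds hp.2)
    refine ContinuousAt.continuousWithinAt ?_
    have h0 : Tendsto (fun p : ℂ × B => F s₀ p.2) (𝓝 (s₀, b₀)) (𝓝 (F s₀ b₀)) :=
      hcb.tendsto.comp (continuous_snd.tendsto (s₀, b₀))
    have h1 : Tendsto (fun p : ℂ × B => F p.1 p.2 - F s₀ p.2) (𝓝 (s₀, b₀)) (𝓝 0) := by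
      have h2 : Tendsto (fun p : ℂ × B => (2 * C + 1) / R * dist p.1 s₀) (𝓝 (s₀, b₀)) (𝓝 0) := by
        have : Continuous fun p : ℂ × B => (2 * C + 1) / R * dist p.1 s₀ := by fun_prop
        simpa using this.tendsto (s₀, b₀)
      refine squeeze_zero_norm' ?_ h2
      rw [nhds_prod_eq]
      filter_upwards [prod_mem_prod (Metric.ball_mem_nhds s₀ hR) hV'] with p hp
      rw [← dist_eq_norm]
      refine Complex.dist_le_div_mul_dist_of_mapsTo_ball (f := fun s => F s p.2) (hd p.2 hp.2)
        (fun s hs => ?_) hp.1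
      have h4 := hC s hs p.2 hp.2
      have h5 := hC s₀ (Metric.mem_ball_self hR) p.2 hp.2
      rw [mem_closedBall_iff_norm]
      exact (norm_sub_le _ _).trans (by linarith)
    have h6 := h1.add h0
    simpa [ContinuousAt] using h6
  · obtain ⟨R, hR, V', hV', C, hd, -⟩ := key s hs b hb
    exact ((hd b (mem_of_mem_nhds hV')).differentiableAt
      (Metric.ball_mem_nhds s hR)).differentiableWithinAt

end HCalc

namespace HCalc
open MeasureTheory

/-! ### Bounds for families of fibred distributions -/

section Bounds

variable {d N : ℕ} {M : Type u} [TopologicalSpace M] [ChartedSpace (Euc d) M]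

theorem iterate_dlast_apply {P : Type*} (Φ : P × ℝ → ℂ) (j : ℕ) (q : P × ℝ) :
    dlast^[j] Φ q = iteratedDeriv j (fun h => Φ (q.1, h)) q.2 := by
  induction j generalizing q with
  | zero => simp
  | succ j ih =>
    rw [Function.iterate_succ_apply', iteratedDeriv_succ, dlast]
    congr 1
    funext h
    exact ih (q.1, h)

/-- The linear functional `g ↦ ∂_h^j g (x, h)`. -/
def heightDeriv (j : ℕ) (b : M × ℝ) : (cylinderAtlas d M).Smooth →ₗ[ℂ] ℂ where
  toFun g := iteratedDeriv j (fun h => g (b.1, h)) b.2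
  map_add' f g := by
    have h1 := ((continuous_cylinder_apply f b.1).contDiffAt (x := b.2)).of_le
      (m := j) (by exact_mod_cast le_top)
    have h2 := ((continuous_cylinder_apply g b.1).contDiffAt (x := b.2)).of_le
      (m := j) (by exact_mod_cast le_top)
    exact iteratedDeriv_fun_add h1 h2
  map_smul' c f := by
    have h1 := ((continuous_cylinder_apply f b.1).contDiffAt (x := b.2)).of_le
      (m := j) (by exact_mod_cast le_top)
    exact iteratedDeriv_fun_const_smul h1 c

theorem heightDeriv_apply (j : ℕ) (x : M) (h : ℝ) (g : (cylinderAtlas d M).Smooth) :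
    heightDeriv j (x, h) g = iteratedDeriv j (fun h => g (x, h)) h := rfl

theorem norm_heightDeriv_le (j : ℕ) (x₀ : M) {K : Set (Euc d × ℝ)} (hK : IsCompact K)
    (hKx : K ⊆ (cylinderAtlas d M).dom x₀) {a : Euc d} {h : ℝ} (hah : (a, h) ∈ K)
    (g : (cylinderAtlas d M).Smooth) :
    ‖heightDeriv j ((chartAt (Euc d) x₀).symm a, h) g‖ ≤
      (cylinderAtlas d M).seminorm ⟨x₀, j, K, hK, hKx⟩ g := by
  rw [heightDeriv_apply, ← iterate_dlast_apply
    (fun p : Euc d × ℝ => g ((chartAt (Euc d) x₀).symm p.1, p.2)) j (a, h)]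
  exact (norm_iterate_dlast_le ((cylinderAtlas d M).isOpen_dom x₀)
    ((cylinderAtlas d M).contDiffOn g x₀) j (hKx hah)).trans
    (le_seminorm (cylinderAtlas d M) ⟨x₀, j, K, hK, hKx⟩ g hah)

theorem continuous_heightDeriv (j : ℕ) (b : M × ℝ) :
    Continuous (heightDeriv (d := d) j b) := by
  refine continuous_of_continuousAt_zero _ ?_
  rw [ContinuousAt, map_zero]
  have hq := (cylinderAtlas d M).withSeminorms.continuous_seminorm
    ⟨b.1, j, {(chartAt (Euc d) b.1 b.1, b.2)}, isCompact_singleton,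
      singleton_subset_iff.2 ⟨mem_chart_target _ _, trivial⟩⟩
  refine squeeze_zero_norm (fun g => ?_) (by simpa using hq.tendsto 0)
  have := norm_heightDeriv_le j b.1 (a := chartAt (Euc d) b.1 b.1) (h := b.2) isCompact_singleton
    (singleton_subset_iff.2 ⟨mem_chart_target _ _, trivial⟩) rfl g
  rwa [(chartAt (Euc d) b.1).left_inv (mem_chart_source _ _)] at this

variable [IsManifold (𝓡 d) ∞ M] {H : LieFiltration d N M} {ψ : H.Splitting} {D : ψ.Exponential}
  {x₀ y₀ : M} {X : ψ.GradedFrame}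

open LieFiltration.Splitting TGroupoid

theorem differentiableOn_heightDeriv {Ω : Set ℂ} {P : ℂ → GroupoidDist D}
    (hP : HolomorphicOn P Ω) (u : (atlas D).Smooth) (j : ℕ) (b : M × ℝ) :
    DifferentiableOn ℂ (fun s => heightDeriv j b ((P s).1 u)) Ω := by
  intro s hs
  obtain ⟨P', hP'⟩ := hP s hs
  have hc : Continuous fun T : GroupoidDist D => heightDeriv j b (T.1 u) :=
    (continuous_heightDeriv j b).comp ((continuous_eval_const u).comp continuous_subtype_val)
  refine (HasDerivAt.differentiableAt (f' := heightDeriv j b (P'.1 u))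
    (hasDerivAt_iff_tendsto_slope.2 ?_)).differentiableWithinAt
  refine ((hc.tendsto P').comp hP').congr fun z => ?_
  rw [slope_def_module]
  change heightDeriv j b ((z - s)⁻¹ • ((P z).1 u - (P s).1 u)) = _
  rw [map_smul, map_sub]

theorem HolomorphicOn.continuousOn {V : Type*} [AddCommGroup V] [Module ℂ V] [TopologicalSpace V]
    [IsTopologicalAddGroup V] [ContinuousSMul ℂ V] {Ω : Set ℂ} {F : ℂ → V}
    (hF : HolomorphicOn F Ω) : ContinuousOn F Ω := by
  intro s hs
  obtain ⟨F', hF'⟩ := hF s hs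
  have h1 : Tendsto (fun z => (z - s) • ((z - s)⁻¹ • (F z - F s)) + F s) (𝓝[≠] s)
      (𝓝 ((0 : ℂ) • F' + F s)) := by
    refine (Tendsto.smul ?_ hF').add_const _
    have : Continuous fun z : ℂ => z - s := by fun_prop
    simpa using (this.tendsto s).mono_left nhdsWithin_le_nhds
  rw [zero_smul, zero_add] at h1
  have h2 : Tendsto F (𝓝[≠] s) (𝓝 (F s)) := by
    refine h1.congr' ?_
    filter_upwards [self_mem_nhdsWithin] with z hz
    rw [smul_inv_smul₀ (sub_ne_zero.2 hz), sub_add_cancel]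
  exact (continuousAt_iff_punctured_nhds.2 h2).continuousWithinAt

/-- A bounded set of fibred distributions maps a family of functions whose seminorms grow
polynomially in `ρ` to a family with the same property, uniformly on the set. Otherwise, suitable
multiples of some of the functions would form a bounded set with unbounded image. -/
theorem exists_polynomial_bound {K : Set (GroupoidDist D)} (hK : IsCompact K)
    (q : (cylinderAtlas d M).SeminormIndex) {ι : Type*} {u : ι → (atlas D).Smooth} {ρ : ι → ℝ}
    (hρ : ∀ i, 1 ≤ ρ i) (hu : ∀ j : (atlas D).SeminormIndex, ∃ (A : ℕ) (C : ℝ),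
      ∀ i, (atlas D).seminorm j (u i) ≤ C * ρ i ^ A) :
    ∃ (A : ℕ) (C : ℝ), 0 ≤ C ∧ ∀ T ∈ K, ∀ i,
      (cylinderAtlas d M).seminorm q (T.1 (u i)) ≤ C * ρ i ^ A := by
  by_contra! hcon
  have hcon' : ∀ n : ℕ, ∃ T ∈ K, ∃ i, n * ρ i ^ n < (cylinderAtlas d M).seminorm q (T.1 (u i)) :=
    fun n => hcon n n n.cast_nonneg
  choose T hT i hi using hcon'
  have hpos : ∀ n, 0 < ρ (i n) := fun n => one_pos.trans_le (hρ _)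
  -- functions for which the bound fails with constant and exponent `n`, normalized to be bounded
  set b : ℕ → (atlas D).Smooth := fun n => (((ρ (i n) ^ n : ℝ) : ℂ))⁻¹ • u (i n) with hb
  have hsm : ∀ {V : Type u} [AddCommGroup V] [Module ℂ V] (p : Seminorm ℂ V) (n : ℕ) (v : V),
      p ((((ρ (i n) ^ n : ℝ) : ℂ))⁻¹ • v) = (ρ (i n) ^ n)⁻¹ * p v := by
    intro V _ _ p n v
    rw [map_smul_eq_mul, norm_inv, Complex.norm_real, Real.norm_of_nonneg (by have := hpos n; positivity)]
  have hB : Bornology.IsVonNBounded ℂ (range b) := by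
    rw [(atlas D).withSeminorms.isVonNBounded_iff_seminorm_bounded]
    intro j
    obtain ⟨A, C, hC⟩ := hu j
    refine ⟨|C| + ∑ n ∈ Finset.range A, (atlas D).seminorm j (b n) + 1, by positivity, ?_⟩
    rintro _ ⟨n, rfl⟩
    rcases lt_or_ge n A with hn | hn
    · have h1 : (atlas D).seminorm j (b n) ≤ ∑ n ∈ Finset.range A, (atlas D).seminorm j (b n) :=
        Finset.single_le_sum (f := fun n => (atlas D).seminorm j (b n))
          (fun _ _ => apply_nonneg _ _) (Finset.mem_range.2 hn)
      have := abs_nonneg C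
      linarith
    · have h1 : (0 : ℝ) ≤ ∑ n ∈ Finset.range A, (atlas D).seminorm j (b n) :=
        Finset.sum_nonneg fun _ _ => apply_nonneg _ _
      have h2 : (atlas D).seminorm j (b n) ≤ |C| := by
        rw [hb, hsm, inv_mul_le_iff₀ (pow_pos (hpos n) n)]
        refine (hC (i n)).trans ?_
        rw [mul_comm]
        have h3 : ρ (i n) ^ A ≤ ρ (i n) ^ n := pow_le_pow_right₀ (hρ _) hn
        calc ρ (i n) ^ A * C ≤ ρ (i n) ^ A * |C| := by
              have := hpos n
              gcongr
              exact le_abs_self C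
          _ ≤ _ := by gcongr
      linarith
  have hK' : IsCompact ((fun T : GroupoidDist D => T.1) '' K) := hK.image continuous_subtype_val
  have h1 := ContinuousLinearMap.isVonNBounded_image2_apply (hK'.isVonNBounded ℂ) hB
  rw [(cylinderAtlas d M).withSeminorms.isVonNBounded_iff_seminorm_bounded] at h1
  obtain ⟨R, -, hR⟩ := h1 q
  obtain ⟨n, hn⟩ := exists_nat_ge R
  have h2 := hR ((T n).1 (b n)) ⟨_, ⟨_, hT n, rfl⟩, _, ⟨n, rfl⟩, rfl⟩
  rw [hb, map_smul, hsm, inv_mul_lt_iff₀ (pow_pos (hpos n) n)] at h2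
  have h3 := hi n
  have h4 : ρ (i n) ^ n * R ≤ n * ρ (i n) ^ n := by
    rw [mul_comm]
    have := hpos n
    gcongr
  linarith

/-- The seminorms of functions obtained from a fixed function `Ψ` by linear changes of variables
grow polynomially in the norm of the latter. -/
theorem exists_seminorm_ext_comp_le [T2Space M] {S : Set (Par d)} (hS : IsCompact S)
    (hSD : S ⊆ domO D x₀ X) {G : Type*} [NormedAddCommGroup G] [NormedSpace ℝ G] {Ψ : G → ℂ}
    (hΨ : ContDiff ℝ ∞ Ψ) (hΨc : HasCompactSupport Ψ) {ι : Type*} {φ : ι → Par d → ℂ}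
    (hφ : ∀ i, ContDiff ℝ ∞ (φ i)) (hφc : ∀ i, HasCompactSupport (φ i))
    (hφs : ∀ i, tsupport (φ i) ⊆ domO D x₀ X) (hφS : ∀ i, tsupport (φ i) ⊆ S)
    {e : ι → ℂ} {Λ : ι → Par d →L[ℝ] G} (hφe : ∀ i p, φ i p = e i * Ψ (Λ i p)) {ρ : ι → ℝ}
    (hρ : ∀ i, 1 ≤ ρ i) {A : ℕ} {C : ℝ} (hC : 1 ≤ C) (he : ∀ i, ‖e i‖ ≤ ρ i ^ A)
    (hΛ : ∀ i, ‖Λ i‖ ≤ C * ρ i) (j : (atlas D).SeminormIndex) :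
    ∃ (A' : ℕ) (C' : ℝ), ∀ i,
      (atlas D).seminorm j (ext (φ i) (hφ i) (hφc i) (hφs i)) ≤ C' * ρ i ^ A' := by
  obtain ⟨C₁, hC₁, h1⟩ := exists_seminorm_ext_le hS hSD j
  have hb : ∀ n : ℕ, ∃ B, ∀ y, ‖iteratedFDeriv ℝ n Ψ y‖ ≤ B := fun n =>
    (hΨc.iteratedFDeriv n).exists_bound_of_continuous
      (hΨ.continuous_iteratedFDeriv (by exact_mod_cast le_top))
  choose B hB using hb
  have hB0 : ∀ n, 0 ≤ B n := fun n => (norm_nonneg _).trans (hB n 0)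
  set m := j.2.1
  set b := ∑ n ∈ Finset.range (m + 1), B n with hbd
  have hb0 : 0 ≤ b := Finset.sum_nonneg fun n _ => hB0 n
  refine ⟨A + m, C₁ * (b * C ^ m), fun i => ?_⟩
  have hρ0 : 0 < ρ i := one_pos.trans_le (hρ i)
  refine (h1 (φ i) (hφ i) (hφc i) (hφs i) (hφS i) (ρ i ^ A * (b * (C * ρ i) ^ m))
    fun n hn p => ?_).trans (le_of_eq (by rw [pow_add, mul_pow]; ring))
  have h2 : φ i = e i • (Ψ ∘ Λ i) := funext fun p => hφe i p
  have hcd : ContDiff ℝ ∞ (Ψ ∘ Λ i) := hΨ.comp (Λ i).contDiff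
  rw [h2, iteratedFDeriv_const_smul_apply (hcd.contDiffAt.of_le (by exact_mod_cast le_top)),
    norm_smul, (Λ i).iteratedFDeriv_comp_right hΨ p (by exact_mod_cast le_top)]
  refine mul_le_mul (he i) ?_ (norm_nonneg _) (by positivity)
  refine (ContinuousMultilinearMap.norm_compContinuousLinearMap_le _ _).trans ?_
  rw [Finset.prod_const, Finset.card_univ, Fintype.card_fin]
  have h3 : B n ≤ b := Finset.single_le_sum (f := B) (fun n _ => hB0 n)
    (Finset.mem_range.2 (Nat.lt_succ_of_le hn))
  have h4 : ‖Λ i‖ ^ n ≤ (C * ρ i) ^ m := by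
    refine (pow_le_pow_left₀ (norm_nonneg _) (hΛ i) n).trans (pow_le_pow_right₀ ?_ hn)
    exact one_le_mul_of_one_le_of_one_le hC (hρ i)
  exact mul_le_mul ((hB n _).trans h3) h4 (by positivity) hb0

/-- The zoom action on functions in exponential coordinates. -/
def zoomW (X : ψ.GradedFrame) {l : ℝ} (hl : 0 < l) : Par d ≃L[ℝ] Par d := zoomLinear X.weight l hl

theorem zoomW_apply (X : ψ.GradedFrame) {l : ℝ} (hl : 0 < l) (p : Par d) :
    zoomW X hl p = (p.1, scale X l p.2.1, l⁻¹ * p.2.2) := rfl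

theorem zoomW_mem_domO_iff {l : ℝ} (hl : 0 < l) {p : Par d} :
    zoomW X hl p ∈ domO D x₀ X ↔ p ∈ domO D x₀ X := by
  have := zoom_mem_domO_iff (D := D) (x₀ := x₀) (X := X) (a := p.1) (z := p.2.1) (h := p.2.2)
    (inv_ne_zero hl.ne')
  rwa [inv_inv] at this

theorem tsupport_comp_zoomW {φ : Par d → ℂ} {l : ℝ} (hl : 0 < l) :
    tsupport (φ ∘ zoomW X hl) = zoomW X hl ⁻¹' tsupport φ :=
  tsupport_comp_eq_preimage φ (zoomW X hl).toHomeomorph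

theorem zoomPullback_ext [T2Space M] {φ : Par d → ℂ} (hφ : ContDiff ℝ ∞ φ)
    (hc : HasCompactSupport φ) (hs : tsupport φ ⊆ domO D x₀ X) {l : ℝ} (hl : 0 < l)
    (hφ' : ContDiff ℝ ∞ (φ ∘ zoomW X hl)) (hc' : HasCompactSupport (φ ∘ zoomW X hl))
    (hs' : tsupport (φ ∘ zoomW X hl) ⊆ domO D x₀ X) :
    zoomPullback D l hl (ext φ hφ hc hs) = ext (φ ∘ zoomW X hl) hφ' hc' hs' := by
  apply DFunLike.coe_injective
  funext q
  change extFun D x₀ X φ (zoom D l hl q) = extFun D x₀ X (φ ∘ zoomW X hl) q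
  have hz : ∀ p ∈ domO D x₀ X, zoom D l hl (expParam D x₀ X p) = expParam D x₀ X (zoomW X hl p) :=
    fun p hp => zoom_expParam hl hp.1.2
  by_cases hq : q ∈ expParam D x₀ X '' domO D x₀ X
  · obtain ⟨p, hp, rfl⟩ := hq
    rw [hz p hp, extFun_expParam hp, extFun_expParam ((zoomW_mem_domO_iff hl).2 hp)]
    rfl
  · have h1 : extFun D x₀ X (φ ∘ zoomW X hl) q = 0 :=
      extFun_eq_zero (S := domO D x₀ X) (fun p hp => image_eq_zero_of_notMem_tsupport
        fun h => hp (hs' h)) hq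
    rw [h1]
    refine extFun_eq_zero (S := domO D x₀ X) (fun p hp => image_eq_zero_of_notMem_tsupport
        fun h => hp (hs h)) ?_
    rintro ⟨p, hp, hpq⟩
    refine hq ⟨(zoomW X hl).symm p, ?_, ?_⟩
    · rwa [← zoomW_mem_domO_iff hl, ContinuousLinearEquiv.apply_symm_apply]
    · have hp' : (zoomW X hl).symm p ∈ domO D x₀ X := by
        rwa [← zoomW_mem_domO_iff hl, ContinuousLinearEquiv.apply_symm_apply]
      have h2 := hz _ hp'
      rw [ContinuousLinearEquiv.apply_symm_apply, hpq] at h2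
      have hinj : Function.Injective (zoom D l hl) := fun q q' hqq => by
        have h3 := congrArg (zoom D l⁻¹ (inv_pos.2 hl)) hqq
        have hone : ∀ q : TGroupoid D, zoom D l⁻¹ (inv_pos.2 hl) (zoom D l hl q) = q := by
          intro q
          rw [zoom_zoom]
          cases q with
          | osc x z =>
            simp only [zoom, inv_mul_cancel₀ hl.ne']
            congr 1
            funext k
            simp [LieFiltration.dil]
          | pair x y h hh => simp only [zoom, inv_mul_cancel₀ hl.ne', inv_one, one_mul]
        rwa [hone, hone] at h3
      exact hinj h2

end Bounds
end HCalc

namespace HCalc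
open MeasureTheory

/-! ### Mollified difference quotients of a kernel along the zoom action -/

section Mollified

variable {d N : ℕ} {M : Type u} [TopologicalSpace M] [ChartedSpace (Euc d) M]
  [IsManifold (𝓡 d) ∞ M] {H : LieFiltration d N M} {ψ : H.Splitting} {D : ψ.Exponential}
  {x₀ y₀ : M} {X : ψ.GradedFrame}

open LieFiltration.Splitting TGroupoid

variable (d) in
/-- A smooth function on `ℝᵈ` with integral one and support in the unit ball. -/
def bump : Euc d → ℝ :=
  (⟨1 / 2, 1, by norm_num, by norm_num⟩ : ContDiffBump (0 : Euc d)).normed volume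

theorem contDiff_bump : ContDiff ℝ ∞ (bump d) := ContDiffBump.contDiff_normed _
theorem hasCompactSupport_bump : HasCompactSupport (bump d) :=
  ContDiffBump.hasCompactSupport_normed _
theorem integral_bump : ∫ y, bump d y = 1 := ContDiffBump.integral_normed _
theorem bump_eq_zero {y : Euc d} (hy : 1 ≤ ‖y‖) : bump d y = 0 := by
  have h : y ∉ Function.support (bump d) := by
    rw [bump, ContDiffBump.support_normed_eq, mem_ball_zero_iff]
    exact not_lt.2 hy
  rwa [Function.notMem_support] at h

variable (x₀ X) in
/-- The pairing with the mollified difference quotient at scale `ε`: the average, over `z = ε y` and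
`t = 1 + ε θ`, of the density in exponential coordinates at the zoomed points. At `ε = 0` this is
the density at the unit. -/
def mollified (f : FibredDensity D) (m : ℂ) (q : (Euc d × ℝ) × ℝ) : ℂ :=
  ∫ y, (bump d y : ℂ) * ∫ θ in Icc (0 : ℝ) 1,
    Complex.exp ((-m - 1 - H.homDim) * Real.log (1 + q.1.2 * θ)) * f.coeff (maxIndex D x₀ X)
      (q.1.1, scale X (1 + q.1.2 * θ)⁻¹ (q.1.2 • y), (1 + q.1.2 * θ) * q.2)

theorem mollified_zero (f : FibredDensity D) (m : ℂ) (a : Euc d) (h : ℝ) :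
    mollified x₀ X f m ((a, 0), h) = f.coeff (maxIndex D x₀ X) (a, 0, h) := by
  have h1 : ∫ y, (bump d y : ℂ) = 1 := by
    rw [integral_complex_ofReal, integral_bump, Complex.ofReal_one]
  simp [mollified, integral_mul_const, h1, scale_zero_right]

/-- The mollified difference quotients are smooth up to `ε = 0`. -/
theorem contDiffOn_mollified {f : FibredDensity D} (hf : f.IsSmooth) (m : ℂ) {a₀ : Euc d} {h₀ r : ℝ}
    (hr1 : r ≤ 1) (hr : Metric.ball ((a₀, 0, h₀) : Par d) r ⊆ domO D x₀ X) :
    ContDiffOn ℝ ∞ (mollified x₀ X f m) (Metric.ball ((a₀, 0), h₀) r) := by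
  set W₁ : Set (((Euc d × ℝ) × ℝ) × Euc d) :=
    {w | (|w.1.1.2| < 1) ∧ (w.1.1.1, w.1.1.2 • w.2, w.1.2) ∈ domO D x₀ X} with hW₁
  set W₂ : Set ((((Euc d × ℝ) × ℝ) × Euc d) × ℝ) :=
    {w | 0 < 1 + w.1.1.1.2 * w.2 ∧ (w.1.1.1.1, w.1.1.1.2 • w.1.2, w.1.1.2) ∈ domO D x₀ X} with hW₂
  have hW₁o : IsOpen W₁ := by
    refine IsOpen.inter (s := {w : ((Euc d × ℝ) × ℝ) × Euc d | |w.1.1.2| < 1})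
      (isOpen_lt (by fun_prop) (by fun_prop)) (isOpen_domO.preimage
      (f := fun w : ((Euc d × ℝ) × ℝ) × Euc d => (w.1.1.1, w.1.1.2 • w.2, w.1.2)) (by fun_prop))
  have hW₂o : IsOpen W₂ := by
    refine IsOpen.inter (s := {w : (((Euc d × ℝ) × ℝ) × Euc d) × ℝ | 0 < 1 + w.1.1.1.2 * w.2})
      (isOpen_lt (by fun_prop) (by fun_prop)) (isOpen_domO.preimage
      (f := fun w : (((Euc d × ℝ) × ℝ) × Euc d) × ℝ =>
        (w.1.1.1.1, w.1.1.1.2 • w.1.2, w.1.1.2)) (by fun_prop))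
  have h2 : ContDiffOn ℝ ∞ (fun w : (((Euc d × ℝ) × ℝ) × Euc d) × ℝ =>
      Complex.exp ((-m - 1 - H.homDim) * Real.log (1 + w.1.1.1.2 * w.2)) *
      f.coeff (maxIndex D x₀ X) (w.1.1.1.1, scale X (1 + w.1.1.1.2 * w.2)⁻¹ (w.1.1.1.2 • w.1.2),
        (1 + w.1.1.1.2 * w.2) * w.1.1.2)) W₂ := by
    have hA : ContDiffOn ℝ ∞ (fun w : (((Euc d × ℝ) × ℝ) × Euc d) × ℝ => 1 + w.1.1.1.2 * w.2) W₂ := by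
      fun_prop
    have hne : ∀ w ∈ W₂, 1 + w.1.1.1.2 * w.2 ≠ 0 := fun w hw => hw.1.ne'
    refine ContDiffOn.mul ?_ ?_
    · refine Complex.contDiff_exp.comp_contDiffOn (contDiffOn_const.mul ?_)
      exact Complex.ofRealCLM.contDiff.comp_contDiffOn (hA.log hne)
    · refine ContDiffOn.comp (g := f.coeff (maxIndex D x₀ X)) (hf (maxIndex D x₀ X))
        (f := fun w : (((Euc d × ℝ) × ℝ) × Euc d) × ℝ => (w.1.1.1.1,
          scale X (1 + w.1.1.1.2 * w.2)⁻¹ (w.1.1.1.2 • w.1.2), (1 + w.1.1.1.2 * w.2) * w.1.1.2))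
        ?_ fun w hw => (zoom_mem_domO_iff (hne w hw)).2 hw.2
      refine ContDiffOn.prodMk (by fun_prop) (ContDiffOn.prodMk ?_ (by fun_prop))
      exact (contDiff_scale X).comp_contDiffOn
        (f := fun w : (((Euc d × ℝ) × ℝ) × Euc d) × ℝ =>
          (w.1.1.1.2 • w.1.2, (1 + w.1.1.1.2 * w.2)⁻¹)) (ContDiffOn.prodMk (by fun_prop) (hA.inv hne))
  have h1 : ContDiffOn ℝ ∞ (fun w : ((Euc d × ℝ) × ℝ) × Euc d => ∫ θ in Icc (0 : ℝ) 1,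
      Complex.exp ((-m - 1 - H.homDim) * Real.log (1 + w.1.1.2 * θ)) * f.coeff (maxIndex D x₀ X)
        (w.1.1.1, scale X (1 + w.1.1.2 * θ)⁻¹ (w.1.1.2 • w.2), (1 + w.1.1.2 * θ) * w.1.2)) W₁ := by
    have h3 := contDiffOn_parametric_integral (μ := volume)
      (w := (Icc (0 : ℝ) 1).indicator fun _ => (1 : ℂ))
      ((integrable_indicator_iff measurableSet_Icc).2 (integrableOn_const
        (hs := isCompact_Icc.measure_lt_top.ne))).locallyIntegrable isCompact_Icc
      (fun t ht => indicator_of_notMem ht _) hW₂o h2 (s := W₁) fun w hw θ hθ => ⟨by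
        have h4 := hw.1
        have h5 : -(1 : ℝ) < w.1.1.2 * θ := by
          have h6 : |w.1.1.2 * θ| < 1 := by
            rw [abs_mul, abs_of_nonneg hθ.1]
            nlinarith [abs_nonneg w.1.1.2, hθ.1, hθ.2]
          exact (abs_lt.1 h6).1
        change 0 < 1 + w.1.1.2 * θ
        linarith, hw.2⟩
    refine h3.congr fun w _ => ?_
    rw [← integral_indicator measurableSet_Icc]
    refine integral_congr_ae (Eventually.of_forall fun θ => ?_)
    beta_reduce
    by_cases hθ : θ ∈ Icc (0 : ℝ) 1
    · rw [indicator_of_mem hθ, indicator_of_mem hθ, one_mul]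
    · rw [indicator_of_notMem hθ, indicator_of_notMem hθ, zero_mul]
  refine contDiffOn_parametric_integral (μ := volume) (w := fun y => (bump d y : ℂ))
    (Continuous.locallyIntegrable (Complex.continuous_ofReal.comp contDiff_bump.continuous))
    (isCompact_closedBall (0 : Euc d) 1) (fun y hy => ?_) hW₁o h1 fun q hq y hy => ?_
  · rw [mem_closedBall_zero_iff, not_le] at hy
    rw [bump_eq_zero hy.le, Complex.ofReal_zero]
  · have hq' := Metric.mem_ball.1 hq
    rw [Prod.dist_eq, Prod.dist_eq, max_lt_iff, max_lt_iff] at hq'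
    obtain ⟨⟨q1, q2⟩, q3⟩ := hq'
    rw [mem_closedBall_zero_iff] at hy
    rw [Real.dist_eq, sub_zero] at q2
    refine ⟨q2.trans_le hr1, hr ?_⟩
    rw [Metric.mem_ball, Prod.dist_eq, Prod.dist_eq, max_lt_iff, max_lt_iff]
    refine ⟨q1, ?_, q3⟩
    rw [dist_zero_right, norm_smul, Real.norm_eq_abs]
    nlinarith [abs_nonneg q.1.2, norm_nonneg y]

/-- The test function that concentrates at `z = 0` as `ε → 0`. -/
def testFun (χ : Par d → ℝ) (ε : ℝ) (p : Par d) : ℂ :=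
  ((ε ^ d)⁻¹ : ℝ) * ((χ p * bump d (ε⁻¹ • p.2.1) : ℝ) : ℂ)

theorem contDiff_testFun {χ : Par d → ℝ} (hχ : ContDiff ℝ ∞ χ) (ε : ℝ) :
    ContDiff ℝ ∞ (testFun χ ε) := by
  refine contDiff_const.mul (Complex.ofRealCLM.contDiff.comp (hχ.mul ?_))
  exact contDiff_bump.comp (by fun_prop)

theorem tsupport_testFun {χ : Par d → ℝ} (ε : ℝ) : tsupport (testFun χ ε) ⊆ tsupport χ := by
  refine closure_mono fun p hp => ?_
  intro h0
  exact hp (by simp [testFun, h0])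

theorem hasCompactSupport_testFun {χ : Par d → ℝ} (hχ : HasCompactSupport χ) (ε : ℝ) :
    HasCompactSupport (testFun χ ε) :=
  hχ.of_isClosed_subset (isClosed_tsupport _) (tsupport_testFun ε)

/-- The zoom by `1 + ε` changes the pairing of a kernel with the test function at scale `ε` by `ε` times
the mollified difference quotient. So the latter depends on `ℙ` only through two of its values. -/
theorem push_sub_testFun [T2Space M] {P L : GroupoidDist D} (hL : GroupoidDist.IsLieDeriv P L)
    {m : ℂ} {f : FibredDensity D} (hf : f.IsSmooth) (hp : f.IsProper)
    (hF : f.Represents (L - m • P)) {χ : Par d → ℝ} (hχ : ContDiff ℝ ∞ χ)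
    (hχc : HasCompactSupport χ) (hχs : tsupport χ ⊆ chartO D x₀ X x₀) {a₀ : Euc d} {h₀ r : ℝ}
    (hr1 : r ≤ 1) (hχ1 : ∀ p ∈ Metric.ball ((a₀, 0, h₀) : Par d) r, χ p = 1) {ε : ℝ} (hε : 0 < ε)
    (hεr : ε < r) {a : Euc d} (ha : dist a a₀ < r) {h : ℝ} (hh : dist h h₀ < r) :
    (((1 + ε : ℝ) : ℂ) ^ (-m) • GroupoidDist.push (1 + ε) (by positivity) P - P).1
      (ext (testFun χ ε) (contDiff_testFun hχ ε) (hasCompactSupport_testFun hχc ε)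
        ((tsupport_testFun ε).trans (hχs.trans chartO_subset))) ((chartAt (Euc d) x₀).symm a, h) =
      ε * mollified x₀ X f m ((a, ε), h) := by
  have hball : ∀ {a : Euc d} {h : ℝ} {z : Euc d}, dist a a₀ < r → dist h h₀ < r → ‖z‖ < r →
      (a, z, h) ∈ Metric.ball ((a₀, 0, h₀) : Par d) r := fun h1 h2 h3 => by
    rw [Metric.mem_ball, Prod.dist_eq, Prod.dist_eq, max_lt_iff, max_lt_iff]
    exact ⟨h1, by rwa [dist_zero_right], h2⟩
  have hsub : Metric.ball ((a₀, 0, h₀) : Par d) r ⊆ domO D x₀ X := fun p hp =>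
    chartO_subset (hχs (subset_tsupport _ (by rw [Function.mem_support, hχ1 p hp]; norm_num)))
  have hl : (0 : ℝ) < 1 + ε := by positivity
  set T := (((1 + ε : ℝ) : ℂ) ^ (-m) • GroupoidDist.push (1 + ε) hl P - P) with hT
  set u := ext (testFun χ ε) (contDiff_testFun hχ ε) (hasCompactSupport_testFun hχc ε)
        ((tsupport_testFun ε).trans (hχs.trans chartO_subset)) with hu
  -- for `h ≠ 0` this is a change of variables
  have key : ∀ h : ℝ, dist h h₀ < r → h ≠ 0 → T.1 u ((chartAt (Euc d) x₀).symm a, h) =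
      ε * mollified x₀ X f m ((a, ε), h) := by
    intro h hh hh0
    have hI : IntervalIntegrable (fun t : ℝ => (t : ℂ) ^ (-m - 1 - H.homDim)) volume 1 (1 + ε) :=
      ContinuousOn.intervalIntegrable fun t ht => (Complex.continuousAt_ofReal_cpow_const _ _
        (Or.inr (lt_of_lt_of_le (lt_min one_pos hl) ht.1).ne')).continuousWithinAt
    have hrep : RepresentsPair (mellinDens f m 1 (1 + ε)) T := by
      refine representsPair_mellinDens hF.2 hf.isContinuous hp zero_le_one (by linarith) hI
        fun u x h hh => ?_
      rw [integral_fibre_eq hL m u x hh one_pos hl, Complex.ofReal_one, Complex.one_cpow, one_mul,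
        push_one]
      rfl
    have hab : a ∈ baseW x₀ X := (hsub (hball (z := 0) ha hh (by simpa using hε.trans hεr))).1
    rw [hrep.apply_ext (contDiff_testFun hχ ε) (hasCompactSupport_testFun hχc ε) _ hab hh0
      (fun z hz => hχs (tsupport_testFun ε hz))]
    have hcv := Measure.integral_comp_smul (volume : Measure (Euc d)) (fun z => testFun χ ε (a, z, h) *
      (mellinDens f m 1 (1 + ε)).coeff (maxIndex D x₀ X) (a, z, h)) ε
    rw [finrank_euclideanSpace_fin, abs_of_pos (by positivity), eq_inv_smul_iff₀ (by positivity)]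
      at hcv
    rw [← hcv, mollified, ← integral_const_mul, ← integral_smul]
    refine integral_congr_ae (Eventually.of_forall fun y => ?_)
    beta_reduce
    rcases le_or_gt 1 ‖y‖ with hy | hy
    · simp [testFun, inv_smul_smul₀ hε.ne', bump_eq_zero hy]
    · have hz : ‖ε • y‖ < r := by
        rw [norm_smul, Real.norm_of_nonneg hε.le]
        nlinarith [norm_nonneg y]
      have hmem := hball ha hh hz
      rw [mellinDens_coeff zero_le_one (by linarith) (hsub hmem), testFun, hχ1 _ hmem, one_mul]
      have hcv2 := intervalIntegral.smul_integral_comp_add_mul (a := (0 : ℝ)) (b := 1)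
        (fun t : ℝ => (t : ℂ) ^ (-m - 1 - H.homDim) *
          f.coeff (maxIndex D x₀ X) (a, scale X t⁻¹ (ε • y), t * h)) ε 1
      rw [mul_zero, add_zero, mul_one] at hcv2
      rw [← hcv2, intervalIntegral.integral_of_le zero_le_one, ← integral_Icc_eq_integral_Ioc]
      have hint : ∫ θ in Icc (0 : ℝ) 1, ((1 + ε * θ : ℝ) : ℂ) ^ (-m - 1 - H.homDim) *
          f.coeff (maxIndex D x₀ X) (a, scale X (1 + ε * θ)⁻¹ (ε • y), (1 + ε * θ) * h) =
          ∫ θ in Icc (0 : ℝ) 1, Complex.exp ((-m - 1 - H.homDim) * Real.log (1 + ε * θ)) *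
          f.coeff (maxIndex D x₀ X) (a, scale X (1 + ε * θ)⁻¹ (ε • y), (1 + ε * θ) * h) := by
        refine setIntegral_congr_fun measurableSet_Icc fun θ hθ => ?_
        have hpos : 0 < 1 + ε * θ := by nlinarith [hθ.1]
        beta_reduce
        rw [Complex.cpow_def_of_ne_zero (Complex.ofReal_ne_zero.2 hpos.ne'),
          ← Complex.ofReal_log hpos.le, mul_comm (Complex.ofReal _) (-m - 1 - _)]
      rw [hint]
      simp only [inv_smul_smul₀ hε.ne', Complex.real_smul]
      generalize (∫ θ in Icc (0 : ℝ) 1, Complex.exp ((-m - 1 - H.homDim) *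
        Real.log (1 + ε * θ)) * f.coeff (maxIndex D x₀ X)
          (a, scale X (1 + ε * θ)⁻¹ (ε • y), (1 + ε * θ) * h)) = J
      have : ((ε ^ d : ℝ) : ℂ) ≠ 0 := Complex.ofReal_ne_zero.2 (by positivity)
      push_cast at this ⊢
      field_simp
  by_cases hh0 : h = 0
  · subst hh0
    -- both sides are continuous in `h`
    have hc1 : Continuous fun h : ℝ => T.1 u ((chartAt (Euc d) x₀).symm a, h) :=
      (continuous_cylinder_apply (T.1 u) _).continuous
    have hc2 : ContinuousAt (fun h : ℝ => (ε : ℂ) * mollified x₀ X f m ((a, ε), h)) 0 := by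
      have h1 := (contDiffOn_mollified hf m hr1 hsub).continuousOn.continuousAt (x := ((a, ε), 0))
        (Metric.isOpen_ball.mem_nhds (by
          rw [Metric.mem_ball, Prod.dist_eq, Prod.dist_eq, max_lt_iff, max_lt_iff]
          exact ⟨⟨ha, by rwa [Real.dist_eq, sub_zero, abs_of_pos hε]⟩, hh⟩))
      exact continuousAt_const.mul (ContinuousAt.comp (g := mollified x₀ X f m)
        (f := fun h : ℝ => ((a, ε), h)) h1 (by fun_prop))
    refine tendsto_nhds_unique ((hc1.tendsto 0).mono_left (nhdsWithin_le_nhds (s := {0}ᶜ)))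
      ((hc2.tendsto.mono_left (nhdsWithin_le_nhds (s := {0}ᶜ))).congr' ?_)
    have hev : ∀ᶠ h in 𝓝 (0 : ℝ), dist h h₀ < r :=
      (continuous_id.dist continuous_const).continuousAt.eventually_lt continuousAt_const hh
    filter_upwards [nhdsWithin_le_nhds hev, self_mem_nhdsWithin] with h h1 h2
    exact (key h h1 h2).symm
  · exact key h hh hh0

end Mollified
end HCalc

namespace HCalc
open MeasureTheory

section HolomorphicDensity

variable {d N : ℕ} {M : Type u} [TopologicalSpace M] [ChartedSpace (Euc d) M]
  [IsManifold (𝓡 d) ∞ M] {H : LieFiltration d N M} {ψ : H.Splitting} {D : ψ.Exponential}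
  {x₀ y₀ : M} {X : ψ.GradedFrame}

open LieFiltration.Splitting TGroupoid

theorem norm_scale_le (X : ψ.GradedFrame) {l : ℝ} (hl : 0 ≤ l) (hl2 : l ≤ 2) (z : Euc d) :
    ‖scale X l z‖ ≤ 2 ^ N * ‖z‖ := by
  have h2N : (0 : ℝ) ≤ 2 ^ N := by positivity
  rw [EuclideanSpace.norm_eq, EuclideanSpace.norm_eq, ← Real.sqrt_sq h2N,
    ← Real.sqrt_mul (by positivity), Finset.mul_sum]
  refine Real.sqrt_le_sqrt (Finset.sum_le_sum fun i _ => ?_)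
  rw [scale_apply, norm_mul, mul_pow]
  gcongr
  rw [norm_pow, Real.norm_of_nonneg hl]
  exact (pow_le_pow_left₀ hl hl2 _).trans (pow_le_pow_right₀ one_le_two (X.weight i).2)

theorem norm_zoomW_le (X : ψ.GradedFrame) {l : ℝ} (hl : 0 < l) (hl1 : 1 ≤ l) (hl2 : l ≤ 2)
    (p : Par d) : ‖zoomW X hl p‖ ≤ 2 ^ N * ‖p‖ := by
  have h1 : (1 : ℝ) ≤ 2 ^ N := one_le_pow₀ one_le_two
  rw [zoomW_apply, Prod.norm_def, Prod.norm_def]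
  have ha : ‖p.1‖ ≤ ‖p‖ := norm_fst_le p
  have hz : ‖p.2.1‖ ≤ ‖p‖ := (norm_fst_le p.2).trans (norm_snd_le p)
  have hh : ‖p.2.2‖ ≤ ‖p‖ := (norm_snd_le p.2).trans (norm_snd_le p)
  refine max_le ?_ (max_le ?_ ?_)
  · nlinarith [norm_nonneg p]
  · exact (norm_scale_le X hl.le hl2 _).trans (by gcongr)
  · rw [norm_mul, norm_inv, Real.norm_of_nonneg hl.le]
    have : l⁻¹ ≤ 1 := inv_le_one_of_one_le₀ hl1
    calc l⁻¹ * ‖p.2.2‖ ≤ 1 * ‖p‖ := by gcongr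
      _ ≤ _ := by gcongr

/-- On the zoomed test functions, the kernels of a compact family grow polynomially in `ε⁻¹`. -/
theorem exists_bound_heightDeriv_testFun [T2Space M] {K : Set (GroupoidDist D)} (hK : IsCompact K)
    {χ : Par d → ℝ} (hχ : ContDiff ℝ ∞ χ) (hχc : HasCompactSupport χ)
    (hχs : tsupport χ ⊆ domO D x₀ X) (j : ℕ) {Kc : Set (Euc d × ℝ)} (hKc : IsCompact Kc)
    (hKx : Kc ⊆ (cylinderAtlas d M).dom x₀) :
    ∃ (A : ℕ) (C : ℝ), 0 ≤ C ∧ ∀ T ∈ K, ∀ (ε : ℝ) (hε : 0 < ε), ε ≤ 1 → ∀ a h, (a, h) ∈ Kc →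
      ‖heightDeriv j ((chartAt (Euc d) x₀).symm a, h) (T.1
        (ext (testFun χ ε) (contDiff_testFun hχ ε) (hasCompactSupport_testFun hχc ε)
          ((tsupport_testFun ε).trans hχs)))‖ ≤ C * ε⁻¹ ^ A ∧
      ‖heightDeriv j ((chartAt (Euc d) x₀).symm a, h) (T.1
        (zoomPullback D (1 + ε) (by positivity)
          (ext (testFun χ ε) (contDiff_testFun hχ ε) (hasCompactSupport_testFun hχc ε)
          ((tsupport_testFun ε).trans hχs))))‖ ≤ C * ε⁻¹ ^ A := by
  let ι := Ioc (0 : ℝ) 1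
  have hρ : ∀ i : ι, 1 ≤ (i.1)⁻¹ := fun i => (one_le_inv₀ i.2.1).2 i.2.2
  have hl : ∀ i : ι, 0 < 1 + i.1 := fun i => by linarith [i.2.1]
  set Ψ : Par d × Euc d → ℂ := fun w => ((χ w.1 * bump d w.2 : ℝ) : ℂ) with hΨd
  have hΨ : ContDiff ℝ ∞ Ψ := Complex.ofRealCLM.contDiff.comp
    ((hχ.comp contDiff_fst).mul (contDiff_bump.comp contDiff_snd))
  have hΨc : HasCompactSupport Ψ := by
    refine HasCompactSupport.intro (hχc.isCompact.prod hasCompactSupport_bump.isCompact) ?_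
    intro w hw
    by_cases h1 : w.1 ∈ tsupport χ
    · have h2 : w.2 ∉ tsupport (bump d) := fun h2 => hw ⟨h1, h2⟩
      simp [Ψ, image_eq_zero_of_notMem_tsupport h2]
    · simp [Ψ, image_eq_zero_of_notMem_tsupport h1]
  let Λ : ι → Par d →L[ℝ] Par d × Euc d := fun i => (ContinuousLinearMap.id ℝ (Par d)).prod
    ((i.1)⁻¹ • ((ContinuousLinearMap.fst ℝ (Euc d) ℝ).comp (ContinuousLinearMap.snd ℝ (Euc d) _)))
  have hΛ : ∀ i p, ‖Λ i p‖ ≤ (i.1)⁻¹ * ‖p‖ := fun i p => by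
    have h0 : (0 : ℝ) ≤ (i.1)⁻¹ := zero_le_one.trans (hρ i)
    change ‖(p, (i.1)⁻¹ • p.2.1)‖ ≤ _
    rw [Prod.norm_def]
    refine max_le ?_ ?_
    · have := hρ i
      dsimp only
      nlinarith [norm_nonneg p]
    · dsimp only
      rw [norm_smul, Real.norm_of_nonneg h0]
      gcongr
      exact (norm_fst_le p.2).trans (norm_snd_le p)
  have he : ∀ i : ι, ‖(((i.1 ^ d)⁻¹ : ℝ) : ℂ)‖ ≤ (i.1)⁻¹ ^ d := fun i => by
    have h0 : (0 : ℝ) ≤ (i.1)⁻¹ := zero_le_one.trans (hρ i)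
    rw [Complex.norm_real, ← inv_pow, Real.norm_of_nonneg (by positivity)]
  set φ : ι → Par d → ℂ := fun i => testFun χ i.1 with hφ
  set φ' : ι → Par d → ℂ := fun i => testFun χ i.1 ∘ zoomW X (hl i) with hφ'
  have h1 := fun k => exists_seminorm_ext_comp_le (D := D) (x₀ := x₀) (X := X) hχc.isCompact hχs hΨ
    hΨc (φ := φ) (fun i => contDiff_testFun hχ _) (fun i => hasCompactSupport_testFun hχc _)
    (fun i => (tsupport_testFun _).trans hχs) (fun i => tsupport_testFun _) (Λ := Λ)
    (e := fun i => (((i.1 ^ d)⁻¹ : ℝ) : ℂ)) (fun i p => rfl) hρ le_rfl he (fun i =>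
      (Λ i).opNorm_le_bound (by rw [one_mul]; exact zero_le_one.trans (hρ i))
        fun p => by rw [one_mul]; exact hΛ i p) k
  obtain ⟨A₁, C₁, hC₁, hb₁⟩ := exists_polynomial_bound hK ⟨x₀, j, Kc, hKc, hKx⟩ hρ h1
  -- the zoomed functions
  have hS' : IsCompact ((fun w : ℝ × Par d => ((w.2.1, scale X w.1⁻¹ w.2.2.1, w.1 * w.2.2.2) : Par d))
      '' (Icc 1 2 ×ˢ tsupport χ)) := by
    refine (isCompact_Icc.prod hχc.isCompact).image_of_continuousOn ?_
    refine ContinuousOn.prodMk (by fun_prop) (ContinuousOn.prodMk ?_ (by fun_prop))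
    refine (contDiff_scale X).continuous.comp_continuousOn
      (f := fun w : ℝ × Par d => (w.2.2.1, w.1⁻¹)) (ContinuousOn.prodMk (by fun_prop) ?_)
    refine ContinuousOn.inv₀ (by fun_prop) fun w hw => ?_
    have : (1 : ℝ) ≤ w.1 := hw.1.1
    exact (one_pos.trans_le this).ne'
  have hS'D : ((fun w : ℝ × Par d => ((w.2.1, scale X w.1⁻¹ w.2.2.1, w.1 * w.2.2.2) : Par d))
      '' (Icc 1 2 ×ˢ tsupport χ)) ⊆ domO D x₀ X := by
    rintro _ ⟨⟨l, p⟩, ⟨hl1, hp⟩, rfl⟩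
    exact (zoom_mem_domO_iff (one_pos.trans_le hl1.1).ne').2 (hχs hp)
  have hts : ∀ i : ι, tsupport (φ' i) ⊆ ((fun w : ℝ × Par d =>
      ((w.2.1, scale X w.1⁻¹ w.2.2.1, w.1 * w.2.2.2) : Par d)) '' (Icc 1 2 ×ˢ tsupport χ)) := by
    intro i p hp
    rw [hφ', tsupport_comp_zoomW] at hp
    refine ⟨(1 + i.1, zoomW X (hl i) p), ⟨⟨by linarith [i.2.1], by linarith [i.2.2]⟩,
      tsupport_testFun _ hp⟩, ?_⟩
    simp only [zoomW_apply, scale_inv_scale X (hl i).ne', mul_inv_cancel_left₀ (hl i).ne']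
  have hcs : ∀ i : ι, HasCompactSupport (φ' i) := fun i =>
    hS'.of_isClosed_subset (isClosed_tsupport _) (hts i)
  have hcd : ∀ i : ι, ContDiff ℝ ∞ (φ' i) := fun i =>
    (contDiff_testFun hχ _).comp (zoomW X (hl i)).contDiff
  have h2N : (1 : ℝ) ≤ 2 ^ N := one_le_pow₀ one_le_two
  have h2 := fun k => exists_seminorm_ext_comp_le (D := D) (x₀ := x₀) (X := X) hS' hS'D hΨ
    hΨc (φ := φ') hcd hcs (fun i => (hts i).trans hS'D) hts
    (Λ := fun i => (Λ i).comp (zoomW X (hl i) : Par d →L[ℝ] Par d))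
    (e := fun i => (((i.1 ^ d)⁻¹ : ℝ) : ℂ)) (fun i p => rfl) hρ h2N he (fun i =>
      ContinuousLinearMap.opNorm_le_bound _ (by have := hρ i; positivity) fun p => by
        have h3 := hΛ i (zoomW X (hl i) p)
        have h4 := norm_zoomW_le X (hl i) (by linarith [i.2.1]) (by linarith [i.2.2]) p
        have h5 := hρ i
        calc ‖Λ i (zoomW X (hl i) p)‖ ≤ (i.1)⁻¹ * ‖zoomW X (hl i) p‖ := h3
          _ ≤ (i.1)⁻¹ * (2 ^ N * ‖p‖) := by gcongr
          _ = _ := by ring) k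
  obtain ⟨A₂, C₂, hC₂, hb₂⟩ := exists_polynomial_bound hK ⟨x₀, j, Kc, hKc, hKx⟩ hρ h2
  refine ⟨A₁ + A₂, C₁ + C₂, by positivity, fun T hT ε hε hε1 a h hah => ⟨?_, ?_⟩⟩
  · refine (norm_heightDeriv_le j x₀ hKc hKx hah _).trans ((hb₁ T hT ⟨ε, hε, hε1⟩).trans ?_)
    have h5 : (1 : ℝ) ≤ ε⁻¹ := hρ ⟨ε, hε, hε1⟩
    have h6 : ε⁻¹ ^ A₁ ≤ ε⁻¹ ^ (A₁ + A₂) := pow_le_pow_right₀ h5 (Nat.le_add_right _ _)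
    dsimp only
    calc C₁ * ε⁻¹ ^ A₁ ≤ C₁ * ε⁻¹ ^ (A₁ + A₂) := by gcongr
      _ ≤ _ := by gcongr; linarith
  · rw [zoomPullback_ext (contDiff_testFun hχ ε) (hasCompactSupport_testFun hχc ε)
      ((tsupport_testFun ε).trans hχs) _ (hcd ⟨ε, hε, hε1⟩) (hcs ⟨ε, hε, hε1⟩)
      ((hts ⟨ε, hε, hε1⟩).trans hS'D)]
    refine (norm_heightDeriv_le j x₀ hKc hKx hah _).trans ((hb₂ T hT ⟨ε, hε, hε1⟩).trans ?_)
    have h5 : (1 : ℝ) ≤ ε⁻¹ := hρ ⟨ε, hε, hε1⟩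
    have h6 : ε⁻¹ ^ A₂ ≤ ε⁻¹ ^ (A₁ + A₂) := pow_le_pow_right₀ h5 (Nat.le_add_left _ _)
    dsimp only
    calc C₂ * ε⁻¹ ^ A₂ ≤ C₂ * ε⁻¹ ^ (A₁ + A₂) := by gcongr
      _ ≤ _ := by gcongr; linarith

end HolomorphicDensity
end HCalc

namespace HCalc
open MeasureTheory

section HolomorphicCoefficient

variable {d N : ℕ} {M : Type u} [TopologicalSpace M] [ChartedSpace (Euc d) M]
  [IsManifold (𝓡 d) ∞ M] {H : LieFiltration d N M} {ψ : H.Splitting} {D : ψ.Exponential}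
  {x₀ y₀ : M} {X : ψ.GradedFrame}

open LieFiltration.Splitting TGroupoid

/-- The chain rule for the zoom action on `M × ℝ`. -/
theorem heightDeriv_push (j : ℕ) (x : M) (h : ℝ) {l : ℝ} (hl : 0 < l) (P : GroupoidDist D)
    (u : (atlas D).Smooth) :
    heightDeriv j (x, h) ((GroupoidDist.push l hl P).1 u) =
      (l : ℂ) ^ j * heightDeriv j (x, l * h) (P.1 (zoomPullback D l hl u)) := by
  have h1 := iteratedDeriv_comp_const_smul (n := j)
    ((continuous_cylinder_apply (P.1 (zoomPullback D l hl u)) x).of_le (by exact_mod_cast le_top)) l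
  have h2 := congrFun h1 h
  rw [Complex.real_smul, Complex.ofReal_pow] at h2
  exact h2

/-- For fixed `j`, the derivatives `∂_h^j` at the units of the densities `(L_Z - μ(s)) ℙ(s)` depend
holomorphically on `s`, since they are limits of the mollified difference quotients of `ℙ(s)`. -/
theorem holC_iteratedDeriv_coeff [T2Space M] {Ω : Set ℂ} (hΩ : IsOpen Ω) {μ : ℂ → ℂ}
    (hμ : DifferentiableOn ℂ μ Ω) {P L : ℂ → GroupoidDist D} (hP : HolomorphicOn P Ω)
    {f : ℂ → FibredDensity D} (hL : ∀ s ∈ Ω, GroupoidDist.IsLieDeriv (P s) (L s))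
    (hf : ∀ s ∈ Ω, (f s).IsSmooth) (hp : ∀ s ∈ Ω, (f s).IsProper)
    (hF : ∀ s ∈ Ω, (f s).Represents (L s - μ s • P s)) (j : ℕ) :
    HolC Ω (baseW x₀ X ×ˢ univ) fun s (p : Euc d × ℝ) =>
      iteratedDeriv j (fun h => (f s).coeff (maxIndex D x₀ X) (p.1, 0, h)) p.2 := by
  have hVo : IsOpen (baseW x₀ X ×ˢ (univ : Set ℝ)) := (isOpen_baseW x₀ X).prod isOpen_univ
  refine holC_of_hartogs hVo (fun s hs => ?_) fun s₀ hs₀ b₀ hb₀ => ?_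
  · have h1 : ContDiffOn ℝ ∞ (fun p : Euc d × ℝ => (f s).coeff (maxIndex D x₀ X) (p.1, 0, p.2))
        (baseW x₀ X ×ˢ univ) :=
      ContDiffOn.comp (g := (f s).coeff (maxIndex D x₀ X)) (hf s hs (maxIndex D x₀ X))
        (f := fun p : Euc d × ℝ => (p.1, 0, p.2)) (by fun_prop) fun p hp => zero_mem_domO hp.1 _
    refine (contDiffOn_iterate_dlast hVo h1 j).continuousOn.congr fun p _ => ?_
    rw [iterate_dlast_apply]
  obtain ⟨a₀, h₀⟩ := b₀
  obtain ⟨χ, hχ, hχc, hχs, hχ1, -⟩ := exists_bump (isCompact_singleton (x := ((a₀, 0, h₀) : Par d)))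
    (isOpen_chartO (D := D) (x₀ := x₀) (X := X) (y₀ := x₀))
    (singleton_subset_iff.2 (zero_mem_chartO hb₀.1 h₀))
  rw [nhdsSet_singleton] at hχ1
  obtain ⟨r', hr', hr1'⟩ := Metric.eventually_nhds_iff_ball.1 hχ1
  set r := min r' 1 with hr
  have hr0 : 0 < r := lt_min hr' one_pos
  have hr1 : r ≤ 1 := min_le_right _ _
  have hχr : ∀ p ∈ Metric.ball ((a₀, 0, h₀) : Par d) r, χ p = 1 := fun p hp =>
    hr1' p (Metric.ball_subset_ball (min_le_left _ _) hp)
  have hsub : Metric.ball ((a₀, 0, h₀) : Par d) r ⊆ domO D x₀ X := fun p hp =>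
    chartO_subset (hχs (subset_tsupport _ (by rw [Function.mem_support, hχr p hp]; norm_num)))
  have hbase : ∀ a, dist a a₀ < r → a ∈ baseW x₀ X := fun a ha =>
    (hsub (show (a, (0 : Euc d), h₀) ∈ Metric.ball ((a₀, 0, h₀) : Par d) r by
      rw [Metric.mem_ball, Prod.dist_eq, Prod.dist_eq, max_lt_iff, max_lt_iff]
      exact ⟨ha, by rwa [dist_self], by rwa [dist_self]⟩)).1
  obtain ⟨R', hR', hRΩ⟩ := Metric.nhds_basis_closedBall.mem_iff.1 (hΩ.mem_nhds hs₀)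
  set R := R' / 2 with hR
  have hR2 : 2 * R = R' := by rw [hR]; ring
  have hball : Metric.ball s₀ (2 * R) ⊆ Metric.closedBall s₀ R' := by
    rw [hR2]; exact Metric.ball_subset_closedBall
  have hK : IsCompact (P '' Metric.closedBall s₀ R') :=
    (isCompact_closedBall s₀ R').image_of_continuousOn ((HolomorphicOn.continuousOn hP).mono hRΩ)
  obtain ⟨m₀, hm₀⟩ := (isCompact_closedBall s₀ R').exists_bound_of_continuousOn
    (hμ.continuousOn.mono hRΩ)
  -- a compact set that contains the points used
  set Kc : Set (Euc d × ℝ) := Metric.closedBall a₀ (r / 2) ×ˢ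
    Metric.closedBall 0 (2 * (|h₀| + 1)) with hKc
  have hKcx : Kc ⊆ (cylinderAtlas d M).dom x₀ := fun p hp => ⟨(hbase p.1
    (lt_of_le_of_lt (Metric.mem_closedBall.1 hp.1) (by linarith))).1, trivial⟩
  obtain ⟨A, C, hC, hb⟩ := exists_bound_heightDeriv_testFun hK hχ hχc (hχs.trans chartO_subset) j
    ((isCompact_closedBall a₀ (r / 2)).prod (isCompact_closedBall (0 : ℝ) (2 * (|h₀| + 1)))) hKcx
  set ε : ℕ → ℝ := fun k => r / 2 * Real.exp (-(k * Real.log 2)) with hε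
  have hlog : 0 < Real.log 2 := Real.log_pos one_lt_two
  have hexp1 : ∀ k : ℕ, Real.exp (-(k * Real.log 2)) ≤ 1 := fun k =>
    Real.exp_le_one_iff.2 (by have : (0:ℝ) ≤ k * Real.log 2 := by positivity
                              linarith)
  have hε0 : ∀ k, 0 < ε k := fun k => by positivity
  have hεr : ∀ k, ε k ≤ r / 2 := fun k => mul_le_of_le_one_right (by positivity) (hexp1 k)
  have hε1 : ∀ k, ε k ≤ 1 := fun k => (hεr k).trans (by linarith)
  have hl : ∀ k, 0 < 1 + ε k := fun k => by linarith [hε0 k]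
  let u : ℕ → (atlas D).Smooth := fun k => ext (testFun χ (ε k)) (contDiff_testFun hχ _)
    (hasCompactSupport_testFun hχc _) ((tsupport_testFun _).trans (hχs.trans chartO_subset))
  set c : ℕ → ℂ → Euc d × ℝ → ℂ := fun k s b => ((ε k : ℝ) : ℂ)⁻¹ *
    (((1 + ε k : ℝ) : ℂ) ^ (-(μ s)) * (((1 + ε k : ℝ) : ℂ) ^ j *
      heightDeriv j ((chartAt (Euc d) x₀).symm b.1, (1 + ε k) * b.2)
        ((P s).1 (zoomPullback D (1 + ε k) (hl k) (u k)))) -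
      heightDeriv j ((chartAt (Euc d) x₀).symm b.1, b.2) ((P s).1 (u k))) with hc
  have hV' : ∀ b ∈ Metric.closedBall (a₀, h₀) (r / 2), dist b.1 a₀ ≤ r / 2 ∧ dist b.2 h₀ ≤ r / 2 :=
    fun b hb => by
      rw [Metric.mem_closedBall, Prod.dist_eq, max_le_iff] at hb
      exact hb
  refine ⟨R, by positivity, hball.trans hRΩ, Metric.closedBall (a₀, h₀) (r / 2),
    Metric.closedBall_mem_nhds _ (by positivity), c, A + 1,
    (2 / r) ^ (A + 1) * (2 ^ m₀ * (2 ^ j * C) + C), by positivity, ?_, fun k b hb => ?_,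
    fun k s hs b hbb => ?_, fun s hs => ?_⟩
  · have : 0 ≤ m₀ := (norm_nonneg _).trans (hm₀ s₀ (Metric.mem_closedBall_self hR'.le))
    positivity
  · -- holomorphy
    have hP' := fun u b => differentiableOn_heightDeriv (j := j) hP u b
    have hΩs := hball.trans hRΩ
    refine (differentiableOn_const _).mul ((DifferentiableOn.mul ?_ ((differentiableOn_const _).mul
      ((hP' _ _).mono hΩs))).sub ((hP' _ _).mono hΩs))
    exact ((hμ.mono hΩs).neg).const_cpow (Or.inl (Complex.ofReal_ne_zero.2 (hl k).ne'))
  · -- polynomial growth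
    obtain ⟨h1, h2⟩ := hV' b hbb
    rw [Real.dist_eq] at h2
    have hb2 : |b.2| ≤ |h₀| + 1 := by
      have := abs_sub_abs_le_abs_sub b.2 h₀
      linarith
    have hmem : ∀ h : ℝ, |h| ≤ 2 * (|h₀| + 1) → (b.1, h) ∈ Kc := fun h hh =>
      ⟨Metric.mem_closedBall.2 h1, by rwa [mem_closedBall_zero_iff, Real.norm_eq_abs]⟩
    have hT : P s ∈ P '' Metric.closedBall s₀ R' := ⟨s, hball hs, rfl⟩
    have hb1' := (hb _ hT (ε k) (hε0 k) (hε1 k) b.1 b.2 (hmem _ (by have := abs_nonneg h₀; linarith))).1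
    have hb2' := (hb _ hT (ε k) (hε0 k) (hε1 k) b.1 ((1 + ε k) * b.2) (hmem _ (by
      rw [abs_mul, abs_of_pos (hl k)]
      have := hε1 k
      have := hε0 k
      exact mul_le_mul (by linarith) hb2 (abs_nonneg _) (by norm_num)))).2
    have hinv : (1 : ℝ) ≤ (ε k)⁻¹ := (one_le_inv₀ (hε0 k)).2 (hε1 k)
    have hpow : ‖((1 + ε k : ℝ) : ℂ) ^ (-(μ s))‖ ≤ 2 ^ m₀ := by
      rw [Complex.norm_cpow_eq_rpow_re_of_pos (hl k)]
      have h3 : (-(μ s)).re ≤ m₀ := (Complex.re_le_norm _).trans (by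
        rw [norm_neg]; exact hm₀ s (hball hs))
      calc (1 + ε k) ^ (-(μ s)).re ≤ (1 + ε k) ^ m₀ :=
            Real.rpow_le_rpow_of_exponent_le (by linarith [hε0 k]) h3
        _ ≤ 2 ^ m₀ := Real.rpow_le_rpow (hl k).le (by linarith [hε1 k])
            ((norm_nonneg _).trans (hm₀ s₀ (Metric.mem_closedBall_self hR'.le)))
    have hlj : ‖((1 + ε k : ℝ) : ℂ) ^ j‖ ≤ 2 ^ j := by
      rw [norm_pow, Complex.norm_real, Real.norm_of_nonneg (hl k).le]
      exact pow_le_pow_left₀ (hl k).le (by linarith [hε1 k]) _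
    have hrhs : (2 / r) ^ (A + 1) * (2 ^ m₀ * (2 ^ j * C) + C) *
        Real.exp ((A + 1) * (k * Real.log 2)) =
        (ε k)⁻¹ * (2 ^ m₀ * (2 ^ j * (C * (ε k)⁻¹ ^ A)) + C * (ε k)⁻¹ ^ A) := by
      have h4 : (ε k)⁻¹ = 2 / r * Real.exp (k * Real.log 2) := by
        rw [hε, mul_inv, Real.exp_neg, inv_inv, inv_div]
      have h5 : Real.exp ((A + 1) * (k * Real.log 2)) = Real.exp (k * Real.log 2) ^ (A + 1) := by
        rw [← Real.exp_nat_mul]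
        push_cast
        rfl
      rw [h4, h5]
      ring
    rw [hrhs, hc]
    dsimp only
    rw [norm_mul, norm_inv, Complex.norm_real, Real.norm_of_nonneg (hε0 k).le]
    refine mul_le_mul_of_nonneg_left ((norm_sub_le _ _).trans (add_le_add ?_ hb1')) (by positivity)
    rw [norm_mul, norm_mul]
    gcongr
  · -- the rate of convergence
    have hsΩ : s ∈ Ω := hRΩ (hball hs)
    have hE := contDiffOn_mollified (hf s hsΩ) (μ s) hr1 hsub
    have hG := contDiffOn_iterate_dlast Metric.isOpen_ball hE j
    set G := dlast^[j] (mollified x₀ X (f s) (μ s)) with hGd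
    have hcl : Metric.closedBall (((a₀, 0), h₀) : (Euc d × ℝ) × ℝ) (r / 2) ⊆
        Metric.ball ((a₀, 0), h₀) r := Metric.closedBall_subset_ball (by linarith)
    obtain ⟨n, hn⟩ := (isCompact_closedBall (((a₀, 0), h₀) : (Euc d × ℝ) × ℝ)
      (r / 2)).exists_bound_of_continuousOn
      ((hG.continuousOn_fderiv_of_isOpen Metric.isOpen_ball (by simp)).mono hcl)
    refine ⟨n, fun k b hbb => ?_⟩
    obtain ⟨h1, h2⟩ := hV' b hbb
    have hm : ∀ e : ℝ, 0 ≤ e → e ≤ r / 2 → ((b.1, e), b.2) ∈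
        Metric.closedBall (((a₀, 0), h₀) : (Euc d × ℝ) × ℝ) (r / 2) := fun e he he' => by
      rw [Metric.mem_closedBall, Prod.dist_eq, Prod.dist_eq, max_le_iff, max_le_iff]
      exact ⟨⟨h1, by rwa [Real.dist_eq, sub_zero, abs_of_nonneg he]⟩, h2⟩
    have hlip := Convex.norm_image_sub_le_of_norm_fderiv_le (𝕜 := ℝ) (f := G)
      (fun q hq => (hG.contDiffAt (Metric.isOpen_ball.mem_nhds (hcl hq))).differentiableAt
        (by simp)) hn (convex_closedBall _ _) (hm 0 le_rfl (by positivity))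
      (hm (ε k) (hε0 k).le (hεr k))
    have hdist : ‖(((b.1, ε k), b.2) : (Euc d × ℝ) × ℝ) - ((b.1, 0), b.2)‖ = ε k := by
      simp [Prod.norm_def, abs_of_pos (hε0 k), (hε0 k).le]
    have hn0 : 0 ≤ n := (norm_nonneg _).trans (hn _ (hm 0 le_rfl (by positivity)))
    have hG0 : G ((b.1, 0), b.2) =
        iteratedDeriv j (fun h => (f s).coeff (maxIndex D x₀ X) (b.1, 0, h)) b.2 := by
      rw [hGd, iterate_dlast_apply]
      simp only [mollified_zero]
    have hGc : c k s b = G ((b.1, ε k), b.2) := by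
      have hid : (fun h => ((((1 + ε k : ℝ) : ℂ) ^ (-(μ s)) •
          GroupoidDist.push (1 + ε k) (hl k) (P s) - P s).1 (u k)) ((chartAt (Euc d) x₀).symm b.1, h))
          =ᶠ[𝓝 b.2] fun h => ((ε k : ℝ) : ℂ) * mollified x₀ X (f s) (μ s) ((b.1, ε k), h) := by
        have hev : ∀ᶠ h in 𝓝 b.2, dist h h₀ < r :=
          (continuous_id.dist continuous_const).continuousAt.eventually_lt continuousAt_const
            (show dist b.2 h₀ < r by linarith)
        filter_upwards [hev] with h hh
        exact push_sub_testFun (hL s hsΩ) (hf s hsΩ) (hp s hsΩ) (hF s hsΩ) hχ hχc hχs hr1 hχr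
          (hε0 k) (by linarith [hεr k]) (by linarith) hh
      have h3 := hid.iteratedDeriv_eq j
      rw [iteratedDeriv_const_mul_field] at h3
      have h4 : heightDeriv j ((chartAt (Euc d) x₀).symm b.1, b.2)
          ((((1 + ε k : ℝ) : ℂ) ^ (-(μ s)) •
          GroupoidDist.push (1 + ε k) (hl k) (P s) - P s).1 (u k)) =
          ((1 + ε k : ℝ) : ℂ) ^ (-(μ s)) * (((1 + ε k : ℝ) : ℂ) ^ j *
          heightDeriv j ((chartAt (Euc d) x₀).symm b.1, (1 + ε k) * b.2)
          ((P s).1 (zoomPullback D (1 + ε k) (hl k) (u k)))) -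
          heightDeriv j ((chartAt (Euc d) x₀).symm b.1, b.2) ((P s).1 (u k)) := by
        rw [← heightDeriv_push]
        change heightDeriv j _ (((1 + ε k : ℝ) : ℂ) ^ (-(μ s)) •
          ((GroupoidDist.push (1 + ε k) (hl k) (P s)).1 (u k)) - (P s).1 (u k)) = _
        rw [map_sub, map_smul, smul_eq_mul]
      have h5 : ((ε k : ℝ) : ℂ) ≠ 0 := Complex.ofReal_ne_zero.2 (hε0 k).ne'
      rw [hc]
      dsimp only
      rw [← h4, heightDeriv_apply, h3, inv_mul_cancel_left₀ h5, hGd, iterate_dlast_apply]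
    rw [hGc, ← hG0]
    rw [hdist] at hlip
    refine hlip.trans (mul_le_mul_of_nonneg_left ?_ hn0)
    exact mul_le_of_le_one_left (Real.exp_pos _).le (by linarith)

theorem holSmooth_coeff [T2Space M] {Ω : Set ℂ} (hΩ : IsOpen Ω) {μ : ℂ → ℂ}
    (hμ : DifferentiableOn ℂ μ Ω) {P L : ℂ → GroupoidDist D} (hP : HolomorphicOn P Ω)
    {f : ℂ → FibredDensity D} (hL : ∀ s ∈ Ω, GroupoidDist.IsLieDeriv (P s) (L s))
    (hf : ∀ s ∈ Ω, (f s).IsSmooth) (hp : ∀ s ∈ Ω, (f s).IsProper)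
    (hF : ∀ s ∈ Ω, (f s).Represents (L s - μ s • P s)) :
    HolSmooth Ω (baseW x₀ X) fun s a h => (f s).coeff (maxIndex D x₀ X) (a, 0, h) := by
  refine ⟨fun s hs a ha => contDiffOn_univ.1 (ContDiffOn.comp
    (g := (f s).coeff (maxIndex D x₀ X)) (hf s hs (maxIndex D x₀ X))
    (f := fun h : ℝ => ((a, 0, h) : Par d)) (by fun_prop) fun h _ => zero_mem_domO ha _), fun j => ?_⟩
  refine (holC_iteratedDeriv_coeff hΩ hμ hP hL hf hp hF j).congr fun s _ p _ => ?_
  rw [iteratedDeriv_eq_iterate]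

end HolomorphicCoefficient
end HCalc

namespace HCalc
open MeasureTheory

/-! ### Holomorphic families of densities -/

theorem HolC.of_local {B : Type*} [TopologicalSpace B] {U : Set ℂ} {V : Set B} {c : ℂ → B → ℂ}
    (h : ∀ s ∈ U, ∀ b ∈ V, ∃ U' ∈ 𝓝 s, ∃ V' ∈ 𝓝 b, HolC U' V' c) : HolC U V c := by
  refine ⟨fun p hp => ?_, fun b hb s hs => ?_⟩
  · obtain ⟨U', hU', V', hV', h1⟩ := h p.1 hp.1 p.2 hp.2
    exact (h1.1.continuousAt (prod_mem_nhds hU' hV')).continuousWithinAt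
  · obtain ⟨U', hU', V', hV', h1⟩ := h s hs b hb
    exact ((h1.2 b (mem_of_mem_nhds hV')).differentiableAt hU').differentiableWithinAt

section HolDens

variable {d : ℕ} {M : Type u} [TopologicalSpace M] [ChartedSpace (Euc d) M]
  {B : Type u} [TopologicalSpace B] {ℓ : B → M}

/-- Families of continuous densities with jointly continuous coefficients that are holomorphic
in `s`. -/
def HolDens (U : Set ℂ) (F : ℂ → ContDens (d := d) ℓ) : Prop :=
  ∀ x₀ : M, HolC U (ℓ ⁻¹' (chartAt (Euc d) x₀).source) fun s b =>
    (F s).eval b (chartFrame x₀ (ℓ b))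

namespace HolDens

theorem smul {U : Set ℂ} {F : ℂ → ContDens (d := d) ℓ} (h : HolDens U F) {g : ℂ → ℂ}
    (hg : DifferentiableOn ℂ g U) : HolDens U fun s => g s • F s :=
  fun x₀ => (HolC.of_fst hg).mul (h x₀)

theorem tendsto {U : Set ℂ} (hU : IsOpen U) (hℓ : Continuous ℓ) {F : ℂ → ContDens (d := d) ℓ}
    (h : HolDens U F) {s : ℂ} (hs : s ∈ U) : Tendsto F (𝓝 s) (𝓝 (F s)) := by
  have hw : WithSeminorms (ContDens.seminorm (d := d) ℓ) := ⟨rfl⟩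
  refine (hw.tendsto_nhds F (F s)).2 fun j ε hε => ?_
  obtain ⟨x₀, K, hK, hKx⟩ := j
  have hV := (chartAt (Euc d) x₀).open_source.preimage hℓ
  have h1 : ∀ᶠ z in 𝓝 s, ∀ b ∈ K,
      ‖(F z).eval b (chartFrame x₀ (ℓ b)) - (F s).eval b (chartFrame x₀ (ℓ b))‖ < ε / 2 := by
    refine hK.eventually_forall_of_forall_eventually fun b hb => ?_
    have h2 : ContinuousAt (fun p : ℂ × B => (F p.1).eval p.2 (chartFrame x₀ (ℓ p.2))) (s, b) :=
      (h x₀).1.continuousAt ((hU.prod hV).mem_nhds ⟨hs, hKx hb⟩)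
    have h3 : ContinuousAt (fun p : ℂ × B => (F s).eval p.2 (chartFrame x₀ (ℓ p.2))) (s, b) :=
      ContinuousAt.comp (f := fun p : ℂ × B => (s, p.2))
        (g := fun p : ℂ × B => (F p.1).eval p.2 (chartFrame x₀ (ℓ p.2))) h2 (by fun_prop)
    refine (h2.sub h3).norm.eventually_lt continuousAt_const ?_
    simpa using hε
  filter_upwards [h1] with z hz
  refine (Real.iSup_le (fun b : K => (hz b.1 b.2).le) (by positivity)).trans_lt (half_lt_self hε)

/-- The first order Taylor expansion of a holomorphic family. -/
theorem exists_slope {U : Set ℂ} (hU : IsOpen U) (hℓ : Continuous ℓ)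
    {F : ℂ → ContDens (d := d) ℓ} (h : HolDens U F) {s : ℂ} (hs : s ∈ U) :
    ∃ K : ℂ → ContDens (d := d) ℓ, HolDens U K ∧ ∀ z, F z = F s + (z - s) • K z := by
  have hV := fun x₀ : M => (chartAt (Euc d) x₀).open_source.preimage hℓ
  let D : ContDens (d := d) ℓ := ⟨fun b => ⟨fun v => deriv (fun z => (F z).eval b v) s, fun A v => by
    have h1 : (fun z => (F z).eval b (fun i => ∑ j, A i j • v j)) =
        fun z => ((|A.det| : ℝ) : ℂ) * (F z).eval b v := funext fun z => ((F z).1 b).2 A v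
    exact (congrArg (fun g => deriv g s) h1).trans (deriv_const_mul_field _)⟩, fun x₀ => (h x₀).deriv hU (hV x₀) hs⟩
  refine ⟨fun z => if z = s then D else (z - s)⁻¹ • (F z - F s), fun x₀ => ?_, fun z => ?_⟩
  · refine ((h x₀).dslope hU (hV x₀) hs).congr fun z _ b _ => ?_
    by_cases hz : z = s
    · subst hz
      beta_reduce
      rw [if_pos rfl, dslope_same]
      rfl
    · beta_reduce
      rw [if_neg hz, dslope_of_ne _ hz, slope_def_module]
      rfl
  · by_cases hz : z = s
    · subst hz
      rw [sub_self, zero_smul, add_zero]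
    · beta_reduce
      rw [if_neg hz, smul_inv_smul₀ (sub_ne_zero.2 hz), add_sub_cancel]

theorem holomorphicOn {U : Set ℂ} (hU : IsOpen U) (hℓ : Continuous ℓ)
    {F : ℂ → ContDens (d := d) ℓ} (h : HolDens U F) : HolomorphicOn F U := fun s hs => by
  obtain ⟨K, hK, hF⟩ := h.exists_slope hU hℓ hs
  refine ⟨K s, ((hK.tendsto hU hℓ hs).mono_left nhdsWithin_le_nhds).congr' ?_⟩
  filter_upwards [self_mem_nhdsWithin] with z hz
  rw [hF z, add_sub_cancel_left, inv_smul_smul₀ (sub_ne_zero.2 hz)]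

theorem exists_principalPart {U : Set ℂ} (hU : IsOpen U) (hℓ : Continuous ℓ) {s₀ : ℂ}
    (hs₀ : s₀ ∈ U) (n : ℕ) {K : ℂ → ContDens (d := d) ℓ} (hK : HolDens U K) :
    ∃ (a : ℕ → ContDens (d := d) ℓ) (G : ℂ → ContDens (d := d) ℓ), HolDens U G ∧
      (n = 1 → a 0 = K s₀) ∧ ∀ s, s ≠ s₀ → ((s - s₀) ^ n)⁻¹ • K s =
        G s + ∑ k ∈ Finset.range n, ((s - s₀) ^ (k + 1))⁻¹ • a k := by
  induction n generalizing K with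
  | zero => exact ⟨0, K, hK, by simp, by simp⟩
  | succ n ih =>
    obtain ⟨K₁, hK₁, hF⟩ := hK.exists_slope hU hℓ hs₀
    obtain ⟨a, G, hG, -, h⟩ := ih hK₁
    refine ⟨fun k => if k = n then K s₀ else a k, G, hG, fun hn => ?_, fun s hs => ?_⟩
    · exact if_pos (by omega)
    · have h1 : ∑ k ∈ Finset.range n, ((s - s₀) ^ (k + 1))⁻¹ • (if k = n then K s₀ else a k) =
          ∑ k ∈ Finset.range n, ((s - s₀) ^ (k + 1))⁻¹ • a k :=
        Finset.sum_congr rfl fun k hk => by rw [if_neg (Finset.mem_range.1 hk).ne]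
      have h2 : ((s - s₀) ^ (n + 1))⁻¹ * (s - s₀) = ((s - s₀) ^ n)⁻¹ := by
        have := sub_ne_zero.2 hs
        rw [pow_succ]
        field_simp
      beta_reduce
      rw [Finset.sum_range_succ, h1, if_pos rfl, ← add_assoc, ← h s hs, hF s, smul_add, smul_smul,
        h2, add_comm]

theorem hasResidueAt {U : Set ℂ} (hU : IsOpen U) (hℓ : Continuous ℓ) {s₀ : ℂ} (hs₀ : s₀ ∈ U)
    (n : ℕ) {F K : ℂ → ContDens (d := d) ℓ} (hK : HolDens U K)
    (hF : ∀ s ∈ U, s ≠ s₀ → F s = ((s - s₀) ^ (n + 1))⁻¹ • K s) :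
    ∃ R, HasResidueAt F s₀ R ∧ (n = 0 → R = K s₀) := by
  obtain ⟨a, G, hG, h0, h⟩ := hK.exists_principalPart hU hℓ hs₀ (n + 1)
  exact ⟨a 0, ⟨n, a, G, U, hU, hs₀, hG.holomorphicOn hU hℓ, rfl, fun s hs hss => by
    rw [hF s hs hss, h s hss]⟩, fun hn => h0 (by omega)⟩

end HolDens

open Classical in
/-- A section of `ℓ^*ΩM` as an element of `C⁰(B, ℓ^*ΩM)`; zero if it is not continuous. -/
def ContDens.ofSection (ρ : ∀ b : B, Dens d (TangentSpace (𝓡 d) (ℓ b))) : ContDens (d := d) ℓ :=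
  if h : ρ ∈ contDens (d := d) ℓ then (⟨ρ, h⟩ : contDens (d := d) ℓ) else 0

theorem ContDens.ofSection_eval {ρ : ∀ b : B, Dens d (TangentSpace (𝓡 d) (ℓ b))}
    (h : ∀ x₀ : M, ContinuousOn (fun b => (ρ b).1 (chartFrame x₀ (ℓ b)))
      (ℓ ⁻¹' (chartAt (Euc d) x₀).source)) (b : B) (v : Fin d → TangentSpace (𝓡 d) (ℓ b)) :
    (ContDens.ofSection ρ).eval b v = (ρ b).1 v := by
  have h' : ρ ∈ contDens (d := d) ℓ := h
  exact congrArg (fun η : ContDens (d := d) ℓ => η.eval b v) (dif_pos h')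

theorem ContDens.ext {ρ η : ContDens (d := d) ℓ} (h : ∀ b v, ρ.eval b v = η.eval b v) : ρ = η :=
  Subtype.ext (funext fun b => Subtype.ext (funext fun v => h b v))

theorem ContDens.ofSection_val (ρ : ContDens (d := d) ℓ) : ContDens.ofSection ρ.1 = ρ :=
  ContDens.ext fun b v => ContDens.ofSection_eval ρ.2 b v

theorem HolDens.ofSection {U : Set ℂ} {ρ : ℂ → ∀ b : B, Dens d (TangentSpace (𝓡 d) (ℓ b))}
    (h : ∀ x₀ : M, HolC U (ℓ ⁻¹' (chartAt (Euc d) x₀).source) fun s b =>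
      (ρ s b).1 (chartFrame x₀ (ℓ b))) :
    (∀ s ∈ U, ∀ b v, (ContDens.ofSection (ρ s)).eval b v = (ρ s b).1 v) ∧
      HolDens U fun s => ContDens.ofSection (ρ s) := by
  have h1 : ∀ s ∈ U, ∀ b v, (ContDens.ofSection (ρ s)).eval b v = (ρ s b).1 v := fun s hs =>
    ContDens.ofSection_eval fun x₀ => (h x₀).1.comp (f := fun b => (s, b)) (by fun_prop)
      fun b hb => ⟨hs, hb⟩
  exact ⟨h1, fun x₀ => (h x₀).congr fun s hs b _ => h1 s hs b _⟩

end HolDens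

section Restriction

variable {d : ℕ} {M : Type u} [TopologicalSpace M] [ChartedSpace (Euc d) M]

/-- The restriction of a density on `M × ℝ` along `M` to the height `h`. -/
def ContDens.restrictAt (h : ℝ) :
    ContDens (d := d) (Prod.fst : M × ℝ → M) →ₗ[ℂ] ContDens (d := d) (id : M → M) where
  toFun ρ := ⟨fun x => ρ.1 (x, h), fun x₀ => (ρ.2 x₀).comp (f := fun x : M => (x, h)) (by fun_prop)
    fun _ hx => hx⟩
  map_add' _ _ := rfl
  map_smul' _ _ := rfl

theorem ContDens.continuous_restrictAt (h : ℝ) :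
    Continuous (ContDens.restrictAt (d := d) (M := M) h) := by
  have hw : WithSeminorms (ContDens.seminorm (d := d) (Prod.fst : M × ℝ → M)) := ⟨rfl⟩
  have hw' : WithSeminorms (ContDens.seminorm (d := d) (id : M → M)) := ⟨rfl⟩
  refine hw.continuous_of_isBounded hw' _ fun j => ?_
  obtain ⟨x₀, K, hK, hKx⟩ := j
  let j' : ContDens.SeminormIndex d (Prod.fst : M × ℝ → M) :=
    ⟨x₀, K ×ˢ {h}, hK.prod isCompact_singleton, fun p hp => hKx hp.1⟩
  refine ⟨{j'}, 1, fun ρ => ?_⟩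
  rw [Finset.sup_singleton, one_smul]
  exact Real.iSup_le (fun b => le_ciSup (ContDens.bddAbove_eval j' ρ) ⟨(b.1, h), b.2, rfl⟩)
    (apply_nonneg _ _)

end Restriction

section Map

variable {V W : Type*} [AddCommGroup V] [Module ℂ V] [TopologicalSpace V] [AddCommGroup W]
  [Module ℂ W] [TopologicalSpace W] {T : V →ₗ[ℂ] W}

theorem HolomorphicOn.map (hT : Continuous T) {F : ℂ → V} {U : Set ℂ} (h : HolomorphicOn F U) :
    HolomorphicOn (fun s => T (F s)) U := fun s hs => by
  obtain ⟨D, hD⟩ := h s hs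
  refine ⟨T D, ((hT.tendsto D).comp hD).congr fun z => ?_⟩
  simp only [Function.comp_apply, map_smul, map_sub]

theorem HasResidueAt.map (hT : Continuous T) {F : ℂ → V} {s₀ : ℂ} {R : V}
    (h : HasResidueAt F s₀ R) : HasResidueAt (fun s => T (F s)) s₀ (T R) := by
  obtain ⟨n, a, G, U, hU, hs, hG, ha, hF⟩ := h
  refine ⟨n, fun k => T (a k), fun s => T (G s), U, hU, hs, hG.map hT, congrArg T ha,
    fun s hsU hss => ?_⟩
  beta_reduce
  rw [hF s hsU hss]
  simp only [map_add, map_sum, map_smul]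

end Map
end HCalc

namespace HCalc
open MeasureTheory

/-! ### Meromorphic continuation of the trace -/

theorem iterate_deriv_const_mul (j : ℕ) (c : ℂ) (φ : ℝ → ℂ) (h : ℝ) :
    deriv^[j] (fun t => c * φ t) h = c * deriv^[j] φ h := by
  induction j generalizing φ with
  | zero => rfl
  | succ j ih =>
    have : deriv (fun t => c * φ t) = fun t => c * deriv φ t := by
      ext t
      exact deriv_const_mul_field c
    rw [Function.iterate_succ_apply, this, ih, Function.iterate_succ_apply]

/-- The order of a zero of `e + j₀`. It is finite, because a constant function `e = -j₀` has no
value in the right half plane. -/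
theorem exists_factorization {Ω : Set ℂ} (hΩ : IsOpen Ω) (hΩc : IsConnected Ω) {e : ℂ → ℂ}
    (he : DifferentiableOn ℂ e Ω) (hne : ∃ s ∈ Ω, 0 < (e s).re) {s₀ : ℂ} (hs₀ : s₀ ∈ Ω) {j₀ : ℕ}
    (hj₀ : e s₀ = -j₀) : ∃ (n : ℕ) (g : ℂ → ℂ), AnalyticAt ℂ g s₀ ∧ g s₀ ≠ 0 ∧
      ∀ᶠ s in 𝓝 s₀, e s + j₀ = (s - s₀) ^ (n + 1) * g s := by
  have hean : AnalyticOnNhd ℂ e Ω := he.analyticOnNhd hΩ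
  have han : AnalyticAt ℂ (fun s => e s + j₀) s₀ := (hean s₀ hs₀).add analyticAt_const
  have hnc : ¬ ∀ᶠ s in 𝓝 s₀, e s + j₀ = 0 := fun h => by
    obtain ⟨s₁, hs₁, hre⟩ := hne
    have h1 : EqOn e (fun _ => -(j₀ : ℂ)) Ω := hean.eqOn_of_preconnected_of_eventuallyEq
      (fun _ _ => analyticAt_const) hΩc.isPreconnected hs₀
      (h.mono fun s hs => eq_neg_of_add_eq_zero_left hs)
    rw [h1 hs₁, Complex.neg_re, Complex.natCast_re] at hre
    have : (0 : ℝ) ≤ j₀ := Nat.cast_nonneg _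
    linarith
  obtain ⟨n, g, hg, hg0, h⟩ := han.exists_eventuallyEq_pow_smul_nonzero_iff.2 hnc
  cases n with
  | zero =>
    have := h.self_of_nhds
    rw [pow_zero, one_smul, hj₀, neg_add_cancel] at this
    exact absurd this.symm hg0
  | succ n => exact ⟨n, g, hg, hg0, h⟩

section Continuation

variable {d : ℕ} {M : Type u} [TopologicalSpace M] [ChartedSpace (Euc d) M]

/-- A homogeneous operation on functions of the height, applied to a family of densities. -/
def densOp (Φ : (ℝ → ℂ) → ℝ → ℂ) (hΦ : ∀ c φ h, Φ (fun t => c * φ t) h = c * Φ φ h)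
    (τ : ∀ b : M × ℝ, Dens d (TangentSpace (𝓡 d) b.1)) (b : M × ℝ) :
    Dens d (TangentSpace (𝓡 d) b.1) :=
  ⟨fun v => Φ (fun t => (τ (b.1, t)).1 v) b.2, fun A v =>
    (congrArg (fun φ => Φ φ b.2) (funext fun t => (τ (b.1, t)).2 A v)).trans (hΦ _ _ _)⟩

/-- The continuation in `e` of `(x, h) ↦ ∫₀¹ t^{e-1} τ(x, th) dt`. -/
def contSection (e : ℂ) (τ : ∀ b : M × ℝ, Dens d (TangentSpace (𝓡 d) b.1)) :
    ∀ b : M × ℝ, Dens d (TangentSpace (𝓡 d) b.1) :=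
  densOp (mellinCont (⌊-e.re⌋₊ + 1) e) (fun c φ h => mellinCont_const_mul _ e c φ h) τ

theorem contSection_apply {e : ℂ} {τ : ∀ b : M × ℝ, Dens d (TangentSpace (𝓡 d) b.1)}
    {b : M × ℝ} {v : Fin d → TangentSpace (𝓡 d) b.1}
    (hτ : ContDiff ℝ ∞ fun t : ℝ => (τ (b.1, t)).1 v) {J : ℕ} (hJ : 0 < e.re + J) :
    (contSection e τ b).1 v = mellinCont J e (fun t => (τ (b.1, t)).1 v) b.2 := by
  have h1 : 0 < e.re + (⌊-e.re⌋₊ + 1 : ℕ) := by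
    have := Nat.lt_floor_add_one (-e.re)
    push_cast
    linarith
  have h2 : (contSection e τ b).1 v =
      mellinCont (⌊-e.re⌋₊ + 1) e (fun t => (τ (b.1, t)).1 v) b.2 := rfl
  rw [h2]
  rcases le_total (⌊-e.re⌋₊ + 1) J with h | h
  · exact mellinCont_eq_of_le h h1 hτ b.2
  · exact (mellinCont_eq_of_le h hJ hτ b.2).symm

/-- Holomorphic families of smooth densities on `M × ℝ`, with regard to derivatives in the
direction of `ℝ` only. -/
def HolSmoothDens (Ω : Set ℂ) (τ : ℂ → ∀ b : M × ℝ, Dens d (TangentSpace (𝓡 d) b.1)) : Prop :=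
  ∀ x₀ : M, HolSmooth Ω (chartAt (Euc d) x₀).source fun s x h => (τ s (x, h)).1 (chartFrame x₀ x)

namespace HolSmoothDens

variable {Ω : Set ℂ} {τ : ℂ → ∀ b : M × ℝ, Dens d (TangentSpace (𝓡 d) b.1)} {e : ℂ → ℂ} {s₀ : ℂ}

theorem contDiff [IsManifold (𝓡 d) ∞ M] (h : HolSmoothDens Ω τ) {s : ℂ} (hs : s ∈ Ω) (x : M)
    (v : Fin d → TangentSpace (𝓡 d) x) : ContDiff ℝ ∞ fun t : ℝ => (τ s (x, t)).1 v := by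
  have h1 : (fun t : ℝ => (τ s (x, t)).1 v) = fun t => _ * (τ s (x, t)).1 (chartFrame x x) :=
    funext fun t => dens_eq_det (mem_chart_source _ x) (τ s (x, t)) v
  rw [h1]
  exact contDiff_const.mul ((h x).1 s hs x (mem_chart_source _ x))

/-- The continuation is holomorphic where `e` avoids `{0, -1, -2, …}`. -/
theorem exists_holDens_contSection [IsManifold (𝓡 d) ∞ M] [FirstCountableTopology M]
    (h : HolSmoothDens Ω τ)
    (hΩ : IsOpen Ω) (he : DifferentiableOn ℂ e Ω) (hs₀ : s₀ ∈ Ω) (h0 : ∀ j : ℕ, e s₀ + j ≠ 0) :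
    ∃ U, IsOpen U ∧ s₀ ∈ U ∧
      HolDens U fun s => ContDens.ofSection (contSection (e s) (τ s)) := by
  have hec : ContinuousAt e s₀ := (he.differentiableAt (hΩ.mem_nhds hs₀)).continuousAt
  set J := ⌊-(e s₀).re⌋₊ + 1
  have hJ : 0 < (e s₀).re + J := by
    have := Nat.lt_floor_add_one (-(e s₀).re)
    simp only [J]
    push_cast
    linarith
  have hev : ∀ᶠ s in 𝓝 s₀, s ∈ Ω ∧ 0 < (e s).re + J ∧ ∀ j ∈ Finset.range J, e s + j ≠ 0 :=
    (hΩ.eventually_mem hs₀).and <| (((Complex.continuous_re.continuousAt.comp hec).add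
      continuousAt_const).eventually_const_lt hJ).and <| (eventually_all_finset _).2 fun j _ =>
        (hec.add continuousAt_const).eventually_ne (h0 j)
  obtain ⟨U, hU, hUo, hsU⟩ := eventually_nhds_iff.1 hev
  refine ⟨U, hUo, hsU, (HolDens.ofSection fun x₀ => ?_).2⟩
  rw [← prod_univ]
  refine (holC_mellinCont hUo (chartAt (Euc d) x₀).open_source J
    ((h x₀).mono (fun s hs => (hU s hs).1) subset_rfl) (he.mono fun s hs => (hU s hs).1)
    (fun s hs => (hU s hs).2.1) fun s hs j hj => (hU s hs).2.2 j (Finset.mem_range.2 hj)).congr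
    fun s hs b hb => contSection_apply (h.contDiff (hU s hs).1 _ _) (hU s hs).2.1

/-- The poles of the continuation. -/
theorem exists_holDens_pole [IsManifold (𝓡 d) ∞ M] [FirstCountableTopology M]
    (h : HolSmoothDens Ω τ)
    (hΩ : IsOpen Ω) (he : DifferentiableOn ℂ e Ω) (hs₀ : s₀ ∈ Ω) {j₀ : ℕ} (hj₀ : e s₀ = -j₀)
    {g : ℂ → ℂ} (hg : AnalyticAt ℂ g s₀) (hg0 : g s₀ ≠ 0) {n : ℕ}
    (heg : ∀ᶠ s in 𝓝 s₀, e s + j₀ = (s - s₀) ^ n * g s) :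
    ∃ U, IsOpen U ∧ s₀ ∈ U ∧ ∃ K : ℂ → ContDens (d := d) (Prod.fst : M × ℝ → M), HolDens U K ∧
      (∀ s ∈ U, s ≠ s₀ →
        ContDens.ofSection (contSection (e s) (τ s)) = ((s - s₀) ^ n)⁻¹ • K s) ∧
      (j₀ = 0 → ∀ (x : M) (t : ℝ) (v : Fin d → TangentSpace (𝓡 d) x),
        (K s₀).eval (x, t) v = (g s₀)⁻¹ * (τ s₀ (x, 0)).1 v) := by
  have hec : ContinuousAt e s₀ := (he.differentiableAt (hΩ.mem_nhds hs₀)).continuousAt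
  -- near `s₀`, `j₀ + 1` integrations by parts suffice, and no other factor `e + j` vanishes
  have hJ : 0 < (e s₀).re + j₀ + 1 + (0 : ℕ) := by simp [hj₀]
  have hev : ∀ᶠ s in 𝓝 s₀, s ∈ Ω ∧ 0 < (e s).re + j₀ + 1 + (0 : ℕ) ∧
      (∀ j ∈ Finset.range (j₀ + 1 + 0), j ≠ j₀ → e s + j ≠ 0) ∧ DifferentiableAt ℂ g s ∧
      g s ≠ 0 ∧ e s + j₀ = (s - s₀) ^ n * g s := by
    refine (hΩ.eventually_mem hs₀).and <| (((((Complex.continuous_re.continuousAt.comp hec).add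
      continuousAt_const).add continuousAt_const).add continuousAt_const).eventually_const_lt
        hJ).and <| ((eventually_all_finset _).2 fun j _ => ?_).and <|
      (hg.eventually_analyticAt.mono fun s hs => hs.differentiableAt).and <|
      (hg.continuousAt.eventually_ne hg0).and heg
    by_cases hj : j = j₀
    · exact Eventually.of_forall fun _ h => absurd hj h
    · refine ((hec.add continuousAt_const).eventually_ne (y := (0 : ℂ)) ?_).mono fun s hs _ => hs
      change e s₀ + j ≠ 0
      rw [hj₀, neg_add_eq_sub, sub_ne_zero]
      exact_mod_cast hj
  obtain ⟨U, hU, hUo, hsU⟩ := eventually_nhds_iff.1 hev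
  have hUΩ : U ⊆ Ω := fun s hs => (hU s hs).1
  obtain ⟨h1, h2⟩ := HolDens.ofSection (U := U) (ℓ := (Prod.fst : M × ℝ → M))
    (ρ := fun s => densOp (mellinReg 0 j₀ (e s))
    (fun c φ h => mellinReg_const_mul 0 j₀ (e s) c φ h) (τ s)) fun x₀ => by
      rw [← prod_univ]
      exact holC_mellinReg hUo (chartAt (Euc d) x₀).open_source 0 j₀ ((h x₀).mono hUΩ subset_rfl)
        (he.mono hUΩ) (fun s hs => (hU s hs).2.1) fun s hs j hj =>
          (hU s hs).2.2.1 j (Finset.mem_range.2 hj)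
  have hgd : DifferentiableOn ℂ (fun s => (g s)⁻¹) U := fun s hs =>
    ((hU s hs).2.2.2.1.inv (hU s hs).2.2.2.2.1).differentiableWithinAt
  refine ⟨U, hUo, hsU, _, h2.smul hgd, fun s hs hss => ?_, fun hj x t v => ?_⟩
  · obtain ⟨hsΩ, hre, h0, -, hgs, hse⟩ := hU s hs
    have hne : e s + j₀ ≠ 0 := by
      rw [hse]
      exact mul_ne_zero (pow_ne_zero _ (sub_ne_zero.2 hss)) hgs
    have h3 : contSection (e s) (τ s) = ((e s + j₀)⁻¹ : ℂ) • densOp (mellinReg 0 j₀ (e s))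
        (fun c φ h => mellinReg_const_mul 0 j₀ (e s) c φ h) (τ s) := by
      funext b
      refine Subtype.ext (funext fun v => ?_)
      rw [contSection_apply (J := j₀ + 1 + 0) (h.contDiff hsΩ _ _) (by push_cast at hre ⊢; linarith)]
      exact mellinCont_eq_reg 0 j₀ (e s) _ _ hne
    have h4 : ContDens.ofSection (contSection (e s) (τ s)) = ((e s + j₀)⁻¹ : ℂ) •
        ContDens.ofSection (ℓ := (Prod.fst : M × ℝ → M)) (densOp (mellinReg 0 j₀ (e s))
        (fun c φ h => mellinReg_const_mul 0 j₀ (e s) c φ h) (τ s)) := by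
      refine ContDens.ext fun b v => ?_
      rw [h3]
      refine (ContDens.ofSection_eval (fun x₀ => ?_) b v).trans
        (congrArg (((e s + j₀)⁻¹ : ℂ) * ·) (h1 s hs b v).symm)
      refine continuousOn_const.mul (((h2 x₀).1.comp (f := fun b => (s, b)) (by fun_prop)
        fun b hb => ⟨hs, hb⟩).congr fun b _ => (h1 s hs b _).symm)
    rw [h4, hse, mul_inv, mul_smul]
  · subst hj
    change (g s₀)⁻¹ * (ContDens.ofSection _).eval (x, t) v = _
    rw [h1 s₀ hsU]
    change (g s₀)⁻¹ * mellinReg 0 0 (e s₀) _ t = _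
    rw [hj₀, Nat.cast_zero, neg_zero, mellinReg_zero_zero 0 (h.contDiff (hUΩ hsU) x v)]

theorem holomorphicOn_contSection [IsManifold (𝓡 d) ∞ M] [FirstCountableTopology M]
    (h : HolSmoothDens Ω τ) (hΩ : IsOpen Ω) (he : DifferentiableOn ℂ e Ω) :
    HolomorphicOn (fun s => ContDens.ofSection (contSection (e s) (τ s)))
      {s ∈ Ω | ∀ j : ℕ, e s + j ≠ 0} := fun s hs => by
  obtain ⟨U, hU, hsU, h⟩ := h.exists_holDens_contSection hΩ he hs.1 hs.2
  exact h.holomorphicOn hU continuous_fst s hsU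

theorem isMeromorphicAt_contSection [IsManifold (𝓡 d) ∞ M] [FirstCountableTopology M]
    (h : HolSmoothDens Ω τ) (hΩ : IsOpen Ω) (hΩc : IsConnected Ω) (he : DifferentiableOn ℂ e Ω)
    (hne : ∃ s ∈ Ω, 0 < (e s).re) (hs₀ : s₀ ∈ Ω) :
    IsMeromorphicAt (fun s => ContDens.ofSection (contSection (e s) (τ s))) s₀ := by
  by_cases h0 : ∀ j : ℕ, e s₀ + j ≠ 0
  · obtain ⟨U, hU, hsU, h⟩ := h.exists_holDens_contSection hΩ he hs₀ h0
    exact ⟨0, 0, 0, _, U, hU, hsU, h.holomorphicOn hU continuous_fst, rfl, by simp⟩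
  · push Not at h0
    obtain ⟨j₀, hj₀⟩ := h0
    have hes := eq_neg_of_add_eq_zero_left hj₀
    obtain ⟨n, g, hg, hg0, heg⟩ := exists_factorization hΩ hΩc he hne hs₀ hes
    obtain ⟨U, hU, hsU, K, hK, hGK, -⟩ := h.exists_holDens_pole hΩ he hs₀ hes hg hg0 heg
    obtain ⟨R, hR, -⟩ := hK.hasResidueAt hU continuous_fst hsU n hGK
    exact ⟨R, hR⟩

/-- The residue at a simple zero of `e`; near `s₀`, `e s = (s - s₀) g s`, where `g` is the
difference quotient of `e`. -/
theorem exists_hasResidueAt_contSection [IsManifold (𝓡 d) ∞ M] [FirstCountableTopology M]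
    (h : HolSmoothDens Ω τ) (hΩ : IsOpen Ω) (he : DifferentiableOn ℂ e Ω) (hs₀ : s₀ ∈ Ω)
    (hes : e s₀ = 0) (hd : deriv e s₀ ≠ 0) :
    ∃ R, HasResidueAt (fun s => ContDens.ofSection (contSection (e s) (τ s))) s₀ R ∧
      ∀ (x : M) (t : ℝ) (v : Fin d → TangentSpace (𝓡 d) x),
        R.eval (x, t) v = (deriv e s₀)⁻¹ * (τ s₀ (x, 0)).1 v := by
  have hg : AnalyticAt ℂ (dslope e s₀) s₀ :=
    ((Complex.differentiableOn_dslope (hΩ.mem_nhds hs₀)).2 he).analyticAt (hΩ.mem_nhds hs₀)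
  obtain ⟨U, hU, hsU, K, hK, hGK, hK0⟩ := h.exists_holDens_pole hΩ he hs₀ (j₀ := 0)
    (by rw [hes, Nat.cast_zero, neg_zero]) hg (by rwa [dslope_same]) (n := 0 + 1)
    (Eventually.of_forall fun s => by
      have := sub_smul_dslope e s₀ s
      rw [smul_eq_mul] at this
      rw [zero_add, pow_one, this, hes, sub_zero, Nat.cast_zero, add_zero])
  obtain ⟨R, hR, hRK⟩ := hK.hasResidueAt hU continuous_fst hsU 0 hGK
  refine ⟨R, hR, fun x t v => ?_⟩
  rw [hRK rfl, hK0 rfl, dslope_same]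

end HolSmoothDens

end Continuation

section Kernel

variable {d N : ℕ} {M : Type u} [TopologicalSpace M] [ChartedSpace (Euc d) M]
  [IsManifold (𝓡 d) ∞ M] {H : LieFiltration d N M} {ψ : H.Splitting} {D : ψ.Exponential}

open LieFiltration.Splitting TGroupoid

/-- The traces of the densities `(L_Z - μ(s)) ℙ(s)` form a holomorphic family. -/
theorem holSmoothDens_unitDens [T2Space M] {Ω : Set ℂ} (hΩ : IsOpen Ω) {μ : ℂ → ℂ}
    (hμ : DifferentiableOn ℂ μ Ω) {P L : ℂ → GroupoidDist D} (hP : HolomorphicOn P Ω)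
    {f : ℂ → FibredDensity D} (hL : ∀ s ∈ Ω, GroupoidDist.IsLieDeriv (P s) (L s))
    (hf : ∀ s ∈ Ω, (f s).IsSmooth) (hp : ∀ s ∈ Ω, (f s).IsProper)
    (hF : ∀ s ∈ Ω, (f s).Represents (L s - μ s • P s)) :
    HolSmoothDens Ω fun s => (f s).unitDens := by
  intro x₀
  set c := chartAt (Euc d) x₀ with hc'
  have hform : ∀ (X : ψ.GradedFrame), ∀ x ∈ c.source, x ∈ X.carrier → c x ∈ baseW x₀ X ∧ ∀ s,
      (fun h : ℝ => ((f s).unitDens (x, h)).1 (chartFrame x₀ x)) = fun h =>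
        ((|jacW D x₀ X x₀ (c x, 0)| : ℝ) : ℂ)⁻¹ * (f s).coeff (maxIndex D x₀ X) (c x, 0, h) := by
    intro X x hx hxX
    have ha : c x ∈ baseW x₀ X := ⟨c.map_source hx, by rwa [c.left_inv hx]⟩
    refine ⟨ha, fun s => funext fun h => ?_⟩
    rw [← (f s).unitDens_chartFrame ha h, c.left_inv hx]
  refine ⟨fun s hs x hx => ?_, fun j => HolC.of_local fun s hs p hpx => ?_⟩
  · obtain ⟨X, hX⟩ := exists_gradedFrame ψ x
    obtain ⟨ha, h1⟩ := hform X x hx hX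
    beta_reduce
    rw [h1 s]
    exact contDiff_const.mul ((holSmooth_coeff hΩ hμ hP hL hf hp hF).1 s hs _ ha)
  · obtain ⟨X, hX⟩ := exists_gradedFrame ψ p.1
    have hV : IsOpen (c.source ∩ X.carrier) := c.open_source.inter X.isOpen_carrier
    refine ⟨Ω, hΩ.mem_nhds hs, (c.source ∩ X.carrier) ×ˢ univ,
      (hV.prod isOpen_univ).mem_nhds ⟨⟨hpx.1, hX⟩, trivial⟩, ?_⟩
    have hc1 : ContinuousOn (fun p : M × ℝ => c p.1) ((c.source ∩ X.carrier) ×ˢ univ) :=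
      c.continuousOn.comp continuousOn_fst fun p hp => hp.1.1
    have h1 := ((holSmooth_coeff (x₀ := x₀) (X := X) hΩ hμ hP hL hf hp hF).2 j).comp
      (f := fun p : M × ℝ => (c p.1, p.2)) (V' := (c.source ∩ X.carrier) ×ˢ univ)
      (hc1.prodMk continuousOn_snd) fun p hp => ⟨(hform X p.1 hp.1.1 hp.1.2).1, trivial⟩
    have hz : ∀ p : M × ℝ, p ∈ (c.source ∩ X.carrier) ×ˢ (univ : Set ℝ) →
        (c p.1, (0 : Euc d)) ∈ chartW D x₀ X x₀ := fun p hp =>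
      zero_mem_chartW (hform X p.1 hp.1.1 hp.1.2).1 (c.map_target (c.map_source hp.1.1))
    have h2 : ContinuousOn (fun p : M × ℝ => ((|jacW D x₀ X x₀ (c p.1, 0)| : ℝ) : ℂ)⁻¹)
        ((c.source ∩ X.carrier) ×ˢ univ) := by
      refine ContinuousOn.inv₀ (Complex.continuous_ofReal.comp_continuousOn ?_) fun p hp =>
        Complex.ofReal_ne_zero.2 (abs_ne_zero.2 (jacW_ne_zero (hz p hp)))
      exact (continuousOn_jacW.comp (f := fun p : M × ℝ => (c p.1, (0 : Euc d)))
        (hc1.prodMk continuousOn_const) hz).abs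
    refine ((HolC.of_snd h2).mul h1).congr fun s hs p hp => ?_
    exact (congrArg (fun φ => deriv^[j] φ p.2) ((hform X p.1 hp.1.1 hp.1.2).2 s)).trans
      (iterate_deriv_const_mul _ _ _ _)

/-- The trace of a kernel of order `m` with `Re m < -d_H`. -/
theorem hasLocalTrace_contSection [T2Space M] {m : ℂ} (hm : m.re < -(H.homDim : ℝ))
    {P L : GroupoidDist D} (hL : GroupoidDist.IsLieDeriv P L) {f : FibredDensity D}
    (hf : f.IsSmooth) (hp : f.IsProper) (hF : f.Represents (L - m • P))
    (hs : ∀ (x : M) (v : Fin d → TangentSpace (𝓡 d) x),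
      ContDiff ℝ ∞ fun t : ℝ => (f.unitDens (x, t)).1 v) :
    GroupoidDist.HasLocalTrace P (ContDens.ofSection (contSection (-m - H.homDim) f.unitDens)) := by
  obtain ⟨hc, hr⟩ := represents_of_re_lt hm hL hf hp hF
  have h1 : contSection (-m - H.homDim) f.unitDens = ((mellinDens f m 0 1).trace hc).1 := by
    funext b
    refine Subtype.ext (funext fun v => ?_)
    rw [contSection_apply (J := 0) (hs _ _) (by simp; linarith)]
    refine Eq.trans ?_ (unitDens_mellinDens f m le_rfl zero_le_one b.1 b.2 v).symm
    simp only [mellinCont, sub_right_comm]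
  rw [h1, ContDens.ofSection_val]
  exact hasLocalTrace_of_represents hc hr

/-- The local traces at `h = 1` of kernels with the same restriction to `h = 1` agree. -/
theorem pairDist_hasLocalTrace [T2Space M] {m : ℂ} (hm : m.re < -(H.homDim : ℝ))
    {P : PairDist d M} {Q : GroupoidDist D} (hQ : GroupoidDist.IsKernel m Q)
    (hr : GroupoidDist.IsRestrictionAtOne Q P) {τ : ContDens (d := d) (Prod.fst : M × ℝ → M)}
    (hτ : GroupoidDist.HasLocalTrace Q τ) :
    PairDist.HasLocalTrace D m P (ContDens.restrictAt 1 τ) := by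
  refine ⟨⟨Q, hQ, hr⟩, fun Q' ⟨L', hL', f', hf', hp', hF'⟩ hr' => ?_⟩
  obtain ⟨hc', hrep'⟩ := represents_of_re_lt hm hL' hf' hp' hF'
  refine ⟨_, hasLocalTrace_of_represents hc' hrep', fun x v => ?_⟩
  obtain ⟨f, hc, hrep, -, hev⟩ := hτ
  refine (hev x 1 one_ne_zero v).trans ?_
  rw [← f.unitDens_ne_zero x one_ne_zero v, unitDens_eq_of_apply_eq hrep.2 hrep'.2 hc hc'
    one_ne_zero fun u => apply_one_eq_of_restriction hr hr' u x]
  rfl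

theorem exists_lieDeriv_density {Ω : Set ℂ} {μ : ℂ → ℂ} {Q : ℂ → GroupoidDist D}
    (hQ : ∀ s ∈ Ω, GroupoidDist.IsKernel (μ s) (Q s)) :
    ∃ (L : ℂ → GroupoidDist D) (f : ℂ → FibredDensity D),
      (∀ s ∈ Ω, GroupoidDist.IsLieDeriv (Q s) (L s)) ∧ (∀ s ∈ Ω, (f s).IsSmooth) ∧
      (∀ s ∈ Ω, (f s).IsProper) ∧ ∀ s ∈ Ω, (f s).Represents (L s - μ s • Q s) := by
  have : Nonempty (FibredDensity D) := ⟨⟨fun _ _ => 0, fun _ _ _ => 0⟩⟩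
  choose! L hL f hf hp hF using hQ
  exact ⟨L, f, hL, hf, hp, hF⟩

/-- The trace of a holomorphic family of kernels is meromorphic. -/
theorem exists_meromorphic_trace [T2Space M] [FirstCountableTopology M] {Ω : Set ℂ}
    (hΩ : IsOpen Ω) (hΩc : IsConnected Ω) {μ : ℂ → ℂ} (hμ : DifferentiableOn ℂ μ Ω)
    (hne : ∃ s ∈ Ω, (μ s).re < -(H.homDim : ℝ)) {Q L : ℂ → GroupoidDist D}
    (hQ : HolomorphicOn Q Ω) {f : ℂ → FibredDensity D}
    (hL : ∀ s ∈ Ω, GroupoidDist.IsLieDeriv (Q s) (L s)) (hf : ∀ s ∈ Ω, (f s).IsSmooth)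
    (hp : ∀ s ∈ Ω, (f s).IsProper) (hF : ∀ s ∈ Ω, (f s).Represents (L s - μ s • Q s)) :
    ∃ G : ℂ → ContDens (d := d) (Prod.fst : M × ℝ → M),
      (∀ s ∈ Ω, (μ s).re < -(H.homDim : ℝ) → GroupoidDist.HasLocalTrace (Q s) (G s)) ∧
      HolomorphicOn G {s ∈ Ω | ∀ j : ℕ, μ s ≠ -(H.homDim : ℂ) + j} ∧
      (∀ s ∈ Ω, IsMeromorphicAt G s) ∧
      ∀ s₀ ∈ Ω, μ s₀ = -(H.homDim : ℂ) → (∃ U ∈ 𝓝 s₀, InjOn μ U) →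
        ∃ (ρ : ContDens (d := d) (id : M → M)) (R : ContDens (d := d) (Prod.fst : M × ℝ → M)),
          (∀ P, GroupoidDist.IsRestrictionAtOne (Q s₀) P → PairDist.IsResidueDensity D P ρ) ∧
          HasResidueAt G s₀ R ∧ ∀ (x : M) (h : ℝ) (v : Fin d → TangentSpace (𝓡 d) x),
            R.eval (x, h) v = -((deriv μ s₀)⁻¹ * ρ.eval x v) := by
  have hτ := holSmoothDens_unitDens hΩ hμ hQ hL hf hp hF
  have he : DifferentiableOn ℂ (fun s => -μ s - H.homDim) Ω := hμ.neg.sub_const _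
  have hne' : ∃ s ∈ Ω, 0 < (-μ s - H.homDim).re := by
    obtain ⟨s, hs, hre⟩ := hne
    refine ⟨s, hs, ?_⟩
    rw [Complex.sub_re, Complex.neg_re, Complex.natCast_re]
    linarith
  refine ⟨fun s => ContDens.ofSection (contSection (-μ s - H.homDim) (f s).unitDens),
    fun s hs hre => hasLocalTrace_contSection hre (hL s hs) (hf s hs) (hp s hs) (hF s hs)
      (hτ.contDiff hs), fun s hs => hτ.holomorphicOn_contSection hΩ he s ⟨hs.1, fun j hj =>
        hs.2 j (by linear_combination -hj)⟩,
    fun s hs => hτ.isMeromorphicAt_contSection hΩ hΩc he hne' hs, fun s₀ hs₀ hμs₀ hinj => ?_⟩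
  have hμa : AnalyticAt ℂ μ s₀ := hμ.analyticAt (hΩ.mem_nhds hs₀)
  have hed : deriv (fun s => -μ s - H.homDim) s₀ = -deriv μ s₀ :=
    (hμa.differentiableAt.hasDerivAt.neg.sub_const (H.homDim : ℂ)).deriv
  obtain ⟨R, hR, hRv⟩ := hτ.exists_hasResidueAt_contSection hΩ he hs₀
    (by rw [hμs₀, neg_neg, sub_self])
    (by rw [hed]; exact neg_ne_zero.2 (deriv_ne_zero_of_injOn hμa hinj))
  refine ⟨ContDens.restrictAt 0 ((f s₀).trace (hf s₀ hs₀).isContinuous), R, fun P hP => ?_, hR,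
    fun x h v => ?_⟩
  · refine isResidueDensity (hL s₀ hs₀) (hf s₀ hs₀) (hp s₀ hs₀) ?_ hP fun x v => rfl
    rw [← hμs₀]
    exact hF s₀ hs₀
  · rw [hRv, hed, inv_neg, neg_mul]
    rfl

end Kernel
end HCalc

end

theorem theorem5p2 {d N : ℕ} {M : Type u} [TopologicalSpace M] [T2Space M]
    [SecondCountableTopology M] [ChartedSpace (HCalc.Euc d) M] [IsManifold (𝓡 d) ∞ M]
    (H : HCalc.LieFiltration d N M) (ψ : H.Splitting) (D : ψ.Exponential)
    (Ω : Set ℂ) (hΩ : IsOpen Ω) (hΩc : IsConnected Ω)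
    (μ : ℂ → ℂ) (hμ : DifferentiableOn ℂ μ Ω)
    (hne : ∃ s ∈ Ω, (μ s).re < -(H.homDim : ℝ))
    (P : ℂ → HCalc.PairDist d M) (hP : HCalc.PairDist.IsHolomorphicFamily D Ω μ P) :
    -- the `C⁰(M, ΩM)`-valued function `s ↦ tr P(s)`
    (∃ F : ℂ → HCalc.ContDens (d := d) (id : M → M),
      (∀ s ∈ Ω, (μ s).re < -(H.homDim : ℝ) →
        HCalc.PairDist.HasLocalTrace D (μ s) (P s) (F s)) ∧
      HCalc.HolomorphicOn F {s ∈ Ω | ∀ j : ℕ, μ s ≠ -(H.homDim : ℂ) + j} ∧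
      (∀ s ∈ Ω, HCalc.IsMeromorphicAt F s) ∧
      ∀ s₀ ∈ Ω, μ s₀ = -(H.homDim : ℂ) → (∃ U ∈ 𝓝 s₀, InjOn μ U) →
        ∃ ρ, HCalc.PairDist.IsResidueDensity D (P s₀) ρ ∧
          HCalc.HasResidueAt F s₀ (-((deriv μ s₀)⁻¹ • ρ))) ∧
    -- the `C⁰(M × ℝ, ΩM)`-valued function `s ↦ tr ℙ(s)`, for every kernel family `ℙ` of `P`
    ∀ Q : ℂ → HCalc.GroupoidDist D, HCalc.GroupoidDist.IsHolomorphicKernelFamily Ω μ Q →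
      (∀ s ∈ Ω, HCalc.GroupoidDist.IsRestrictionAtOne (Q s) (P s)) →
      ∃ G : ℂ → HCalc.ContDens (d := d) (Prod.fst : M × ℝ → M),
        (∀ s ∈ Ω, (μ s).re < -(H.homDim : ℝ) →
          HCalc.GroupoidDist.HasLocalTrace (Q s) (G s)) ∧
        HCalc.HolomorphicOn G {s ∈ Ω | ∀ j : ℕ, μ s ≠ -(H.homDim : ℂ) + j} ∧
        (∀ s ∈ Ω, HCalc.IsMeromorphicAt G s) ∧
        ∀ s₀ ∈ Ω, μ s₀ = -(H.homDim : ℂ) → (∃ U ∈ 𝓝 s₀, InjOn μ U) →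
          ∃ (ρ : HCalc.ContDens (d := d) (id : M → M))
            (R : HCalc.ContDens (d := d) (Prod.fst : M × ℝ → M)),
            HCalc.PairDist.IsResidueDensity D (P s₀) ρ ∧ HCalc.HasResidueAt G s₀ R ∧
              ∀ (x : M) (h : ℝ) (v : Fin d → TangentSpace (𝓡 d) x),
                R.eval (x, h) v = -((deriv μ s₀)⁻¹ * ρ.eval x v) := by
  have key := fun (Q : ℂ → HCalc.GroupoidDist D)
      (hQ : HCalc.GroupoidDist.IsHolomorphicKernelFamily Ω μ Q) =>
    (HCalc.exists_lieDeriv_density hQ.2).elim fun L h => h.elim fun f h =>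
      HCalc.exists_meromorphic_trace hΩ hΩc hμ hne hQ.1 h.1 h.2.1 h.2.2.1 h.2.2.2
  refine ⟨?_, fun Q hQ hr => ?_⟩
  · obtain ⟨Q, hQ, hr⟩ := hP
    obtain ⟨G, hG, hol, hmer, hres⟩ := key Q hQ
    have hc := HCalc.ContDens.continuous_restrictAt (d := d) (M := M) 1
    refine ⟨fun s => HCalc.ContDens.restrictAt 1 (G s), fun s hs hre =>
      HCalc.pairDist_hasLocalTrace hre (hQ.2 s hs) (hr s hs) (hG s hs hre), hol.map hc,
      fun s hs => ?_, fun s₀ hs₀ hμs₀ hinj => ?_⟩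
    · obtain ⟨R, hR⟩ := hmer s hs
      exact ⟨_, hR.map hc⟩
    · obtain ⟨ρ, R, hρ, hR, hRv⟩ := hres s₀ hs₀ hμs₀ hinj
      refine ⟨ρ, hρ _ (hr s₀ hs₀), ?_⟩
      have h1 : HCalc.ContDens.restrictAt 1 R = -((deriv μ s₀)⁻¹ • ρ) :=
        HCalc.ContDens.ext fun x v => hRv x 1 v
      rw [← h1]
      exact hR.map hc
  · obtain ⟨G, hG, hol, hmer, hres⟩ := key Q hQ
    refine ⟨G, hG, hol, hmer, fun s₀ hs₀ hμs₀ hinj => ?_⟩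
    obtain ⟨ρ, R, hρ, hR, hRv⟩ := hres s₀ hs₀ hμs₀ hinj
    exact ⟨ρ, R, hρ _ (hr s₀ hs₀), hR, hRv⟩
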